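/- **Setting.** An instance is a bipartite graph $G=(A\cup B,E)$ (men $A$, women $B$) with $n=|A|+|B|$ vertices and $m=|E|\ge 1$ edges, in which every vertex ranks its neighbours by a linearly ordered list of ties. Write $\mathrm{rank}_x(y)$ for the rank of $y$ on the list of $x$ (smaller is better), $y\succ_x z$ for strict preference, $y\succeq_x z$ for weak preference and $y=_xz$ for indifference. A matching $M$ is *super-stable* if there is no edge $(x,y)\in E\setminus M$ such that each of $x$ and $y$ is unmatched or weakly prefers the other to its partner in $M$. Assume that $G$ has a super-stable matching. The man-optimal (woman-optimal) super-stable matching is the one that every man (woman) weakly prefers to every super-stable matching, being unmatched counting as worst. A man $x$ is *settled* in $M$ if he is unmatched or $M(x)=_xM_z(x)$, where $M_z$ is as below. **Algorithm** (computing a sequence of matchings from the man-optimal to the woman-optimal super-stable matching). Let $M_0$ be the man-optimal and $M_z$ the woman-optimal super-stable matching; set $M:=M_0$, $E_d:=M$, $E':=E\setminus M$, and $E_c:=\{(x,M(x)) : x \text{ matched},\ M(x)=_xM_z(x)\}$. Throughout, $G_d$ is the digraph on $A\cup B$ with edge set $E_d$, where edges in $E_d\cap M$ are directed from the woman to the man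 and the other edges of $E_d$ from the man to the woman; $G_c=(A\cup B,E_c)$; $S(v)$ is the strongly connected component of $v$ in $G_d$; $\mathrm{outdeg}(S)$ is the number of arcs of $G_d$ leaving $S$. For every $(x,w)\in M$, remove from $E'$ all $(x',w)$ with $x\succ_w x'$ and all $(x,w')$ with $w'\succeq_x w$. Repeat the following three phases until every man is settled. 1. While there is an unsettled man $x$ with $\deg_{G_c}(x)=0$ and $\mathrm{outdeg}(S(x))=0$, choose one. Let $E_x$ be the set of top choices of $x$ in $E'$ and add $E_x$ to $E_d$. If now still $\mathrm{outdeg}(S(x))=0$, then add to $E_c$ every $(x,w)\in E_x$ with $x\succ_wM(w)$ and $M(x)\succ_xw$, remove from $E_c$ every edge that is strictly dominated at its woman by one of these added edges, and remove $E_x$ from $E'$. 2. For each man $x$ in turn with $\mathrm{outdeg}(S(x))=0$: for each woman $w\in S(x)$ with $\deg_{G_c}(w)\ge2$, delete from $E_c$ and $E'$ all edges of lowest rank for $w$ among the edges of $E_c\cup E'$ incident to $w$. 3. While there is a strongly connected component $S$ of $G_d$ with $\mathrm{outdeg}(S)=0$ on which $E_c$ is a perfect matching, choose one, set $M:=(E_c\cap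 S)\cup(M\setminus S)$, and output $M$. Then update: $E_c\cap S$ keeps only the edges $(x,M(x))$ with $M(x)=_xM_z(x)$; an edge of $E_d$ inside $S$ stays only if it is in $M$; and for every woman $w\in S$, all edges $(x',w)$ with $M(w)\succ_wx'$ are removed from $E_d$ and $E'$. **Theorem.** The algorithm runs in $O(mn)$ time. Precisely: there are a random access machine program $P$ and a constant $C$ such that for every instance with $m\ge1$ edges that has a super-stable matching, given by adjacency lists (the edges numbered arbitrarily, with their endpoints and the two ranks of each edge, and for every vertex the list of its edges sorted by preference), $P$ halts after at most $C\,mn$ elementary steps and executes a complete terminating run of the algorithm on that instance. That is, it writes the whole record of such a run: $M_0$ and $M_z$, then in order the man chosen in every round of phase 1, every execution of phase 2, and every matching output in phase 3. The elementary steps of the machine are loading constants, copying, adding or subtracting 1, reading and writing an array cell, writing to the output, and comparing two registers, each at cost 1. -/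

import Mathlib

noncomputable section

open scoped Classical

namespace SuperStable

/-! ### Instances and super-stable matchings -/

/-- Bipartite graph on men `Fin a` and women `Fin b` with edge set `E`. Preference lists with ties
are given by ranks (the index of the tie, smaller is better): `w` is strictly preferred to `w'`
by `m` iff `rankM m w < rankM m w'`, and `m` is indifferent iff the ranks agree; ranks of
non-adjacent pairs are never used. -/
structure Inst where
  a : ℕ
  b : ℕ
  E : Finset (Fin a × Fin b)
  rankM : Fin a → Fin b → ℕ
  rankW : Fin b → Fin a → ℕ

namespace Inst

/-- Number of vertices. -/
def numV (I : Inst) : ℕ := I.a + I.b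

/-- Number of edges. -/
def numE (I : Inst) : ℕ := I.E.card

/-- Men and women. -/
abbrev V (I : Inst) : Type := Fin I.a ⊕ Fin I.b

abbrev EdgeSet (I : Inst) : Type := Finset (Fin I.a × Fin I.b)

end Inst

variable (I : Inst)

def IsMatching (M : I.EdgeSet) : Prop :=
  M ⊆ I.E ∧ ∀ e ∈ M, ∀ f ∈ M, (e.1 = f.1 ∨ e.2 = f.2) → e = f

/-- `e ∈ E \ M` blocks `M`: each endpoint of `e` is unmatched or weakly prefers the other
endpoint of `e` to its partner. -/
def Blocks (M : I.EdgeSet) (e : Fin I.a × Fin I.b) : Prop :=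
  e ∈ I.E ∧ e ∉ M ∧
    (∀ w, (e.1, w) ∈ M → I.rankM e.1 e.2 ≤ I.rankM e.1 w) ∧
    (∀ m, (m, e.2) ∈ M → I.rankW e.2 e.1 ≤ I.rankW e.2 m)

def IsSuperStable (M : I.EdgeSet) : Prop :=
  IsMatching I M ∧ ∀ e, ¬ Blocks I M e

/-- Every man weakly prefers his situation in `M` to that in `N` (being unmatched is worst). -/
def MenPrefer (M N : I.EdgeSet) : Prop :=
  ∀ m w', (m, w') ∈ N → ∃ w, (m, w) ∈ M ∧ I.rankM m w ≤ I.rankM m w'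

/-- Every woman weakly prefers her situation in `M` to that in `N`. -/
def WomenPrefer (M N : I.EdgeSet) : Prop :=
  ∀ w m', (m', w) ∈ N → ∃ m, (m, w) ∈ M ∧ I.rankW w m ≤ I.rankW w m'

def IsManOptimal (M : I.EdgeSet) : Prop :=
  IsSuperStable I M ∧ ∀ N, IsSuperStable I N → MenPrefer I M N

def IsWomanOptimal (M : I.EdgeSet) : Prop :=
  IsSuperStable I M ∧ ∀ N, IsSuperStable I N → WomenPrefer I M N

/-! ### The state of the algorithm and the digraph `G_d` -/

/-- `M` is the current matching, `Ed` the edges of `G_d`, `Er` the edges not yet processed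
(the set `E'` of the pseudocode), `Ec` the candidate edges, i.e. the edges of `G_c`. -/
structure State where
  M : I.EdgeSet
  Ed : I.EdgeSet
  Er : I.EdgeSet
  Ec : I.EdgeSet

variable {I}

/-- The arcs of `G_d`: edges of `Ed ∩ M` go from the woman to the man, other edges of `Ed` from
the man to the woman. -/
def Arc (s : State I) : I.V → I.V → Prop
  | Sum.inl m, Sum.inr w => (m, w) ∈ s.Ed ∧ (m, w) ∉ s.M
  | Sum.inr w, Sum.inl m => (m, w) ∈ s.Ed ∧ (m, w) ∈ s.M
  | _, _ => False

/-- `S(v)`: the vertex set of the strongly connected component of `v` in `G_d`. -/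
def scc (s : State I) (v : I.V) : Set I.V :=
  {u | Relation.ReflTransGen (Arc s) v u ∧ Relation.ReflTransGen (Arc s) u v}

/-- `outdeg(S) = 0`. -/
def NoOut (s : State I) (S : Set I.V) : Prop :=
  ∀ u ∈ S, ∀ v, Arc s u v → v ∈ S

/-- Both endpoints of `e` lie in `S`. -/
def Inside (S : Set I.V) (e : Fin I.a × Fin I.b) : Prop :=
  Sum.inl e.1 ∈ S ∧ Sum.inr e.2 ∈ S

/-- `rank_M(m) = rank_{Mz}(m)`; vacuous for a man without a partner. -/
def Settled (M Mz : I.EdgeSet) (m : Fin I.a) : Prop :=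
  ∀ w w', (m, w) ∈ M → (m, w') ∈ Mz → I.rankM m w = I.rankM m w'

/-- `w` strictly prefers her partner in `M` to `m`, where `e = (m, w)`. -/
def Dominated (M : I.EdgeSet) (e : Fin I.a × Fin I.b) : Prop :=
  ∃ m, (m, e.2) ∈ M ∧ I.rankW e.2 m < I.rankW e.2 e.1

/-! ### The steps of the algorithm -/

/-- Initialisation. -/
def initState (M₀ Mz : I.EdgeSet) : State I where
  M := M₀
  Ed := M₀
  Er := (I.E \ M₀).filter fun e =>
    ¬ Dominated M₀ e ∧ ¬ ∃ w, (e.1, w) ∈ M₀ ∧ I.rankM e.1 e.2 ≤ I.rankM e.1 w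
  Ec := M₀.filter fun e => Settled M₀ Mz e.1

/-- The condition under which the search loop may pick the man `m`. -/
def CanScan (Mz : I.EdgeSet) (s : State I) (m : Fin I.a) : Prop :=
  ¬ Settled s.M Mz m ∧ (∀ w, (m, w) ∉ s.Ec) ∧ NoOut s (scc s (Sum.inl m))

/-- `E_m`: the top choices of `m` among the edges of `Er`. -/
def topChoices (s : State I) (m : Fin I.a) : I.EdgeSet :=
  s.Er.filter fun e => e.1 = m ∧ ∀ w, (m, w) ∈ s.Er → I.rankM m e.2 ≤ I.rankM m w

/-- `m ≻_w M(w)` and `M(m) ≻_m w`, for `e = (m, w)`. -/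
def Candidate (M : I.EdgeSet) (e : Fin I.a × Fin I.b) : Prop :=
  (∃ m', (m', e.2) ∈ M ∧ I.rankW e.2 e.1 < I.rankW e.2 m') ∧
  (∃ w', (e.1, w') ∈ M ∧ I.rankM e.1 w' < I.rankM e.1 e.2)

/-- One execution of the body of the search loop, for the man `m`. -/
def scan (s : State I) (m : Fin I.a) : State I :=
  let s₁ : State I := { s with Ed := s.Ed ∪ topChoices s m }
  if NoOut s₁ (scc s₁ (Sum.inl m)) then
    let added := (topChoices s m).filter (Candidate s.M)
    { s₁ with
      Ec := (s.Ec ∪ added).filter fun e =>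
        ¬ ∃ f ∈ added, f.2 = e.2 ∧ I.rankW e.2 f.1 < I.rankW e.2 e.1
      Er := s.Er \ topChoices s m }
  else s₁

/-- `w` is multiply engaged: at least two edges of `Ec` are incident to `w`. -/
def MultiplyEngaged (s : State I) (w : Fin I.b) : Prop :=
  ∃ m m', m ≠ m' ∧ (m, w) ∈ s.Ec ∧ (m', w) ∈ s.Ec

/-- Body of the `for` loop for the man `m`: for every multiply engaged `w ∈ S(m)`, delete all
lowest ranked edges of `Ec ∪ Er` incident to `w`. -/
def pruneAt (s : State I) (m : Fin I.a) : State I :=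
  if NoOut s (scc s (Sum.inl m)) then
    let del := (s.Ec ∪ s.Er).filter fun e =>
      Sum.inr e.2 ∈ scc s (Sum.inl m) ∧ MultiplyEngaged s e.2 ∧
        ∀ m', (m', e.2) ∈ s.Ec ∪ s.Er → I.rankW e.2 m' ≤ I.rankW e.2 e.1
    { s with Ec := s.Ec \ del, Er := s.Er \ del }
  else s

/-- The whole `for` loop. -/
def prune (s : State I) : State I :=
  (List.finRange I.a).foldl pruneAt s

/-- `S` is a strongly connected component without outgoing edges on which `Ec` is a perfect
matching. -/
def CanRotate (s : State I) (S : Set I.V) : Prop :=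
  (∃ v, S = scc s v) ∧ NoOut s S ∧
    (∀ m, Sum.inl m ∈ S → ∃! w, Sum.inr w ∈ S ∧ (m, w) ∈ s.Ec) ∧
    (∀ w, Sum.inr w ∈ S → ∃! m, Sum.inl m ∈ S ∧ (m, w) ∈ s.Ec)

/-- `(Ec ∩ S) ∪ (M \ S)`. -/
def newMatching (s : State I) (S : Set I.V) : I.EdgeSet :=
  s.Ec.filter (Inside S) ∪ s.M.filter fun e => ¬ Inside S e

/-- One execution of the body of the output loop, with the update of `G_c`, `G_d` and `Er`. -/
def rotate (Mz : I.EdgeSet) (s : State I) (S : Set I.V) : State I :=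
  let M' := newMatching s S
  { M := M'
    Ec := s.Ec.filter fun e => Inside S e → e ∈ M' ∧ Settled M' Mz e.1
    Ed := s.Ed.filter fun e =>
      (Inside S e → e ∈ M') ∧ (Sum.inr e.2 ∈ S → ¬ Dominated M' e)
    Er := s.Er.filter fun e => Sum.inr e.2 ∈ S → ¬ Dominated M' e }

/-! ### Runs of the algorithm -/

variable (I) in
/-- What a run records: the computed `M₀` and `Mz`, the man chosen in each round of the search
loop, each execution of the `for` loop, and each matching that is output. -/
inductive Event where
  | start (M₀ Mz : I.EdgeSet)
  | scan (m : Fin I.a)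
  | prune
  | output (M : I.EdgeSet)

/-- A complete execution of the search loop (the first `while` loop). -/
inductive SearchLoop (Mz : I.EdgeSet) : State I → List (Event I) → State I → Prop
  | exit (s : State I) (h : ∀ m, ¬ CanScan Mz s m) : SearchLoop Mz s [] s
  | step (s t : State I) (m : Fin I.a) (l : List (Event I)) (h : CanScan Mz s m)
      (hl : SearchLoop Mz (scan s m) l t) : SearchLoop Mz s (Event.scan m :: l) t

/-- A complete execution of the output loop (the second `while` loop). -/
inductive OutputLoop (Mz : I.EdgeSet) : State I → List (Event I) → State I → Prop
  | exit (s : State I) (h : ∀ S, ¬ CanRotate s S) : OutputLoop Mz s [] s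
  | step (s t : State I) (S : Set I.V) (l : List (Event I)) (h : CanRotate s S)
      (hl : OutputLoop Mz (rotate Mz s S) l t) :
      OutputLoop Mz s (Event.output (newMatching s S) :: l) t

/-- A complete execution of the `repeat ... until` loop. -/
inductive RepeatLoop (Mz : I.EdgeSet) : State I → List (Event I) → Prop
  | last (s t u : State I) (l₁ l₂ : List (Event I)) (h₁ : SearchLoop Mz s l₁ t)
      (h₂ : OutputLoop Mz (prune t) l₂ u) (hu : ∀ m, Settled u.M Mz m) :
      RepeatLoop Mz s (l₁ ++ Event.prune :: l₂)
  | again (s t u : State I) (l₁ l₂ l₃ : List (Event I)) (h₁ : SearchLoop Mz s l₁ t)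
      (h₂ : OutputLoop Mz (prune t) l₂ u) (hu : ¬ ∀ m, Settled u.M Mz m)
      (h₃ : RepeatLoop Mz u l₃) :
      RepeatLoop Mz s (l₁ ++ Event.prune :: l₂ ++ l₃)

variable (I) in
/-- `l` records a complete (terminated) run of the algorithm on `I`. -/
def IsRun (l : List (Event I)) : Prop :=
  ∃ M₀ Mz l', IsManOptimal I M₀ ∧ IsWomanOptimal I Mz ∧
    RepeatLoop Mz (initState M₀ Mz) l' ∧ l = Event.start M₀ Mz :: l'

/-- A matching written as the list of the partners of men `0, 1, ...`: `w + 1` for a man matched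
to `w` and `0` for an unmatched man. -/
def matchingCode (M : I.EdgeSet) : List ℕ :=
  (List.finRange I.a).map fun m => ∑ w : Fin I.b, if (m, w) ∈ M then w.val + 1 else 0

def eventCode : Event I → List ℕ
  | Event.start M₀ Mz => matchingCode M₀ ++ matchingCode Mz
  | Event.scan m => [0, m.val]
  | Event.prune => [1]
  | Event.output M => 2 :: matchingCode M

/-! ### Random access machine programs and their running time -/

/-- Memory: registers, arrays of natural numbers, and the output tape. -/
structure Mem where
  reg : ℕ → ℕ
  arr : ℕ → ℕ → ℕ
  out : List ℕ

/-- Programs. The only arithmetic is `± 1`, so that after `t` steps every stored number exceeds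
those of the input and the program text by at most `t`. -/
inductive Prog where
  | skip
  | const (x c : ℕ)
  | copy (x y : ℕ)
  | succ (x : ℕ)
  | pred (x : ℕ)
  | load (x A i : ℕ)
  | store (A i x : ℕ)
  | emit (x : ℕ)
  | seq (p q : Prog)
  | ifLt (x y : ℕ) (p q : Prog)
  | whileLt (x y : ℕ) (p : Prog)

namespace Mem

def setReg (σ : Mem) (x v : ℕ) : Mem :=
  { σ with reg := Function.update σ.reg x v }

def setArr (σ : Mem) (A i v : ℕ) : Mem :=
  { σ with arr := Function.update σ.arr A (Function.update (σ.arr A) i v) }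

end Mem

/-- `Exec p σ t τ`: started in memory `σ`, the program `p` halts after exactly `t` steps in
memory `τ`. Each elementary instruction and each test costs one step. -/
inductive Exec : Prog → Mem → ℕ → Mem → Prop
  | skip (σ : Mem) : Exec Prog.skip σ 1 σ
  | const (σ : Mem) (x c : ℕ) : Exec (Prog.const x c) σ 1 (σ.setReg x c)
  | copy (σ : Mem) (x y : ℕ) : Exec (Prog.copy x y) σ 1 (σ.setReg x (σ.reg y))
  | succ (σ : Mem) (x : ℕ) : Exec (Prog.succ x) σ 1 (σ.setReg x (σ.reg x + 1))
  | pred (σ : Mem) (x : ℕ) : Exec (Prog.pred x) σ 1 (σ.setReg x (σ.reg x - 1))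
  | load (σ : Mem) (x A i : ℕ) : Exec (Prog.load x A i) σ 1 (σ.setReg x (σ.arr A (σ.reg i)))
  | store (σ : Mem) (A i x : ℕ) :
      Exec (Prog.store A i x) σ 1 (σ.setArr A (σ.reg i) (σ.reg x))
  | emit (σ : Mem) (x : ℕ) : Exec (Prog.emit x) σ 1 { σ with out := σ.out ++ [σ.reg x] }
  | seq (p q : Prog) (σ τ υ : Mem) (t u : ℕ) (hp : Exec p σ t τ) (hq : Exec q τ u υ) :
      Exec (Prog.seq p q) σ (t + u) υ
  | ifTrue (x y : ℕ) (p q : Prog) (σ τ : Mem) (t : ℕ) (h : σ.reg x < σ.reg y)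
      (hp : Exec p σ t τ) : Exec (Prog.ifLt x y p q) σ (t + 1) τ
  | ifFalse (x y : ℕ) (p q : Prog) (σ τ : Mem) (t : ℕ) (h : ¬ σ.reg x < σ.reg y)
      (hq : Exec q σ t τ) : Exec (Prog.ifLt x y p q) σ (t + 1) τ
  | whileFalse (x y : ℕ) (p : Prog) (σ : Mem) (h : ¬ σ.reg x < σ.reg y) :
      Exec (Prog.whileLt x y p) σ 1 σ
  | whileTrue (x y : ℕ) (p : Prog) (σ τ υ : Mem) (t u : ℕ) (h : σ.reg x < σ.reg y)
      (hp : Exec p σ t τ) (hw : Exec (Prog.whileLt x y p) τ u υ) :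
      Exec (Prog.whileLt x y p) σ (t + u + 1) υ

/-! ### The input: adjacency lists -/

variable (I) in
/-- An adjacency-list layout of `I`: a numbering of the edges, and the concatenation of the
preference lists of men `0, 1, ...` (`listM`) and of women `0, 1, ...` (`listW`), each list in
order of non-increasing preference. -/
structure Layout where
  edge : Fin I.numE ≃ {e // e ∈ I.E}
  listM : Fin I.numE ≃ Fin I.numE
  listW : Fin I.numE ≃ Fin I.numE
  sortedM : ∀ k l, k ≤ l →
    (edge (listM k)).1.1 < (edge (listM l)).1.1 ∨
      ((edge (listM k)).1.1 = (edge (listM l)).1.1 ∧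
        I.rankM (edge (listM k)).1.1 (edge (listM k)).1.2 ≤
          I.rankM (edge (listM l)).1.1 (edge (listM l)).1.2)
  sortedW : ∀ k l, k ≤ l →
    (edge (listW k)).1.2 < (edge (listW l)).1.2 ∨
      ((edge (listW k)).1.2 = (edge (listW l)).1.2 ∧
        I.rankW (edge (listW k)).1.2 (edge (listW k)).1.1 ≤
          I.rankW (edge (listW l)).1.2 (edge (listW l)).1.1)

/-- The array `f 0, ..., f (k - 1), 0, 0, ...`. -/
def tabulate {k : ℕ} (f : Fin k → ℕ) (i : ℕ) : ℕ :=
  if h : i < k then f ⟨i, h⟩ else 0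

/-- The initial memory. Registers `0, 1, 2` hold the numbers of men, women and edges. Arrays
`0, 1` hold the man and the woman of each edge, arrays `2, 3` the rank of each edge in the list of
its man and of its woman. Array `4` holds the concatenated preference lists of the men (as edge
numbers), and the list of man `i` occupies the positions from entry `i` of array `5` up to, but
excluding, entry `i + 1`; arrays `6, 7` are the same for the women. Everything else is zero. -/
def inputMem (L : Layout I) : Mem where
  reg
    | 0 => I.a
    | 1 => I.b
    | 2 => I.numE
    | _ => 0
  arr
    | 0 => tabulate fun e => (L.edge e).1.1.val
    | 1 => tabulate fun e => (L.edge e).1.2.val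
    | 2 => tabulate fun e => I.rankM (L.edge e).1.1 (L.edge e).1.2
    | 3 => tabulate fun e => I.rankW (L.edge e).1.2 (L.edge e).1.1
    | 4 => tabulate fun k => (L.listM k).val
    | 5 => tabulate fun i : Fin (I.a + 1) => (I.E.filter fun e => e.1.val < i.val).card
    | 6 => tabulate fun k => (L.listW k).val
    | 7 => tabulate fun i : Fin (I.b + 1) => (I.E.filter fun e => e.2.val < i.val).card
    | _ => fun _ => 0
  out := []

end SuperStable

end

/-! ### Program logic: a structured language, its compilation to the machine, and rules for loops.
-/

noncomputable section

open scoped Classical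

namespace SuperStable

/-! ### A structured language on top of the machine

The running time of a statement is measured by the number of loop iterations; up to the constant
factor given by the size of the program text this bounds the number of machine steps. -/

/-! Two things are needed: the algorithm never gets stuck while some man is unsettled, and a run can
be carried out within O(mn) machine steps.

Correctness rests on the invariant `Good`. Its engine is `IsSuperStable.better`, applied to the
woman-optimal matching Mz: if a man y weakly prefers w to his situation in Mz, then w is matched in
Mz to y or to somebody strictly better than y, since otherwise the edge would block Mz. All top
choices of a scanned man and all candidate edges are of this kind. Hence no deletion, whether of
dominated edges or of the lowest edges at a woman with several candidates (`mz_not_low`), can hit an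
edge of Mz, and such an edge always stays in E' or in E_c. For progress (`not_stuck`), start from an
unsettled man and follow arcs to a component without leaving arcs. All its men are unsettled. If
none of them can be scanned, each has a candidate edge inside the component; if no woman is multiply
engaged these edges are injective on the men; and there are at most as many women as men, because M
matches the women into the component. So the candidates form a perfect matching and a rotation is
possible.

The time bound is an amortised argument. `Phi` gives every edge a bounded weight that falls as the
edge is scanned, becomes a candidate, is matched or is deleted, and every event that changes the
state lowers it. What must not be done is to recompute strongly connected components at each test.
Instead a `Forest` is kept: a partition of the men into classes that lie inside components, one
recorded leaving edge for each class known not to be closed, and a set of "dirty" men whose edges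
still have to be examined. Repairing the forest proceeds in steps of cost O(n), each of which lowers
a second potential `Psi`: a dirty man is cleared, or a leaving edge is recorded, or two classes are
merged. Once no unrecorded class contains a dirty man, the closed components are exactly the classes
without a recorded edge (`ForestOK.noOut_iff`). The events raise `Psi` only by amounts that the fall
of `Phi` pays for (`Phi_rotate` against `ForestOK.rotated_ok`). With `Theta` = `Phi` + `Psi`, every
event costs O(n) per unit of decrease of `Theta`, every round of the outer loop but the last lowers
it, and initially it is at most 24m.

The two optimal matchings are computed by proposals along all top choices at once, in which a woman
who receives a tie refuses both proposals (`PInv`). Comparing sizes with an arbitrary super-stable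
matching shows that the final engagements are super-stable and optimal for the proposing side
(`PInv.final`). The measure 3|R| + |dirty| − engaged bounds the number of passes by O(m), each of
cost O(n). One program serves both sides.

All programs are written in a small structured language in which only loop iterations cost time;
`St.exec_cmp` translates this into machine steps with a factor given by the program text. -/

inductive Ex where
  | r (x : ℕ)
  | k (c : ℕ)
  | ld (A : ℕ) (e : Ex)
  | inc (e : Ex)
  | dec (e : Ex)

def Ex.val (σ : Mem) : Ex → ℕ
  | .r x => σ.reg x
  | .k c => c
  | .ld A e => σ.arr A (e.val σ)
  | .inc e => e.val σ + 1
  | .dec e => e.val σ - 1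

inductive Cd where
  | lt (e f : Ex)
  | eq (e f : Ex)
  | ne (e f : Ex)

def Cd.holds (σ : Mem) : Cd → Prop
  | .lt e f => e.val σ < f.val σ
  | .eq e f => e.val σ = f.val σ
  | .ne e f => e.val σ ≠ f.val σ

inductive St where
  | skip
  | set (x : ℕ) (e : Ex)
  | put (A : ℕ) (e f : Ex)
  | out (e : Ex)
  | seq (p q : St)
  | ite (c : Cd) (p q : St)
  | whl (e f : Ex) (p : St)

infixr:60 " ⨟ " => St.seq

/-- Loops are split off as an inductive predicate over the semantics of the body, so that `Run` can
be defined by recursion on the program. The unit added per iteration is the only source of cost. -/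
inductive WRun (c : Mem → Prop) (B : Mem → ℕ → Mem → Prop) : Mem → ℕ → Mem → Prop
  | done (σ : Mem) (h : ¬ c σ) : WRun c B σ 0 σ
  | step (σ μ τ : Mem) (t u : ℕ) (h : c σ) (hb : B σ t μ) (hw : WRun c B μ u τ) :
      WRun c B σ (t + u + 1) τ

def Run : St → Mem → ℕ → Mem → Prop
  | .skip, σ, t, τ => t = 0 ∧ τ = σ
  | .set x e, σ, t, τ => t = 0 ∧ τ = σ.setReg x (e.val σ)
  | .put A e f, σ, t, τ => t = 0 ∧ τ = σ.setArr A (e.val σ) (f.val σ)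
  | .out e, σ, t, τ => t = 0 ∧ τ = { σ with out := σ.out ++ [e.val σ] }
  | .seq p q, σ, t, τ => ∃ t₁ μ t₂, Run p σ t₁ μ ∧ Run q μ t₂ τ ∧ t = t₁ + t₂
  | .ite c p q, σ, t, τ => (c.holds σ ∧ Run p σ t τ) ∨ (¬ c.holds σ ∧ Run q σ t τ)
  | .whl e f p, σ, t, τ => WRun (fun σ => e.val σ < f.val σ) (Run p) σ t τ

/-- `p` terminates from `σ` with running time and final memory satisfying `Q`. -/
def HT (p : St) (σ : Mem) (Q : ℕ → Mem → Prop) : Prop := ∃ t τ, Run p σ t τ ∧ Q t τ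

theorem HT.mono {p σ} {Q Q' : ℕ → Mem → Prop} (h : HT p σ Q) (hQ : ∀ t τ, Q t τ → Q' t τ) :
    HT p σ Q' := by
  obtain ⟨t, τ, h1, h2⟩ := h
  exact ⟨t, τ, h1, hQ _ _ h2⟩

theorem HT_skip {σ Q} : HT .skip σ Q ↔ Q 0 σ := by simp [HT, Run]

theorem HT_set {σ Q x e} : HT (.set x e) σ Q ↔ Q 0 (σ.setReg x (e.val σ)) := by simp [HT, Run]

theorem HT_put {σ Q A e f} :
    HT (.put A e f) σ Q ↔ Q 0 (σ.setArr A (e.val σ) (f.val σ)) := by simp [HT, Run]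

theorem HT_out {σ Q e} :
    HT (.out e) σ Q ↔ Q 0 { σ with out := σ.out ++ [e.val σ] } := by simp [HT, Run]

theorem HT_seq {σ Q p q} :
    HT (p ⨟ q) σ Q ↔ HT p σ (fun t τ => HT q τ (fun u υ => Q (t + u) υ)) := by
  constructor
  · rintro ⟨t, τ, ⟨t₁, μ, t₂, h1, h2, rfl⟩, h⟩
    exact ⟨t₁, μ, h1, t₂, τ, h2, h⟩
  · rintro ⟨t₁, μ, h1, t₂, τ, h2, h⟩
    exact ⟨_, τ, ⟨t₁, μ, t₂, h1, h2, rfl⟩, h⟩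

theorem HT_ite {σ Q c p q} :
    HT (.ite c p q) σ Q ↔ (c.holds σ → HT p σ Q) ∧ (¬ c.holds σ → HT q σ Q) := by
  by_cases h : c.holds σ <;> simp [HT, Run, h]

theorem HT_whl {σ Q e f p} :
    HT (.whl e f p) σ Q ↔
      (e.val σ < f.val σ → HT p σ (fun t τ => HT (.whl e f p) τ (fun u υ => Q (t + u + 1) υ))) ∧
      (¬ e.val σ < f.val σ → Q 0 σ) := by
  constructor
  · rintro ⟨t, τ, h, hQ⟩
    cases h with
    | done _ h => exact ⟨fun h' => absurd h' h, fun _ => hQ⟩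
    | step _ μ _ t u h hb hw => exact ⟨fun _ => ⟨t, μ, hb, u, τ, hw, hQ⟩, fun h' => absurd h h'⟩
  · rintro ⟨h1, h2⟩
    by_cases h : e.val σ < f.val σ
    · obtain ⟨t, μ, hb, u, τ, hw, hQ⟩ := h1 h
      exact ⟨_, τ, .step _ _ _ _ _ h hb hw, hQ⟩
    · exact ⟨0, σ, .done _ h, h2 h⟩

/-! ### Compilation -/

/-- Registers 0, 1, 2 must stay where the input puts them. Skipping 3 and 4 frees two scratch
registers for the evaluation of expressions; accordingly `Sim` says nothing about them. -/
def rho (x : ℕ) : ℕ := if x < 3 then x else x + 2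

theorem rho_inj {x y : ℕ} : rho x = rho y ↔ x = y := by
  unfold rho; split_ifs <;> omega

theorem rho_ne3 (x : ℕ) : rho x ≠ 3 := by unfold rho; split_ifs <;> omega
theorem rho_ne4 (x : ℕ) : rho x ≠ 4 := by unfold rho; split_ifs <;> omega

def Sim (σ h : Mem) : Prop := (∀ x, σ.reg (rho x) = h.reg x) ∧ σ.arr = h.arr ∧ σ.out = h.out

def Ex.cmp (d : ℕ) : Ex → Prog
  | .r x => .copy d (rho x)
  | .k c => .const d c
  | .ld A e => .seq (e.cmp d) (.load d A d)
  | .inc e => .seq (e.cmp d) (.succ d)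
  | .dec e => .seq (e.cmp d) (.pred d)

def Ex.size : Ex → ℕ
  | .r _ => 1
  | .k _ => 1
  | .ld _ e => e.size + 1
  | .inc e => e.size + 1
  | .dec e => e.size + 1

theorem Ex.exec_cmp {σ h : Mem} (hs : Sim σ h) (d : ℕ) (e : Ex) :
    Exec (e.cmp d) σ e.size (σ.setReg d (e.val h)) := by
  induction e with
  | r x => rw [Ex.val, ← hs.1 x]; exact .copy _ _ _
  | k c => exact .const _ _ _
  | ld A e ih =>
    refine .seq _ _ _ _ _ _ _ ih ?_
    have := Exec.load (σ.setReg d (e.val h)) d A d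
    simpa [Mem.setReg, Ex.val, hs.2.1] using this
  | inc e ih =>
    refine .seq _ _ _ _ _ _ _ ih ?_
    have := Exec.succ (σ.setReg d (e.val h)) d
    simpa [Mem.setReg, Ex.val, hs.2.1] using this
  | dec e ih =>
    refine .seq _ _ _ _ _ _ _ ih ?_
    have := Exec.pred (σ.setReg d (e.val h)) d
    simpa [Mem.setReg, Ex.val, hs.2.1] using this

theorem Sim.set3 {σ h : Mem} (hs : Sim σ h) (v : ℕ) : Sim (σ.setReg 3 v) h :=
  ⟨fun x => by simp [Mem.setReg, Function.update_of_ne (rho_ne3 x), hs.1], hs.2⟩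

theorem Sim.set4 {σ h : Mem} (hs : Sim σ h) (v : ℕ) : Sim (σ.setReg 4 v) h :=
  ⟨fun x => by simp [Mem.setReg, Function.update_of_ne (rho_ne4 x), hs.1], hs.2⟩

theorem Sim.setRho {σ h : Mem} (hs : Sim σ h) (x v : ℕ) :
    Sim (σ.setReg (rho x) v) (h.setReg x v) :=
  ⟨fun y => by simp [Mem.setReg, Function.update_apply, rho_inj, hs.1], hs.2⟩

def ev2 (e f : Ex) : Prog := .seq (e.cmp 3) (f.cmp 4)

theorem exec_ev2 {σ h : Mem} (hs : Sim σ h) (e f : Ex) :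
    ∃ τ, Exec (ev2 e f) σ (e.size + f.size) τ ∧ Sim τ h ∧ τ.reg 3 = e.val h ∧
      τ.reg 4 = f.val h := by
  refine ⟨_, .seq _ _ _ _ _ _ _ (e.exec_cmp hs 3) (f.exec_cmp (hs.set3 _) 4),
    (hs.set3 _).set4 _, ?_, ?_⟩ <;> simp [Mem.setReg]

def St.cmp : St → Prog
  | .skip => .skip
  | .set x e => .seq (e.cmp 3) (.copy (rho x) 3)
  | .put A e f => .seq (ev2 e f) (.store A 3 4)
  | .out e => .seq (e.cmp 3) (.emit 3)
  | .seq p q => .seq p.cmp q.cmp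
  | .ite (.lt e f) p q => .seq (ev2 e f) (.ifLt 3 4 p.cmp q.cmp)
  | .ite (.eq e f) p q => .seq (ev2 e f) (.ifLt 3 4 q.cmp (.ifLt 4 3 q.cmp p.cmp))
  | .ite (.ne e f) p q => .seq (ev2 e f) (.ifLt 3 4 p.cmp (.ifLt 4 3 p.cmp q.cmp))
  | .whl e f p => .seq (ev2 e f) (.whileLt 3 4 (.seq p.cmp (ev2 e f)))

def St.size : St → ℕ
  | .skip => 1
  | .set _ e => e.size + 1
  | .put _ e f => e.size + f.size + 1
  | .out e => e.size + 1
  | .seq p q => p.size + q.size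
  | .ite (.lt e f) p q => e.size + f.size + 2 + p.size + q.size
  | .ite (.eq e f) p q => e.size + f.size + 2 + p.size + q.size
  | .ite (.ne e f) p q => e.size + f.size + 2 + p.size + q.size
  | .whl e f p => e.size + f.size + 1 + p.size

/-- Code between two loop tests runs at most once per iteration of an enclosing loop, and once
outside all loops, so its length times 1 + t bounds the machine steps. -/
theorem St.exec_cmp (p : St) : ∀ {σ h : Mem} {t : ℕ} {h' : Mem}, Sim σ h → Run p h t h' →
    ∃ u τ, Exec p.cmp σ u τ ∧ Sim τ h' ∧ u ≤ p.size * (1 + t) := by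
  induction p with
  | skip =>
    rintro σ h t h' hs ⟨rfl, rfl⟩
    exact ⟨1, σ, .skip _, hs, by simp [St.size]⟩
  | set x e =>
    rintro σ h t h' hs ⟨rfl, rfl⟩
    refine ⟨_, _, .seq _ _ _ _ _ _ _ (e.exec_cmp hs 3) (.copy _ _ _), ?_, ?_⟩
    · have := (hs.set3 (e.val h)).setRho x (e.val h)
      simpa [Mem.setReg] using this
    · simp [St.size]
  | put A e f =>
    rintro σ h t h' hs ⟨rfl, rfl⟩
    obtain ⟨τ, h1, h2, h3, h4⟩ := exec_ev2 hs e f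
    refine ⟨_, _, .seq _ _ _ _ _ _ _ h1 (.store _ _ _ _), ?_, ?_⟩
    · refine ⟨fun x => h2.1 x, ?_, h2.2.2⟩
      simp [Mem.setArr, h3, h4, h2.2.1]
    · simp [St.size]
  | out e =>
    rintro σ h t h' hs ⟨rfl, rfl⟩
    refine ⟨_, _, .seq _ _ _ _ _ _ _ (e.exec_cmp hs 3) (.emit _ _), ?_, ?_⟩
    · refine ⟨fun x => (hs.set3 (e.val h)).1 x, hs.2.1, ?_⟩
      simp [Mem.setReg, hs.2.2]
    · simp [St.size]
  | seq p q ihp ihq =>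
    rintro σ h t h' hs ⟨t₁, μ, t₂, h1, h2, rfl⟩
    obtain ⟨u, τ, a1, a2, a3⟩ := ihp hs h1
    obtain ⟨v, υ, b1, b2, b3⟩ := ihq a2 h2
    refine ⟨_, _, .seq _ _ _ _ _ _ _ a1 b1, b2, ?_⟩
    simp only [St.size]
    nlinarith [Nat.zero_le (p.size * t₂), Nat.zero_le (q.size * t₁)]
  | ite c p q ihp ihq =>
    rintro σ h t h' hs hr
    cases c with
    | lt e f =>
      obtain ⟨τ, h1, h2, h3, h4⟩ := exec_ev2 hs e f
      rcases hr with ⟨hc, hr⟩ | ⟨hc, hr⟩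
      · obtain ⟨u, υ, a1, a2, a3⟩ := ihp h2 hr
        refine ⟨_, _, .seq _ _ _ _ _ _ _ h1 (.ifTrue _ _ _ _ _ _ _ ?_ a1), a2, ?_⟩
        · rw [h3, h4]; exact hc
        · simp only [St.size]
          nlinarith [Nat.zero_le (q.size * (1 + t)), Nat.zero_le ((e.size + f.size + 2) * t)]
      · obtain ⟨u, υ, a1, a2, a3⟩ := ihq h2 hr
        refine ⟨_, _, .seq _ _ _ _ _ _ _ h1 (.ifFalse _ _ _ _ _ _ _ ?_ a1), a2, ?_⟩
        · rw [h3, h4]; exact hc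
        · simp only [St.size]
          nlinarith [Nat.zero_le (p.size * (1 + t)), Nat.zero_le ((e.size + f.size + 2) * t)]
    | eq e f =>
      obtain ⟨τ, h1, h2, h3, h4⟩ := exec_ev2 hs e f
      rcases hr with ⟨hc, hr⟩ | ⟨hc, hr⟩
      · obtain ⟨u, υ, a1, a2, a3⟩ := ihp h2 hr
        simp only [Cd.holds] at hc
        refine ⟨_, _, .seq _ _ _ _ _ _ _ h1 (.ifFalse _ _ _ _ _ _ _ ?_
          (.ifFalse _ _ _ _ _ _ _ ?_ a1)), a2, ?_⟩
        · rw [h3, h4]; omega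
        · rw [h3, h4]; omega
        · simp only [St.size]
          nlinarith [Nat.zero_le (q.size * (1 + t)), Nat.zero_le ((e.size + f.size + 2) * t)]
      · obtain ⟨u, υ, a1, a2, a3⟩ := ihq h2 hr
        simp only [Cd.holds] at hc
        by_cases hlt : e.val h < f.val h
        · refine ⟨_, _, .seq _ _ _ _ _ _ _ h1 (.ifTrue _ _ _ _ _ _ _ ?_ a1), a2, ?_⟩
          · rw [h3, h4]; exact hlt
          · simp only [St.size]
            nlinarith [Nat.zero_le (p.size * (1 + t)), Nat.zero_le ((e.size + f.size + 2) * t)]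
        · refine ⟨_, _, .seq _ _ _ _ _ _ _ h1 (.ifFalse _ _ _ _ _ _ _ ?_
            (.ifTrue _ _ _ _ _ _ _ ?_ a1)), a2, ?_⟩
          · rw [h3, h4]; omega
          · rw [h3, h4]; omega
          · simp only [St.size]
            nlinarith [Nat.zero_le (p.size * (1 + t)), Nat.zero_le ((e.size + f.size + 2) * t)]
    | ne e f =>
      obtain ⟨τ, h1, h2, h3, h4⟩ := exec_ev2 hs e f
      rcases hr with ⟨hc, hr⟩ | ⟨hc, hr⟩
      · obtain ⟨u, υ, a1, a2, a3⟩ := ihp h2 hr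
        simp only [Cd.holds] at hc
        by_cases hlt : e.val h < f.val h
        · refine ⟨_, _, .seq _ _ _ _ _ _ _ h1 (.ifTrue _ _ _ _ _ _ _ ?_ a1), a2, ?_⟩
          · rw [h3, h4]; exact hlt
          · simp only [St.size]
            nlinarith [Nat.zero_le (q.size * (1 + t)), Nat.zero_le ((e.size + f.size + 2) * t)]
        · refine ⟨_, _, .seq _ _ _ _ _ _ _ h1 (.ifFalse _ _ _ _ _ _ _ ?_
            (.ifTrue _ _ _ _ _ _ _ ?_ a1)), a2, ?_⟩
          · rw [h3, h4]; omega
          · rw [h3, h4]; omega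
          · simp only [St.size]
            nlinarith [Nat.zero_le (q.size * (1 + t)), Nat.zero_le ((e.size + f.size + 2) * t)]
      · obtain ⟨u, υ, a1, a2, a3⟩ := ihq h2 hr
        simp only [Cd.holds, ne_eq, not_not] at hc
        refine ⟨_, _, .seq _ _ _ _ _ _ _ h1 (.ifFalse _ _ _ _ _ _ _ ?_
          (.ifFalse _ _ _ _ _ _ _ ?_ a1)), a2, ?_⟩
        · rw [h3, h4]; omega
        · rw [h3, h4]; omega
        · simp only [St.size]
          nlinarith [Nat.zero_le (p.size * (1 + t)), Nat.zero_le ((e.size + f.size + 2) * t)]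
  | whl e f p ihp =>
    intro σ h t h' hs hr
    -- The compiled loop evaluates both sides of its test before entering and again at the end of
    -- the body, so the induction assumes that registers 3 and 4 hold the current values.
    have key : ∀ {τ : Mem}, Sim τ h → τ.reg 3 = e.val h → τ.reg 4 = f.val h →
        ∃ u υ, Exec (.whileLt 3 4 (.seq p.cmp (ev2 e f))) τ u υ ∧ Sim υ h' ∧
          u ≤ (e.size + f.size + 1 + p.size) * t + 1 := by
      clear hs σ
      simp only [Run] at hr
      induction hr with
      | done h hc =>
        intro τ hs h3 h4
        exact ⟨1, τ, .whileFalse _ _ _ _ (by rw [h3, h4]; exact hc), hs, by simp⟩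
      | step h μ h' t u hc hb hw ih =>
        intro τ hs h3 h4
        obtain ⟨v, υ, a1, a2, a3⟩ := ihp hs hb
        obtain ⟨ξ, b1, b2, b3, b4⟩ := exec_ev2 a2 e f
        obtain ⟨x, ζ, c1, c2, c3⟩ := ih b2 b3 b4
        refine ⟨_, ζ, .whileTrue _ _ _ _ _ _ _ _ (by rw [h3, h4]; exact hc)
          (.seq _ _ _ _ _ _ _ a1 b1) c1, c2, ?_⟩
        nlinarith [Nat.zero_le ((e.size + f.size + 1) * t)]
    obtain ⟨τ, h1, h2, h3, h4⟩ := exec_ev2 hs e f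
    obtain ⟨u, υ, a1, a2, a3⟩ := key h2 h3 h4
    refine ⟨_, υ, .seq _ _ _ _ _ _ _ h1 a1, a2, ?_⟩
    simp only [St.size]
    nlinarith

/-! ### Frames -/

/-- Over-approximates the written registers by a computable Boolean, so that frame conditions for
concrete programs hold by `rfl`. -/
def St.wr : St → ℕ → Bool
  | .skip, _ => false
  | .set y _, x => Nat.beq y x
  | .put _ _ _, _ => false
  | .out _, _ => false
  | .seq p q, x => p.wr x || q.wr x
  | .ite _ p q, x => p.wr x || q.wr x
  | .whl _ _ p, x => p.wr x

def St.wa : St → ℕ → Bool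
  | .skip, _ => false
  | .set _ _, _ => false
  | .put A _ _, x => Nat.beq A x
  | .out _, _ => false
  | .seq p q, x => p.wa x || q.wa x
  | .ite _ p q, x => p.wa x || q.wa x
  | .whl _ _ p, x => p.wa x

def St.we : St → Bool
  | .skip => false
  | .set _ _ => false
  | .put _ _ _ => false
  | .out _ => true
  | .seq p q => p.we || q.we
  | .ite _ p q => p.we || q.we
  | .whl _ _ p => p.we

structure Frame (p : St) (σ τ : Mem) : Prop where
  reg : ∀ x, p.wr x = false → τ.reg x = σ.reg x
  arr : ∀ A, p.wa A = false → τ.arr A = σ.arr A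
  out : p.we = false → τ.out = σ.out

theorem Frame.refl (p : St) (σ : Mem) : Frame p σ σ := ⟨fun _ _ => rfl, fun _ _ => rfl, fun _ => rfl⟩

theorem Frame.trans {p : St} {σ τ υ : Mem} (h : Frame p σ τ) (h' : Frame p τ υ) : Frame p σ υ :=
  ⟨fun x hx => (h'.reg x hx).trans (h.reg x hx), fun x hx => (h'.arr x hx).trans (h.arr x hx),
    fun hx => (h'.out hx).trans (h.out hx)⟩

theorem Frame.weaken {p q : St} {σ τ : Mem} (h : Frame p σ τ)
    (hr : ∀ x, q.wr x = false → p.wr x = false) (ha : ∀ x, q.wa x = false → p.wa x = false)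
    (he : q.we = false → p.we = false) : Frame q σ τ :=
  ⟨fun x hx => h.reg x (hr x hx), fun x hx => h.arr x (ha x hx), fun hx => h.out (he hx)⟩

theorem Run.frame (p : St) : ∀ {σ t τ}, Run p σ t τ → Frame p σ τ := by
  induction p with
  | skip => rintro σ t τ ⟨-, rfl⟩; exact Frame.refl _ _
  | set y e =>
    rintro σ t τ ⟨-, rfl⟩
    refine ⟨fun x hx => ?_, fun _ _ => rfl, fun _ => rfl⟩
    have : x ≠ y := by rintro rfl; simp [St.wr] at hx
    simp [Mem.setReg, this]
  | put A e f =>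
    rintro σ t τ ⟨-, rfl⟩
    refine ⟨fun _ _ => rfl, fun x hx => ?_, fun _ => rfl⟩
    have : x ≠ A := by rintro rfl; simp [St.wa] at hx
    simp [Mem.setArr, this]
  | out e =>
    rintro σ t τ ⟨-, rfl⟩
    exact ⟨fun _ _ => rfl, fun _ _ => rfl, fun h => by simp [St.we] at h⟩
  | seq p q ihp ihq =>
    rintro σ t τ ⟨t₁, μ, t₂, h1, h2, -⟩
    exact ((ihp h1).weaken (by simp +contextual [St.wr]) (by simp +contextual [St.wa])
      (by simp +contextual [St.we])).trans ((ihq h2).weaken (by simp +contextual [St.wr])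
      (by simp +contextual [St.wa]) (by simp +contextual [St.we]))
  | ite c p q ihp ihq =>
    rintro σ t τ (⟨-, h⟩ | ⟨-, h⟩)
    · exact (ihp h).weaken (by simp +contextual [St.wr]) (by simp +contextual [St.wa])
        (by simp +contextual [St.we])
    · exact (ihq h).weaken (by simp +contextual [St.wr]) (by simp +contextual [St.wa])
        (by simp +contextual [St.we])
  | whl e f p ihp =>
    intro σ t τ h
    simp only [Run] at h
    induction h with
    | done σ h => exact Frame.refl _ _
    | step σ μ τ t u h hb hw ih =>
      have h1 : Frame (.whl e f p) σ μ :=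
        (ihp hb).weaken (fun _ h => h) (fun _ h => h) (fun h => h)
      exact h1.trans ih

theorem HT.frame {p σ Q} (h : HT p σ Q) : HT p σ (fun t τ => Q t τ ∧ Frame p σ τ) := by
  obtain ⟨t, τ, h1, h2⟩ := h
  exact ⟨t, τ, h1, h2, h1.frame⟩

/-! ### Loops -/

theorem Mem.setReg_reg (σ : Mem) (x v y : ℕ) :
    (σ.setReg x v).reg y = if y = x then v else σ.reg y := by
  simp [Mem.setReg, Function.update_apply]

theorem Mem.setReg_arr (σ : Mem) (x v : ℕ) : (σ.setReg x v).arr = σ.arr := rfl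

theorem Mem.setReg_out (σ : Mem) (x v : ℕ) : (σ.setReg x v).out = σ.out := rfl

theorem Mem.setArr_arr (σ : Mem) (A i v B : ℕ) :
    (σ.setArr A i v).arr B = if B = A then Function.update (σ.arr A) i v else σ.arr B := by
  simp [Mem.setArr, Function.update_apply]

theorem Mem.setArr_reg (σ : Mem) (A i v : ℕ) : (σ.setArr A i v).reg = σ.reg := rfl

theorem nat_beq_false {i j : ℕ} (h : i ≠ j) : Nat.beq i j = false := by
  cases hb : Nat.beq i j
  · rfl
  · exact absurd (Nat.eq_of_beq_eq_true hb) h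

def forN (i lim : ℕ) (p : St) : St :=
  .set i (.k 0) ⨟ .whl (.r i) (.r lim) (p ⨟ .set i (.inc (.r i)))

/-- The second argument of the invariant is the time spent so far. The body also receives the frame
relation to the initial memory, so invariants need not mention registers and arrays that the loop
leaves alone. -/
theorem HT_for {i lim : ℕ} {p : St} {σ : Mem} {N : ℕ} (Inv : ℕ → ℕ → Mem → Prop)
    (hi : p.wr i = false) (hl : p.wr lim = false) (hne : i ≠ lim) (hN : σ.reg lim = N)
    (h0 : Inv 0 0 (σ.setReg i 0))
    (hs : ∀ k T τ, k < N → τ.reg i = k → τ.reg lim = N → Frame (forN i lim p) σ τ → Inv k T τ →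
      HT p τ (fun t υ => Inv (k + 1) (T + t + 1) (υ.setReg i (k + 1)))) :
    HT (forN i lim p) σ (fun t τ => Inv N t τ ∧ Frame (forN i lim p) σ τ) := by
  refine HT.frame ?_
  have key : ∀ d k T τ, k + d = N → τ.reg i = k → Frame (forN i lim p) σ τ → Inv k T τ →
      HT (.whl (.r i) (.r lim) (p ⨟ .set i (.inc (.r i)))) τ (fun t υ => Inv N (T + t) υ) := by
    intro d
    induction d with
    | zero =>
      intro k T τ hk hik hF hI
      have hlim : τ.reg lim = N := by
        rw [hF.reg lim (by simp [forN, St.wr, hl, nat_beq_false hne]), hN]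
      rw [HT_whl]
      refine ⟨fun h => ?_, fun _ => ?_⟩
      · simp only [Ex.val] at h; omega
      · obtain rfl : k = N := by omega
        exact hI
    | succ d ih =>
      intro k T τ hk hik hF hI
      have hlim : τ.reg lim = N := by
        rw [hF.reg lim (by simp [forN, St.wr, hl, nat_beq_false hne]), hN]
      rw [HT_whl]
      refine ⟨fun h => ?_, fun h => ?_⟩
      · rw [HT_seq]
        refine (hs k T τ (by omega) hik hlim hF hI).frame.mono ?_
        rintro t υ ⟨h1, h2⟩
        rw [HT_set]
        have hv : (Ex.inc (Ex.r i)).val υ = k + 1 := by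
          simp [Ex.val, h2.reg i hi, hik]
        rw [hv]
        refine (ih (k + 1) (T + t + 1) _ (by omega) (by simp [Mem.setReg]) ?_ h1).mono ?_
        · refine hF.trans ?_
          have h3 : Frame (forN i lim p) τ υ := h2.weaken (by simp +contextual [forN, St.wr])
            (by simp +contextual [forN, St.wa]) (by simp +contextual [forN, St.we])
          refine h3.trans ⟨fun x hx => ?_, fun _ _ => rfl, fun _ => rfl⟩
          have : x ≠ i := by rintro rfl; simp [forN, St.wr] at hx
          simp [Mem.setReg, this]
        · intro u ξ h4
          have : T + t + 1 + u = T + (t + 0 + u + 1) := by omega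
          rw [← this]; exact h4
      · simp only [Ex.val] at h; omega
  rw [forN, HT_seq, HT_set]
  refine (key N 0 0 _ (by omega) (by simp [Mem.setReg]) ?_ h0).mono ?_
  · refine ⟨fun x hx => ?_, fun _ _ => rfl, fun _ => rfl⟩
    have : x ≠ i := by rintro rfl; simp [forN, St.wr] at hx
    simp [Mem.setReg, this]
  · intro u υ h; simpa using h

/-- The body `p` is executed for every entry `e` of the list of the vertex in register `x`. -/
def forL (lst off kk en e x : ℕ) (p : St) : St :=
  .set kk (.ld off (.r x)) ⨟ .set en (.ld off (.inc (.r x))) ⨟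
    .whl (.r kk) (.r en) (.set e (.ld lst (.r kk)) ⨟ p ⨟ .set kk (.inc (.r kk)))

theorem tabulate_val {n : ℕ} (f : Fin n → ℕ) (i : Fin n) : tabulate f i.val = f i := by
  simp [tabulate]

theorem tabulate_lt {n i : ℕ} (f : Fin n → ℕ) (h : i < n) : tabulate f i = f ⟨i, h⟩ := by
  simp [tabulate, h]

/-- `ord` lists the indices grouped by owner, the group of `x` being `off x, …, off (x+1) - 1`. -/
structure Lists {m c : ℕ} (own : Fin m → Fin c) (ord : Fin m → Fin m) (off : Fin (c + 1) → ℕ) :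
    Prop where
  inj : Function.Injective ord
  surj : Function.Surjective ord
  mem : ∀ (k : Fin m) (x : Fin c), own (ord k) = x ↔ off x.castSucc ≤ k.val ∧ k.val < off x.succ
  le : ∀ x : Fin c, off x.succ ≤ m

/-- The invariant speaks of the set of entries already visited and not of their order. Preference
order within a list is thus never used; minima are found by scanning the whole list. -/
theorem HT_list {m c : ℕ} {own : Fin m → Fin c} {ord : Fin m → Fin m} {ofs : Fin (c + 1) → ℕ}
    (hL : Lists own ord ofs) {lst off kk en e x : ℕ} {p : St} {σ : Mem} {v : Fin c}
    (Inv : Finset (Fin m) → ℕ → Mem → Prop)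
    (hpl : p.wa lst = false) (hk : p.wr kk = false) (hen : p.wr en = false)
    (hne : kk ≠ en ∧ kk ≠ x ∧ e ≠ kk ∧ e ≠ en)
    (hlst : σ.arr lst = tabulate fun k => (ord k).val) (hoff : σ.arr off = tabulate ofs)
    (hx : σ.reg x = v.val)
    (h0 : ∀ y z, Inv ∅ 0 ((σ.setReg kk y).setReg en z))
    (hs : ∀ D T τ f, D ⊆ Finset.univ.filter (fun f => own f = v) → f ∉ D → own f = v →
      Frame (forL lst off kk en e x p) σ τ → Inv D T τ →
      HT p (τ.setReg e f.val) (fun t υ => ∀ y, Inv (insert f D) (T + t + 1) (υ.setReg kk y))) :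
    HT (forL lst off kk en e x p) σ (fun t τ => Inv (Finset.univ.filter (fun f => own f = v)) t τ ∧
      Frame (forL lst off kk en e x p) σ τ) := by
  refine HT.frame ?_
  set P := forL lst off kk en e x p with hP
  have hwlst : P.wa lst = false := by simp [hP, forL, St.wa, hpl]
  let DD : ℕ → Finset (Fin m) := fun k => Finset.univ.filter fun f =>
    own f = v ∧ ∀ j, ord j = f → j.val < k
  have key : ∀ d k T τ, k + d = ofs v.succ → ofs v.castSucc ≤ k → τ.reg kk = k →
      τ.reg en = ofs v.succ → Frame P σ τ → Inv (DD k) T τ →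
      HT (.whl (.r kk) (.r en) (.set e (.ld lst (.r kk)) ⨟ p ⨟ .set kk (.inc (.r kk)))) τ
        (fun t υ => Inv (Finset.univ.filter (fun f => own f = v)) (T + t) υ) := by
    intro d
    induction d with
    | zero =>
      intro k T τ hkd hlo hkk hen' hF hI
      rw [HT_whl]
      refine ⟨fun h => ?_, fun _ => ?_⟩
      · simp only [Ex.val] at h; omega
      · have : DD k = Finset.univ.filter (fun f => own f = v) := by
          ext f
          simp only [DD, Finset.mem_filter, Finset.mem_univ, true_and, and_iff_left_iff_imp]
          intro hf j hj
          have := ((hL.mem j v).1 (hj ▸ hf)).2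
          omega
        rw [this] at hI
        exact hI
    | succ d ih =>
      intro k T τ hkd hlo hkk hen' hF hI
      rw [HT_whl]
      refine ⟨fun h => ?_, fun h => ?_⟩
      · have hkm : k < m := by have := hL.le v; omega
        have hown : own (ord ⟨k, hkm⟩) = v := (hL.mem _ _).2 ⟨hlo, by simp; omega⟩
        have hload : (Ex.ld lst (.r kk)).val τ = (ord ⟨k, hkm⟩).val := by
          simp only [Ex.val, hkk]
          rw [hF.arr lst hwlst, hlst, tabulate_lt _ hkm]
        rw [HT_seq, HT_set, hload, HT_seq]
        have hnot : ord ⟨k, hkm⟩ ∉ DD k := by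
          simp only [DD, Finset.mem_filter, not_and, not_forall]
          intro _ _
          exact ⟨⟨k, hkm⟩, rfl, by simp⟩
        refine (hs (DD k) T τ (ord ⟨k, hkm⟩) ?_ hnot hown hF hI).frame.mono ?_
        · intro f hf
          simp only [DD, Finset.mem_filter] at hf ⊢
          exact ⟨hf.1, hf.2.1⟩
        · rintro t υ ⟨h1, h2⟩
          rw [HT_set]
          have hυ : υ.reg kk = k := by
            rw [h2.reg kk hk, Mem.setReg_reg, if_neg (Ne.symm hne.2.2.1), hkk]
          have hv : (Ex.inc (Ex.r kk)).val υ = k + 1 := by simp [Ex.val, hυ]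
          rw [hv]
          have hDD : insert (ord ⟨k, hkm⟩) (DD k) = DD (k + 1) := by
            ext f
            simp only [DD, Finset.mem_insert, Finset.mem_filter, Finset.mem_univ, true_and]
            constructor
            · rintro (rfl | ⟨hf, hf'⟩)
              · refine ⟨hown, fun j hj => ?_⟩
                rw [hL.inj hj]; simp
              · exact ⟨hf, fun j hj => (hf' j hj).trans (Nat.lt_succ_self _)⟩
            · rintro ⟨hf, hf'⟩
              obtain ⟨j, rfl⟩ := hL.surj f
              by_cases hjk : j.val = k
              · left; congr 1; exact Fin.ext hjk
              · right
                refine ⟨hf, fun i hi => ?_⟩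
                have := hf' i hi
                have := hf' j rfl
                rw [hL.inj hi]; omega
          rw [hDD] at h1
          refine (ih (k + 1) (T + t + 1) _ (by omega) (by omega) (by simp [Mem.setReg]) ?_ ?_
            (h1 _)).mono ?_
          · rw [Mem.setReg_reg, if_neg (Ne.symm hne.1), h2.reg en hen, Mem.setReg_reg,
              if_neg (Ne.symm hne.2.2.2), hen']
          · refine hF.trans ?_
            have h3 : Frame P (τ.setReg e (ord ⟨k, hkm⟩).val) υ :=
              h2.weaken (by simp +contextual [hP, forL, St.wr])
                (by simp +contextual [hP, forL, St.wa]) (by simp +contextual [hP, forL, St.we])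
            have h4 : Frame P τ (τ.setReg e (ord ⟨k, hkm⟩).val) := by
              refine ⟨fun y hy => ?_, fun _ _ => rfl, fun _ => rfl⟩
              have : y ≠ e := by rintro rfl; simp [hP, forL, St.wr] at hy
              simp [Mem.setReg, this]
            refine (h4.trans h3).trans ⟨fun y hy => ?_, fun _ _ => rfl, fun _ => rfl⟩
            have : y ≠ kk := by rintro rfl; simp [hP, forL, St.wr] at hy
            simp [Mem.setReg, this]
          · intro u ξ h4
            have : T + t + 1 + u = T + (0 + (t + 0) + u + 1) := by omega
            rw [← this]; exact h4
      · simp only [Ex.val] at h; omega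
  have e1 : (Ex.ld off (.r x)).val σ = ofs v.castSucc := by
    simp only [Ex.val, hx, hoff]
    exact tabulate_val ofs v.castSucc
  rw [hP, forL, HT_seq, HT_set, HT_seq, HT_set, e1]
  have e2 : (Ex.ld off (.inc (.r x))).val (σ.setReg kk (ofs v.castSucc)) = ofs v.succ := by
    simp only [Ex.val, Mem.setReg_arr, Mem.setReg_reg, if_neg (Ne.symm hne.2.1), hx, hoff]
    exact tabulate_val ofs v.succ
  rw [e2]
  have hD0 : DD (ofs v.castSucc) = ∅ := by
    ext f
    simp only [DD, Finset.mem_filter, Finset.mem_univ, true_and, Finset.notMem_empty, iff_false,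
      not_and, not_forall]
    intro hf
    obtain ⟨j, rfl⟩ := hL.surj f
    exact ⟨j, rfl, by have := ((hL.mem j v).1 hf).1; omega⟩
  have hmono : ofs v.castSucc ≤ ofs v.succ ∨ ofs v.succ < ofs v.castSucc := le_or_gt _ _
  rcases hmono with hmono | hmono
  · refine (key (ofs v.succ - ofs v.castSucc) (ofs v.castSucc) 0 _ (by omega) le_rfl
      (by simp [Mem.setReg, hne.1]) (by simp [Mem.setReg]) ?_ ?_).mono ?_
    · refine ⟨fun y hy => ?_, fun _ _ => rfl, fun _ => rfl⟩
      have h1 : y ≠ kk := by rintro rfl; simp [hP, forL, St.wr] at hy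
      have h2 : y ≠ en := by rintro rfl; simp [hP, forL, St.wr] at hy
      simp [Mem.setReg, h1, h2]
    · rw [hD0]; exact h0 _ _
    · intro u υ h; simpa using h
  -- `Lists` does not force the offsets to increase. If they are reversed, the list is empty and the
  -- body is never executed.
  · rw [HT_whl]
    refine ⟨fun h => ?_, fun _ => ?_⟩
    · simp [Ex.val, Mem.setReg, hne.1] at h; omega
    · have : Finset.univ.filter (fun f => own f = v) = ∅ := by
        ext f
        simp only [Finset.mem_filter, Finset.mem_univ, true_and, Finset.notMem_empty, iff_false]
        intro hf
        obtain ⟨j, rfl⟩ := hL.surj f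
        have := (hL.mem j v).1 hf
        omega
      rw [this]
      exact h0 _ _

end SuperStable

end


/-! ### The abstract algorithm: its invariant, preservation by every step, and progress. -/

noncomputable section

open scoped Classical

namespace SuperStable

variable {I : Inst}

/-! ### Invariants of the algorithm -/

open Relation

/-- The invariant of the algorithm, relative to the woman-optimal matching `Mz`. -/
structure Good (Mz : I.EdgeSet) (s : State I) : Prop where
  mat : IsMatching I s.M
  menM : ∀ x, (∃ w, (x, w) ∈ s.M) ↔ ∃ w, (x, w) ∈ Mz
  womM : ∀ w, (∃ x, (x, w) ∈ s.M) ↔ ∃ x, (x, w) ∈ Mz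
  -- Against Mz the women only gain and the men only lose, and strictly so when the partner changes.
  -- Hence equality of ranks in the definition of settled is equality of partners.
  wom : ∀ w m m', (m, w) ∈ s.M → (m', w) ∈ Mz → m' = m ∨ I.rankW w m' < I.rankW w m
  men : ∀ m w w', (m, w) ∈ s.M → (m, w') ∈ Mz → w' = w ∨ I.rankM m w < I.rankM m w'
  subR : s.Er ⊆ I.E
  subD : s.Ed ⊆ I.E
  subC : s.Ec ⊆ I.E
  mEd : s.M ⊆ s.Ed
  domR : ∀ x w m, (x, w) ∈ s.Er → (m, w) ∈ s.M → I.rankW w x ≤ I.rankW w m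
  domD : ∀ x w m, (x, w) ∈ s.Ed → (m, w) ∈ s.M → I.rankW w x ≤ I.rankW w m
  rkR : ∀ x w, (x, w) ∈ s.Er → ∃ w', (x, w') ∈ s.M ∧ I.rankM x w' < I.rankM x w
  -- No edge of Mz is ever lost. This is what every deletion has to respect.
  cov : ∀ x w, (x, w) ∈ Mz → (x, w) ∈ s.Er ∨ (x, w) ∈ s.Ec
  -- The path back from the woman puts a candidate edge off the matching on a cycle of the digraph,
  -- so both of its ends lie in one component. It survives later steps, because rotations of closed
  -- components cannot cut it.
  cand : ∀ x w, (x, w) ∈ s.Ec → ((x, w) ∈ s.M ∧ (x, w) ∈ Mz) ∨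
    ((x, w) ∈ s.Ed ∧ (x, w) ∉ s.M ∧ ReflTransGen (Arc s) (Sum.inr w) (Sum.inl x))
  ecEr : ∀ x w w', (x, w) ∈ s.Ec → (x, w') ∈ s.Er → I.rankM x w < I.rankM x w'
  ecEc : ∀ x w w', (x, w) ∈ s.Ec → (x, w') ∈ s.Ec → I.rankM x w = I.rankM x w'
  edMz : ∀ x w w', (x, w) ∈ s.Ed → (x, w) ∉ s.M → (x, w') ∈ Mz → I.rankM x w ≤ I.rankM x w'
  edUn : ∀ x w, (x, w) ∈ s.Ed → (x, w) ∉ s.M → ∃ w₀, (x, w₀) ∈ s.M ∧ (x, w₀) ∉ Mz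
  edM : ∀ x w, (x, w) ∈ s.Ed → ∃ m, (m, w) ∈ s.M
  -- Edges that are both unprocessed and in the digraph come from a scan that opened a way out of
  -- the component. They remain top choices of a man without candidates; the potential depends on
  -- this.
  pend : ∀ x w, (x, w) ∈ s.Er → (x, w) ∈ s.Ed →
    (∀ w', (x, w') ∉ s.Ec) ∧ ∀ w', (x, w') ∈ s.Er → I.rankM x w ≤ I.rankM x w'

theorem IsMatching.fst {M : I.EdgeSet} (h : IsMatching I M) {x w w'} (h1 : (x, w) ∈ M)
    (h2 : (x, w') ∈ M) : w = w' := congrArg Prod.snd (h.2 _ h1 _ h2 (Or.inl rfl))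

theorem IsMatching.snd {M : I.EdgeSet} (h : IsMatching I M) {x x' w} (h1 : (x, w) ∈ M)
    (h2 : (x', w) ∈ M) : x = x' := congrArg Prod.fst (h.2 _ h1 _ h2 (Or.inr rfl))

/-- Otherwise the edge would block the matching. In this positive form super-stability of Mz is used
throughout. -/
theorem IsSuperStable.better {M : I.EdgeSet} (hz : IsSuperStable I M) {y w} (he : (y, w) ∈ I.E)
    (h : ∀ w', (y, w') ∈ M → I.rankM y w ≤ I.rankM y w') :
    ∃ x, (x, w) ∈ M ∧ (x = y ∨ I.rankW w x < I.rankW w y) := by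
  by_cases hm : (y, w) ∈ M
  · exact ⟨y, hm, Or.inl rfl⟩
  · by_contra hcon
    push Not at hcon
    exact hz.2 (y, w) ⟨he, hm, h, fun m hm' => (hcon m hm').2⟩

namespace Good

variable {Mz : I.EdgeSet} {s : State I}

/-- The Mz-edge of the man is itself unprocessed or a candidate by `cov`, and candidates are tied
with each other and better than everything unprocessed. -/
theorem ecMz (g : Good Mz s) {y w} (h : (y, w) ∈ s.Ec) {w'} (h' : (y, w') ∈ Mz) :
    I.rankM y w ≤ I.rankM y w' := by
  rcases g.cov _ _ h' with h1 | h1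
  · exact (g.ecEr _ _ _ h h1).le
  · exact (g.ecEc _ _ _ h h1).le

theorem ecBetter (hz : IsSuperStable I Mz) (g : Good Mz s) {y w} (h : (y, w) ∈ s.Ec) :
    ∃ x, (x, w) ∈ Mz ∧ (x = y ∨ I.rankW w x < I.rankW w y) :=
  hz.better (g.subC h) fun _ => g.ecMz h

theorem edBetter (hz : IsSuperStable I Mz) (g : Good Mz s) {y w} (h : (y, w) ∈ s.Ed)
    (h' : (y, w) ∉ s.M) : ∃ x, (x, w) ∈ Mz ∧ (x = y ∨ I.rankW w x < I.rankW w y) :=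
  hz.better (g.subD h) fun _ => g.edMz _ _ _ h h'

/-- Equal rank with a different partner is excluded by the strictness in the invariant, so
settledness reduces to comparing edges. The program tests it in this way. -/
theorem unsettled_iff (hz : IsSuperStable I Mz) (g : Good Mz s) (m) :
    ¬ Settled s.M Mz m ↔ ∃ w, (m, w) ∈ s.M ∧ (m, w) ∉ Mz := by
  unfold Settled
  push Not
  constructor
  · rintro ⟨w, w', h1, h2, h3⟩
    exact ⟨w, h1, fun h4 => h3 (by rw [hz.1.fst h4 h2])⟩
  · rintro ⟨w, h1, h2⟩
    obtain ⟨w', h3⟩ := (g.menM m).1 ⟨w, h1⟩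
    refine ⟨w, w', h1, h3, fun h => ?_⟩
    rcases g.men _ _ _ h1 h3 with rfl | h4
    · exact h2 h3
    · omega

/-- An arc leaving a man leads to a woman with an unsettled partner. -/
theorem unsettled_next (hz : IsSuperStable I Mz) (g : Good Mz s) {y w m} (h : (y, w) ∈ s.Ed)
    (h' : (y, w) ∉ s.M) (hm : (m, w) ∈ s.M) : (m, w) ∉ Mz := by
  intro hmz
  obtain ⟨x, h1, h2⟩ := g.edBetter hz h h'
  obtain rfl := hz.1.snd h1 hmz
  rcases h2 with rfl | h2
  · exact h' hm
  · have := g.domD _ _ _ h hm; omega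

/-! #### Arcs -/

theorem arc_mw {s : State I} {m : Fin I.a} {v : I.V} (h : Arc s (Sum.inl m) v) :
    ∃ w, v = Sum.inr w ∧ (m, w) ∈ s.Ed ∧ (m, w) ∉ s.M := by
  rcases v with m' | w
  · exact h.elim
  · exact ⟨w, rfl, h⟩

theorem arc_wm {s : State I} {w : Fin I.b} {v : I.V} (h : Arc s (Sum.inr w) v) :
    ∃ m, v = Sum.inl m ∧ (m, w) ∈ s.Ed ∧ (m, w) ∈ s.M := by
  rcases v with m | w'
  · exact ⟨m, rfl, h⟩
  · exact h.elim

theorem arc_to_m {s : State I} {m : Fin I.a} {v : I.V} (h : Arc s v (Sum.inl m)) :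
    ∃ w, v = Sum.inr w ∧ (m, w) ∈ s.Ed ∧ (m, w) ∈ s.M := by
  rcases v with m' | w
  · exact h.elim
  · exact ⟨w, rfl, h⟩

theorem noOut_reach {s : State I} {S : Set I.V} (h : NoOut s S) {u v : I.V} (hu : u ∈ S)
    (hr : ReflTransGen (Arc s) u v) : v ∈ S := by
  induction hr with
  | refl => exact hu
  | tail _ hb ih => exact h _ ih _ hb

theorem self_mem_scc (s : State I) (v : I.V) : v ∈ scc s v := ⟨.refl, .refl⟩

theorem noOut_scc_iff {s : State I} {v : I.V} : NoOut s (scc s v) ↔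
    ∀ u, ReflTransGen (Arc s) v u → ReflTransGen (Arc s) u v := by
  constructor
  · intro h u hu
    exact (noOut_reach h (self_mem_scc s v) hu).2
  · intro h u hu x hx
    exact ⟨hu.1.tail hx, h _ (hu.1.tail hx)⟩

theorem scc_eq {s : State I} {u v : I.V} (h : u ∈ scc s v) : scc s u = scc s v := by
  ext x
  exact ⟨fun hx => ⟨h.1.trans hx.1, hx.2.trans h.2⟩, fun hx => ⟨h.2.trans hx.1, hx.2.trans h.1⟩⟩

/-- Among the vertices reachable from the given one, take one whose own set of reachable vertices is
smallest: whatever it reaches must reach it back. -/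
theorem exists_closed (s : State I) (v : I.V) :
    ∃ u, ReflTransGen (Arc s) v u ∧ NoOut s (scc s u) := by
  let R : I.V → Finset I.V := fun u => Finset.univ.filter fun x => ReflTransGen (Arc s) u x
  obtain ⟨u, hu, hmin⟩ := Finset.exists_min_image (R v) (fun u => (R u).card)
    ⟨v, by simp [R, ReflTransGen.refl]⟩
  refine ⟨u, by simpa [R] using hu, noOut_scc_iff.2 fun x hx => ?_⟩
  have hxv : x ∈ R v := by
    simp only [R, Finset.mem_filter, Finset.mem_univ, true_and] at hu ⊢
    exact hu.trans hx
  have hsub : R x ⊆ R u := by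
    intro y hy
    simp only [R, Finset.mem_filter, Finset.mem_univ, true_and] at hy ⊢
    exact hx.trans hy
  have := Finset.eq_of_subset_of_card_le hsub (hmin x hxv)
  have hu' : u ∈ R x := by rw [this]; simp [R, ReflTransGen.refl]
  simpa [R] using hu'

/-! #### Scanning -/

theorem mem_topChoices {s : State I} {m x w} : (x, w) ∈ topChoices s m ↔
    (x, w) ∈ s.Er ∧ x = m ∧ ∀ w', (m, w') ∈ s.Er → I.rankM m w ≤ I.rankM m w' := by
  simp [topChoices]

/-- A scan is split into the insertion of the top choices and, if the component is still closed, the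
creation of candidates. Between the two the forest has to be repaired, so the intermediate state
needs its own invariant. -/
def addTop (s : State I) (m : Fin I.a) : State I := { s with Ed := s.Ed ∪ topChoices s m }

def scanAdded (s : State I) (m : Fin I.a) : I.EdgeSet := (topChoices s m).filter (Candidate s.M)

def scanDone (s : State I) (m : Fin I.a) : State I :=
  { addTop s m with
    Ec := (s.Ec ∪ scanAdded s m).filter fun e =>
      ¬ ∃ f ∈ scanAdded s m, f.2 = e.2 ∧ I.rankW e.2 f.1 < I.rankW e.2 e.1
    Er := s.Er \ topChoices s m }

theorem scan_pos {s : State I} {m} (h : NoOut (addTop s m) (scc (addTop s m) (Sum.inl m))) :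
    scan s m = scanDone s m := by
  unfold scan; exact if_pos h

theorem scan_neg {s : State I} {m} (h : ¬ NoOut (addTop s m) (scc (addTop s m) (Sum.inl m))) :
    scan s m = addTop s m := by
  unfold scan; exact if_neg h

theorem canScan_mz (g : Good Mz s) {m} (hc : CanScan Mz s m) :
    ∃ w, (m, w) ∈ Mz ∧ (m, w) ∈ s.Er := by
  have h := hc.1
  unfold Settled at h
  push Not at h
  obtain ⟨w, w', h1, h2, -⟩ := h
  exact ⟨w', h2, (g.cov _ _ h2).resolve_right (hc.2.1 w')⟩

theorem topChoices_nonempty (g : Good Mz s) {m} (hc : CanScan Mz s m) :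
    (topChoices s m).Nonempty := by
  obtain ⟨w, -, hw⟩ := canScan_mz g hc
  obtain ⟨w0, h0, hmin⟩ := Finset.exists_min_image
    (Finset.univ.filter fun w => (m, w) ∈ s.Er) (fun w => I.rankM m w) ⟨w, by simpa using hw⟩
  exact ⟨(m, w0), mem_topChoices.2 ⟨by simpa using h0, rfl, fun w' hw' => hmin w' (by simpa)⟩⟩

/-- A man who may be scanned has no candidates, so his Mz-edge is still unprocessed and competes for
the top. -/
theorem top_mz (hz : IsSuperStable I Mz) (g : Good Mz s) {m w} (hc : CanScan Mz s m)
    (h : (m, w) ∈ topChoices s m) {w'} (h' : (m, w') ∈ Mz) : I.rankM m w ≤ I.rankM m w' := by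
  obtain ⟨w1, h1, h2⟩ := canScan_mz g hc
  obtain rfl := hz.1.fst h1 h'
  exact (mem_topChoices.1 h).2.2 _ h2

theorem top_better (hz : IsSuperStable I Mz) (g : Good Mz s) {m w} (hc : CanScan Mz s m)
    (h : (m, w) ∈ topChoices s m) : ∃ x, (x, w) ∈ Mz ∧ (x = m ∨ I.rankW w x < I.rankW w m) :=
  hz.better (g.subR (mem_topChoices.1 h).1) fun _ h' => top_mz hz g hc h h'

theorem Er_not_M (g : Good Mz s) {x w} (h : (x, w) ∈ s.Er) : (x, w) ∉ s.M := by
  intro hm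
  obtain ⟨w', h1, h2⟩ := g.rkR _ _ h
  rw [g.mat.fst hm h1] at h2; omega

theorem reach_mono {s s' : State I} (hM : s'.M = s.M) (hd : s.Ed ⊆ s'.Ed) {u v : I.V}
    (h : ReflTransGen (Arc s) u v) : ReflTransGen (Arc s') u v := by
  refine Relation.ReflTransGen.mono (r := Arc s) (fun u v h => ?_) u v h
  rcases u with m | w <;> rcases v with m' | w'
  · exact h
  · exact ⟨hd h.1, hM ▸ h.2⟩
  · exact ⟨hd h.1, hM ▸ h.2⟩
  · exact h

theorem addTop_good (hz : IsSuperStable I Mz) (g : Good Mz s) {m} (hc : CanScan Mz s m) :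
    Good Mz (addTop s m) where
  mat := g.mat
  menM := g.menM
  womM := g.womM
  wom := g.wom
  men := g.men
  subR := g.subR
  subD := by
    intro e he
    rcases Finset.mem_union.1 he with h | h
    · exact g.subD h
    · exact g.subR (Finset.mem_filter.1 h).1
  subC := g.subC
  mEd := g.mEd.trans Finset.subset_union_left
  domR := g.domR
  domD := by
    intro x w y he hm
    rcases Finset.mem_union.1 he with h | h
    · exact g.domD _ _ _ h hm
    · exact g.domR _ _ _ (mem_topChoices.1 h).1 hm
  rkR := g.rkR
  cov := g.cov
  cand := by
    intro x w h
    rcases g.cand _ _ h with h | ⟨h1, h2, h3⟩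
    · exact Or.inl h
    · exact Or.inr ⟨Finset.mem_union_left _ h1, h2,
        reach_mono (s := s) (s' := addTop s m) rfl Finset.subset_union_left h3⟩
  ecEr := g.ecEr
  ecEc := g.ecEc
  edMz := by
    intro x w w' he hm hz'
    rcases Finset.mem_union.1 he with h | h
    · exact g.edMz _ _ _ h hm hz'
    · obtain rfl := (mem_topChoices.1 h).2.1
      exact top_mz hz g hc h hz'
  edUn := by
    intro x w he hm
    rcases Finset.mem_union.1 he with h | h
    · exact g.edUn _ _ h hm
    · obtain rfl := (mem_topChoices.1 h).2.1
      exact (g.unsettled_iff hz x).1 hc.1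
  edM := by
    intro x w he
    rcases Finset.mem_union.1 he with h | h
    · exact g.edM _ _ h
    · obtain rfl := (mem_topChoices.1 h).2.1
      obtain ⟨y, hy, -⟩ := top_better hz g hc h
      exact (g.womM w).2 ⟨y, hy⟩
  pend := by
    intro x w hr he
    rcases Finset.mem_union.1 he with h | h
    · exact g.pend _ _ hr h
    · obtain ⟨-, rfl, h2⟩ := mem_topChoices.1 h
      exact ⟨hc.2.1, h2⟩

theorem scanDone_good (hz : IsSuperStable I Mz) (g : Good Mz s) {m} (hc : CanScan Mz s m)
    (hN : NoOut (addTop s m) (scc (addTop s m) (Sum.inl m))) : Good Mz (scanDone s m) := by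
  have ga := addTop_good hz g hc
  have hEc : ∀ {x w}, (x, w) ∈ (scanDone s m).Ec → (x, w) ∈ s.Ec ∨ (x, w) ∈ topChoices s m := by
    intro x w h
    rcases Finset.mem_union.1 (Finset.mem_filter.1 h).1 with h | h
    · exact Or.inl h
    · exact Or.inr (Finset.mem_filter.1 h).1
  have hEr : ∀ {x w}, (x, w) ∈ (scanDone s m).Er → (x, w) ∈ s.Er ∧ (x, w) ∉ topChoices s m :=
    fun h => Finset.mem_sdiff.1 h
  have hlow : ∀ {w'}, (m, w') ∈ (scanDone s m).Er → ∀ {w}, (m, w) ∈ topChoices s m →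
      I.rankM m w < I.rankM m w' := by
    intro w' h1 w h2
    by_contra hcon
    obtain ⟨h3, h4⟩ := hEr h1
    refine h4 (mem_topChoices.2 ⟨h3, rfl, fun w1 hw1 => ?_⟩)
    have := (mem_topChoices.1 h2).2.2 _ hw1
    omega
  refine {
    mat := g.mat, menM := g.menM, womM := g.womM, wom := g.wom, men := g.men,
    subR := fun e he => g.subR (Finset.mem_sdiff.1 he).1, subD := ga.subD, subC := ?_,
    mEd := ga.mEd, domR := fun x w y h => g.domR x w y (hEr h).1, domD := ga.domD,
    rkR := fun x w h => g.rkR x w (hEr h).1, cov := ?_, cand := ?_, ecEr := ?_, ecEc := ?_,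
    edMz := ga.edMz, edUn := ga.edUn, edM := ga.edM, pend := ?_ }
  · rintro ⟨x, w⟩ he
    rcases hEc he with h | h
    · exact g.subC h
    · exact g.subR (mem_topChoices.1 h).1
  · intro x w hmz
    -- An added edge at w that dominated the Mz-edge of w would be weakly better for its man than Mz
    -- and better for w than her Mz-partner, contrary to super-stability of Mz.
    have hkeep : ¬ ∃ f ∈ scanAdded s m, f.2 = w ∧ I.rankW w f.1 < I.rankW w x := by
      rintro ⟨⟨m', w'⟩, hf, rfl, hlt⟩
      have hf' := (Finset.mem_filter.1 hf).1
      obtain rfl := (mem_topChoices.1 hf').2.1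
      obtain ⟨y, h1, h2⟩ := top_better hz g hc hf'
      obtain rfl := hz.1.snd h1 hmz
      simp only at hlt
      rcases h2 with rfl | h2 <;> omega
    rcases g.cov _ _ hmz with h | h
    · by_cases ht : (x, w) ∈ topChoices s m
      · right
        refine Finset.mem_filter.2 ⟨Finset.mem_union_right _ (Finset.mem_filter.2 ⟨ht, ?_⟩), hkeep⟩
        obtain ⟨m', hm'⟩ := (g.womM w).2 ⟨x, hmz⟩
        refine ⟨⟨m', hm', ?_⟩, g.rkR _ _ h⟩
        rcases g.wom _ _ _ hm' hmz with rfl | h1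
        · exact absurd hm' (Er_not_M g h)
        · exact h1
      · left; exact Finset.mem_sdiff.2 ⟨h, ht⟩
    · right
      exact Finset.mem_filter.2 ⟨Finset.mem_union_left _ h, hkeep⟩
  · intro x w h
    rcases hEc h with h | h
    · exact ga.cand _ _ h
    · obtain ⟨h1, rfl, -⟩ := mem_topChoices.1 h
      have hM := Er_not_M g h1
      have hd : (x, w) ∈ (addTop s x).Ed := Finset.mem_union_right _ h
      -- The component is still closed after the insertion, so the woman of a new edge belongs to it
      -- and has a path back to the man.
      exact Or.inr ⟨hd, hM, (hN _ (self_mem_scc _ _) (Sum.inr w) ⟨hd, hM⟩).2⟩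
  · intro x w w' h h'
    rcases hEc h with h | h
    · exact g.ecEr _ _ _ h (hEr h').1
    · obtain rfl := (mem_topChoices.1 h).2.1
      exact hlow h' h
  · intro x w w' h h'
    rcases hEc h with h1 | h1 <;> rcases hEc h' with h2 | h2
    · exact g.ecEc _ _ _ h1 h2
    · obtain rfl := (mem_topChoices.1 h2).2.1
      exact absurd h1 (hc.2.1 _)
    · obtain rfl := (mem_topChoices.1 h1).2.1
      exact absurd h2 (hc.2.1 _)
    · obtain ⟨a1, rfl, a2⟩ := mem_topChoices.1 h1
      obtain ⟨b1, -, b2⟩ := mem_topChoices.1 h2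
      exact le_antisymm (a2 _ b1) (b2 _ a1)
  · intro x w hr hd
    obtain ⟨p1, p2⟩ := ga.pend _ _ (hEr hr).1 hd
    have hx : x ≠ m := by
      rintro rfl
      exact (hEr hr).2 (mem_topChoices.2 ⟨(hEr hr).1, rfl, p2⟩)
    refine ⟨fun w' h => ?_, fun w' h => p2 _ (hEr h).1⟩
    rcases hEc h with h | h
    · exact p1 _ h
    · exact hx (mem_topChoices.1 h).2.1

/-! #### Pruning -/

/-- The lowest edges of `Ec ∪ Er` at a multiply engaged woman. -/
def lowSet (s : State I) (w : Fin I.b) : I.EdgeSet :=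
  (s.Ec ∪ s.Er).filter fun e => e.2 = w ∧ MultiplyEngaged s w ∧
    ∀ m', (m', w) ∈ s.Ec ∪ s.Er → I.rankW w m' ≤ I.rankW w e.1

/-- The deletion at a single woman. -/
def lowAt (s : State I) (w : Fin I.b) : State I :=
  { s with Ec := s.Ec \ lowSet s w, Er := s.Er \ lowSet s w }

theorem mem_lowSet {s : State I} {w x y} : (x, y) ∈ lowSet s w ↔
    ((x, y) ∈ s.Ec ∨ (x, y) ∈ s.Er) ∧ y = w ∧ MultiplyEngaged s w ∧
    ∀ m', ((m', w) ∈ s.Ec ∨ (m', w) ∈ s.Er) → I.rankW w m' ≤ I.rankW w x := by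
  simp [lowSet]

/-- A multiply engaged woman has a candidate from a man other than her Mz-partner. By `ecBetter` she
strictly prefers that partner, so his edge is not among her lowest. -/
theorem mz_not_low (hz : IsSuperStable I Mz) (g : Good Mz s) {x w w₀} (hmz : (x, w) ∈ Mz) :
    (x, w) ∉ lowSet s w₀ := by
  intro hl
  obtain ⟨-, rfl, ⟨m, m', hne, h1, h2⟩, hlow⟩ := mem_lowSet.1 hl
  have : ∃ y, y ≠ x ∧ (y, w) ∈ s.Ec := by
    by_cases hm : m = x
    · exact ⟨m', fun h => hne (hm.trans h.symm), h2⟩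
    · exact ⟨m, hm, h1⟩
  obtain ⟨y, hy, hyc⟩ := this
  obtain ⟨x', h3, h4⟩ := g.ecBetter hz hyc
  obtain rfl := hz.1.snd h3 hmz
  have := hlow y (Or.inl hyc)
  rcases h4 with rfl | h4
  · exact hy rfl
  · omega

theorem lowAt_good (hz : IsSuperStable I Mz) (g : Good Mz s) (w₀) : Good Mz (lowAt s w₀) := by
  have hC : (lowAt s w₀).Ec ⊆ s.Ec := Finset.sdiff_subset
  have hR : (lowAt s w₀).Er ⊆ s.Er := Finset.sdiff_subset
  refine {
    mat := g.mat, menM := g.menM, womM := g.womM, wom := g.wom, men := g.men,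
    subR := hR.trans g.subR, subD := g.subD, subC := hC.trans g.subC,
    mEd := g.mEd, domR := fun x w y h => g.domR x w y (hR h), domD := g.domD,
    rkR := fun x w h => g.rkR x w (hR h), cov := ?_, cand := fun x w h => g.cand x w (hC h),
    ecEr := fun x w w' h h' => g.ecEr x w w' (hC h) (hR h'),
    ecEc := fun x w w' h h' => g.ecEc x w w' (hC h) (hC h'),
    edMz := g.edMz, edUn := g.edUn, edM := g.edM,
    pend := fun x w h h' => ⟨fun w' hw' => (g.pend x w (hR h) h').1 w' (hC hw'),
      fun w' hw' => (g.pend x w (hR h) h').2 w' (hR hw')⟩ }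
  intro x w hmz
  have hnot := g.mz_not_low hz (w₀ := w₀) hmz
  rcases g.cov _ _ hmz with h | h
  · exact Or.inl (Finset.mem_sdiff.2 ⟨h, hnot⟩)
  · exact Or.inr (Finset.mem_sdiff.2 ⟨h, hnot⟩)

end Good
end SuperStable

end


noncomputable section

open scoped Classical

namespace SuperStable

variable {I : Inst}

open Relation

namespace Good

variable {Mz : I.EdgeSet} {s : State I}

/-! #### Rotating -/

/-- Structure of a component on which the candidate edges form a perfect matching. -/
structure RotFacts (Mz : I.EdgeSet) (s : State I) (S : Set I.V) : Prop where
  closed : ∀ u ∈ S, ∀ v, Arc s u v → v ∈ S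
  wM : ∀ w m, Sum.inr w ∈ S → (m, w) ∈ s.M → Sum.inl m ∈ S
  mM : ∀ w m, Sum.inl m ∈ S → (m, w) ∈ s.M → Sum.inr w ∈ S
  uns : ∀ m, Sum.inl m ∈ S → ∃ w, (m, w) ∈ s.M ∧ (m, w) ∉ Mz
  ec : ∀ m w, Sum.inl m ∈ S → (m, w) ∈ s.Ec →
    Sum.inr w ∈ S ∧ (m, w) ∈ s.Ed ∧ (m, w) ∉ s.M
  ecM : ∀ m, Sum.inl m ∈ S → ∃ w, (m, w) ∈ s.Ec
  ecM' : ∀ m w w', Sum.inl m ∈ S → (m, w) ∈ s.Ec → (m, w') ∈ s.Ec → w = w'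
  ecW : ∀ w, Sum.inr w ∈ S → ∃ m, Sum.inl m ∈ S ∧ (m, w) ∈ s.Ec
  ecW' : ∀ m m' w, Sum.inr w ∈ S → (m, w) ∈ s.Ec → (m', w) ∈ s.Ec → m = m'
  wMat : ∀ w, Sum.inr w ∈ S → ∃ m, (m, w) ∈ s.M

/-- A candidate in both M and Mz would make the man settled, so the other alternative of `cand`
holds. -/
theorem uns_of_ec (g : Good Mz s) {m w} (h : (m, w) ∈ s.Ec)
    (hu : ∃ w, (m, w) ∈ s.M ∧ (m, w) ∉ Mz) : (m, w) ∈ s.Ed ∧ (m, w) ∉ s.M ∧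
    ReflTransGen (Arc s) (Sum.inr w) (Sum.inl m) := by
  rcases g.cand _ _ h with ⟨h1, h2⟩ | h
  · obtain ⟨w', h3, h4⟩ := hu
    obtain rfl := g.mat.fst h1 h3
    exact absurd h2 h4
  · exact h

theorem rotFacts (g : Good Mz s) {S : Set I.V} (h : CanRotate s S) :
    RotFacts Mz s S := by
  obtain ⟨⟨v, hv⟩, hN, hm, hw⟩ := h
  have conn : ∀ u ∈ S, ∀ v ∈ S, ReflTransGen (Arc s) u v := by
    intro u hu x hx
    rw [hv] at hu hx
    exact hu.2.trans hx.1
  have wM : ∀ w m, Sum.inr w ∈ S → (m, w) ∈ s.M → Sum.inl m ∈ S :=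
    fun w m h1 h2 => hN _ h1 _ ⟨g.mEd h2, h2⟩
  have uns : ∀ m, Sum.inl m ∈ S → ∃ w, (m, w) ∈ s.M ∧ (m, w) ∉ Mz := by
    intro m hmS
    obtain ⟨w, ⟨hwS, hec⟩, -⟩ := hm m hmS
    -- The man reaches the woman of his candidate, so some arc leaves him, and arcs leave only
    -- unsettled men.
    have hr := conn _ hmS _ hwS
    rcases ReflTransGen.cases_head hr with h0 | ⟨x, h1, -⟩
    · exact absurd h0 (by simp)
    · obtain ⟨w', -, h3, h4⟩ := arc_mw h1
      exact g.edUn _ _ h3 h4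
  have ec : ∀ m w, Sum.inl m ∈ S → (m, w) ∈ s.Ec →
      Sum.inr w ∈ S ∧ (m, w) ∈ s.Ed ∧ (m, w) ∉ s.M := by
    intro m w hmS hec
    obtain ⟨h1, h2, -⟩ := uns_of_ec g hec (uns m hmS)
    exact ⟨hN _ hmS _ ⟨h1, h2⟩, h1, h2⟩
  have ecIn : ∀ m w, Sum.inr w ∈ S → (m, w) ∈ s.Ec → Sum.inl m ∈ S := by
    intro m w hwS hec
    rcases g.cand _ _ hec with ⟨h1, h2⟩ | ⟨h1, h2, h3⟩
    · exact wM _ _ hwS h1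
    · exact noOut_reach hN hwS h3
  refine {
    closed := hN, wM := wM, mM := ?_, uns := uns, ec := ec, ecM := ?_,
    ecM' := ?_, ecW := ?_, ecW' := ?_, wMat := ?_ }
  · intro w m hmS hM
    obtain ⟨w', ⟨hwS, -⟩, -⟩ := hm m hmS
    have hr := conn _ hwS _ hmS
    rcases ReflTransGen.cases_tail hr with h0 | ⟨x, h1, h2⟩
    · exact absurd h0 (by simp)
    · obtain ⟨w2, rfl, h3, h4⟩ := arc_to_m h2
      rw [g.mat.fst hM h4]
      exact noOut_reach hN hwS h1
  · intro m hmS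
    obtain ⟨w, ⟨-, h⟩, -⟩ := hm m hmS
    exact ⟨w, h⟩
  · intro m w w' hmS h1 h2
    exact (hm m hmS).unique ⟨(ec _ _ hmS h1).1, h1⟩ ⟨(ec _ _ hmS h2).1, h2⟩
  · intro w hwS
    obtain ⟨m, h, -⟩ := hw w hwS
    exact ⟨m, h⟩
  · intro m m' w hwS h1 h2
    exact (hw w hwS).unique ⟨ecIn _ _ hwS h1, h1⟩ ⟨ecIn _ _ hwS h2, h2⟩
  · intro w hwS
    obtain ⟨m, ⟨h1, h2⟩, -⟩ := hw w hwS
    exact g.edM _ _ (ec _ _ h1 h2).2.1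

theorem mem_newMatching {s : State I} {S : Set I.V} {x w} : (x, w) ∈ newMatching s S ↔
    ((x, w) ∈ s.Ec ∧ Sum.inl x ∈ S ∧ Sum.inr w ∈ S) ∨
      ((x, w) ∈ s.M ∧ ¬ (Sum.inl x ∈ S ∧ Sum.inr w ∈ S)) := by
  simp [newMatching, Inside]

namespace RotFacts

variable {S : Set I.V}

theorem man_in (f : RotFacts Mz s S) {x w} (hx : Sum.inl x ∈ S) :
    (x, w) ∈ newMatching s S ↔ (x, w) ∈ s.Ec := by
  rw [mem_newMatching]
  constructor
  · rintro (h | ⟨h1, h2⟩)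
    · exact h.1
    · exact absurd ⟨hx, f.mM _ _ hx h1⟩ h2
  · intro h; exact Or.inl ⟨h, hx, (f.ec _ _ hx h).1⟩

theorem man_out (_ : RotFacts Mz s S) {x w} (hx : Sum.inl x ∉ S) :
    (x, w) ∈ newMatching s S ↔ (x, w) ∈ s.M := by
  rw [mem_newMatching]; tauto

theorem wom_in (f : RotFacts Mz s S) {x w} (hw : Sum.inr w ∈ S) :
    (x, w) ∈ newMatching s S ↔ (x, w) ∈ s.Ec ∧ Sum.inl x ∈ S := by
  rw [mem_newMatching]
  constructor
  · rintro (h | ⟨h1, h2⟩)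
    · exact ⟨h.1, h.2.1⟩
    · exact absurd ⟨f.wM _ _ hw h1, hw⟩ h2
  · intro h; exact Or.inl ⟨h.1, h.2, hw⟩

theorem wom_out (_ : RotFacts Mz s S) {x w} (hw : Sum.inr w ∉ S) :
    (x, w) ∈ newMatching s S ↔ (x, w) ∈ s.M := by
  rw [mem_newMatching]; tauto

theorem matching (f : RotFacts Mz s S) (g : Good Mz s) : IsMatching I (newMatching s S) := by
  have hfst : ∀ x w w', (x, w) ∈ newMatching s S → (x, w') ∈ newMatching s S → w = w' := by
    intro x w w' h h'
    by_cases hx : Sum.inl x ∈ S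
    · rw [f.man_in hx] at h h'
      exact f.ecM' _ _ _ hx h h'
    · rw [f.man_out hx] at h h'
      exact g.mat.fst h h'
  have hsnd : ∀ x x' w, (x, w) ∈ newMatching s S → (x', w) ∈ newMatching s S → x = x' := by
    intro x x' w h h'
    by_cases hw : Sum.inr w ∈ S
    · rw [f.wom_in hw] at h h'
      exact f.ecW' _ _ _ hw h.1 h'.1
    · rw [f.wom_out hw] at h h'
      exact g.mat.snd h h'
  refine ⟨?_, ?_⟩
  · rintro ⟨x, w⟩ h
    rcases mem_newMatching.1 h with h | h
    · exact g.subC h.1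
    · exact g.mat.1 h.1
  · rintro ⟨x, w⟩ h ⟨x', w'⟩ h' (he | he)
    · simp only at he; subst he; rw [hfst _ _ _ h h']
    · simp only at he; subst he; rw [hsnd _ _ _ h h']

end RotFacts

theorem mem_rotate_Ec {S : Set I.V} {x w} : (x, w) ∈ (rotate Mz s S).Ec ↔ (x, w) ∈ s.Ec ∧
    (Sum.inl x ∈ S → Sum.inr w ∈ S →
      (x, w) ∈ newMatching s S ∧ Settled (newMatching s S) Mz x) := by
  simp [rotate, Inside]

theorem mem_rotate_Ed {S : Set I.V} {x w} : (x, w) ∈ (rotate Mz s S).Ed ↔ (x, w) ∈ s.Ed ∧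
    (Sum.inl x ∈ S → Sum.inr w ∈ S → (x, w) ∈ newMatching s S) ∧
      (Sum.inr w ∈ S → ¬ Dominated (newMatching s S) (x, w)) := by
  simp [rotate, Inside]

theorem mem_rotate_Er {S : Set I.V} {x w} : (x, w) ∈ (rotate Mz s S).Er ↔ (x, w) ∈ s.Er ∧
      (Sum.inr w ∈ S → ¬ Dominated (newMatching s S) (x, w)) := by
  simp [rotate]

theorem rotate_M {S : Set I.V} : (rotate Mz s S).M = newMatching s S := rfl

/-- An edge of the old matching survives outside `S`, an edge off the matching has its man
outside `S`. -/
theorem rotate_Ed_off (f : RotFacts Mz s S) {x w} (h : (x, w) ∈ (rotate Mz s S).Ed)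
    (h' : (x, w) ∉ newMatching s S) : (x, w) ∈ s.Ed ∧ (x, w) ∉ s.M ∧ Sum.inl x ∉ S := by
  obtain ⟨h1, h2, -⟩ := mem_rotate_Ed.1 h
  have hM : (x, w) ∉ s.M := by
    intro hM
    apply h'
    by_cases hi : Sum.inl x ∈ S ∧ Sum.inr w ∈ S
    · exact h2 hi.1 hi.2
    · exact mem_newMatching.2 (Or.inr ⟨hM, hi⟩)
  refine ⟨h1, hM, fun hx => h' (h2 hx (f.closed _ hx _ ⟨h1, hM⟩))⟩

theorem rotate_arc (f : RotFacts Mz s S) {u v : I.V} (hu : u ∉ S) (hv : v ∉ S) (h : Arc s u v) :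
    Arc (rotate Mz s S) u v := by
  rcases u with m | w <;> rcases v with m' | w'
  · exact h
  · exact ⟨mem_rotate_Ed.2 ⟨h.1, fun h' => absurd h' hu, fun h' => absurd h' hv⟩,
      fun h' => h.2 ((f.man_out hu).1 h')⟩
  · exact ⟨mem_rotate_Ed.2 ⟨h.1, fun h' => absurd h' hv, fun h' => absurd h' hu⟩,
      (f.man_out hv).2 h.2⟩
  · exact h

/-- A path that ends outside a set without leaving arcs never enters it, and the rotation keeps
every arc between vertices outside. -/
theorem rotate_reach (f : RotFacts Mz s S) {u v : I.V} (hv : v ∉ S)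
    (h : ReflTransGen (Arc s) u v) : ReflTransGen (Arc (rotate Mz s S)) u v := by
  induction h using ReflTransGen.head_induction_on with
  | refl => exact .refl
  | head h' h ih =>
    rename_i a c
    have hc : c ∉ S := fun hc => hv (noOut_reach f.closed hc h)
    have ha : a ∉ S := fun ha => hc (f.closed _ ha _ h')
    exact .head (rotate_arc f ha hc h') ih

theorem ec_inside_rank (f : RotFacts Mz s S) (g : Good Mz s) {x w w'} (hx : Sum.inl x ∈ S)
    (h : (x, w) ∈ s.Ec) (h' : (x, w') ∈ Mz) : w' = w ∨ I.rankM x w < I.rankM x w' := by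
  rcases g.cov _ _ h' with h1 | h1
  · exact Or.inr (g.ecEr _ _ _ h h1)
  · exact Or.inl (f.ecM' _ _ _ hx h1 h)

theorem rotate_good_mEd {S : Set I.V} (f : RotFacts Mz s S) (g : Good Mz s) :
    newMatching s S ⊆ (rotate Mz s S).Ed := by
  rintro ⟨x, w⟩ hm
  refine mem_rotate_Ed.2 ⟨?_, fun _ _ => hm, fun _ => ?_⟩
  · rcases mem_newMatching.1 hm with h | h
    · exact (f.ec _ _ h.2.1 h.1).2.1
    · exact g.mEd h.1
  · rintro ⟨m, h1, h2⟩
    obtain rfl := (f.matching g).snd h1 hm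
    exact lt_irrefl _ h2

theorem rotate_good (hz : IsSuperStable I Mz) (g : Good Mz s) {S : Set I.V} (h : CanRotate s S) :
    Good Mz (rotate Mz s S) := by
  have f := rotFacts g h
  have hmat := f.matching g
  have hC : (rotate Mz s S).Ec ⊆ s.Ec := Finset.filter_subset _ _
  have hR : (rotate Mz s S).Er ⊆ s.Er := Finset.filter_subset _ _
  have hD : (rotate Mz s S).Ed ⊆ s.Ed := Finset.filter_subset _ _
  have hmen : ∀ x, (∃ w, (x, w) ∈ newMatching s S) ↔ ∃ w, (x, w) ∈ s.M := by
    intro x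
    by_cases hx : Sum.inl x ∈ S
    · simp only [f.man_in hx]
      exact ⟨fun _ => (f.uns x hx).imp fun _ h => h.1, fun _ => f.ecM x hx⟩
    · simp only [f.man_out hx]
  have hwom : ∀ w, (∃ x, (x, w) ∈ newMatching s S) ↔ ∃ x, (x, w) ∈ s.M := by
    intro w
    by_cases hw : Sum.inr w ∈ S
    · simp only [f.wom_in hw]
      exact ⟨fun _ => f.wMat w hw, fun _ => (f.ecW w hw).imp fun _ h => ⟨h.2, h.1⟩⟩
    · simp only [f.wom_out hw]
  have hdom : ∀ x w m, (Sum.inr w ∈ S → ¬ Dominated (newMatching s S) (x, w)) →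
      ((m, w) ∈ s.M → I.rankW w x ≤ I.rankW w m) → (m, w) ∈ newMatching s S →
      I.rankW w x ≤ I.rankW w m := by
    intro x w m h1 h2 hm
    by_cases hw : Sum.inr w ∈ S
    · have := h1 hw
      unfold Dominated at this
      push Not at this
      exact this m hm
    · exact h2 ((f.wom_out hw).1 hm)
  refine {
    mat := hmat, menM := fun x => (hmen x).trans (g.menM x),
    womM := fun x => (hwom x).trans (g.womM x), wom := ?_, men := ?_,
    subR := hR.trans g.subR, subD := hD.trans g.subD, subC := hC.trans g.subC,
    mEd := rotate_good_mEd f g, domR := fun x w m h hm => hdom x w m (mem_rotate_Er.1 h).2 (g.domR _ _ _ (hR h)) hm,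
    domD := fun x w m h hm => hdom x w m (mem_rotate_Ed.1 h).2.2 (g.domD _ _ _ (hD h)) hm,
    rkR := ?_, cov := ?_, cand := ?_,
    ecEr := fun x w w' h h' => g.ecEr x w w' (hC h) (hR h'),
    ecEc := fun x w w' h h' => g.ecEc x w w' (hC h) (hC h'), edMz := ?_, edUn := ?_,
    edM := fun x w h => (hwom w).2 (g.edM x w (hD h)),
    pend := fun x w h h' => ⟨fun w' hw' => (g.pend x w (hR h) (hD h')).1 w' (hC hw'),
      fun w' hw' => (g.pend x w (hR h) (hD h')).2 w' (hR hw')⟩ }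
  · intro w m m' hm hm'
    by_cases hw : Sum.inr w ∈ S
    · obtain ⟨hec, -⟩ := (f.wom_in hw).1 hm
      obtain ⟨x, h1, h2⟩ := g.ecBetter hz hec
      obtain rfl := hz.1.snd h1 hm'
      exact h2
    · exact g.wom _ _ _ ((f.wom_out hw).1 hm) hm'
  · intro m w w' hm hm'
    by_cases hx : Sum.inl m ∈ S
    · exact ec_inside_rank f g hx ((f.man_in hx).1 hm) hm'
    · exact g.men _ _ _ ((f.man_out hx).1 hm) hm'
  · intro x w hr
    obtain ⟨w', h1, h2⟩ := g.rkR _ _ (hR hr)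
    by_cases hx : Sum.inl x ∈ S
    · obtain ⟨w2, h3⟩ := f.ecM x hx
      exact ⟨w2, (f.man_in hx).2 h3, g.ecEr _ _ _ h3 (hR hr)⟩
    · exact ⟨w', (f.man_out hx).2 h1, h2⟩
  · intro x w hmz
    rcases g.cov _ _ hmz with h | h
    · refine Or.inl (mem_rotate_Er.2 ⟨h, fun hw => ?_⟩)
      -- The new partner of a woman in S comes from a candidate edge, so by `ecBetter` her
      -- Mz-partner is that man or strictly better and is not dominated.
      rintro ⟨y, hy, hlt⟩
      simp only at hy hlt
      obtain ⟨hec, -⟩ := (f.wom_in hw).1 hy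
      obtain ⟨x', h1, h2⟩ := g.ecBetter hz hec
      obtain rfl := hz.1.snd h1 hmz
      rcases h2 with rfl | h2 <;> omega
    · refine Or.inr (mem_rotate_Ec.2 ⟨h, fun hx hw => ?_⟩)
      have hn := (f.man_in hx).2 h
      refine ⟨hn, fun w1 w2 h1 h2 => ?_⟩
      rw [hmat.fst h1 hn, hz.1.fst h2 hmz]
  · intro x w hec
    obtain ⟨h1, h2⟩ := mem_rotate_Ec.1 hec
    by_cases hx : Sum.inl x ∈ S
    · left
      obtain ⟨h3, h4⟩ := h2 hx (f.ec _ _ hx h1).1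
      refine ⟨h3, ?_⟩
      obtain ⟨w', hw'⟩ := (g.menM x).1 ((hmen x).1 ⟨w, h3⟩)
      rcases ec_inside_rank f g hx h1 hw' with rfl | h5
      · exact hw'
      · have := h4 _ _ h3 hw'; omega
    · rcases g.cand _ _ h1 with ⟨h3, h4⟩ | ⟨h3, h4, h5⟩
      · exact Or.inl ⟨(f.man_out hx).2 h3, h4⟩
      · right
        have hw : Sum.inr w ∉ S := fun hw => hx (noOut_reach f.closed hw h5)
        exact ⟨mem_rotate_Ed.2 ⟨h3, fun h => absurd h hx, fun h => absurd h hw⟩,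
          fun h => h4 ((f.man_out hx).1 h), rotate_reach f hx h5⟩
  · intro x w w' hd hm
    obtain ⟨h1, h2, -⟩ := rotate_Ed_off f hd hm
    exact g.edMz _ _ _ h1 h2
  · intro x w hd hm
    obtain ⟨h1, h2, h3⟩ := rotate_Ed_off f hd hm
    obtain ⟨w0, h4, h5⟩ := g.edUn _ _ h1 h2
    exact ⟨w0, (f.man_out h3).2 h4, h5⟩

/-! #### The algorithm does not get stuck -/

/-- If a closed component is reached at a woman, her incoming arc shows that she is matched, and the
matching arc leads to a man of the same component. -/
theorem closed_man (g : Good Mz s) {x : Fin I.a} : ∃ m : Fin I.a,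
    ReflTransGen (Arc s) (Sum.inl x) (Sum.inl m) ∧ NoOut s (scc s (Sum.inl m)) := by
  obtain ⟨u, h1, h2⟩ := exists_closed s (Sum.inl x)
  rcases u with m | w
  · exact ⟨m, h1, h2⟩
  · rcases ReflTransGen.cases_tail h1 with h0 | ⟨v, h3, h4⟩
    · exact absurd h0 (by simp)
    · rcases v with y | w'
      · obtain ⟨m, hm⟩ := g.edM _ _ h4.1
        have ha : Arc s (Sum.inr w) (Sum.inl m) := ⟨g.mEd hm, hm⟩
        have hin := h2 _ (self_mem_scc s _) _ ha
        exact ⟨m, h1.tail ha, by rw [scc_eq hin]; exact h2⟩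
      · exact h4.elim

/-- Being unsettled propagates along arcs: from a man to the partner of the woman he points at by
`unsettled_next`, and from that woman to her partner. -/
theorem unsettled_reach (hz : IsSuperStable I Mz) (g : Good Mz s) {x : Fin I.a} {v : I.V}
    (hx : ∃ w, (x, w) ∈ s.M ∧ (x, w) ∉ Mz) (h : ReflTransGen (Arc s) (Sum.inl x) v) :
    (∀ m, v = Sum.inl m → ∃ w, (m, w) ∈ s.M ∧ (m, w) ∉ Mz) ∧
      (∀ w, v = Sum.inr w → ∀ m, (m, w) ∈ s.M → (m, w) ∉ Mz) := by
  induction h with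
  | refl => exact ⟨fun m hm => (by cases hm; exact hx), fun w hw => (by cases hw)⟩
  | @tail b c _ hb ih =>
    rcases b with y | w <;> rcases c with m | w'
    · exact hb.elim
    · refine ⟨fun m hm => (by cases hm), fun w hw m hm => ?_⟩
      cases hw
      exact g.unsettled_next hz hb.1 hb.2 hm
    · refine ⟨fun m' hm => ?_, fun w hw => (by cases hw)⟩
      cases hm
      exact ⟨w, hb.2, ih.2 w rfl _ hb.2⟩
    · exact hb.elim

/-- Take a closed component reached from an unsettled man. Since none of its men can be scanned,
each has a candidate edge inside it; single engagement makes the choice injective; and counting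
against M makes it a perfect matching, which could be rotated. -/
theorem not_stuck (hz : IsSuperStable I Mz) (g : Good Mz s) (h1 : ∀ m, ¬ CanScan Mz s m)
    (h2 : ∀ m w, NoOut s (scc s (Sum.inl m)) → Sum.inr w ∈ scc s (Sum.inl m) →
      ¬ MultiplyEngaged s w) (h3 : ∀ S, ¬ CanRotate s S) : ∀ m, Settled s.M Mz m := by
  by_contra hcon
  push Not at hcon
  obtain ⟨x, hx⟩ := hcon
  rw [g.unsettled_iff hz] at hx
  obtain ⟨m0, hr, hN⟩ := closed_man g (x := x)
  set S := scc s (Sum.inl m0) with hS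
  have hself : (Sum.inl m0 : I.V) ∈ S := self_mem_scc s _
  have huns : ∀ m, (Sum.inl m : I.V) ∈ S → ∃ w, (m, w) ∈ s.M ∧ (m, w) ∉ Mz := fun m hm =>
    (unsettled_reach hz g hx (hr.trans hm.1)).1 m rfl
  have hec : ∀ m, (Sum.inl m : I.V) ∈ S → ∃ w, Sum.inr w ∈ S ∧ (m, w) ∈ s.Ec := by
    intro m hm
    by_contra hcon
    push Not at hcon
    refine h1 m ⟨(g.unsettled_iff hz m).2 (huns m hm), fun w hw => ?_, by rw [scc_eq hm]; exact hN⟩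
    obtain ⟨a1, a2, -⟩ := uns_of_ec g hw (huns m hm)
    exact hcon w (hN _ hm _ ⟨a1, a2⟩) hw
  have hmat : ∀ w, (Sum.inr w : I.V) ∈ S → ∃ m, Sum.inl m ∈ S ∧ (m, w) ∈ s.M := by
    intro w hw
    rcases ReflTransGen.cases_tail hw.1 with h0 | ⟨v, a1, a2⟩
    · exact absurd h0 (by simp)
    · rcases v with y | w'
      · obtain ⟨m, hm⟩ := g.edM _ _ a2.1
        exact ⟨m, hN _ hw _ ⟨g.mEd hm, hm⟩, hm⟩
      · exact a2.elim
  have hme : ∀ w m m', (Sum.inr w : I.V) ∈ S → (m, w) ∈ s.Ec → (m', w) ∈ s.Ec → m = m' := by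
    intro w m m' hw a1 a2
    by_contra hne
    exact h2 m0 w hN hw ⟨m, m', hne, a1, a2⟩
  have : Nonempty (Fin I.a) := ⟨x⟩
  have : Nonempty (Fin I.b) := ⟨hx.choose⟩
  choose! f hf using hec
  choose! q hq using hmat
  let A : Finset (Fin I.a) := Finset.univ.filter fun m => (Sum.inl m : I.V) ∈ S
  let B : Finset (Fin I.b) := Finset.univ.filter fun w => (Sum.inr w : I.V) ∈ S
  have hfB : ∀ m ∈ A, f m ∈ B := fun m hm => by
    simp only [A, B, Finset.mem_filter, Finset.mem_univ, true_and] at hm ⊢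
    exact (hf m hm).1
  have hfinj : Set.InjOn f A := by
    intro m hm m' hm' he
    simp only [A, Finset.coe_filter, Finset.mem_univ, true_and, Set.mem_ofPred_eq] at hm hm'
    exact hme _ _ _ (hf m hm).1 (hf m hm).2 (he ▸ (hf m' hm').2)
  -- The matching M sends the women of the component injectively to its men.
  have hcard : B.card ≤ A.card := by
    refine Finset.card_le_card_of_injOn q (fun w hw => ?_) fun w hw w' hw' he => ?_
    · simp only [A, B, Finset.coe_filter, Finset.mem_univ, true_and, Set.mem_ofPred_eq] at hw ⊢
      exact (hq w hw).1
    · simp only [B, Finset.coe_filter, Finset.mem_univ, true_and, Set.mem_ofPred_eq] at hw hw'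
      exact g.mat.fst (hq w hw).2 (he ▸ (hq w' hw').2)
  have himg : A.image f = B := by
    refine Finset.eq_of_subset_of_card_le (fun w hw => ?_) ?_
    · obtain ⟨m, hm, rfl⟩ := Finset.mem_image.1 hw
      exact hfB m hm
    · rw [Finset.card_image_of_injOn hfinj]; exact hcard
  have hsurj : ∀ w, (Sum.inr w : I.V) ∈ S → ∃ m, Sum.inl m ∈ S ∧ f m = w := by
    intro w hw
    have : w ∈ A.image f := by rw [himg]; simp [B, hw]
    obtain ⟨m, hm, he⟩ := Finset.mem_image.1 this
    exact ⟨m, by simpa [A] using hm, he⟩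
  refine h3 S ⟨⟨_, hS⟩, hN, fun m hm => ⟨f m, hf m hm, ?_⟩, fun w hw => ?_⟩
  · rintro w ⟨hw, hmw⟩
    obtain ⟨m', hm', rfl⟩ := hsurj w hw
    rw [hme _ _ _ hw hmw (hf m' hm').2]
  · obtain ⟨m, hm, rfl⟩ := hsurj w hw
    exact ⟨m, ⟨hm, (hf m hm).2⟩, fun y hy => hme _ _ _ hw hy.2 (hf m hm).2⟩

/-! #### The initial state -/

theorem init_good {M₀ : I.EdgeSet} (h0 : IsManOptimal I M₀) (hz : IsWomanOptimal I Mz) :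
    Good Mz (initState M₀ Mz) := by
  have hm : ∀ x w, (x, w) ∈ Mz → ∃ w', (x, w') ∈ M₀ ∧ I.rankM x w' ≤ I.rankM x w :=
    fun x w h => h0.2 Mz hz.1 x w h
  have hw : ∀ w x, (x, w) ∈ M₀ → ∃ x', (x', w) ∈ Mz ∧ I.rankW w x' ≤ I.rankW w x :=
    fun w x h => hz.2 M₀ h0.1 w x h
  choose! p hp using hm
  choose! q hq using hw
  -- Man-optimality gives an injection of Mz into M₀ that keeps the man, woman-optimality one of M₀
  -- into Mz that keeps the woman. Hence both are bijections, and the two matchings cover the same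
  -- men and the same women.
  have hcard : Mz.card = M₀.card := by
    apply le_antisymm
    · refine Finset.card_le_card_of_injOn (fun e => (e.1, p e.1 e.2)) ?_ ?_
      · rintro ⟨x, w⟩ h; exact (hp x w h).1
      · rintro ⟨x, w⟩ h ⟨x', w'⟩ h' he
        simp only [Prod.mk.injEq] at he
        obtain ⟨rfl, -⟩ := he
        rw [hz.1.1.fst h h']
    · refine Finset.card_le_card_of_injOn (fun e => (q e.2 e.1, e.2)) ?_ ?_
      · rintro ⟨x, w⟩ h; exact (hq w x h).1
      · rintro ⟨x, w⟩ h ⟨x', w'⟩ h' he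
        simp only [Prod.mk.injEq] at he
        obtain ⟨-, rfl⟩ := he
        rw [h0.1.1.snd h h']
  have menM : ∀ x, (∃ w, (x, w) ∈ M₀) ↔ ∃ w, (x, w) ∈ Mz := by
    intro x
    have e1 : Mz.image (fun e => (e.1, p e.1 e.2)) = M₀ := by
      refine Finset.eq_of_subset_of_card_le ?_ ?_
      · intro e he
        obtain ⟨⟨y, w⟩, h1, rfl⟩ := Finset.mem_image.1 he
        exact (hp y w h1).1
      · rw [Finset.card_image_of_injOn, hcard]
        rintro ⟨x, w⟩ h ⟨x', w'⟩ h' he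
        simp only [Prod.mk.injEq] at he
        obtain ⟨rfl, -⟩ := he
        rw [hz.1.1.fst h h']
    constructor
    · rintro ⟨w, h⟩
      rw [← e1] at h
      obtain ⟨⟨y, w'⟩, h1, h2⟩ := Finset.mem_image.1 h
      simp only [Prod.mk.injEq] at h2
      exact ⟨w', h2.1 ▸ h1⟩
    · rintro ⟨w, h⟩; exact ⟨_, (hp x w h).1⟩
  have womM : ∀ w, (∃ x, (x, w) ∈ M₀) ↔ ∃ x, (x, w) ∈ Mz := by
    intro w
    have e1 : M₀.image (fun e => (q e.2 e.1, e.2)) = Mz := by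
      refine Finset.eq_of_subset_of_card_le ?_ ?_
      · intro e he
        obtain ⟨⟨y, w⟩, h1, rfl⟩ := Finset.mem_image.1 he
        exact (hq w y h1).1
      · rw [Finset.card_image_of_injOn, hcard]
        rintro ⟨x, w⟩ h ⟨x', w'⟩ h' he
        simp only [Prod.mk.injEq] at he
        obtain ⟨-, rfl⟩ := he
        rw [h0.1.1.snd h h']
    constructor
    · rintro ⟨x, h⟩; exact ⟨_, (hq w x h).1⟩
    · rintro ⟨x, h⟩
      rw [← e1] at h
      obtain ⟨⟨y, w'⟩, h1, h2⟩ := Finset.mem_image.1 h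
      simp only [Prod.mk.injEq] at h2
      exact ⟨y, h2.2 ▸ h1⟩
  have wom : ∀ w m m', (m, w) ∈ M₀ → (m', w) ∈ Mz → m' = m ∨ I.rankW w m' < I.rankW w m := by
    intro w m m' h1 h2
    obtain ⟨x, h3, h4⟩ := hz.1.better (y := m) (w := w) (h0.1.1.1 h1) (fun w' h' => by
      obtain ⟨h5, h6⟩ := hp m w' h'
      rwa [h0.1.1.fst h1 h5])
    rw [hz.1.1.snd h2 h3]; exact h4
  have men : ∀ m w w', (m, w) ∈ M₀ → (m, w') ∈ Mz → w' = w ∨ I.rankM m w < I.rankM m w' := by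
    intro m w w' h1 h2
    by_contra hcon
    push Not at hcon
    refine h0.1.2 (m, w') ⟨hz.1.1.1 h2, fun h => hcon.1 (h0.1.1.fst h h1), fun w2 h => ?_,
      fun m2 h => ?_⟩
    · rw [h0.1.1.fst h h1]; exact hcon.2
    · obtain ⟨h3, h4⟩ := hq _ _ h
      rwa [hz.1.1.snd h2 h3]
  have hEr : ∀ x w, (x, w) ∈ (initState M₀ Mz).Er ↔ (((x, w) ∈ I.E ∧ (x, w) ∉ M₀) ∧
      ¬ Dominated M₀ (x, w) ∧ ¬ ∃ w', (x, w') ∈ M₀ ∧ I.rankM x w ≤ I.rankM x w') := by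
    intro x w; simp [initState]
  have hEc : ∀ x w, (x, w) ∈ (initState M₀ Mz).Ec ↔ (x, w) ∈ M₀ ∧ Settled M₀ Mz x := by
    intro x w; simp [initState]
  have ecMz : ∀ x w, (x, w) ∈ (initState M₀ Mz).Ec → (x, w) ∈ M₀ ∧ (x, w) ∈ Mz := by
    intro x w h
    obtain ⟨h1, h2⟩ := (hEc x w).1 h
    obtain ⟨w', h3⟩ := (menM x).1 ⟨w, h1⟩
    rcases men _ _ _ h1 h3 with rfl | h4
    · exact ⟨h1, h3⟩
    · have := h2 _ _ h1 h3; omega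
  refine {
    mat := h0.1.1, menM := menM, womM := womM, wom := wom, men := men,
    subR := fun e he => ((hEr e.1 e.2).1 he).1.1, subD := h0.1.1.1,
    subC := fun e he => h0.1.1.1 ((hEc e.1 e.2).1 he).1, mEd := Finset.Subset.refl _,
    domR := ?_, domD := ?_, rkR := ?_, cov := ?_, cand := fun x w h => Or.inl (ecMz x w h),
    ecEr := ?_, ecEc := ?_, edMz := fun x w w' h h' => absurd h h',
    edUn := fun x w h h' => absurd h h', edM := fun x w h => ⟨x, h⟩,
    pend := fun x w h h' => absurd h' ((hEr x w).1 h).1.2 }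
  · intro x w m h hm
    have := ((hEr x w).1 h).2.1
    unfold Dominated at this
    push Not at this
    exact this m hm
  · intro x w m h hm
    rw [h0.1.1.snd h hm]
  · intro x w h
    obtain ⟨⟨h1, h2⟩, h3, h4⟩ := (hEr x w).1 h
    push Not at h4
    by_cases hx : ∃ w', (x, w') ∈ M₀
    · obtain ⟨w', hw'⟩ := hx
      exact ⟨w', hw', h4 w' hw'⟩
    -- For a man unmatched in M₀, an edge that is not dominated at its woman would block M₀.
    · exfalso
      refine h0.1.2 (x, w) ⟨h1, h2, fun w' hw' => absurd ⟨w', hw'⟩ hx, fun m hm => ?_⟩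
      by_contra hlt
      exact h3 ⟨m, hm, by simpa using hlt⟩
  · intro x w h
    obtain ⟨h1, h2⟩ := hp x w h
    rcases men _ _ _ h1 h with h3 | h3
    · right
      rw [← h3] at h1
      exact (hEc x w).2 ⟨h1, fun w1 w2 h3 h4 => by rw [h0.1.1.fst h3 h1, hz.1.1.fst h4 h]⟩
    · left
      refine (hEr x w).2 ⟨⟨hz.1.1.1 h, fun h' => ?_⟩, ?_, ?_⟩
      · rw [h0.1.1.fst h1 h'] at h3; omega
      · rintro ⟨m, h4, h5⟩
        simp only at h4 h5
        obtain ⟨h6, h7⟩ := hq w m h4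
        rw [hz.1.1.snd h6 h] at h7; omega
      · rintro ⟨w', h4, h5⟩
        rw [h0.1.1.fst h4 h1] at h5; omega
  · intro x w w' h h'
    have h1 := ((hEc x w).1 h).1
    have h2 := ((hEr x w').1 h').2.2
    push Not at h2
    exact h2 w h1
  · intro x w w' h h'
    rw [h0.1.1.fst ((hEc x w).1 h).1 ((hEc x w').1 h').1]

end Good
end SuperStable

end


/-! ### Reordering the deletions, and the potential that bounds the number of events. -/

noncomputable section

open scoped Classical

namespace SuperStable

variable {I : Inst}

open Relation

/-! ### Pruning woman by woman -/

theorem arc_congr {s s' : State I} (hM : s'.M = s.M) (hd : s'.Ed = s.Ed) : Arc s' = Arc s := by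
  funext u v
  rcases u with m | w <;> rcases v with m' | w' <;> simp [Arc, hM, hd]

/-- Depends on M and on the digraph only, neither of which the deletions change. It may therefore be
evaluated once, in the state before the loop. -/
def PruneCond (s : State I) (m : Fin I.a) (w : Fin I.b) : Prop :=
  NoOut s (scc s (Sum.inl m)) ∧ Sum.inr w ∈ scc s (Sum.inl m)

theorem pruneCond_congr {s s' : State I} (hM : s'.M = s.M) (hd : s'.Ed = s.Ed) :
    PruneCond s' = PruneCond s := by
  funext m w
  simp only [PruneCond, NoOut, scc, arc_congr hM hd]

namespace Good

theorem lowSet_lowAt {s : State I} {w w'} (h : w' ≠ w) : lowSet (lowAt s w) w' = lowSet s w' := by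
  have hC : ∀ x, (x, w') ∈ (lowAt s w).Ec ↔ (x, w') ∈ s.Ec := by
    intro x
    simp only [lowAt, Finset.mem_sdiff, and_iff_left_iff_imp]
    intro _ h1
    exact h (mem_lowSet.1 h1).2.1
  have hR : ∀ x, (x, w') ∈ (lowAt s w).Er ↔ (x, w') ∈ s.Er := by
    intro x
    simp only [lowAt, Finset.mem_sdiff, and_iff_left_iff_imp]
    intro _ h1
    exact h (mem_lowSet.1 h1).2.1
  ext ⟨x, y⟩
  rw [mem_lowSet, mem_lowSet]
  by_cases hy : y = w'
  · subst hy
    simp only [hC, hR, MultiplyEngaged]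
  · simp [hy]

/-- The lowest edges at a woman are determined by the edges incident to her, so deletions at
different women do not interact. -/
theorem lowAt_comm (s : State I) (w w') : lowAt (lowAt s w) w' = lowAt (lowAt s w') w := by
  by_cases h : w' = w
  · subst h; rfl
  · have h1 := lowSet_lowAt (s := s) h
    have h2 := lowSet_lowAt (s := s) (Ne.symm h)
    have h3 : ∀ (A : I.EdgeSet), (A \ lowSet s w) \ lowSet s w' = (A \ lowSet s w') \ lowSet s w :=
      fun A => by ext e; simp only [Finset.mem_sdiff]; tauto
    have h4 : lowAt (lowAt s w) w' = { s with
        Ec := (s.Ec \ lowSet s w) \ lowSet (lowAt s w) w'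
        Er := (s.Er \ lowSet s w) \ lowSet (lowAt s w) w' } := rfl
    have h5 : lowAt (lowAt s w') w = { s with
        Ec := (s.Ec \ lowSet s w') \ lowSet (lowAt s w') w
        Er := (s.Er \ lowSet s w') \ lowSet (lowAt s w') w } := rfl
    rw [h4, h5, h1, h2, h3, h3]

theorem foldl_lowAt (l : List (Fin I.b)) : ∀ (s : State I), l.Nodup →
    l.foldl lowAt s = { s with Ec := s.Ec.filter fun e => ¬ ∃ w ∈ l, e ∈ lowSet s w
                               Er := s.Er.filter fun e => ¬ ∃ w ∈ l, e ∈ lowSet s w } := by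
  induction l with
  | nil => intro s _; simp
  | cons w l ih =>
    intro s hnd
    rw [List.nodup_cons] at hnd
    rw [List.foldl_cons, ih _ hnd.2]
    have h1 : ∀ e, (∃ w' ∈ l, e ∈ lowSet (lowAt s w) w') ↔ ∃ w' ∈ l, e ∈ lowSet s w' := by
      intro e
      refine exists_congr fun w' => and_congr_right fun hw' => ?_
      rw [lowSet_lowAt (by rintro rfl; exact hnd.1 hw')]
    simp only [h1]
    simp only [lowAt, State.mk.injEq, true_and]
    constructor <;>
    · ext e
      simp only [Finset.mem_filter, Finset.mem_sdiff, List.mem_cons, exists_eq_or_imp, not_or,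
        and_assoc]

theorem pruneAt_eq (s : State I) (m : Fin I.a) :
    pruneAt s m = ((List.finRange I.b).filter fun w => decide (PruneCond s m w)).foldl lowAt s := by
  rw [foldl_lowAt _ _ ((List.nodup_finRange _).filter _)]
  unfold pruneAt
  by_cases h : NoOut s (scc s (Sum.inl m))
  · rw [if_pos h]
    simp only [State.mk.injEq, true_and]
    constructor <;>
    · ext ⟨x, y⟩
      simp only [Finset.mem_sdiff, Finset.mem_filter, Finset.mem_union, List.mem_filter,
        List.mem_finRange, true_and, decide_eq_true_eq, PruneCond, h, mem_lowSet]
      constructor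
      · rintro ⟨h1, h2⟩
        refine ⟨h1, ?_⟩
        rintro ⟨w, hw, h3, rfl, h4, h5⟩
        exact h2 ⟨h3, hw, h4, h5⟩
      · rintro ⟨h1, h2⟩
        exact ⟨h1, fun h3 => h2 ⟨y, h3.2.1, h3.1, rfl, h3.2.2.1, h3.2.2.2⟩⟩
  · rw [if_neg h]
    simp [PruneCond, h]

theorem foldl_lowAt_M (l : List (Fin I.b)) (s : State I) : (l.foldl lowAt s).M = s.M ∧
    (l.foldl lowAt s).Ed = s.Ed := by
  induction l generalizing s with
  | nil => exact ⟨rfl, rfl⟩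
  | cons w l ih => exact ih (lowAt s w)

theorem prune_eq_flatMap (s : State I) : prune s = ((List.finRange I.a).flatMap fun m =>
    (List.finRange I.b).filter fun w => decide (PruneCond s m w)).foldl lowAt s := by
  rw [List.foldl_flatMap]
  unfold prune
  have key : ∀ (l : List (Fin I.a)) (s' : State I), s'.M = s.M → s'.Ed = s.Ed →
      l.foldl pruneAt s' = l.foldl (fun acc m => ((List.finRange I.b).filter fun w =>
        decide (PruneCond s m w)).foldl lowAt acc) s' := by
    intro l
    induction l with
    | nil => intro s' _ _; rfl
    | cons m l ih =>
      intro s' hM hd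
      have e : pruneAt s' m = ((List.finRange I.b).filter fun w =>
          decide (PruneCond s m w)).foldl lowAt s' := by
        rw [pruneAt_eq, pruneCond_congr hM hd]
      rw [List.foldl_cons, List.foldl_cons, ih (pruneAt s' m), e]
      · rw [e, (foldl_lowAt_M _ _).1, hM]
      · rw [e, (foldl_lowAt_M _ _).2, hd]
  exact key _ s rfl rfl

theorem filter_eq_flatMap {α : Type*} (l : List α) (p : α → Prop) [DecidablePred p] :
    (l.filter fun x => decide (p x)) = l.flatMap fun x => if p x then [x] else [] := by
  induction l with
  | nil => rfl
  | cons x l ih => by_cases h : p x <;> simp [h, ih]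

/-- The deletions at the women may be carried out woman by woman. -/
theorem prune_eq (s : State I) : prune s = (List.finRange I.b).foldl (fun t w =>
    (List.finRange I.a).foldl (fun t m => if PruneCond s m w then lowAt t w else t) t) s := by
  have h1 : ∀ w t, (List.finRange I.a).foldl (fun t m => if PruneCond s m w then lowAt t w else t) t
      = ((List.finRange I.a).flatMap fun m => if PruneCond s m w then [w] else []).foldl lowAt t := by
    intro w t
    rw [List.foldl_flatMap]
    congr 1
    funext t m
    split_ifs <;> rfl
  simp only [h1]
  rw [← List.foldl_flatMap, prune_eq_flatMap]
  have : RightCommutative (lowAt (I := I)) := ⟨fun s w w' => lowAt_comm s w w'⟩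
  -- Both orders of the double loop perform the same multiset of commuting deletions. A woman may
  -- occur several times, once for each man of her component.
  refine List.Perm.foldl_eq ?_ s
  simp only [filter_eq_flatMap]
  rw [← Multiset.coe_eq_coe]
  have h2 := Multiset.bind_bind (↑(List.finRange I.a) : Multiset (Fin I.a))
    (↑(List.finRange I.b) : Multiset (Fin I.b))
    (f := fun m w => ((if PruneCond s m w then [w] else [] : List (Fin I.b)) : Multiset (Fin I.b)))
  simpa only [Multiset.coe_bind] using h2

end Good

/-! ### The potential of a state -/

/-- Weight of an edge, according to its membership in `Er`, `Ed`, `M` and `Ec`. -/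
def wt (r d m c : Prop) : ℕ :=
  -- An edge weighs 16 while untouched, 12 after a scan that failed to process it, 8 = 2 + 6 as a
  -- candidate arc off the matching, 2 as a processed arc off the matching, and 0 once matched or
  -- gone. The gaps give 4 for each scan, 6 for a deleted candidate and 2 for a deleted arc.
  (if r then (if d then 12 else 16) else if d ∧ ¬ m then 2 else 0) + (if c ∧ ¬ m then 6 else 0)

def phi (s : State I) (e : Fin I.a × Fin I.b) : ℕ := wt (e ∈ s.Er) (e ∈ s.Ed) (e ∈ s.M) (e ∈ s.Ec)

/-- Bounds the number of remaining events. -/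
def Phi (s : State I) : ℕ := ∑ e ∈ I.E, phi s e

theorem phi_le (s : State I) (e) : phi s e ≤ 22 := by
  unfold phi wt; split_ifs <;> omega

theorem Phi_le (s : State I) : Phi s ≤ 22 * I.numE := by
  have := Finset.sum_le_card_nsmul I.E (phi s) 22 fun e _ => phi_le s e
  simpa [Phi, Inst.numE, mul_comm] using this

theorem Phi_drop {s s' : State I} {T : I.EdgeSet} {c : ℕ} (hT : T ⊆ I.E)
    (h : ∀ e, phi s' e + (if e ∈ T then c else 0) ≤ phi s e) : Phi s' + c * T.card ≤ Phi s := by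
  have h1 : ∑ e ∈ I.E, (phi s' e + if e ∈ T then c else 0) ≤ Phi s :=
    Finset.sum_le_sum fun e _ => h e
  rw [Finset.sum_add_distrib, Finset.sum_ite_mem, Finset.inter_eq_right.2 hT,
    Finset.sum_const, smul_eq_mul, mul_comm] at h1
  exact h1

namespace Good

variable {Mz : I.EdgeSet} {s : State I}

theorem Er_not_Ec (g : Good Mz s) {x w} (h : (x, w) ∈ s.Er) : (x, w) ∉ s.Ec :=
  fun h' => lt_irrefl _ (g.ecEr _ _ _ h' h)

/-- The only transition that could raise the weight is an unprocessed edge dropping out of the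
digraph, from 12 to 16. The second hypothesis excludes it. -/
theorem wt_mono {r d m c r' d' c' : Prop} (hr : r' → r) (hd : d → r' → d') (hd' : d' → d ∨ r)
    (hc : c' → c) : wt r' d' m c' ≤ wt r d m c := by
  unfold wt
  split_ifs <;> first | omega | (exfalso; tauto)

/-- If all top choices were arcs already, the digraph would not change and the component would still
be closed. So at least one edge passes from 16 to 12. -/
theorem Phi_addTop {m} (hc : CanScan Mz s m) (g : Good Mz s)
    (hN : ¬ NoOut (addTop s m) (scc (addTop s m) (Sum.inl m))) : Phi (addTop s m) + 4 ≤ Phi s := by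
  have : ∃ e ∈ topChoices s m, e ∉ s.Ed := by
    by_contra hcon
    push Not at hcon
    apply hN
    have h1 : addTop s m = s := by
      have : s.Ed ∪ topChoices s m = s.Ed := Finset.union_eq_left.2 hcon
      unfold addTop; rw [this]
    rw [h1]; exact hc.2.2
  obtain ⟨e, he, hd⟩ := this
  have hr := (Finset.mem_filter.1 he).1
  have := Phi_drop (s := s) (s' := addTop s m) (T := {e}) (c := 4) (by simpa using g.subR hr) (by
    intro f
    by_cases hf : f = e
    · subst hf
      have h1 : f ∉ s.Ec := g.Er_not_Ec hr
      simp [phi, addTop, wt, hr, hd, he, h1]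
    · rw [if_neg (by simpa using hf), add_zero]
      refine wt_mono (fun h => h) (fun h _ => Finset.mem_union_left _ h) (fun h => ?_) (fun h => h)
      exact (Finset.mem_union.1 h).imp id fun h => (Finset.mem_filter.1 h).1)
  simpa using this

theorem Phi_scanDone {m} (g : Good Mz s) :
    Phi (scanDone s m) + 4 * (topChoices s m).card ≤ Phi s := by
  refine Phi_drop (fun e he => g.subR (Finset.mem_filter.1 he).1) ?_
  rintro ⟨x, w⟩
  by_cases ht : (x, w) ∈ topChoices s m
  · have hr := (mem_topChoices.1 ht).1
    have h1 := g.Er_not_M hr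
    have h2 : (x, w) ∉ (scanDone s m).Er := fun h => (Finset.mem_sdiff.1 h).2 ht
    have h3 : (x, w) ∈ (scanDone s m).Ed := Finset.mem_union_right _ ht
    simp only [phi, wt, ht, hr, h1, h2, h3, if_true, if_false]
    split_ifs <;> omega
  · rw [if_neg ht, add_zero]
    refine wt_mono (fun h => (Finset.mem_sdiff.1 h).1) (fun h _ => Finset.mem_union_left _ h)
      (fun h => Or.inl ((Finset.mem_union.1 h).resolve_right ht)) (fun h => ?_)
    exact (Finset.mem_union.1 (Finset.mem_filter.1 h).1).resolve_right
      fun h => ht (Finset.mem_filter.1 h).1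

/-- A deleted candidate does not belong to M: candidates in M are also in Mz and are spared. So it
really carried the extra 6, and an unprocessed edge loses even more. -/
theorem Phi_lowAt (hz : IsSuperStable I Mz) (g : Good Mz s) (w₀) :
    Phi (lowAt s w₀) + 6 * (lowSet s w₀).card ≤ Phi s := by
  refine Phi_drop (fun e he => ?_) ?_
  · exact (Finset.mem_union.1 (Finset.mem_filter.1 he).1).elim (fun h => g.subC h) fun h => g.subR h
  rintro ⟨x, w⟩
  have h3 : (x, w) ∈ (lowAt s w₀).Er ↔ (x, w) ∈ s.Er ∧ (x, w) ∉ lowSet s w₀ := Finset.mem_sdiff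
  have h4 : (x, w) ∈ (lowAt s w₀).Ec ↔ (x, w) ∈ s.Ec ∧ (x, w) ∉ lowSet s w₀ := Finset.mem_sdiff
  by_cases ht : (x, w) ∈ lowSet s w₀
  · simp only [ht, not_true_eq_false, and_false, iff_false] at h3 h4
    have hor := (mem_lowSet.1 ht).1
    have hM : (x, w) ∈ s.Ec → (x, w) ∉ s.M := by
      intro h
      rcases g.cand _ _ h with ⟨-, h⟩ | ⟨-, h, -⟩
      · exact absurd ht (g.mz_not_low hz h)
      · exact h
    have hrc := g.Er_not_Ec (x := x) (w := w)
    show wt _ ((x, w) ∈ s.Ed) ((x, w) ∈ s.M) _ + _ ≤ _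
    simp only [phi, h3, h4, ht, if_true]
    unfold wt
    split_ifs <;> first | omega | (exfalso; tauto)
  · rw [if_neg ht, add_zero]
    exact wt_mono (fun h => (h3.1 h).1) (fun h _ => h) (fun h => Or.inl h) (fun h => (h4.1 h).1)

theorem wt_rotate {r d m c r' d' c' : Prop} (hR : r' → r) (hD : d' → d) (hC : c' → c)
    (hrd : r' → d → d') (hdr : d' → r → r') (hrm : r → ¬ m) :
    wt r' d' m c' + (if (d ∧ ¬ m) ∧ ¬ d' then 2 else 0) ≤ wt r d m c := by
  by_cases r <;> by_cases r' <;> by_cases d <;> by_cases d' <;> by_cases m <;> by_cases c <;>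
    by_cases c' <;> simp_all [wt]

/-- Each man of S turns a candidate of weight 8 into a matching edge of weight 0, and every other
arc off the matching that is removed gives up at least 2. An unprocessed edge never leaves the
digraph without being deleted: for men of S `pend` says it was not an arc, since they have
candidates, and for other men both deletions follow the same rule. -/
theorem Phi_rotate (g : Good Mz s) {S : Set I.V} (f : RotFacts Mz s S) :
    Phi (rotate Mz s S) + 6 * (Finset.univ.filter fun m => (Sum.inl m : I.V) ∈ S).card +
      2 * ((s.Ed \ s.M) \ (rotate Mz s S).Ed).card ≤ Phi s := by
  have hcard : (Finset.univ.filter fun m => (Sum.inl m : I.V) ∈ S).card ≤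
      (s.Ec.filter fun e => (Sum.inl e.1 : I.V) ∈ S).card := by
    have hex := f.ecM
    rcases isEmpty_or_nonempty (Fin I.b) with he | he
    · rw [Finset.card_eq_zero.2]
      · exact Nat.zero_le _
      · ext m
        simp only [Finset.mem_filter, Finset.mem_univ, true_and, Finset.notMem_empty, iff_false]
        intro hm
        exact he.elim (hex m hm).choose
    · choose! q hq using hex
      refine Finset.card_le_card_of_injOn (fun m => (m, q m)) (fun m hm => ?_) ?_
      · simp only [Finset.coe_filter, Finset.mem_univ, true_and, Set.mem_ofPred_eq] at hm ⊢
        exact ⟨hq m hm, hm⟩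
      · intro m _ m' _ he
        exact congrArg Prod.fst he
  have key : ∑ e ∈ I.E, (phi (rotate Mz s S) e +
      (if e ∈ s.Ec.filter (fun e => (Sum.inl e.1 : I.V) ∈ S) then 6 else 0) +
      (if e ∈ (s.Ed \ s.M) \ (rotate Mz s S).Ed then 2 else 0)) ≤ Phi s := by
    refine Finset.sum_le_sum fun e _ => ?_
    obtain ⟨x, w⟩ := e
    have hC : (x, w) ∈ (rotate Mz s S).Ec → (x, w) ∈ s.Ec :=
      fun h => (Finset.mem_filter.1 h).1
    have hR : (x, w) ∈ (rotate Mz s S).Er → (x, w) ∈ s.Er :=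
      fun h => (Finset.mem_filter.1 h).1
    have hD : (x, w) ∈ (rotate Mz s S).Ed → (x, w) ∈ s.Ed :=
      fun h => (Finset.mem_filter.1 h).1
    have hMD : (x, w) ∈ (rotate Mz s S).M → (x, w) ∈ (rotate Mz s S).Ed :=
      fun h => rotate_good_mEd f g h
    have hrc := g.Er_not_Ec (x := x) (w := w)
    have hrM := g.Er_not_M (x := x) (w := w)
    simp only [Finset.mem_filter, Finset.mem_sdiff, phi]
    by_cases hx : (Sum.inl x : I.V) ∈ S
    · have hM' : (x, w) ∈ (rotate Mz s S).M ↔ (x, w) ∈ s.Ec := f.man_in hx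
      have hoff : (x, w) ∈ (rotate Mz s S).Ed → (x, w) ∈ (rotate Mz s S).M := by
        intro h; by_contra h'; exact (rotate_Ed_off f h h').2.2 hx
      have hec : (x, w) ∈ s.Ec → (x, w) ∈ s.Ed ∧ (x, w) ∉ s.M := fun h => (f.ec _ _ hx h).2
      have hp : (x, w) ∈ s.Er → (x, w) ∉ s.Ed := by
        intro h h'
        obtain ⟨w', hw'⟩ := f.ecM x hx
        exact (g.pend _ _ h h').1 w' hw'
      simp only [hx, and_true]
      by_cases c : (x, w) ∈ s.Ec
      · have m' := hM'.2 c
        have d' := hMD m'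
        have r : (x, w) ∉ s.Er := fun h => hrc h c
        have r' : (x, w) ∉ (rotate Mz s S).Er := fun h => r (hR h)
        simp [wt, c, m', d', r, r', hec c]
      · have m' : (x, w) ∉ (rotate Mz s S).M := fun h => c (hM'.1 h)
        have d' : (x, w) ∉ (rotate Mz s S).Ed := fun h => m' (hoff h)
        have c' : (x, w) ∉ (rotate Mz s S).Ec := fun h => c (hC h)
        by_cases r : (x, w) ∈ s.Er
        · by_cases r' : (x, w) ∈ (rotate Mz s S).Er <;> simp [wt, c, m', d', r, r', c', hp r]
        · have r' : (x, w) ∉ (rotate Mz s S).Er := fun h => r (hR h)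
          simp only [wt, c, m', d', r, r', c', false_and, if_false, not_false_eq_true, and_true,
            add_zero, zero_add]
          split_ifs <;> omega
    · have hM' : (x, w) ∈ (rotate Mz s S).M ↔ (x, w) ∈ s.M := f.man_out hx
      have hrd : (x, w) ∈ (rotate Mz s S).Er → ((x, w) ∈ (rotate Mz s S).Ed ↔ (x, w) ∈ s.Ed) := by
        intro h
        rw [mem_rotate_Ed]
        have := (mem_rotate_Er.1 h).2
        tauto
      have hdr : (x, w) ∈ (rotate Mz s S).Ed → (x, w) ∈ s.Er → (x, w) ∈ (rotate Mz s S).Er := by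
        intro h h'
        rw [mem_rotate_Er]
        exact ⟨h', (mem_rotate_Ed.1 h).2.2⟩
      simp only [hx, and_false, if_false, add_zero, hM']
      have h9 := wt_rotate hR hD hC (fun h => (hrd h).2) hdr hrM
      split_ifs at h9 ⊢ <;> exact h9
  rw [Finset.sum_add_distrib, Finset.sum_add_distrib, Finset.sum_ite_mem, Finset.sum_ite_mem,
    Finset.inter_eq_right.2 ((Finset.filter_subset _ _).trans g.subC),
    Finset.inter_eq_right.2 (Finset.sdiff_subset.trans (Finset.sdiff_subset.trans g.subD)),
    Finset.sum_const, Finset.sum_const, smul_eq_mul, smul_eq_mul] at key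
  have : Phi (rotate Mz s S) = ∑ e ∈ I.E, phi (rotate Mz s S) e := rfl
  omega

end Good

end SuperStable

end


/-! ### Strongly connected components maintained by contraction, with amortised repairs. -/

noncomputable section

open scoped Classical

namespace SuperStable

variable {I : Inst}

open Relation

/-! ### Maintaining the strongly connected components -/

/-- A partition of the men into classes, an edge leaving each class that is known not to be
closed, and the men whose edges may leave their class. -/
structure Forest (I : Inst) where
  lab : Fin I.a → Fin I.a
  out : Fin I.a → Option (Fin I.a × Fin I.b)
  dirty : Finset (Fin I.a)

/-- Following the edges `out` from the class `ℓ` leads to the class `r`. -/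
inductive Leads (s : State I) (F : Forest I) : Fin I.a → Fin I.a → Prop
  | root (ℓ : Fin I.a) (h : F.out ℓ = none) : Leads s F ℓ ℓ
  | step (ℓ : Fin I.a) (e : Fin I.a × Fin I.b) (m r : Fin I.a) (h : F.out ℓ = some e)
      (hm : (m, e.2) ∈ s.M) (hl : Leads s F (F.lab m) r) : Leads s F ℓ r

def MReach (s : State I) (x y : Fin I.a) : Prop :=
  ReflTransGen (Arc s) (Sum.inl x) (Sum.inl y)

theorem MReach.trans {s : State I} {x y z} (h : MReach s x y) (h' : MReach s y z) :
    MReach s x z := ReflTransGen.trans h h'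

/-- Classes lie inside components, recorded edges really leave from their class and lead on to a
class without one, and arcs out of a class start only at dirty men. Women need no labels, since a
matched woman passes on to her partner. The conditions on Mz confine the dirty men and their
representatives to the men that `Psi` counts. -/
structure ForestOK (Mz : I.EdgeSet) (s : State I) (F : Forest I) : Prop where
  idem : ∀ y, F.lab (F.lab y) = F.lab y
  conn : ∀ y, MReach s y (F.lab y) ∧ MReach s (F.lab y) y
  outOK : ∀ ℓ e, F.lab ℓ = ℓ → F.out ℓ = some e → e ∈ s.Ed ∧ e ∉ s.M ∧ F.lab e.1 = ℓ
  leads : ∀ y, ∃ r, Leads s F (F.lab y) r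
  clean : ∀ y w m, y ∉ F.dirty → (y, w) ∈ s.Ed → (y, w) ∉ s.M → (m, w) ∈ s.M →
    F.lab m = F.lab y
  dirtyMz : ∀ y ∈ F.dirty, ∃ w, (y, w) ∈ Mz
  labMz : ∀ y, (∃ w, (y, w) ∈ Mz) → ∃ w, (F.lab y, w) ∈ Mz

/-- The classes without a recorded outgoing edge have no outgoing edges. -/
def Forest.Clean (F : Forest I) : Prop := ∀ y ∈ F.dirty, F.out (F.lab y) ≠ none

/-- A representative counts 2 without and 1 with a recorded edge, and 0 after its class has been
absorbed; a dirty man counts 1 more. Each of the three kinds of repair thus gains exactly one unit.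
-/
def psi (F : Forest I) (y : Fin I.a) : ℕ :=
  (if F.lab y = y then (if F.out y = none then 2 else 1) else 0) + (if y ∈ F.dirty then 1 else 0)

/-- Only men matched in Mz are summed, so that the initial value is O(m) even if there are many
unmatched men. -/
def Psi (Mz : I.EdgeSet) (F : Forest I) : ℕ :=
  ∑ y ∈ Finset.univ.filter (fun y => ∃ w, (y, w) ∈ Mz), psi F y

theorem psi_dirty {F F' : Forest I} (hl : F'.lab = F.lab) (ho : F'.out = F.out) (y : Fin I.a) :
    psi F' y + (if y ∈ F.dirty then 1 else 0) = psi F y + (if y ∈ F'.dirty then 1 else 0) := by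
  unfold psi
  rw [hl, ho]
  omega

theorem Leads.unique {s : State I} (hM : IsMatching I s.M) {F : Forest I} {ℓ r r' : Fin I.a}
    (h : Leads s F ℓ r) (h' : Leads s F ℓ r') : r = r' := by
  induction h with
  | root ℓ h =>
    cases h' with
    | root _ h' => rfl
    | step _ e m _ h1 h2 h3 => rw [h] at h1; cases h1
  | step ℓ e m r h1 h2 h3 ih =>
    cases h' with
    | root _ h' => rw [h1] at h'; cases h'
    | step _ e' m' _ h1' h2' h3' =>
      rw [h1] at h1'; cases h1'
      obtain rfl := hM.snd h2 h2'
      exact ih h3'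

theorem Leads.out_eq {s : State I} {F : Forest I} {ℓ r : Fin I.a} (h : Leads s F ℓ r) :
    F.out r = none := by
  induction h with
  | root ℓ h => exact h
  | step ℓ e m r h1 h2 h3 ih => exact ih

namespace ForestOK

open Good

variable {Mz : I.EdgeSet} {s : State I} {F : Forest I}

theorem arc_man (g : Good Mz s) {y w m} (h : (y, w) ∈ s.Ed) (h' : (y, w) ∉ s.M)
    (hm : (m, w) ∈ s.M) : MReach s y m :=
  .tail (.single (b := Sum.inr w) ⟨h, h'⟩) ⟨g.mEd hm, hm⟩

theorem leads_reach (g : Good Mz s) (ok : ForestOK Mz s F) {ℓ r : Fin I.a} (h : Leads s F ℓ r)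
    (hℓ : F.lab ℓ = ℓ) : MReach s ℓ r ∧ F.lab r = r := by
  induction h with
  | root ℓ h => exact ⟨.refl, hℓ⟩
  | step ℓ e m r h1 h2 h3 ih =>
    obtain ⟨a1, a2, a3⟩ := ok.outOK _ _ hℓ h1
    obtain ⟨b1, b2⟩ := ih (ok.idem m)
    have c1 := (ok.conn e.1).2
    rw [a3] at c1
    exact ⟨((c1.trans (arc_man g a1 a2 h2)).trans (ok.conn m).1).trans b1, b2⟩

theorem class_reach (ok : ForestOK Mz s F) {y y'} (h : F.lab y' = F.lab y) : MReach s y y' :=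
  (ok.conn y).1.trans (h ▸ (ok.conn y').2)

/-- Nothing outside a closed class can be reached from it. -/
theorem closed_reach (ok : ForestOK Mz s F) (hc : F.Clean) {y : Fin I.a}
    (hy : F.out (F.lab y) = none) {v : I.V} (h : ReflTransGen (Arc s) (Sum.inl y) v) :
    (∀ m, v = Sum.inl m → F.lab m = F.lab y) ∧
      (∀ w, v = Sum.inr w → ∀ m, (m, w) ∈ s.M → F.lab m = F.lab y) := by
  induction h with
  | refl =>
    refine ⟨fun m hm => ?_, fun w hw => ?_⟩
    · cases hm; rfl
    · cases hw
  | @tail b c _ hb ih =>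
    rcases b with y' | w <;> rcases c with m | w'
    · exact hb.elim
    · refine ⟨fun m hm => ?_, fun w hw m hm => ?_⟩
      · cases hm
      · cases hw
        have h1 := ih.1 y' rfl
        rw [← h1]
        refine ok.clean _ _ _ (fun hd => ?_) hb.1 hb.2 hm
        exact hc _ hd (h1 ▸ hy)
    · refine ⟨fun m' hm => ?_, fun w hw => ?_⟩
      · cases hm
        exact ih.2 w rfl _ hb.2
      · cases hw
    · exact hb.elim

/-- If a class has a recorded edge, following the edges ends at a class r without one. Were the
component closed, r could reach back, but in a clean forest nothing leaves the class of r.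
Conversely, everything reachable from a class without a recorded edge stays in that class and its
partners. -/
theorem noOut_iff (g : Good Mz s) (ok : ForestOK Mz s F) (hc : F.Clean) (y : Fin I.a) :
    NoOut s (scc s (Sum.inl y)) ↔ F.out (F.lab y) = none := by
  constructor
  · intro h
    by_contra hne
    obtain ⟨r, hr⟩ := ok.leads y
    obtain ⟨h1, h2⟩ := leads_reach g ok hr (ok.idem y)
    have h3 : MReach s r y := noOut_scc_iff.1 h _ ((ok.conn y).1.trans h1)
    have h4 := hr.out_eq
    have h5 := (closed_reach ok hc (y := r) (by rw [h2]; exact h4) h3).1 y rfl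
    rw [h5, h2] at hne
    exact hne h4
  · intro h
    refine noOut_scc_iff.2 fun u hu => ?_
    have h1 := closed_reach ok hc h hu
    rcases u with m | w
    · exact class_reach ok (h1.1 m rfl).symm
    · rcases ReflTransGen.cases_tail hu with h0 | ⟨x, h2, h3⟩
      · exact absurd h0 (by simp)
      · rcases x with y' | w'
        · obtain ⟨m, hm⟩ := g.edM _ _ h3.1
          exact .head (b := Sum.inl m) ⟨g.mEd hm, hm⟩ (class_reach ok (h1.2 w rfl m hm).symm)
        · exact h3.elim

theorem mem_scc_iff (ok : ForestOK Mz s F) (hc : F.Clean) {y : Fin I.a}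
    (hy : F.out (F.lab y) = none) (y' : Fin I.a) :
    (Sum.inl y' : I.V) ∈ scc s (Sum.inl y) ↔ F.lab y' = F.lab y :=
  ⟨fun h => (closed_reach ok hc hy h.1).1 y' rfl,
    fun h => ⟨class_reach ok h, class_reach ok h.symm⟩⟩

/-- Partners of the women in a closed component belong to it. -/
theorem mem_scc_woman (ok : ForestOK Mz s F) (hc : F.Clean) {y : Fin I.a}
    (hy : F.out (F.lab y) = none) {w m} (h : (Sum.inr w : I.V) ∈ scc s (Sum.inl y))
    (hm : (m, w) ∈ s.M) : F.lab m = F.lab y :=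
  (closed_reach ok hc hy h.1).2 w rfl m hm

/-- A woman who receives an edge from another man of the closed class of her partner. -/
theorem woman_mem_scc (g : Good Mz s) (ok : ForestOK Mz s F) {y x : Fin I.a} {w m}
    (hm : (m, w) ∈ s.M) (hl : F.lab m = F.lab y) (h1 : (x, w) ∈ s.Ed) (h2 : (x, w) ∉ s.M)
    (h3 : ReflTransGen (Arc s) (Sum.inr w) (Sum.inl x)) :
    (Sum.inr w : I.V) ∈ scc s (Sum.inl y) := by
  have hwm : Arc s (Sum.inr w) (Sum.inl m) := ⟨g.mEd hm, hm⟩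
  refine ⟨ReflTransGen.trans (class_reach ok hl) ?_, .head hwm (class_reach ok hl.symm)⟩
  rcases ReflTransGen.cases_head h3 with h0 | ⟨v, h4, h5⟩
  · exact absurd h0 (by simp)
  · obtain ⟨m', rfl, h6, h7⟩ := Good.arc_wm h4
    obtain rfl := g.mat.snd h7 hm
    exact h5.tail ⟨h1, h2⟩

/-! #### Updates -/

theorem congr {s' : State I} (hM : s'.M = s.M) (hd : s'.Ed = s.Ed) (ok : ForestOK Mz s F) :
    ForestOK Mz s' F := by
  have hl : ∀ {ℓ r}, Leads s F ℓ r → Leads s' F ℓ r := by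
    intro ℓ r h
    induction h with
    | root ℓ h => exact .root ℓ h
    | step ℓ e m r h1 h2 h3 ih => exact .step ℓ e m r h1 (hM ▸ h2) ih
  refine ⟨ok.idem, ?_, ?_, fun y => (ok.leads y).imp fun _ h => hl h, ?_, ok.dirtyMz, ok.labMz⟩
  · intro y; simp only [MReach, arc_congr hM hd]; exact ok.conn y
  · rw [hM, hd]; exact ok.outOK
  · rw [hM, hd]; exact ok.clean

def erase (F : Forest I) (y : Fin I.a) : Forest I := { F with dirty := F.dirty.erase y }

def setOut (F : Forest I) (ℓ : Fin I.a) (e : Fin I.a × Fin I.b) : Forest I :=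
  { F with out := Function.update F.out ℓ (some e) }

def merge (F : Forest I) (ℓ c : Fin I.a) : Forest I :=
  { F with lab := fun v => if F.lab v = c then ℓ else F.lab v }

def mark (F : Forest I) (y : Fin I.a) : Forest I := { F with dirty := insert y F.dirty }

theorem mem_mz (ok : ForestOK Mz s F) {y} (h : y ∈ F.dirty) :
    F.lab y ∈ Finset.univ.filter (fun y => ∃ w, (y, w) ∈ Mz) := by
  simpa using ok.labMz y (ok.dirtyMz y h)

theorem psi_drop {F' : Forest I} {z : Fin I.a}
    (hz : z ∈ Finset.univ.filter (fun y => ∃ w, (y, w) ∈ Mz))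
    (h : ∀ y, psi F' y + (if y = z then 1 else 0) ≤ psi F y) : Psi Mz F' + 1 ≤ Psi Mz F := by
  have h1 := Finset.sum_le_sum (s := Finset.univ.filter (fun y => ∃ w, (y, w) ∈ Mz))
    fun y _ => h y
  rw [Finset.sum_add_distrib, Finset.sum_ite_eq', if_pos hz] at h1
  exact h1

theorem leads_mono {s' : State I} {F' : Forest I} (hM : s'.M = s.M) (hl : F'.lab = F.lab)
    (ho : F'.out = F.out) {ℓ r} (h : Leads s F ℓ r) : Leads s' F' ℓ r := by
  induction h with
  | root ℓ h => exact .root ℓ (by rw [ho, h])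
  | step ℓ e m r h1 h2 h3 ih => exact .step ℓ e m r (by rw [ho, h1]) (by rw [hM]; exact h2) (by rw [hl]; exact ih)

theorem erase_ok (ok : ForestOK Mz s F) {y} (hy : y ∈ F.dirty)
    (h : ∀ w m, (y, w) ∈ s.Ed → (y, w) ∉ s.M → (m, w) ∈ s.M → F.lab m = F.lab y) :
    ForestOK Mz s (erase F y) ∧ Psi Mz (erase F y) + 1 ≤ Psi Mz F := by
  refine ⟨⟨ok.idem, ok.conn, ok.outOK, fun y' => ?_, ?_, ?_, ok.labMz⟩, ?_⟩
  · obtain ⟨r, h⟩ := ok.leads y'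
    exact ⟨r, leads_mono (s := s) (s' := s) (F := F) (F' := erase F y) rfl rfl rfl h⟩
  · intro y' w m hd h1 h2 h3
    by_cases hy' : y' = y
    · subst hy'; exact h w m h1 h2 h3
    · exact ok.clean _ _ _ (fun h => hd (Finset.mem_erase.2 ⟨hy', h⟩)) h1 h2 h3
  · intro y' hd; exact ok.dirtyMz _ (Finset.mem_of_mem_erase hd)
  · refine psi_drop (z := y) (by simpa using ok.dirtyMz y hy) fun y' => ?_
    have h1 := psi_dirty (F := F) (F' := erase F y) rfl rfl y'
    by_cases hy' : y' = y
    · subst hy'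
      simp only [erase, Finset.mem_erase, ne_eq, not_true, false_and, if_false, hy, if_true]
        at h1 ⊢
      omega
    · simp only [erase, Finset.mem_erase, ne_eq, hy', not_false_eq_true, true_and, if_false]
        at h1 ⊢
      omega

theorem mark_ok {m : Fin I.a} (g : Good Mz s) (ok : ForestOK Mz s F)
    (hc : CanScan Mz s m) :
    ForestOK Mz (addTop s m) (mark F m) ∧ Psi Mz (mark F m) ≤ Psi Mz F + 1 := by
  have hr : ∀ {x y}, MReach s x y → MReach (addTop s m) x y := fun h =>
    Good.reach_mono (s := s) (s' := addTop s m) rfl Finset.subset_union_left h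
  refine ⟨⟨ok.idem, fun y => ⟨hr (ok.conn y).1, hr (ok.conn y).2⟩, ?_,
    fun y => ?_, ?_, ?_, ok.labMz⟩, ?_⟩
  · intro ℓ e h1 h2
    obtain ⟨a1, a2⟩ := ok.outOK ℓ e h1 h2
    exact ⟨Finset.mem_union_left _ a1, a2⟩
  · obtain ⟨r, h⟩ := ok.leads y
    exact ⟨r, leads_mono (s := s) (s' := addTop s m) (F := F) (F' := mark F m) rfl rfl rfl h⟩
  · intro y w x hd h1 h2 h3
    have hd' : y ≠ m ∧ y ∉ F.dirty := by
      simpa [mark, not_or] using hd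
    rcases Finset.mem_union.1 h1 with h1 | h1
    · exact ok.clean _ _ _ hd'.2 h1 h2 h3
    · exact absurd (Good.mem_topChoices.1 h1).2.1 hd'.1
  · intro y hd
    rcases Finset.mem_insert.1 hd with rfl | hd
    · exact (Good.canScan_mz g hc).imp fun _ h => h.1
    · exact ok.dirtyMz _ hd
  · have hm : m ∈ Finset.univ.filter (fun y => ∃ w, (y, w) ∈ Mz) := by
      simpa using (Good.canScan_mz g hc).imp fun _ h => h.1
    have h1 := Finset.sum_le_sum (s := Finset.univ.filter (fun y => ∃ w, (y, w) ∈ Mz))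
      (f := psi (mark F m)) (g := fun y => psi F y + if y = m then 1 else 0) (fun y _ => by
        have h1 := psi_dirty (F := F) (F' := mark F m) rfl rfl y
        by_cases hy : y = m
        · subst hy
          simp only [mark, if_true, Finset.mem_insert_self] at h1 ⊢
          omega
        · simp only [mark, Finset.mem_insert, hy, false_or, if_false] at h1 ⊢
          omega)
    rw [Finset.sum_add_distrib, Finset.sum_ite_eq', if_pos hm] at h1
    exact h1

/-- Since the target leads to a root other than the class of y, the new pointer closes no cycle.
Paths that used to end at the class of y now continue to r. -/
theorem setOut_ok (ok : ForestOK Mz s F) {y w m r} (hy : y ∈ F.dirty)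
    (hroot : F.out (F.lab y) = none) (h1 : (y, w) ∈ s.Ed) (h2 : (y, w) ∉ s.M)
    (h3 : (m, w) ∈ s.M) (hl : Leads s F (F.lab m) r) (hr : r ≠ F.lab y) :
    ForestOK Mz s (setOut F (F.lab y) (y, w)) ∧
      Psi Mz (setOut F (F.lab y) (y, w)) + 1 ≤ Psi Mz F := by
  set F' := setOut F (F.lab y) (y, w) with hF'
  have hout : ∀ ℓ, ℓ ≠ F.lab y → F'.out ℓ = F.out ℓ := fun ℓ h => by simp [hF', setOut, h]
  have hself : F'.out (F.lab y) = some (y, w) := by simp [hF', setOut]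
  have key : ∀ {ℓ r}, Leads s F ℓ r → r ≠ F.lab y → Leads s F' ℓ r := by
    intro ℓ r h
    induction h with
    | root ℓ h => intro hne; exact .root ℓ (by rw [hout _ hne, h])
    | step ℓ e m r h1 h2 h3 ih =>
      intro hne
      refine .step ℓ e m r ?_ h2 (ih hne)
      rw [hout _ (by rintro rfl; rw [hroot] at h1; cases h1), h1]
  have key2 : ∀ {ℓ r'}, Leads s F ℓ r' → r' = F.lab y → Leads s F' ℓ r := by
    intro ℓ r h
    induction h with
    | root ℓ h =>
      rintro rfl
      exact .step _ _ m _ hself h3 (key hl hr)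
    | step ℓ e m r h1 h2 h3 ih =>
      intro he
      refine .step ℓ e m _ ?_ h2 (ih he)
      rw [hout _ (by rintro rfl; rw [hroot] at h1; cases h1), h1]
  refine ⟨⟨ok.idem, ok.conn, ?_, fun z => ?_, ok.clean, ok.dirtyMz, ok.labMz⟩, ?_⟩
  · intro ℓ e hℓ he
    by_cases h : ℓ = F.lab y
    · subst h
      rw [hself] at he; cases he
      exact ⟨h1, h2, rfl⟩
    · rw [hout _ h] at he
      exact ok.outOK _ _ hℓ he
  · obtain ⟨r', h⟩ := ok.leads z
    by_cases hr' : r' = F.lab y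
    · exact ⟨r, key2 h hr'⟩
    · exact ⟨r', key h hr'⟩
  · refine psi_drop (mem_mz ok hy) fun z => ?_
    by_cases hzz : z = F.lab y
    · subst hzz
      have : F'.lab = F.lab := rfl
      have h' : F'.dirty = F.dirty := rfl
      simp only [psi, this, h', ok.idem, hself, hroot, if_true]
      simp only [reduceCtorEq, if_false]
      omega
    · have : F'.lab = F.lab := rfl
      have h' : F'.dirty = F.dirty := rfl
      simp only [psi, this, h', hout _ hzz, hzz, if_false, add_zero, le_refl]

/-- The target class leads back to the class of y, so together with the edge from y the two classes
lie on a common cycle. Only the target class is absorbed; other classes on the cycle are left to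
later repairs. -/
theorem merge_ok (g : Good Mz s) (ok : ForestOK Mz s F) {y w m} (hy : y ∈ F.dirty)
    (hroot : F.out (F.lab y) = none) (h1 : (y, w) ∈ s.Ed) (h2 : (y, w) ∉ s.M)
    (h3 : (m, w) ∈ s.M) (hl : Leads s F (F.lab m) (F.lab y)) (hne : F.lab m ≠ F.lab y) :
    ForestOK Mz s (merge F (F.lab y) (F.lab m)) ∧
      Psi Mz (merge F (F.lab y) (F.lab m)) + 1 ≤ Psi Mz F := by
  set ℓ := F.lab y with hℓ
  set c := F.lab m with hc
  set F' := merge F ℓ c with hF'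
  have hlab : ∀ v, F'.lab v = if F.lab v = c then ℓ else F.lab v := fun v => rfl
  have hℓℓ : F.lab ℓ = ℓ := ok.idem y
  have hcc : F.lab c = c := ok.idem m
  have hout : F'.out = F.out := rfl
  have hcout : F.out c ≠ none := by
    intro h
    exact hne (hl.unique g.mat (.root _ h)).symm
  have key : ∀ {x r}, Leads s F x r → Leads s F' (if x = c then ℓ else x) r := by
    intro x r h
    induction h with
    | root x h =>
      rw [if_neg (by rintro rfl; exact hcout h)]
      exact .root x h
    | step x e m r h1 h2 h3 ih =>
      by_cases hx : x = c
      · rw [if_pos hx]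
        subst hx
        have := (Leads.step _ e m r h1 h2 h3).unique g.mat hl
        rw [this]
        exact .root _ hroot
      · rw [if_neg hx]
        exact .step x e m r h1 h2 (by rw [hlab]; exact ih)
  have hreach1 : MReach s c ℓ := (leads_reach g ok hl hcc).1
  have hreach2 : MReach s ℓ c :=
    ((ok.conn y).2.trans (arc_man g h1 h2 h3)).trans (ok.conn m).1
  refine ⟨⟨fun z => ?_, fun z => ?_, fun z e hz he => ?_, fun z => ?_, ?_, ok.dirtyMz, ?_⟩, ?_⟩
  · simp only [hlab]
    by_cases h : F.lab z = c
    · simp only [h, if_true, hℓℓ, hne.symm, if_false]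
    · simp only [h, if_false, ok.idem]
  · rw [hlab]
    split_ifs with h
    · have := ok.conn z
      rw [h] at this
      exact ⟨this.1.trans hreach1, hreach2.trans this.2⟩
    · exact ok.conn z
  · rw [hlab] at hz
    have hz' : F.lab z = z := by
      split_ifs at hz with h
      · rw [← hz]; exact hℓℓ
      · exact hz
    obtain ⟨a1, a2, a3⟩ := ok.outOK z e hz' he
    refine ⟨a1, a2, ?_⟩
    rw [hlab, a3]
    split_ifs with h
    · rw [hz', if_pos h] at hz; exact hz
    · rfl
  · obtain ⟨r, h⟩ := ok.leads z
    exact ⟨r, by rw [hlab]; exact key h⟩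
  · intro z w' m' hd a1 a2 a3
    rw [hlab, hlab, ok.clean _ _ _ hd a1 a2 a3]
  · intro z hz
    rw [hlab]
    split_ifs with h
    · exact ok.labMz _ (ok.dirtyMz _ hy)
    · exact ok.labMz _ hz
  · have hcm : c ∈ Finset.univ.filter (fun y => ∃ w, (y, w) ∈ Mz) := by
      simpa using ok.labMz m ((g.menM m).1 ⟨w, h3⟩)
    refine psi_drop hcm fun z => ?_
    have hd : F'.dirty = F.dirty := rfl
    by_cases hzc : z = c
    · subst hzc
      simp only [psi, hlab, hcc, hd, if_true, if_neg hne.symm]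
      split_ifs <;> omega
    · simp only [psi, hlab, hout, hd, if_neg hzc, add_zero]
      have hz1 : ℓ = z → F.lab z = z := by rintro rfl; exact hℓℓ
      split_ifs <;> omega

/-- The forest after rotating `S`. -/
def rotated (s' : State I) (F : Forest I) (S : Set I.V) : Forest I where
  lab y := if Sum.inl y ∈ S then y else F.lab y
  out y := if Sum.inl y ∈ S then none else
    match F.out y with
    | none => none
    | some e => if e ∈ s'.Ed then some e else none
  dirty := F.dirty.filter fun y => Sum.inl y ∉ S

/-- The men of S become singleton classes, at a cost of at most 2 each. Outside S connectivity is
unaffected by `rotate_reach`; a class merely loses its recorded edge if that arc was deleted, which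
costs 1 and makes it a root again with its dirty men still marked. A pointer into S now ends at the
new partner of its woman. -/
theorem rotated_ok (g : Good Mz s) (ok : ForestOK Mz s F) (hc : F.Clean) {S : Set I.V} {y₀}
    (f : Good.RotFacts Mz s S) (hroot : F.out (F.lab y₀) = none)
    (hS : S = scc s (Sum.inl y₀)) :
    ForestOK Mz (rotate Mz s S) (rotated (rotate Mz s S) F S) ∧
      Psi Mz (rotated (rotate Mz s S) F S) ≤ Psi Mz F +
        2 * (Finset.univ.filter fun m => (Sum.inl m : I.V) ∈ S).card +
        ((s.Ed \ s.M) \ (rotate Mz s S).Ed).card := by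
  have hmem : ∀ y, (Sum.inl y : I.V) ∈ S ↔ F.lab y = F.lab y₀ := by
    intro y; rw [hS]; exact mem_scc_iff ok hc hroot y
  have hlabS : ∀ y, (Sum.inl (F.lab y) : I.V) ∈ S ↔ (Sum.inl y : I.V) ∈ S := by
    intro y; rw [hmem, hmem, ok.idem]
  set s' := rotate Mz s S with hs'
  set F' := rotated s' F S with hF'
  have lin : ∀ y, (Sum.inl y : I.V) ∈ S → F'.lab y = y := fun y h => by simp [hF', rotated, h]
  have lout : ∀ y, (Sum.inl y : I.V) ∉ S → F'.lab y = F.lab y := fun y h => by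
    simp [hF', rotated, h]
  have oin : ∀ y, (Sum.inl y : I.V) ∈ S → F'.out y = none := fun y h => by simp [hF', rotated, h]
  have onone : ∀ y, F.out y = none → F'.out y = none := fun y h => by
    simp [hF', rotated, h]
  have osome : ∀ y e, (Sum.inl y : I.V) ∉ S → F.out y = some e →
      F'.out y = if e ∈ s'.Ed then some e else none := fun y e h h' => by
    simp only [hF', rotated, h, if_false, h']
  have key : ∀ {x r}, Leads s F x r → (Sum.inl x : I.V) ∉ S → ∃ r', Leads s' F' x r' := by
    intro x r h
    induction h with
    | root x h => intro hx; exact ⟨x, .root x (onone x h)⟩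
    | step x e m r h1 h2 h3 ih =>
      intro hx
      by_cases he : e ∈ s'.Ed
      · have ho : F'.out x = some e := by rw [osome x e hx h1, if_pos he]
        by_cases hm : (Sum.inl m : I.V) ∈ S
        · have hw : (Sum.inr e.2 : I.V) ∈ S := f.mM _ _ hm h2
          obtain ⟨m', hm', hec⟩ := f.ecW _ hw
          refine ⟨m', .step x e m' m' ho ((f.wom_in hw).2 ⟨hec, hm'⟩) ?_⟩
          rw [lin _ hm']
          exact .root _ (oin _ hm')
        · obtain ⟨r', hr'⟩ := ih (by rw [hlabS]; exact hm)
          refine ⟨r', .step x e m r' ho ((f.man_out hm).2 h2) ?_⟩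
          rw [lout _ hm]; exact hr'
      · exact ⟨x, .root x (by rw [osome x e hx h1, if_neg he])⟩
  refine ⟨⟨fun y => ?_, fun y => ?_, fun ℓ e hℓ he => ?_, fun y => ?_, ?_, ?_, ?_⟩, ?_⟩
  · by_cases hy : (Sum.inl y : I.V) ∈ S
    · rw [lin _ hy, lin _ hy]
    · rw [lout _ hy, lout _ (by rw [hlabS]; exact hy), ok.idem]
  · by_cases hy : (Sum.inl y : I.V) ∈ S
    · rw [lin _ hy]; exact ⟨.refl, .refl⟩
    · rw [lout _ hy]
      exact ⟨Good.rotate_reach f (by rw [hlabS]; exact hy) (ok.conn y).1,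
        Good.rotate_reach f hy (ok.conn y).2⟩
  · have hnS : (Sum.inl ℓ : I.V) ∉ S := fun h => by rw [oin _ h] at he; cases he
    rw [lout _ hnS] at hℓ
    cases ho : F.out ℓ with
    | none => rw [onone _ ho] at he; cases he
    | some e' =>
      rw [osome _ _ hnS ho] at he
      split_ifs at he with hd
      cases he
      obtain ⟨a1, a2, a3⟩ := ok.outOK _ _ hℓ ho
      have hx : (Sum.inl e.1 : I.V) ∉ S := by rw [← hlabS, a3]; exact hnS
      exact ⟨hd, fun h => a2 ((f.man_out hx).1 h), by rw [lout _ hx, a3]⟩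
  · by_cases hy : (Sum.inl y : I.V) ∈ S
    · rw [lin _ hy]; exact ⟨y, .root y (oin _ hy)⟩
    · rw [lout _ hy]
      obtain ⟨r, hr⟩ := ok.leads y
      exact key hr (by rw [hlabS]; exact hy)
  · intro y w m hd h1 h2 h3
    obtain ⟨a1, a2, a3⟩ := Good.rotate_Ed_off f h1 h2
    have hd' : y ∉ F.dirty := fun h => hd (Finset.mem_filter.2 ⟨h, a3⟩)
    obtain ⟨m', hm'⟩ := g.edM _ _ a1
    have hlm := ok.clean _ _ _ hd' a1 a2 hm'
    have hm'S : (Sum.inl m' : I.V) ∉ S := by rwa [hmem, hlm, ← hmem]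
    have hw : (Sum.inr w : I.V) ∉ S := fun hw => hm'S (f.wM _ _ hw hm')
    obtain rfl := g.mat.snd ((f.wom_out hw).1 h3) hm'
    rw [lout _ hm'S, lout _ a3, hlm]
  · intro y hd; exact ok.dirtyMz _ (Finset.mem_filter.1 hd).1
  · intro y hy
    by_cases hyS : (Sum.inl y : I.V) ∈ S
    · rw [lin _ hyS]; exact hy
    · rw [lout _ hyS]; exact ok.labMz _ hy
  · let Q : Finset (Fin I.a) := Finset.univ.filter fun y => (Sum.inl y : I.V) ∉ S ∧ F.lab y = y ∧
      ∃ e, F.out y = some e ∧ e ∉ s'.Ed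
    -- A recorded edge determines its class through its man, so different classes that lose their
    -- pointers lose different arcs.
    have hQ : Q.card ≤ ((s.Ed \ s.M) \ s'.Ed).card := by
      rcases Q.eq_empty_or_nonempty with h0 | ⟨y, hyQ⟩
      · rw [h0]; simp
      · have : Nonempty (Fin I.a × Fin I.b) := by
          obtain ⟨e, -⟩ := (Finset.mem_filter.1 hyQ).2.2.2
          exact ⟨e⟩
        have hex : ∀ y ∈ Q, ∃ e, F.out y = some e ∧ e ∉ s'.Ed := fun y hy =>
          (Finset.mem_filter.1 hy).2.2.2
        choose! q hq using hex
        have hl : ∀ y ∈ Q, F.lab y = y := fun y hy => (Finset.mem_filter.1 hy).2.2.1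
        refine Finset.card_le_card_of_injOn q (fun y hy => ?_) fun y hy y' hy' he => ?_
        · obtain ⟨a1, a2, -⟩ := ok.outOK _ _ (hl y hy) (hq y hy).1
          exact Finset.mem_coe.2 (Finset.mem_sdiff.2
            ⟨Finset.mem_sdiff.2 ⟨a1, a2⟩, (hq y hy).2⟩)
        · rw [← (ok.outOK _ _ (hl y hy) (hq y hy).1).2.2,
            ← (ok.outOK _ _ (hl y' hy') (hq y' hy').1).2.2, he]
    have hpt : ∀ y, psi F' y ≤ psi F y +
        (if y ∈ (Finset.univ.filter fun m => (Sum.inl m : I.V) ∈ S) then 2 else 0) +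
        (if y ∈ Q then 1 else 0) := by
      intro y
      by_cases hyS : (Sum.inl y : I.V) ∈ S
      · have h1 : y ∉ F'.dirty := fun h => (Finset.mem_filter.1 h).2 hyS
        simp only [psi, lin _ hyS, oin _ hyS, h1, hyS, if_true, if_false, Finset.mem_filter,
          Finset.mem_univ, true_and]
        omega
      · have h1 : y ∈ F'.dirty ↔ y ∈ F.dirty := by
          simp [hF', rotated, hyS]
        simp only [psi, lout _ hyS, h1, hyS, if_false, Finset.mem_filter, Finset.mem_univ,
          true_and, add_zero]
        by_cases hl : F.lab y = y
        · cases ho : F.out y with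
          | none =>
            simp only [hl, onone _ ho, if_true]; omega
          | some e =>
            by_cases he : e ∈ s'.Ed
            · simp only [hl, osome _ _ hyS ho, he, if_true]
              simp
            · have hyQ : y ∈ Q := by
                simp only [Q, Finset.mem_filter, Finset.mem_univ, true_and]
                exact ⟨hyS, hl, e, ho, he⟩
              simp only [hl, osome _ _ hyS ho, he, if_true, if_false, hyQ]
              simp only [reduceCtorEq, if_false]
              omega
        · simp only [hl, if_false]; omega
    refine (Finset.sum_le_sum fun y _ => hpt y).trans ?_
    rw [Finset.sum_add_distrib, Finset.sum_add_distrib]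
    have e1 : ∀ (A B : Finset (Fin I.a)) (k : ℕ), ∑ y ∈ A, (if y ∈ B then k else 0) ≤ k * B.card := by
      intro A B k
      rw [Finset.sum_ite_mem, Finset.sum_const, smul_eq_mul, mul_comm]
      exact Nat.mul_le_mul_left _ (Finset.card_le_card Finset.inter_subset_right)
    have e2 := e1 (Finset.univ.filter (fun y => ∃ w, (y, w) ∈ Mz))
      (Finset.univ.filter fun m => (Sum.inl m : I.V) ∈ S) 2
    have e3 := e1 (Finset.univ.filter (fun y => ∃ w, (y, w) ∈ Mz)) Q 1
    have e4 : Psi Mz F = ∑ y ∈ Finset.univ.filter (fun y => ∃ w, (y, w) ∈ Mz), psi F y := rfl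
    omega

/-- The initial forest of singletons. -/
def init (I : Inst) : Forest I where
  lab y := y
  out _ := none
  dirty := ∅

theorem init_ok {M₀ : I.EdgeSet} : ForestOK Mz (initState M₀ Mz) (init I) where
  idem _ := rfl
  conn _ := ⟨.refl, .refl⟩
  outOK _ _ _ h := by cases h
  leads y := ⟨y, .root y rfl⟩
  clean y w m _ h1 h2 := absurd h1 h2
  dirtyMz _ h := by simp [init] at h
  labMz _ h := h

theorem init_Psi (hz : IsMatching I Mz) : Psi Mz (init I) ≤ 2 * I.numE := by
  have h1 : Psi Mz (init I) =
      ∑ y ∈ Finset.univ.filter (fun y : Fin I.a => ∃ w, (y, w) ∈ Mz), 2 :=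
    Finset.sum_congr rfl fun y _ => by simp [psi, init]
  have h2 : (Finset.univ.filter (fun y : Fin I.a => ∃ w, (y, w) ∈ Mz)) = Mz.image Prod.fst := by
    ext y; simp
  have h3 : (Mz.image Prod.fst).card ≤ I.numE :=
    Finset.card_image_le.trans (Finset.card_le_card hz.1)
  rw [h1, Finset.sum_const, smul_eq_mul, h2]
  omega

end ForestOK

/-- A function iterated as often as there are points has reached the fixed point, if any. -/
theorem iterate_card_fixed {n : ℕ} (f : Fin n → Fin n) {x r : Fin n} {k : ℕ} (h : f^[k] x = r)
    (hr : f r = r) : f^[n] x = r := by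
  have hfix : ∀ j, f^[j] r = r := fun j => Function.iterate_fixed hr j
  have hpig : ∃ i j : Fin (n + 1), i < j ∧ f^[i] x = f^[j] x := by
    have hni : ¬ Function.Injective fun i : Fin (n + 1) => f^[i] x := by
      intro hinj
      have := Fintype.card_le_of_injective _ hinj
      simp at this
    unfold Function.Injective at hni
    push Not at hni
    obtain ⟨i, j, h1, h2⟩ := hni
    rcases lt_or_gt_of_ne h2 with h3 | h3
    · exact ⟨i, j, h3, h1⟩
    · exact ⟨j, i, h3, h1.symm⟩
  obtain ⟨i, j, hij, he⟩ := hpig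
  have hij' : i.val < j.val := hij
  -- From the first repetition on, the orbit is periodic. It also reaches the fixed point, so the
  -- cycle is that point alone and was entered within n steps.
  have hper : ∀ t, f^[t * (j.val - i.val)] (f^[i] x) = f^[i] x := by
    intro t
    induction t with
    | zero => simp
    | succ t ih =>
      rw [Nat.succ_mul, Function.iterate_add_apply, ← Function.iterate_add_apply f (j.val - i.val)]
      rw [Nat.sub_add_cancel hij'.le, ← he, ih]
  have h1 : f^[i.val] x = r := by
    have h2 := hper k
    have hk : k ≤ k * (j.val - i.val) := Nat.le_mul_of_pos_right _ (by omega)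
    rw [← Function.iterate_add_apply] at h2
    have h3 : k * (j.val - i.val) + i.val = (k * (j.val - i.val) + i.val - k) + k := by omega
    rw [h3, Function.iterate_add_apply, h, hfix] at h2
    exact h2.symm
  have hi : i.val ≤ n := by omega
  calc f^[n] x = f^[(n - i.val) + i.val] x := by rw [Nat.sub_add_cancel hi]
    _ = r := by rw [Function.iterate_add_apply, h1, hfix]

end SuperStable

end


/-! ### Search loops and the adjacency lists of the input. -/

noncomputable section

open scoped Classical

namespace SuperStable

variable {I : Inst}

/-! ### Conditionals and searches -/

def ifAll : List Cd → St → St → St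
  | [], p, _ => p
  | c :: cs, p, q => .ite c (ifAll cs p q) q

theorem HT_ifAll {cs : List Cd} {p q : St} {σ : Mem} {Q : ℕ → Mem → Prop} :
    HT (ifAll cs p q) σ Q ↔
      ((∀ c ∈ cs, c.holds σ) → HT p σ Q) ∧ ((¬ ∀ c ∈ cs, c.holds σ) → HT q σ Q) := by
  induction cs with
  | nil => simp [ifAll]
  | cons c cs ih =>
    rw [ifAll, HT_ite, ih]
    by_cases h : c.holds σ <;> simp [h]

theorem ifAll_wr {cs : List Cd} {p q : St} {x : ℕ} (h : p.wr x = false) (h' : q.wr x = false) :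
    (ifAll cs p q).wr x = false := by
  induction cs with
  | nil => exact h
  | cons c cs ih => simp [ifAll, St.wr, ih, h']

theorem ifAll_wa {cs : List Cd} {p q : St} {x : ℕ} (h : p.wa x = false) (h' : q.wa x = false) :
    (ifAll cs p q).wa x = false := by
  induction cs with
  | nil => exact h
  | cons c cs ih => simp [ifAll, St.wa, ih, h']

/-- `τ` differs from `σ` at most in the registers `ws`. -/
structure Agree (ws : List ℕ) (σ τ : Mem) : Prop where
  reg : ∀ x, x ∉ ws → τ.reg x = σ.reg x
  arr : τ.arr = σ.arr
  out : τ.out = σ.out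

theorem Agree.refl (ws : List ℕ) (σ : Mem) : Agree ws σ σ := ⟨fun _ _ => rfl, rfl, rfl⟩

theorem Agree.setReg {ws : List ℕ} {σ τ : Mem} (h : Agree ws σ τ) {x : ℕ} (hx : x ∈ ws) (v : ℕ) :
    Agree ws σ (τ.setReg x v) := by
  refine ⟨fun y hy => ?_, h.arr, h.out⟩
  rw [Mem.setReg_reg, if_neg (by rintro rfl; exact hy hx), h.reg y hy]

/-- Search for an index `k < N` satisfying the conditions; the result is `k + 1` or `0`. -/
def findN (i lim r : ℕ) (cs : List Cd) : St :=
  .set r (.k 0) ⨟ forN i lim (ifAll cs (.set r (.inc (.r i))) .skip)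

/-- The loop does not stop at a hit, so the last one is returned. The value is shifted by one to let
0 mean failure. -/
theorem HT_findN {i lim r : ℕ} {cs : List Cd} {σ : Mem} {N : ℕ} (P : ℕ → Prop)
    (hne : r ≠ i ∧ r ≠ lim ∧ i ≠ lim) (hN : σ.reg lim = N)
    (hc : ∀ k τ, k < N → Agree [i, r] σ τ → τ.reg i = k → ((∀ c ∈ cs, c.holds τ) ↔ P k)) :
    HT (findN i lim r cs) σ (fun t τ => t ≤ N ∧ Agree [i, r] σ τ ∧
      ((τ.reg r = 0 ∧ ∀ k < N, ¬ P k) ∨ ∃ k < N, τ.reg r = k + 1 ∧ P k)) := by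
  rw [findN, HT_seq, HT_set]
  refine (HT_for (N := N) (fun k t τ => t ≤ k ∧ Agree [i, r] σ τ ∧
      ((τ.reg r = 0 ∧ ∀ j < k, ¬ P j) ∨ ∃ j < N, τ.reg r = j + 1 ∧ P j))
    (ifAll_wr (by simp [St.wr, nat_beq_false hne.1]) rfl)
    (ifAll_wr (by simp [St.wr, nat_beq_false hne.2.1]) rfl) hne.2.2
    (by rw [Mem.setReg_reg, if_neg hne.2.1.symm, hN]) ?_ ?_).mono ?_
  · refine ⟨le_rfl, ((Agree.refl _ σ).setReg (by simp) _).setReg (by simp) _, Or.inl ⟨?_, by simp⟩⟩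
    rw [Mem.setReg_reg, if_neg hne.1, Mem.setReg_reg, if_pos rfl]; rfl
  · rintro k T τ hk hik - - ⟨hT, hA, hI⟩
    have hcc := hc k τ hk hA hik
    rw [HT_ifAll, hcc, HT_set, HT_skip]
    have hv : (Ex.inc (.r i)).val τ = k + 1 := by simp [Ex.val, hik]
    rw [hv]
    refine ⟨fun hP => ⟨by omega, (hA.setReg (by simp) _).setReg (by simp) _, Or.inr
      ⟨k, hk, ?_, hP⟩⟩, fun hP => ⟨by omega, hA.setReg (by simp) _, ?_⟩⟩
    · rw [Mem.setReg_reg, if_neg hne.1, Mem.setReg_reg, if_pos rfl]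
    · rw [Mem.setReg_reg, if_neg hne.1]
      refine hI.imp_left fun h => ⟨h.1, fun j hj => ?_⟩
      rcases Nat.lt_succ_iff_lt_or_eq.1 hj with h' | rfl
      · exact h.2 j h'
      · exact hP
  · rintro t τ ⟨⟨h1, h2, h3⟩, -⟩
    exact ⟨by omega, h2, h3⟩

/-- Search the list of the vertex in register `x` for an entry that satisfies the conditions `cs`
and is minimal for the comparison `c`. -/
def minL (lst off kk en e x r : ℕ) (cs : List Cd) (c : Cd) : St :=
  .set r (.k 0) ⨟ forL lst off kk en e x (ifAll cs
    (.ite (.eq (.r r) (.k 0)) (.set r (.inc (.r e))) (.ite c (.set r (.inc (.r e))) .skip)) .skip)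

/-- The key is an integer so that maxima are minima of a negated rank. With a constant key and a
comparison that never holds, this is a plain search in a list. -/
theorem HT_minL {m c : ℕ} {own : Fin m → Fin c} {ord : Fin m → Fin m} {ofs : Fin (c + 1) → ℕ}
    (hL : Lists own ord ofs) {lst off kk en e x r : ℕ} {cs : List Cd} {cd : Cd} {σ : Mem}
    {v : Fin c} (P : Fin m → Prop) (key : Fin m → ℤ)
    (hne : (kk ≠ en ∧ kk ≠ x ∧ e ≠ kk ∧ e ≠ en) ∧ r ≠ kk ∧ r ≠ en ∧ r ≠ e ∧ r ≠ x)
    (hlst : σ.arr lst = tabulate fun k => (ord k).val) (hoff : σ.arr off = tabulate ofs)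
    (hx : σ.reg x = v.val)
    (hc : ∀ f τ, own f = v → Agree [kk, en, e, r] σ τ → τ.reg e = f.val →
      ((∀ c ∈ cs, c.holds τ) ↔ P f))
    (hk : ∀ f g τ, own f = v → own g = v → P g → Agree [kk, en, e, r] σ τ → τ.reg e = f.val →
      τ.reg r = g.val + 1 → (cd.holds τ ↔ key f < key g)) :
    HT (minL lst off kk en e x r cs cd) σ (fun t τ =>
      t ≤ (Finset.univ.filter fun f => own f = v).card ∧ Agree [kk, en, e, r] σ τ ∧
      ((τ.reg r = 0 ∧ ∀ f, own f = v → ¬ P f) ∨ ∃ f, own f = v ∧ τ.reg r = f.val + 1 ∧ P f ∧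
        ∀ g, own g = v → P g → key f ≤ key g)) := by
  have hset : ∀ y, y ≠ r → (ifAll cs (.ite (.eq (.r r) (.k 0)) (.set r (.inc (.r e)))
      (.ite cd (.set r (.inc (.r e))) .skip)) .skip).wr y = false := fun y hy =>
    ifAll_wr (by simp [St.wr, nat_beq_false hy.symm]) rfl
  have hseta : ∀ y, (ifAll cs (.ite (.eq (.r r) (.k 0)) (.set r (.inc (.r e)))
      (.ite cd (.set r (.inc (.r e))) .skip)) .skip).wa y = false := fun y =>
    ifAll_wa (by simp [St.wa]) rfl
  rw [minL, HT_seq, HT_set]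
  refine (HT_list (σ := σ.setReg r ((Ex.k 0).val σ)) hL (v := v) (fun D t τ => t ≤ D.card ∧ Agree [kk, en, e, r] σ τ ∧
      ((τ.reg r = 0 ∧ ∀ f ∈ D, ¬ P f) ∨ ∃ f, own f = v ∧ τ.reg r = f.val + 1 ∧ P f ∧
        ∀ g ∈ D, P g → key f ≤ key g)) (hseta _) (hset _ hne.2.1.symm) (hset _ hne.2.2.1.symm)
      hne.1 hlst hoff ?_ ?_ ?_).mono ?_
  · rw [Mem.setReg_reg, if_neg hne.2.2.2.2.symm, hx]
  · intro y z
    refine ⟨le_rfl, (((Agree.refl _ σ).setReg (by simp) _).setReg (by simp) _).setReg (by simp) _,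
      Or.inl ⟨?_, by simp⟩⟩
    rw [Mem.setReg_reg, if_neg hne.2.2.1, Mem.setReg_reg, if_neg hne.2.1, Mem.setReg_reg, if_pos rfl]
    rfl
  · rintro D T τ f - hfD hf - ⟨hT, hA, hI⟩
    have hA' : Agree [kk, en, e, r] σ (τ.setReg e f.val) := hA.setReg (by simp) _
    have hef : (τ.setReg e f.val).reg e = f.val := by rw [Mem.setReg_reg, if_pos rfl]
    have her : (τ.setReg e f.val).reg r = τ.reg r := by
      rw [Mem.setReg_reg, if_neg hne.2.2.2.1]
    have hcc := hc f _ hf hA' hef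
    have hcard : (insert f D).card = D.card + 1 := Finset.card_insert_of_notMem hfD
    have hv : (Ex.inc (.r e)).val (τ.setReg e f.val) = f.val + 1 := by
      simp only [Ex.val, hef]
    rw [HT_ifAll, hcc, HT_ite, HT_ite, HT_set, HT_skip, hv]
    have hset' : ∀ y, Agree [kk, en, e, r] σ (((τ.setReg e f.val).setReg r (f.val + 1)).setReg kk y)
      ∧ (((τ.setReg e f.val).setReg r (f.val + 1)).setReg kk y).reg r = f.val + 1 := fun y =>
      ⟨(hA'.setReg (by simp) _).setReg (by simp) _, by
        rw [Mem.setReg_reg, if_neg hne.2.1, Mem.setReg_reg, if_pos rfl]⟩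
    have hkeep : ∀ y, Agree [kk, en, e, r] σ ((τ.setReg e f.val).setReg kk y)
      ∧ ((τ.setReg e f.val).setReg kk y).reg r = τ.reg r := fun y =>
      ⟨hA'.setReg (by simp) _, by rw [Mem.setReg_reg, if_neg hne.2.1, her]⟩
    refine ⟨fun hP => ⟨fun h0 y => ⟨by omega, (hset' y).1, Or.inr ⟨f, hf, (hset' y).2, hP, ?_⟩⟩,
      fun h0 => ⟨fun hlt y => ⟨by omega, (hset' y).1, Or.inr ⟨f, hf, (hset' y).2, hP, ?_⟩⟩,
        fun hlt y => ⟨by omega, (hkeep y).1, Or.inr ?_⟩⟩⟩,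
      fun hP y => ⟨by omega, (hkeep y).1, ?_⟩⟩
    · simp only [Cd.holds, Ex.val, her] at h0
      rcases hI with h | ⟨f', -, h2, -⟩
      · intro g hg hPg
        rcases Finset.mem_insert.1 hg with rfl | hg
        · exact le_rfl
        · exact absurd hPg (h.2 g hg)
      · omega
    · simp only [Cd.holds, Ex.val, her] at h0
      rcases hI with h | ⟨f', h1, h2, h3, h4⟩
      · exact absurd h.1 h0
      · have := (hk f f' _ hf h1 h3 hA' hef (her.trans h2)).1 hlt
        intro g hg hPg
        rcases Finset.mem_insert.1 hg with rfl | hg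
        · exact le_rfl
        · exact this.le.trans (h4 g hg hPg)
    · simp only [Cd.holds, Ex.val, her] at h0
      rcases hI with h | ⟨f', h1, h2, h3, h4⟩
      · exact absurd h.1 h0
      · have := fun h => hlt ((hk f f' _ hf h1 h3 hA' hef (her.trans h2)).2 h)
        refine ⟨f', h1, (hkeep y).2.trans h2, h3, fun g hg hPg => ?_⟩
        rcases Finset.mem_insert.1 hg with rfl | hg
        · exact not_lt.1 this
        · exact h4 g hg hPg
    · rw [(hkeep y).2]
      refine hI.imp (fun h => ⟨h.1, fun g hg => ?_⟩)
        (fun ⟨f', h1, h2, h3, h4⟩ => ⟨f', h1, h2, h3, fun g hg hPg => ?_⟩)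
      · rcases Finset.mem_insert.1 hg with rfl | hg
        · exact hP
        · exact h.2 g hg
      · rcases Finset.mem_insert.1 hg with rfl | hg
        · exact absurd hPg hP
        · exact h4 g hg hPg
  · rintro t τ ⟨⟨h1, h2, h3⟩, -⟩
    exact ⟨by omega, h2, by simpa using h3⟩

/-! ### The adjacency lists of the input -/

/-- Since the list is sorted by owner, the entries with owner below i form an initial segment, whose
length is the offset of i. -/
theorem lists_of_sorted {m c : ℕ} (own : Fin m → Fin c) (ord : Fin m ≃ Fin m)
    (ofs : Fin (c + 1) → ℕ) (hs : ∀ k l, k ≤ l → own (ord k) ≤ own (ord l))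
    (ho : ∀ i, ofs i = (Finset.univ.filter fun k => (own k).val < i.val).card) :
    Lists own ord ofs := by
  have hcard : ∀ i, ofs i = (Finset.univ.filter fun k => (own (ord k)).val < i.val).card := by
    intro i
    rw [ho]
    refine (Finset.card_bij (fun k _ => ord k) (fun k hk => ?_) (fun k _ l _ h => ord.injective h)
      fun k hk => ⟨ord.symm k, ?_, by simp⟩).symm
    · simpa using hk
    · simpa using hk
  have seg : ∀ (i : Fin (c + 1)) (k : Fin m), (own (ord k)).val < i.val ↔ k.val < ofs i := by
    intro i k
    rw [hcard]
    constructor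
    · intro h
      have : Finset.Iic k ⊆ Finset.univ.filter fun k => (own (ord k)).val < i.val := by
        intro j hj
        have := hs j k (Finset.mem_Iic.1 hj)
        simp only [Finset.mem_filter, Finset.mem_univ, true_and]
        exact lt_of_le_of_lt this h
      have := Finset.card_le_card this
      rw [Fin.card_Iic] at this
      omega
    · intro h
      by_contra hcon
      have : (Finset.univ.filter fun k => (own (ord k)).val < i.val) ⊆ Finset.Iio k := by
        intro j hj
        rw [Finset.mem_Iio]
        by_contra hjk
        have h1 := hs k j (not_lt.1 hjk)
        have h2 : (own (ord j)).val < i.val := by simpa using hj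
        exact hcon (lt_of_le_of_lt h1 h2)
      have := Finset.card_le_card this
      rw [Fin.card_Iio] at this
      omega
  refine ⟨ord.injective, ord.surjective, fun k x => ?_, fun x => ?_⟩
  · have h1 := seg x.castSucc k
    have h2 := seg x.succ k
    simp only [Fin.val_castSucc, Fin.val_succ] at h1 h2
    rw [← h2, ← not_lt, ← h1, Fin.ext_iff]
    omega
  · rw [ho]
    exact (Finset.card_le_univ _).trans (by simp)

namespace Layout

variable (L : Layout I)

def man (k : Fin I.numE) : Fin I.a := (L.edge k).1.1

def wom (k : Fin I.numE) : Fin I.b := (L.edge k).1.2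

theorem mem_E (k : Fin I.numE) : (L.man k, L.wom k) ∈ I.E := (L.edge k).2

theorem edge_inj {k l : Fin I.numE} (h1 : L.man k = L.man l) (h2 : L.wom k = L.wom l) : k = l :=
  L.edge.injective (Subtype.ext (Prod.ext h1 h2))

theorem exists_edge {m w} (h : (m, w) ∈ I.E) : ∃ k, L.man k = m ∧ L.wom k = w :=
  ⟨L.edge.symm ⟨(m, w), h⟩, by simp [man], by simp [wom]⟩

theorem card_filter (p : Fin I.a × Fin I.b → Prop) [DecidablePred p] :
    (I.E.filter p).card = (Finset.univ.filter fun k => p (L.man k, L.wom k)).card := by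
  refine (Finset.card_bij (fun k _ => (L.man k, L.wom k)) (fun k hk => ?_)
    (fun k _ l _ h => ?_) fun e he => ?_).symm
  · exact Finset.mem_filter.2 ⟨L.mem_E k, (Finset.mem_filter.1 hk).2⟩
  · exact L.edge_inj (congrArg Prod.fst h) (congrArg Prod.snd h)
  · obtain ⟨h1, h2⟩ := Finset.mem_filter.1 he
    obtain ⟨k, hk1, hk2⟩ := L.exists_edge (m := e.1) (w := e.2) h1
    refine ⟨k, ?_, by rw [hk1, hk2]⟩
    rw [Finset.mem_filter, hk1, hk2]
    exact ⟨Finset.mem_univ _, h2⟩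

def ofsM (i : Fin (I.a + 1)) : ℕ := (I.E.filter fun e => e.1.val < i.val).card

def ofsW (i : Fin (I.b + 1)) : ℕ := (I.E.filter fun e => e.2.val < i.val).card

theorem listsM : Lists L.man L.listM (ofsM (I := I)) := by
  refine lists_of_sorted _ _ _ (fun k l h => ?_)
    fun i => L.card_filter fun e => e.1.val < i.val
  rcases L.sortedM k l h with h1 | h1
  · exact h1.le
  · exact h1.1.le

theorem listsW : Lists L.wom L.listW (ofsW (I := I)) := by
  refine lists_of_sorted _ _ _ (fun k l h => ?_)
    fun i => L.card_filter fun e => e.2.val < i.val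
  rcases L.sortedW k l h with h1 | h1
  · exact h1.le
  · exact h1.1.le

theorem degM (x : Fin I.a) : (Finset.univ.filter fun k => L.man k = x).card ≤ I.b := by
  have := Finset.card_le_card_of_injOn (s := Finset.univ.filter fun k => L.man k = x)
    (t := Finset.univ) L.wom (fun _ _ => Finset.mem_coe.2 (Finset.mem_univ _)) fun k hk l hl h =>
      L.edge_inj (by simp at hk hl; rw [hk, hl]) h
  simpa using this

theorem degW (x : Fin I.b) : (Finset.univ.filter fun k => L.wom k = x).card ≤ I.a := by
  have := Finset.card_le_card_of_injOn (s := Finset.univ.filter fun k => L.wom k = x)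
    (t := Finset.univ) L.man (fun _ _ => Finset.mem_coe.2 (Finset.mem_univ _)) fun k hk l hl h =>
      L.edge_inj h (by simp at hk hl; rw [hk, hl])
  simpa using this

end Layout

/-- The input arrays are intact. -/
structure Inp (L : Layout I) (A : ℕ → ℕ → ℕ) : Prop where
  man : ∀ k : Fin I.numE, A 0 k.val = (L.man k).val
  wom : ∀ k : Fin I.numE, A 1 k.val = (L.wom k).val
  rkM : ∀ k : Fin I.numE, A 2 k.val = I.rankM (L.man k) (L.wom k)
  rkW : ∀ k : Fin I.numE, A 3 k.val = I.rankW (L.wom k) (L.man k)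
  lstM : A 4 = tabulate fun k => (L.listM k).val
  offM : A 5 = tabulate (Layout.ofsM (I := I))
  lstW : A 6 = tabulate fun k => (L.listW k).val
  offW : A 7 = tabulate (Layout.ofsW (I := I))

theorem inp_inputMem (L : Layout I) : Inp L (inputMem L).arr :=
  ⟨fun k => tabulate_val (fun k => (L.man k).val) k, fun k => tabulate_val (fun k => (L.wom k).val) k,
    fun k => tabulate_val (fun k => I.rankM (L.man k) (L.wom k)) k,
    fun k => tabulate_val (fun k => I.rankW (L.wom k) (L.man k)) k, rfl, rfl, rfl, rfl⟩

theorem Inp.congr {L : Layout I} {A A' : ℕ → ℕ → ℕ} (h : Inp L A) (h' : ∀ i < 8, A' i = A i) :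
    Inp L A' := by
  refine ⟨?_, ?_, ?_, ?_, ?_, ?_, ?_, ?_⟩ <;> rw [h' _ (by norm_num)]
  exacts [h.man, h.wom, h.rkM, h.rkW, h.lstM, h.offM, h.lstW, h.offW]

theorem Inp.frame {L : Layout I} {σ τ : Mem} {p : St} (h : Inp L σ.arr) (hf : Frame p σ τ)
    (hp : ∀ i < 8, p.wa i = false) : Inp L τ.arr := h.congr fun i hi => hf.arr i (hp i hi)

end SuperStable

end


/-! ### Proposals with ties: the optimal super-stable matching of the proposing side. -/

noncomputable section

open scoped Classical

/-! ### Proposals -/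

namespace SuperStable.Proposal

variable {ι α β : Type*} {mn : ι → α} {wm : ι → β} {rm rw : ι → ℕ}

variable (mn wm rm rw) in
/-- Super-stability for sets of edges given by their endpoints and ranks. -/
structure Stable (N : Finset ι) : Prop where
  mat : ∀ e ∈ N, ∀ f ∈ N, (mn e = mn f ∨ wm e = wm f) → e = f
  ss : ∀ e, e ∉ N → (∀ f ∈ N, mn f = mn e → rm e ≤ rm f) → ∃ f ∈ N, wm f = wm e ∧ rw f < rw e

variable (ι α β) in
/-- The edges not yet deleted, the engagements, and the men who may have to propose. -/
structure PState where
  R : Finset ι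
  eng : β → Option ι
  dirty : Finset α

variable (mn rm) in
def Top (R : Finset ι) (e : ι) : Prop := e ∈ R ∧ ∀ f ∈ R, mn f = mn e → rm e ≤ rm f

variable (mn wm rm rw) in
-- An engagement is a top choice of its man and the worst edge still open to its woman. Every stable
-- set survives in R, a deleted edge is worse for its woman than all that remain, and such a woman
-- is matched in every stable set. Men outside `dirty` are engaged along all their top choices
-- simultaneously.
structure PInv (s : PState ι α β) : Prop where
  engOK : ∀ w e, s.eng w = some e → wm e = w ∧ Top mn rm s.R e ∧ ∀ f ∈ s.R, wm f = w → rw f ≤ rw e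
  sub : ∀ N, Stable mn wm rm rw N → N ⊆ s.R
  clean : ∀ e, Top mn rm s.R e → mn e ∉ s.dirty → s.eng (wm e) = some e
  dead : ∀ e, e ∉ s.R → ∀ f ∈ s.R, wm f = wm e → rw f < rw e
  deadM : ∀ e, e ∉ s.R → ∀ N, Stable mn wm rm rw N → ∃ f ∈ N, wm f = wm e

/-- Progress is measured by 3|R| + |dirty| − engaged. An engagement of a free woman gains 1;
replacing a fiancé deletes an edge but makes one man dirty; a tie deletes two edges, makes one man
dirty and frees a woman; clearing a man gains 1. -/
def engaged [Fintype β] (s : PState ι α β) : ℕ := (Finset.univ.filter fun w => s.eng w ≠ none).card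

theorem exists_top {R : Finset ι} {f : ι} (hf : f ∈ R) :
    ∃ e, Top mn rm R e ∧ mn e = mn f ∧ rm e ≤ rm f := by
  obtain ⟨e, he, hmin⟩ := Finset.exists_min_image (R.filter fun g => mn g = mn f) rm
    ⟨f, Finset.mem_filter.2 ⟨hf, rfl⟩⟩
  obtain ⟨h1, h2⟩ := Finset.mem_filter.1 he
  exact ⟨e, ⟨h1, fun g hg hge => hmin g (Finset.mem_filter.2 ⟨hg, hge.trans h2⟩)⟩, h2,
    hmin f (Finset.mem_filter.2 ⟨hf, rfl⟩)⟩

namespace PInv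

variable {s : PState ι α β}

/-- Stable sets lie in R, so the man of a top edge weakly prefers it to whatever he has there; if
the edge is missing, its woman must have something better. -/
theorem top_blocks (h : PInv mn wm rm rw s) {e : ι} (he : Top mn rm s.R e) {N : Finset ι}
    (hN : Stable mn wm rm rw N) (heN : e ∉ N) : ∃ f ∈ N, wm f = wm e ∧ rw f < rw e :=
  hN.ss e heN fun f hf hm => he.2 f (h.sub N hN hf) hm

theorem top_matched (h : PInv mn wm rm rw s) {e : ι} (he : Top mn rm s.R e) {N : Finset ι}
    (hN : Stable mn wm rm rw N) : ∃ f ∈ N, wm f = wm e := by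
  by_cases heN : e ∈ N
  · exact ⟨e, heN, rfl⟩
  · obtain ⟨f, h1, h2, -⟩ := h.top_blocks he hN heN
    exact ⟨f, h1, h2⟩

/-- Deleting edges at the woman `w` keeps the invariant. -/
theorem step (h : PInv mn wm rm rw s) {w : β} {R' : Finset ι} {o : Option ι} {D' : Finset α}
    (hR : R' ⊆ s.R) (hw : ∀ f ∈ s.R, f ∉ R' → wm f = w)
    (ho : ∀ e, o = some e → wm e = w ∧ Top mn rm s.R e ∧ e ∈ R' ∧ ∀ f ∈ R', wm f = w → rw f ≤ rw e)
    (hD : s.dirty ⊆ D') (hg : ∀ g, s.eng w = some g → mn g ∈ D')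
    (hlt : ∀ e ∈ s.R, e ∉ R' → ∀ f ∈ R', wm f = w → rw f < rw e)
    (hss : ∀ N, Stable mn wm rm rw N → ∀ f ∈ N, f ∈ s.R → f ∈ R')
    (hm : ∀ N, Stable mn wm rm rw N → ∃ f ∈ N, wm f = w) :
    PInv mn wm rm rw ⟨R', Function.update s.eng w o, D'⟩ := by
  refine ⟨fun w' e he => ?_, fun N hN f hf => hss N hN f hf (h.sub N hN hf), fun e he hd => ?_,
    fun e he f hf hwm => ?_, fun e he N hN => ?_⟩
  · dsimp only at he ⊢
    by_cases hww : w' = w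
    · subst hww
      rw [Function.update_self] at he
      obtain ⟨h1, h2, h3, h4⟩ := ho e he
      exact ⟨h1, ⟨h3, fun f hf => h2.2 f (hR hf)⟩, h4⟩
    · rw [Function.update_of_ne hww] at he
      obtain ⟨h1, h2, h3⟩ := h.engOK w' e he
      refine ⟨h1, ⟨?_, fun f hf => h2.2 f (hR hf)⟩, fun f hf => h3 f (hR hf)⟩
      by_contra hcon
      exact hww (h1.symm.trans (hw e h2.1 hcon))
  · dsimp only at hd he ⊢
    have hd' : mn e ∉ s.dirty := fun h => hd (hD h)
    -- A man outside D' has lost no top choice: he was engaged along all of them, and losing the one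
    -- at w would have put him into D'.
    have htop : Top mn rm s.R e := by
      refine ⟨hR he.1, fun f hf hfe => ?_⟩
      obtain ⟨t, h1, h2, h3⟩ := exists_top (mn := mn) (rm := rm) hf
      have h4 := h.clean t h1 (by rw [h2, hfe]; exact hd')
      by_cases htR : t ∈ R'
      · exact (he.2 t htR (h2.trans hfe)).trans h3
      · have h5 := hw t h1.1 htR
        rw [h5] at h4
        exact absurd (hg t h4) (by rw [h2, hfe]; exact hd)
    have h5 := h.clean e htop hd'
    by_cases hww : wm e = w
    · rw [hww] at h5
      exact absurd (hg e h5) hd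
    · rw [Function.update_of_ne hww, h5]
  · dsimp only at he hf
    by_cases heR : e ∈ s.R
    · exact hlt e heR he f hf (hwm.trans (hw e heR he))
    · exact h.dead e heR f (hR hf) hwm
  · dsimp only at he
    by_cases heR : e ∈ s.R
    · rw [hw e heR he]; exact hm N hN
    · exact h.deadM e heR N hN

/-- The proposal along `e` is accepted. -/
theorem engage [Fintype β] (h : PInv mn wm rm rw s) {e : ι} (he : Top mn rm s.R e)
    (hg : ∀ g, s.eng (wm e) = some g → rw e < rw g) :
    let s' : PState ι α β := ⟨s.R.filter fun f => wm f = wm e → rw f ≤ rw e,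
      Function.update s.eng (wm e) (some e),
      match s.eng (wm e) with
      | none => s.dirty
      | some g => insert (mn g) s.dirty⟩
    PInv mn wm rm rw s' ∧
      3 * s'.R.card + s'.dirty.card + engaged s + 1 ≤
        3 * s.R.card + s.dirty.card + engaged s' := by
  intro s'
  constructor
  · refine h.step (Finset.filter_subset _ _) (fun f hf hf' => ?_) ?_ ?_ ?_ ?_ ?_
      fun N hN => h.top_matched he hN
    · by_contra hcon
      exact hf' (Finset.mem_filter.2 ⟨hf, fun h => absurd h hcon⟩)
    · rintro _ ⟨⟩
      exact ⟨rfl, he, Finset.mem_filter.2 ⟨he.1, fun _ => le_rfl⟩, fun f hf hw =>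
        (Finset.mem_filter.1 hf).2 hw⟩
    · split
      · exact subset_rfl
      · exact Finset.subset_insert _ _
    · intro g hg'
      rw [hg']
      exact Finset.mem_insert_self _ _
    · intro f hf hf' f' hf1 hw
      have h1 := (Finset.mem_filter.1 hf1).2 hw
      by_contra hcon
      exact hf' (Finset.mem_filter.2 ⟨hf, fun _ => by omega⟩)
    · intro N hN f hfN hfR
      refine Finset.mem_filter.2 ⟨hfR, fun hw => ?_⟩
      by_contra hcon
      have heN : e ∉ N := fun heN => hcon (by rw [hN.mat f hfN e heN (Or.inr hw)])
      obtain ⟨f', h1, h2, h3⟩ := h.top_blocks he hN heN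
      obtain rfl := hN.mat f hfN f' h1 (Or.inr (hw.trans h2.symm))
      omega
  · have hsub : s'.R ⊆ s.R := Finset.filter_subset _ _
    cases ho : s.eng (wm e) with
    | none =>
      have hd : s'.dirty = s.dirty := by simp only [s', ho]
      have he' : engaged s + 1 = engaged s' := by
        unfold engaged
        rw [← Finset.card_insert_of_notMem (a := wm e) (by simp [ho])]
        congr 1
        ext w
        simp only [s', Finset.mem_insert, Finset.mem_filter, Finset.mem_univ, true_and,
          Function.update_apply]
        split_ifs with hw <;> simp [hw]
      have := Finset.card_le_card hsub
      rw [hd]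
      omega
    | some g =>
      have hd : s'.dirty = insert (mn g) s.dirty := by simp only [s', ho]
      have he' : engaged s = engaged s' := by
        unfold engaged
        congr 1
        ext w
        simp only [s', Finset.mem_filter, Finset.mem_univ, true_and, Function.update_apply]
        split_ifs with hw
        · subst hw; simp [ho]
        · rfl
      obtain ⟨h1, h2, h3⟩ := h.engOK _ _ ho
      have hlt : s'.R ⊂ s.R := by
        refine Finset.ssubset_iff_subset_ne.2 ⟨hsub, fun heq => ?_⟩
        have : g ∈ s'.R := heq ▸ h2.1
        have := (Finset.mem_filter.1 this).2 h1
        have := hg g ho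
        omega
      have := Finset.card_lt_card hlt
      have := Finset.card_insert_le (mn g) s.dirty
      rw [hd]
      omega

/-- A tie: the woman refuses both proposals and everything that is not better. -/
theorem tie [Fintype β] (h : PInv mn wm rm rw s) {e g : ι} (he : Top mn rm s.R e)
    (hg : s.eng (wm e) = some g) (hne : e ≠ g) (hr : rw e = rw g) :
    let s' : PState ι α β := ⟨s.R.filter fun f => wm f = wm e → rw f < rw e,
      Function.update s.eng (wm e) none, insert (mn g) s.dirty⟩
    PInv mn wm rm rw s' ∧
      3 * s'.R.card + s'.dirty.card + engaged s + 1 ≤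
        3 * s.R.card + s.dirty.card + engaged s' := by
  intro s'
  obtain ⟨hg1, hg2, hg3⟩ := h.engOK _ _ hg
  constructor
  · refine h.step (Finset.filter_subset _ _) (fun f hf hf' => ?_) ?_ (Finset.subset_insert _ _) ?_ ?_
      ?_ fun N hN => h.top_matched he hN
    · by_contra hcon
      exact hf' (Finset.mem_filter.2 ⟨hf, fun h => absurd h hcon⟩)
    · rintro _ ⟨⟩
    · intro g' hg'
      rw [hg] at hg'
      cases hg'
      exact Finset.mem_insert_self _ _
    · intro f hf hf' f' hf1 hw
      have h1 := (Finset.mem_filter.1 hf1).2 hw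
      by_contra hcon
      exact hf' (Finset.mem_filter.2 ⟨hf, fun _ => by omega⟩)
    · intro N hN f hfN hfR
      refine Finset.mem_filter.2 ⟨hfR, fun hw => ?_⟩
      by_contra hcon
      -- A stable set cannot contain both tied edges. The one it misses is a top choice, so its
      -- woman has a strictly better edge in the set and none of those refused.
      by_cases heN : e ∈ N
      · have hgN : g ∉ N := fun hgN => hne (hN.mat e heN g hgN (Or.inr hg1.symm))
        obtain ⟨f', h1, h2, h3⟩ := h.top_blocks hg2 hN hgN
        obtain rfl := hN.mat f hfN f' h1 (Or.inr (hw.trans (hg1.symm.trans h2.symm)))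
        omega
      · obtain ⟨f', h1, h2, h3⟩ := h.top_blocks he hN heN
        obtain rfl := hN.mat f hfN f' h1 (Or.inr (hw.trans h2.symm))
        omega
  · have he' : engaged s' + 1 = engaged s := by
      unfold engaged
      rw [← Finset.card_insert_of_notMem (a := wm e) (by simp [s'])]
      congr 1
      ext w
      simp only [s', Finset.mem_insert, Finset.mem_filter, Finset.mem_univ, true_and,
        Function.update_apply]
      split_ifs with hw <;> simp [hw, hg]
    have hsub : s'.R ⊆ (s.R.erase e).erase g := by
      intro f hf
      obtain ⟨h1, h2⟩ := Finset.mem_filter.1 hf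
      refine Finset.mem_erase.2 ⟨?_, Finset.mem_erase.2 ⟨?_, h1⟩⟩
      · rintro rfl
        have := h2 hg1
        omega
      · rintro rfl
        have := h2 rfl
        omega
    have h1 := Finset.card_le_card hsub
    have h2 : g ∈ s.R.erase e := Finset.mem_erase.2 ⟨hne.symm, hg2.1⟩
    have h3 := Finset.card_erase_add_one h2
    have h4 := Finset.card_erase_add_one he.1
    have h5 := Finset.card_insert_le (mn g) s.dirty
    have h6 : s'.dirty = insert (mn g) s.dirty := rfl
    rw [h6]
    omega

theorem idle [Fintype β] (h : PInv mn wm rm rw s) {m : α} (hm : m ∈ s.dirty)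
    (hc : ∀ e, Top mn rm s.R e → mn e = m → s.eng (wm e) = some e) :
    let s' : PState ι α β := ⟨s.R, s.eng, s.dirty.erase m⟩
    PInv mn wm rm rw s' ∧
      3 * s'.R.card + s'.dirty.card + engaged s + 1 ≤
        3 * s.R.card + s.dirty.card + engaged s' := by
  intro s'
  refine ⟨⟨h.engOK, h.sub, fun e he hd => ?_, h.dead, h.deadM⟩, ?_⟩
  · by_cases hme : mn e = m
    · exact hc e he hme
    · exact h.clean e he fun h => hd (Finset.mem_erase.2 ⟨hme, h⟩)
  · have h1 := Finset.card_erase_add_one hm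
    have h2 : engaged s' = engaged s := rfl
    have h3 : s'.dirty = s.dirty.erase m := rfl
    have h4 : s'.R = s.R := rfl
    rw [h2, h3, h4]
    omega

theorem init [Fintype ι] (D : Finset α) (hD : ∀ e, mn e ∈ D) :
    PInv mn wm rm rw (⟨Finset.univ, fun _ => none, D⟩ : PState ι α β) :=
  ⟨fun _ _ h => (by cases h), fun _ _ => Finset.subset_univ _, fun e _ h => absurd (hD e) h,
    fun e h => absurd (Finset.mem_univ e) h, fun e h => absurd (Finset.mem_univ e) h⟩

theorem engaged_le [Fintype β] (h : PInv mn wm rm rw s) : engaged s ≤ s.R.card := by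
  rw [engaged]
  have hex : ∀ w ∈ Finset.univ.filter (fun w => s.eng w ≠ none), ∃ e, s.eng w = some e :=
    fun w hw => Option.ne_none_iff_exists'.1 (Finset.mem_filter.1 hw).2
  by_cases hne : Nonempty ι
  · choose! f hf using hex
    refine Finset.card_le_card_of_injOn f (fun w hw => ?_) fun w hw w' hw' he => ?_
    · exact (h.engOK _ _ (hf w hw)).2.1.1
    · rw [← (h.engOK _ _ (hf w hw)).1, he, (h.engOK _ _ (hf w' hw')).1]
  · rw [Finset.card_eq_zero.2]
    · omega
    · refine Finset.eq_empty_of_forall_notMem fun w hw => ?_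
      obtain ⟨e, -⟩ := hex w hw
      exact hne ⟨e⟩

/-- When nobody has to propose any more, the engagements are the optimal matching. -/
theorem final (h : PInv mn wm rm rw s) (hd : s.dirty = ∅) {N₀ : Finset ι}
    (hN₀ : Stable mn wm rm rw N₀) {T : Finset ι} (hT : ∀ e, e ∈ T ↔ s.eng (wm e) = some e) :
    Stable mn wm rm rw T ∧
      ∀ N, Stable mn wm rm rw N → ∀ f ∈ N, ∃ e ∈ T, mn e = mn f ∧ rm e ≤ rm f := by
  have hTtop : ∀ e, e ∈ T ↔ Top mn rm s.R e := fun e =>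
    ⟨fun he => (h.engOK _ _ ((hT e).1 he)).2.1, fun he => (hT e).2 (h.clean e he (by simp [hd]))⟩
  have hopt : ∀ f ∈ s.R, ∃ e ∈ T, mn e = mn f ∧ rm e ≤ rm f := by
    intro f hf
    obtain ⟨e, h1, h2⟩ := exists_top (mn := mn) (rm := rm) hf
    exact ⟨e, (hTtop e).2 h1, h2⟩
  have hTw : Set.InjOn wm (T : Set ι) := by
    intro e he f hf hef
    have h1 := (hT e).1 he
    have h2 := (hT f).1 hf
    rw [hef, h2] at h1
    cases h1; rfl
  have hNm : Set.InjOn mn (N₀ : Set ι) := fun e he f hf hef => hN₀.mat e he f hf (Or.inl hef)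
  have hNw : Set.InjOn wm (N₀ : Set ι) := fun e he f hf hef => hN₀.mat e he f hf (Or.inr hef)
  have hsubw : T.image wm ⊆ N₀.image wm := by
    intro w hw
    obtain ⟨e, he, rfl⟩ := Finset.mem_image.1 hw
    obtain ⟨f, h1, h2⟩ := h.top_matched ((hTtop e).1 he) hN₀
    exact Finset.mem_image.2 ⟨f, h1, h2⟩
  have hsubm : N₀.image mn ⊆ T.image mn := by
    intro m hm
    obtain ⟨f, hf, rfl⟩ := Finset.mem_image.1 hm
    obtain ⟨e, h1, h2, -⟩ := hopt f (h.sub _ hN₀ hf)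
    exact Finset.mem_image.2 ⟨e, h1, h2⟩
  -- The chain |N₀| ≤ |men of T| ≤ |T| = |women of T| ≤ |N₀| collapses. So T is injective on men and
  -- covers exactly the women of N₀.
  have c1 := Finset.card_le_card hsubw
  have c2 := Finset.card_le_card hsubm
  rw [Finset.card_image_of_injOn hTw, Finset.card_image_of_injOn hNw] at c1
  rw [Finset.card_image_of_injOn hNm] at c2
  have c3 : (T.image mn).card ≤ T.card := Finset.card_image_le
  have hTm : Set.InjOn mn (T : Set ι) := Finset.injOn_of_card_image_eq (by omega)
  have heqw : T.image wm = N₀.image wm := Finset.eq_of_subset_of_card_le hsubw (by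
    rw [Finset.card_image_of_injOn hTw, Finset.card_image_of_injOn hNw]; omega)
  refine ⟨⟨fun e he f hf hef => ?_, fun e he hm => ?_⟩, fun N hN f hf => hopt f (h.sub N hN hf)⟩
  · rcases hef with hef | hef
    · exact hTm he hf hef
    · exact hTw he hf hef
  · by_cases heR : e ∈ s.R
    · obtain ⟨t, h1, h2, h3⟩ := hopt e heR
      have h4 := hm t h1 h2
      refine absurd ((hTtop e).2 ⟨heR, fun f hf hfe => ?_⟩) he
      exact h4.trans (((hTtop t).1 h1).2 f hf (hfe.trans h2.symm))
    -- The woman of a deleted edge is matched in N₀, hence in T, and she prefers every remaining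
    -- edge to the deleted one.
    · obtain ⟨f, h1, h2⟩ := h.deadM e heR N₀ hN₀
      have : wm e ∈ T.image wm := heqw ▸ Finset.mem_image.2 ⟨f, h1, h2⟩
      obtain ⟨t, h3, h4⟩ := Finset.mem_image.1 this
      exact ⟨t, h3, h4, h.dead e heR t ((hTtop t).1 h3).1 h4⟩

end PInv

end SuperStable.Proposal

end


/-! ### The proposal procedure as a program, with its running time. -/

noncomputable section

open scoped Classical

namespace SuperStable

/-! ### Loops that write an array, and loops with a measure -/

/-- `τ` differs from `σ` at most in the registers `ws` and the array `A`. -/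
structure AgreeA (ws : List ℕ) (A : ℕ) (σ τ : Mem) : Prop where
  reg : ∀ x, x ∉ ws → τ.reg x = σ.reg x
  arr : ∀ B, B ≠ A → τ.arr B = σ.arr B
  out : τ.out = σ.out

theorem AgreeA.refl (ws : List ℕ) (A : ℕ) (σ : Mem) : AgreeA ws A σ σ :=
  ⟨fun _ _ => rfl, fun _ _ => rfl, rfl⟩

theorem AgreeA.setReg {ws : List ℕ} {A : ℕ} {σ τ : Mem} (h : AgreeA ws A σ τ) {x : ℕ} (hx : x ∈ ws)
    (v : ℕ) : AgreeA ws A σ (τ.setReg x v) := by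
  refine ⟨fun y hy => ?_, h.arr, h.out⟩
  rw [Mem.setReg_reg, if_neg (by rintro rfl; exact hy hx), h.reg y hy]

theorem AgreeA.setArr {ws : List ℕ} {A : ℕ} {σ τ : Mem} (h : AgreeA ws A σ τ) (i v : ℕ) :
    AgreeA ws A σ (τ.setArr A i v) := by
  refine ⟨h.reg, fun B hB => ?_, h.out⟩
  rw [Mem.setArr_arr, if_neg hB, h.arr B hB]

/-- Write `c` into the entries of `A` for the members of a list that satisfy the conditions. -/
def putL (lst off kk en e x A c : ℕ) (cs : List Cd) : St :=
  forL lst off kk en e x (ifAll cs (.put A (.r e) (.k c)) .skip)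

theorem HT_putL {m c : ℕ} {own : Fin m → Fin c} {ord : Fin m → Fin m} {ofs : Fin (c + 1) → ℕ}
    (hL : Lists own ord ofs) {lst off kk en e x A b : ℕ} {cs : List Cd} {σ : Mem}
    {v : Fin c} (P : Fin m → Prop)
    (hne : kk ≠ en ∧ kk ≠ x ∧ e ≠ kk ∧ e ≠ en) (hA : A ≠ lst)
    (hlst : σ.arr lst = tabulate fun k => (ord k).val) (hoff : σ.arr off = tabulate ofs)
    (hx : σ.reg x = v.val)
    (hc : ∀ f τ, own f = v → AgreeA [kk, en, e] A σ τ → τ.reg e = f.val →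
      ((∀ c ∈ cs, c.holds τ) ↔ P f)) :
    HT (putL lst off kk en e x A b cs) σ (fun t τ =>
      t ≤ (Finset.univ.filter fun f => own f = v).card ∧ AgreeA [kk, en, e] A σ τ ∧
      ∀ f : Fin m, τ.arr A f.val = if own f = v ∧ P f then b else σ.arr A f.val) := by
  refine (HT_list hL (v := v) (fun D t τ => t ≤ D.card ∧ AgreeA [kk, en, e] A σ τ ∧
      ∀ f : Fin m, τ.arr A f.val = if f ∈ D ∧ P f then b else σ.arr A f.val)
      (ifAll_wa (by simp [St.wa, nat_beq_false hA]) rfl) (ifAll_wr rfl rfl) (ifAll_wr rfl rfl)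
      hne hlst hoff hx ?_ ?_).mono ?_
  · intro y z
    exact ⟨le_rfl, ((AgreeA.refl _ _ σ).setReg (by simp) _).setReg (by simp) _, by simp [Mem.setReg]⟩
  · rintro D T τ f - hfD hf - ⟨hT, hA', hI⟩
    have hA2 : AgreeA [kk, en, e] A σ (τ.setReg e f.val) := hA'.setReg (by simp) _
    have hef : (τ.setReg e f.val).reg e = f.val := by rw [Mem.setReg_reg, if_pos rfl]
    have hcard : (insert f D).card = D.card + 1 := Finset.card_insert_of_notMem hfD
    rw [HT_ifAll, hc f _ hf hA2 hef, HT_put, HT_skip]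
    refine ⟨fun hP y => ⟨by omega, (hA2.setArr _ _).setReg (by simp) _, fun g => ?_⟩,
      fun hP y => ⟨by omega, hA2.setReg (by simp) _, fun g => ?_⟩⟩
    · simp only [Mem.setReg_arr, Mem.setArr_arr, if_true, Ex.val, hef, Function.update_apply, hI,
        Finset.mem_insert, Fin.val_inj]
      by_cases hg : g = f
      · subst hg; simp [hP]
      · simp [hg]
    · simp only [Mem.setReg_arr, hI, Finset.mem_insert]
      by_cases hg : g = f
      · subst hg; simp [hP]
      · simp [hg]
  · rintro t τ ⟨⟨h1, h2, h3⟩, -⟩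
    exact ⟨h1, h2, fun f => by simpa using h3 f⟩

/-- The first argument of `J` is a strictly decreasing measure, the second the time elapsed; time
bounds are put into `J` by the caller. -/
theorem HT_measure {e f : Ex} {p : St} (J : ℕ → ℕ → Mem → Prop)
    (hs : ∀ n T τ, J n T τ → e.val τ < f.val τ → HT p τ (fun t υ => ∃ n' < n, J n' (T + t + 1) υ)) :
    ∀ n T σ, J n T σ →
      HT (.whl e f p) σ (fun t τ => ¬ e.val τ < f.val τ ∧ ∃ n', J n' (T + t) τ) := by
  intro n
  induction n using Nat.strong_induction_on with
  | _ n ih =>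
    intro T σ hJ
    rw [HT_whl]
    refine ⟨fun h => (hs n T σ hJ h).mono ?_, fun h => ⟨h, n, hJ⟩⟩
    rintro t υ ⟨n', hn', hJ'⟩
    refine (ih n' hn' _ υ hJ').mono ?_
    rintro u ξ ⟨h1, n'', h2⟩
    exact ⟨h1, n'', by rwa [show T + (t + u + 1) = T + t + 1 + u by omega]⟩

/-! ### The proposal program -/

/-- The arrays used by the proposals: the input with the sides exchanged if `q` holds, the
engagements (`8`), the deleted edges (`9`), and the men who may have to propose (`10`). -/
def ar (q : Bool) (i : ℕ) : ℕ :=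
  if i < 8 then
    cond q (if i < 4 then (if i % 2 = 0 then i + 1 else i - 1) else if i < 6 then i + 2 else i - 2) i
  -- Work arrays get odd numbers when the men propose and even ones when the women do, so the two
  -- runs do not interfere. The engagements end in array 11, the edge of M₀ at each woman, and in
  -- array 12, the edge of Mz at each man.
  else cond q (2 * i - 4) (2 * i - 5)

theorem ar_inj {q : Bool} {i j : ℕ} : ar q i = ar q j ↔ i = j := by
  constructor
  · intro h
    cases q <;> simp only [ar, cond_true, cond_false] at h <;> split_ifs at h <;> omega
  · rintro rfl; rfl

theorem ar_lt {q : Bool} {i : ℕ} (h : i < 8) : ar q i < 8 := by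
  cases q <;> simp only [ar, cond_true, cond_false] <;> split_ifs <;> omega

def propose (q : Bool) (g : Ex) : St :=
  putL (ar q 6) (ar q 7) 8 9 10 13 (ar q 9) 1 [.lt (.r 15) g]

def accept (q : Bool) : St :=
  .put (ar q 8) (.r 13) (.inc (.r 11)) ⨟ propose q (.ld (ar q 3) (.r 10))

/-- The first list search finds the rank of the top choices of a dirty man, the second one a top
choice along which he is not engaged; its comparison never holds, so any hit is kept. If he has no
edges left, the rank read from a decremented 0 is meaningless, but then the second search fails as
well. -/
def proposeStep (q : Bool) : St :=
  findN 4 (cond q 1 0) 5 [.eq (.ld (ar q 10) (.r 4)) (.k 1)] ⨟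
  .ite (.eq (.r 5) (.k 0)) (.set 6 (.k 0)) (
    .set 7 (.dec (.r 5)) ⨟
    minL (ar q 4) (ar q 5) 8 9 10 7 11 [.eq (.ld (ar q 9) (.r 10)) (.k 0)]
      (.lt (.ld (ar q 2) (.r 10)) (.ld (ar q 2) (.dec (.r 11)))) ⨟
    .set 12 (.ld (ar q 2) (.dec (.r 11))) ⨟
    minL (ar q 4) (ar q 5) 8 9 10 7 11 [.eq (.ld (ar q 9) (.r 10)) (.k 0),
      .eq (.ld (ar q 2) (.r 10)) (.r 12), .ne (.ld (ar q 8) (.ld (ar q 1) (.r 10))) (.inc (.r 10))]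
      (.lt (.k 0) (.k 0)) ⨟
    .ite (.eq (.r 11) (.k 0)) (.put (ar q 10) (.r 7) (.k 0)) (
      .set 11 (.dec (.r 11)) ⨟
      .set 13 (.ld (ar q 1) (.r 11)) ⨟
      .set 14 (.ld (ar q 8) (.r 13)) ⨟
      .set 15 (.ld (ar q 3) (.r 11)) ⨟
      .ite (.eq (.r 14) (.k 0)) (accept q) (
        .put (ar q 10) (.ld (ar q 0) (.dec (.r 14))) (.k 1) ⨟
        .ite (.lt (.r 15) (.ld (ar q 3) (.dec (.r 14)))) (accept q) (
          .put (ar q 8) (.r 13) (.k 0) ⨟ propose q (.inc (.ld (ar q 3) (.r 10)))))))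

def proposals (q : Bool) : St :=
  forN 4 2 (.put (ar q 10) (.ld (ar q 0) (.r 4)) (.k 1)) ⨟
  .set 6 (.k 1) ⨟ .whl (.k 0) (.r 6) (proposeStep q)

namespace Proposal

/-- One side of the market as it is stored in the input arrays. -/
structure Side (q : Bool) (N : ℕ) {m c d : ℕ} (mn : Fin m → Fin c) (wm : Fin m → Fin d)
    (rm rw : Fin m → ℕ) (ordM ordW : Fin m → Fin m) (ofsM : Fin (c + 1) → ℕ)
    (ofsW : Fin (d + 1) → ℕ) (A : ℕ → ℕ → ℕ) : Prop where
  man : ∀ k : Fin m, A (ar q 0) k.val = (mn k).val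
  wom : ∀ k : Fin m, A (ar q 1) k.val = (wm k).val
  rkM : ∀ k : Fin m, A (ar q 2) k.val = rm k
  rkW : ∀ k : Fin m, A (ar q 3) k.val = rw k
  lstM : A (ar q 4) = tabulate fun k => (ordM k).val
  offM : A (ar q 5) = tabulate ofsM
  lstW : A (ar q 6) = tabulate fun k => (ordW k).val
  offW : A (ar q 7) = tabulate ofsW
  hM : Lists mn ordM ofsM
  hW : Lists wm ordW ofsW
  hc : c ≤ N
  degM : ∀ x, (Finset.univ.filter fun k => mn k = x).card ≤ N
  degW : ∀ x, (Finset.univ.filter fun k => wm k = x).card ≤ N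

variable {q : Bool} {N m c d : ℕ} {mn : Fin m → Fin c} {wm : Fin m → Fin d}
  {rm rw : Fin m → ℕ} {ordM ordW : Fin m → Fin m} {ofsM : Fin (c + 1) → ℕ} {ofsW : Fin (d + 1) → ℕ}

theorem Side.congr {A A' : ℕ → ℕ → ℕ} (h : Side q N mn wm rm rw ordM ordW ofsM ofsW A)
    (h' : ∀ i < 8, A' i = A i) : Side q N mn wm rm rw ordM ordW ofsM ofsW A' := by
  refine ⟨?_, ?_, ?_, ?_, ?_, ?_, ?_, ?_, h.hM, h.hW, h.hc, h.degM, h.degW⟩ <;>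
    rw [h' _ (ar_lt (by norm_num))]
  exacts [h.man, h.wom, h.rkM, h.rkW, h.lstM, h.offM, h.lstW, h.offW]

theorem Side.frame {σ τ : Mem} {p : St} (h : Side q N mn wm rm rw ordM ordW ofsM ofsW σ.arr)
    (hf : Frame p σ τ) (hp : ∀ i < 8, p.wa i = false) :
    Side q N mn wm rm rw ordM ordW ofsM ofsW τ.arr := h.congr fun i hi => hf.arr i (hp i hi)

theorem Side.rkW' {A : ℕ → ℕ → ℕ} (h : Side q N mn wm rm rw ordM ordW ofsM ofsW A) {i : ℕ}
    {k : Fin m} (hi : i = k.val) : A (ar q 3) i = rw k := by rw [hi, h.rkW]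

/-- The arrays hold the state of the proposals. -/
structure RepP (q : Bool) (s : PState (Fin m) (Fin c) (Fin d)) (A : ℕ → ℕ → ℕ) : Prop where
  dead : ∀ k : Fin m, A (ar q 9) k.val = if k ∈ s.R then 0 else 1
  eng : ∀ w : Fin d, A (ar q 8) w.val = (s.eng w).elim 0 fun e => e.val + 1
  dirty : ∀ x : Fin c, A (ar q 10) x.val = if x ∈ s.dirty then 1 else 0

theorem HT_propose {σ : Mem} {g : Ex} {w : Fin d} (P : Fin m → Prop)
    (hS : Side q N mn wm rm rw ordM ordW ofsM ofsW σ.arr) (hw : σ.reg 13 = w.val)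
    (hg : ∀ f τ, AgreeA [8, 9, 10] (ar q 9) σ τ → τ.reg 10 = f.val →
      (σ.reg 15 < g.val τ ↔ P f)) :
    HT (propose q g) σ (fun t τ => t ≤ N ∧ AgreeA [8, 9, 10] (ar q 9) σ τ ∧
      ∀ f : Fin m, τ.arr (ar q 9) f.val = if wm f = w ∧ P f then 1 else σ.arr (ar q 9) f.val) := by
  refine (HT_putL hS.hW (v := w) P (by decide) (by simp [ar_inj]) hS.lstW hS.offW hw ?_).mono ?_
  · intro f τ _ hA hf
    rw [← hg f τ hA hf]
    simp [Cd.holds, Ex.val, hA.reg 15 (by decide)]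
  · rintro t τ ⟨h1, h2⟩
    exact ⟨h1.trans (hS.degW w), h2⟩

theorem HT_accept {σ : Mem} {s : PState (Fin m) (Fin c) (Fin d)} {w : Fin d} {e : Fin m}
    (hS : Side q N mn wm rm rw ordM ordW ofsM ofsW σ.arr) (hR : RepP q s σ.arr)
    (hw : σ.reg 13 = w.val) (he : σ.reg 11 = e.val) (hr : σ.reg 15 = rw e) :
    HT (accept q) σ (fun t τ => t ≤ N ∧ RepP q ⟨s.R.filter fun f => wm f = w → rw f ≤ rw e,
      Function.update s.eng w (some e), s.dirty⟩ τ.arr ∧ τ.reg 6 = σ.reg 6) := by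
  rw [accept, HT_seq, HT_put]
  simp only [Ex.val, hw, he]
  set μ := σ.setArr (ar q 8) w.val (e.val + 1) with hμ
  have hμ' : ∀ B, B ≠ ar q 8 → μ.arr B = σ.arr B := fun B hB => by
    rw [hμ, Mem.setArr_arr, if_neg hB]
  have hSμ : Side q N mn wm rm rw ordM ordW ofsM ofsW μ.arr := hS.congr fun i hi => hμ' i (by
    rintro rfl; cases q <;> simp [ar] at hi)
  refine (HT_propose (w := w) (fun f => rw e < rw f) hSμ hw ?_).mono ?_
  · intro f τ hA hf
    rw [Ex.val, hA.arr _ (by simp [ar_inj]), Ex.val, hf, hSμ.rkW]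
    change σ.reg 15 < _ ↔ _
    rw [hr]
  · rintro t τ ⟨h1, h2, h3⟩
    refine ⟨by omega, ⟨fun f => ?_, fun w' => ?_, fun x => ?_⟩, h2.reg 6 (by decide)⟩
    · rw [h3, hμ' _ (by simp [ar_inj]), hR.dead]
      simp only [Finset.mem_filter]
      by_cases h4 : wm f = w <;> by_cases h5 : rw e < rw f <;> by_cases h6 : f ∈ s.R <;>
        simp [h4, h5, h6, not_le.2, not_lt.1]
    · rw [h2.arr _ (by simp [ar_inj]), hμ, Mem.setArr_arr, if_pos rfl]
      by_cases h4 : w' = w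
      · subst h4; simp
      · simp [h4, Fin.val_inj, hR.eng]
    · rw [h2.arr _ (by simp [ar_inj]), hμ' _ (by simp [ar_inj]), hR.dirty]

theorem HT_refuse {σ : Mem} {s : PState (Fin m) (Fin c) (Fin d)} {w : Fin d} {e : Fin m}
    (hS : Side q N mn wm rm rw ordM ordW ofsM ofsW σ.arr) (hR : RepP q s σ.arr)
    (hw : σ.reg 13 = w.val) (hr : σ.reg 15 = rw e) :
    HT (.put (ar q 8) (.r 13) (.k 0) ⨟ propose q (.inc (.ld (ar q 3) (.r 10)))) σ
      (fun t τ => t ≤ N ∧ RepP q ⟨s.R.filter fun f => wm f = w → rw f < rw e,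
      Function.update s.eng w none, s.dirty⟩ τ.arr ∧ τ.reg 6 = σ.reg 6) := by
  rw [HT_seq, HT_put]
  simp only [Ex.val, hw]
  set μ := σ.setArr (ar q 8) w.val 0 with hμ
  have hμ' : ∀ B, B ≠ ar q 8 → μ.arr B = σ.arr B := fun B hB => by
    rw [hμ, Mem.setArr_arr, if_neg hB]
  have hSμ : Side q N mn wm rm rw ordM ordW ofsM ofsW μ.arr := hS.congr fun i hi => hμ' i (by
    rintro rfl; cases q <;> simp [ar] at hi)
  refine (HT_propose (w := w) (fun f => rw e ≤ rw f) hSμ hw ?_).mono ?_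
  · intro f τ hA hf
    rw [Ex.val, Ex.val, hA.arr _ (by simp [ar_inj]), Ex.val, hf, hSμ.rkW]
    change σ.reg 15 < _ ↔ _
    rw [hr]; omega
  · rintro t τ ⟨h1, h2, h3⟩
    refine ⟨by omega, ⟨fun f => ?_, fun w' => ?_, fun x => ?_⟩, h2.reg 6 (by decide)⟩
    · rw [h3, hμ' _ (by simp [ar_inj]), hR.dead]
      simp only [Finset.mem_filter]
      by_cases h4 : wm f = w <;> by_cases h5 : rw e ≤ rw f <;> by_cases h6 : f ∈ s.R <;>
        simp [h4, h5, h6, not_lt.2, not_le.1]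
    · rw [h2.arr _ (by simp [ar_inj]), hμ, Mem.setArr_arr, if_pos rfl]
      by_cases h4 : w' = w
      · subst h4; simp
      · simp [h4, Fin.val_inj, hR.eng]
    · rw [h2.arr _ (by simp [ar_inj]), hμ' _ (by simp [ar_inj]), hR.dirty]

theorem HT_proposeStep {σ : Mem} {s : PState (Fin m) (Fin c) (Fin d)}
    (hS : Side q N mn wm rm rw ordM ordW ofsM ofsW σ.arr) (hR : RepP q s σ.arr)
    (hI : PInv mn wm rm rw s) (hlim : σ.reg (cond q 1 0) = c) (h6 : σ.reg 6 = 1) :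
    HT (proposeStep q) σ (fun t τ => t ≤ 4 * N ∧ ((τ.reg 6 = 0 ∧ s.dirty = ∅ ∧ RepP q s τ.arr) ∨
      (τ.reg 6 = 1 ∧ ∃ s', PInv mn wm rm rw s' ∧ RepP q s' τ.arr ∧
        3 * s'.R.card + s'.dirty.card + engaged s + 1 ≤
          3 * s.R.card + s.dirty.card + engaged s'))) := by
  rw [proposeStep, HT_seq]
  refine (HT_findN (N := c) (fun k => ∃ h : k < c, (⟨k, h⟩ : Fin c) ∈ s.dirty)
    (by cases q <;> decide) hlim ?_).mono ?_
  · intro k τ hk hA hk4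
    have := hR.dirty ⟨k, hk⟩
    simp only at this
    simp [Cd.holds, Ex.val, hA.arr, hk4, this, hk]
  rintro t₁ τ₁ ⟨ht₁, hA₁, hres⟩
  have hN := hS.hc
  rw [HT_ite]
  refine ⟨fun h0 => ?_, fun h0 => ?_⟩
  · rw [HT_set]
    refine ⟨by omega, Or.inl ⟨by simp [Mem.setReg, Ex.val], ?_, ?_⟩⟩
    · simp only [Cd.holds, Ex.val] at h0
      rcases hres with ⟨-, h⟩ | ⟨k, _, h, -⟩
      · exact Finset.eq_empty_of_forall_notMem fun x hx => h x.val x.2 ⟨x.2, hx⟩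
      · omega
    · rw [Mem.setReg_arr, hA₁.arr]; exact hR
  simp only [Cd.holds, Ex.val] at h0
  obtain ⟨x, hx5, hxd⟩ : ∃ x : Fin c, τ₁.reg 5 = x.val + 1 ∧ x ∈ s.dirty := by
    rcases hres with ⟨h, -⟩ | ⟨k, hk, h, _, h'⟩
    · exact absurd h h0
    · exact ⟨⟨k, hk⟩, h, h'⟩
  rw [HT_seq, HT_set]
  simp only [Ex.val, hx5, Nat.add_sub_cancel]
  set μ := τ₁.setReg 7 x.val with hμ
  have hμarr : μ.arr = σ.arr := hA₁.arr
  have hμ7 : μ.reg 7 = x.val := by simp [hμ, Mem.setReg]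
  have hμ6 : μ.reg 6 = 1 := by
    rw [hμ, Mem.setReg_reg, if_neg (by decide), hA₁.reg 6 (by decide), h6]
  rw [HT_seq]
  refine (HT_minL hS.hM (v := x) (fun f => f ∈ s.R) (fun f => (rm f : ℤ)) (by decide)
    (by rw [hμarr]; exact hS.lstM) (by rw [hμarr]; exact hS.offM) hμ7 ?_ ?_).mono ?_
  · intro f τ _ hA hf
    simp [Cd.holds, Ex.val, hA.arr, hμarr, hf, hR.dead]
  · intro f g τ _ _ _ hA hf hg
    simp [Cd.holds, Ex.val, hA.arr, hμarr, hf, hg, hS.rkM]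
  rintro t₂ τ₂ ⟨ht₂, hA₂, hres₂⟩
  have hd1 := hS.degM x
  rw [HT_seq, HT_set, HT_seq]
  set ν := τ₂.setReg 12 (Ex.val τ₂ (.ld (ar q 2) (.dec (.r 11)))) with hν
  have hνarr : ν.arr = σ.arr := hA₂.arr.trans hμarr
  have hν7 : ν.reg 7 = x.val := by
    rw [hν, Mem.setReg_reg, if_neg (by decide), hA₂.reg 7 (by decide), hμ7]
  have hν6 : ν.reg 6 = 1 := by
    rw [hν, Mem.setReg_reg, if_neg (by decide), hA₂.reg 6 (by decide), hμ6]
  have hν12 : ∀ e, Top mn rm s.R e → mn e = x → ν.reg 12 = rm e := by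
    intro e he hex
    rw [hν, Mem.setReg_reg, if_pos rfl]
    rcases hres₂ with ⟨-, h⟩ | ⟨f, h1, h2, h3, h4⟩
    · exact absurd he.1 (h e hex)
    · simp only [Ex.val, h2, Nat.add_sub_cancel, hA₂.arr, hμarr, hS.rkM]
      have h5 := h4 e hex he.1
      have h6 := he.2 f h3 (h1.trans hex.symm)
      omega
  refine (HT_minL hS.hM (v := x) (fun f => Top mn rm s.R f ∧ s.eng (wm f) ≠ some f) (fun _ => 0)
    (by decide) (by rw [hνarr]; exact hS.lstM) (by rw [hνarr]; exact hS.offM) hν7 ?_ ?_).mono ?_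
  · intro f τ hfx hA hf
    have he : ∀ (o : Option (Fin m)), (o.elim 0 (fun e => e.val + 1) = f.val + 1) ↔ o = some f := by
      intro o
      cases o <;> simp [Fin.ext_iff]
    simp only [List.mem_cons, List.not_mem_nil, or_false, forall_eq_or_imp, forall_eq, Cd.holds,
      Ex.val, hA.arr, hνarr, hf, hR.dead, hS.rkM, hS.wom, hR.eng, ne_eq, he,
      hA.reg 12 (by decide)]
    by_cases hfR : f ∈ s.R
    · simp only [hfR, if_true, true_and]
      refine and_congr_left fun _ => ⟨fun h => ⟨hfR, fun g hg hgf => ?_⟩, fun h => ?_⟩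
      · obtain ⟨t, h1, h2, h3⟩ := exists_top (mn := mn) (rm := rm) hg
        have := hν12 t h1 (by rw [h2, hgf, hfx])
        omega
      · rw [hν12 f h hfx]
    · simp only [hfR, if_false]
      simp [Top, hfR]
  · intro f g τ _ _ _ _ _ _
    simp [Cd.holds, Ex.val]
  rintro t₃ τ₃ ⟨ht₃, hA₃, hres₃⟩
  have h₃arr : τ₃.arr = σ.arr := hA₃.arr.trans hνarr
  have h₃7 : τ₃.reg 7 = x.val := by rw [hA₃.reg 7 (by decide), hν7]
  have h₃6 : τ₃.reg 6 = 1 := by rw [hA₃.reg 6 (by decide), hν6]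
  rw [HT_ite]
  refine ⟨fun h0 => ?_, fun h0 => ?_⟩
  · simp only [Cd.holds, Ex.val] at h0
    rw [HT_put]
    refine ⟨by omega, Or.inr ⟨h₃6, _, (hI.idle hxd ?_).1, ⟨?_, ?_, ?_⟩, (hI.idle hxd ?_).2⟩⟩
    · intro e he hex
      rcases hres₃ with ⟨-, h⟩ | ⟨f, -, h, -⟩
      · by_contra hcon
        exact h e hex ⟨he, hcon⟩
      · omega
    · intro f
      rw [Mem.setArr_arr, if_neg (by simp [ar_inj]), h₃arr, hR.dead]
    · intro f
      rw [Mem.setArr_arr, if_neg (by simp [ar_inj]), h₃arr, hR.eng]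
    · intro y
      rw [Mem.setArr_arr, if_pos rfl]
      simp only [Ex.val, h₃7, Function.update_apply, h₃arr, hR.dirty, Finset.mem_erase, Fin.val_inj]
      by_cases hy : y = x <;> simp [hy]
    · intro e he hex
      rcases hres₃ with ⟨-, h⟩ | ⟨f, -, h, -⟩
      · by_contra hcon
        exact h e hex ⟨he, hcon⟩
      · omega
  simp only [Cd.holds, Ex.val] at h0
  obtain ⟨e, hex, he11, heT, hene⟩ : ∃ e : Fin m, mn e = x ∧ τ₃.reg 11 = e.val + 1 ∧
      Top mn rm s.R e ∧ s.eng (wm e) ≠ some e := by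
    rcases hres₃ with ⟨h, -⟩ | ⟨f, h1, h2, h3, -⟩
    · exact absurd h h0
    · exact ⟨f, h1, h2, h3⟩
  simp only [HT_seq, HT_set, Ex.val, he11, Nat.add_sub_cancel, Mem.setReg_arr, Mem.setReg_reg,
    if_true, if_false, Nat.reduceEqDiff, h₃arr, hS.wom, hS.rkW, hR.eng]
  set ξ := (((τ₃.setReg 11 e.val).setReg 13 (wm e).val).setReg 14
    ((s.eng (wm e)).elim 0 fun e => e.val + 1)).setReg 15 (rw e) with hξ
  have hξarr : ξ.arr = σ.arr := h₃arr
  have hξ6 : ξ.reg 6 = 1 := by simpa [hξ, Mem.setReg] using h₃6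
  have hξ11 : ξ.reg 11 = e.val := by simp [hξ, Mem.setReg]
  have hξ13 : ξ.reg 13 = (wm e).val := by simp [hξ, Mem.setReg]
  have hξ14 : ξ.reg 14 = (s.eng (wm e)).elim 0 fun e => e.val + 1 := by simp [hξ, Mem.setReg]
  have hξ15 : ξ.reg 15 = rw e := by simp [hξ, Mem.setReg]
  rw [HT_ite]
  have hSξ : Side q N mn wm rm rw ordM ordW ofsM ofsW ξ.arr := by rw [hξarr]; exact hS
  cases ho : s.eng (wm e) with
  | none =>
    refine ⟨fun _ => ?_, fun h => ?_⟩
    · refine (HT_accept hSξ (by rw [hξarr]; exact hR) hξ13 hξ11 hξ15).mono ?_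
      rintro t τ ⟨h1, h2, h3⟩
      have hg : ∀ g, s.eng (wm e) = some g → rw e < rw g := fun g hg => by rw [ho] at hg; cases hg
      have hE := hI.engage heT hg
      simp only [ho] at hE
      exact ⟨by omega, Or.inr ⟨h3.trans hξ6, _, hE.1, by convert h2, hE.2⟩⟩
    · exact absurd (by simp [Cd.holds, Ex.val, hξ14, ho]) h
  | some g =>
    obtain ⟨hg1, hg2, hg3⟩ := hI.engOK _ _ ho
    have hne : e ≠ g := by rintro rfl; exact hene ho
    have hξ14' : ξ.reg 14 = g.val + 1 := by rw [hξ14, ho]; rfl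
    refine ⟨fun h => ?_, fun _ => ?_⟩
    · simp [Cd.holds, Ex.val, hξ14'] at h
    rw [HT_seq, HT_put]
    simp only [Ex.val, hξ14', Nat.add_sub_cancel, hξarr, hS.man]
    set ζ := ξ.setArr (ar q 10) (mn g).val 1 with hζ
    have hζarr : ∀ B, B ≠ ar q 10 → ζ.arr B = σ.arr B := fun B hB => by
      rw [hζ, Mem.setArr_arr, if_neg hB, hξarr]
    have hSζ : Side q N mn wm rm rw ordM ordW ofsM ofsW ζ.arr := hS.congr fun i hi => hζarr i (by
      rintro rfl; cases q <;> simp [ar] at hi)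
    have hRζ : RepP q ⟨s.R, s.eng, insert (mn g) s.dirty⟩ ζ.arr := by
      refine ⟨fun f => ?_, fun w => ?_, fun y => ?_⟩
      · rw [hζarr _ (by simp [ar_inj]), hR.dead]
      · rw [hζarr _ (by simp [ar_inj]), hR.eng]
      · rw [hζ, Mem.setArr_arr, if_pos rfl]
        simp only [Function.update_apply, hξarr, hR.dirty, Finset.mem_insert, Fin.val_inj]
        by_cases hy : y = mn g <;> simp [hy]
    rw [HT_ite]
    have hcond : (Cd.lt (.r 15) (.ld (ar q 3) (.dec (.r 14)))).holds ζ ↔ rw e < rw g := by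
      simp only [Cd.holds, Ex.val]
      rw [hSζ.rkW' (k := g) (by rw [show ζ.reg 14 = ξ.reg 14 from rfl, hξ14', Nat.add_sub_cancel]),
        show ζ.reg 15 = ξ.reg 15 from rfl, hξ15]
    rw [hcond]
    refine ⟨fun hlt => ?_, fun hlt => ?_⟩
    · refine (HT_accept hSζ hRζ hξ13 hξ11 hξ15).mono ?_
      rintro t τ ⟨h1, h2, h3⟩
      have hg : ∀ g, s.eng (wm e) = some g → rw e < rw g := fun g' hg => by
        rw [ho] at hg; cases hg; exact hlt
      have hE := hI.engage heT hg
      simp only [ho] at hE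
      exact ⟨by omega, Or.inr ⟨h3.trans hξ6, _, hE.1, by convert h2, hE.2⟩⟩
    · refine (HT_refuse hSζ hRζ hξ13 hξ15).mono ?_
      rintro t τ ⟨h1, h2, h3⟩
      have hE := hI.tie heT ho hne (le_antisymm (hg3 e heT.1 rfl) (not_lt.1 hlt))
      exact ⟨by omega, Or.inr ⟨h3.trans hξ6, _, hE.1, by convert h2, hE.2⟩⟩

theorem HT_proposals {σ : Mem} (hS : Side q N mn wm rm rw ordM ordW ofsM ofsW σ.arr)
    (hlim : σ.reg (cond q 1 0) = c) (h2 : σ.reg 2 = m) (hm : 0 < m)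
    (h0 : ∀ i, 8 ≤ i → ∀ k, σ.arr (ar q i) k = 0) {N₀ : Finset (Fin m)}
    (hN₀ : Stable mn wm rm rw N₀) :
    HT (proposals q) σ (fun t τ => t ≤ 41 * (N * m) ∧ ∃ T : Finset (Fin m),
      Stable mn wm rm rw T ∧
      (∀ N, Stable mn wm rm rw N → ∀ f ∈ N, ∃ e ∈ T, mn e = mn f ∧ rm e ≤ rm f) ∧
      ∀ w : Fin d, (τ.arr (ar q 8) w.val = 0 ∧ ∀ e ∈ T, wm e ≠ w) ∨
        ∃ e ∈ T, wm e = w ∧ τ.arr (ar q 8) w.val = e.val + 1) := by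
  have hN : 0 < N := lt_of_lt_of_le (mn ⟨0, hm⟩).pos hS.hc
  set D₀ : Finset (Fin c) := Finset.univ.image mn with hD₀
  set s₀ : PState (Fin m) (Fin c) (Fin d) := ⟨Finset.univ, fun _ => none, D₀⟩ with hs₀
  rw [proposals, HT_seq]
  refine (HT_for (N := m) (fun k t τ => t ≤ k ∧ AgreeA [4] (ar q 10) σ τ ∧
    ∀ x : Fin c, τ.arr (ar q 10) x.val = if ∃ e : Fin m, e.val < k ∧ mn e = x then 1 else 0)
    rfl rfl (by decide) h2 ?_ ?_).mono ?_
  · refine ⟨le_rfl, (AgreeA.refl _ _ _).setReg (by simp) _, fun x => ?_⟩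
    simp [Mem.setReg, h0]
  · rintro k T τ hk hk4 - - ⟨h5, h6, h7⟩
    rw [HT_put]
    have hv : (Ex.ld (ar q 0) (.r 4)).val τ = (mn ⟨k, hk⟩).val := by
      rw [Ex.val, Ex.val, h6.arr _ (by simp [ar_inj]), hk4]; exact hS.man ⟨k, hk⟩
    rw [hv]
    refine ⟨by omega, (h6.setArr _ _).setReg (by simp) _, fun x => ?_⟩
    rw [Mem.setReg_arr, Mem.setArr_arr, if_pos rfl]
    simp only [Ex.val, Function.update_apply, Fin.val_inj, h7]
    by_cases hx : x = mn ⟨k, hk⟩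
    · rw [if_pos hx, if_pos ⟨⟨k, hk⟩, by simp, hx.symm⟩]
    · rw [if_neg hx]
      congr 1
      refine propext ⟨fun ⟨e, h, h'⟩ => ⟨e, by omega, h'⟩, fun ⟨e, h, h'⟩ => ⟨e, ?_, h'⟩⟩
      rcases Nat.lt_succ_iff_lt_or_eq.1 h with h | h
      · exact h
      · subst h; exact absurd h'.symm hx
  rintro t₁ τ₁ ⟨⟨ht₁, hA₁, hd₁⟩, -⟩
  rw [HT_seq, HT_set]
  set μ := τ₁.setReg 6 1 with hμ
  change HT _ μ _
  have hSμ : Side q N mn wm rm rw ordM ordW ofsM ofsW μ.arr := hS.congr fun i hi =>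
    hA₁.arr i (by rintro rfl; cases q <;> simp [ar] at hi)
  have hRμ : RepP q s₀ μ.arr := by
    refine ⟨fun k => ?_, fun w => ?_, fun x => ?_⟩
    · change τ₁.arr _ _ = _
      rw [hA₁.arr _ (by simp [ar_inj]), h0 _ (by norm_num)]; simp [hs₀]
    · change τ₁.arr _ _ = _
      rw [hA₁.arr _ (by simp [ar_inj]), h0 _ (by norm_num)]; simp [hs₀]
    · change τ₁.arr _ _ = _
      rw [hd₁]
      have : x ∈ s₀.dirty ↔ ∃ e, mn e = x := by simp [hs₀, hD₀]
      simp [this]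
  have hI₀ : PInv mn wm rm rw s₀ := PInv.init D₀ fun e => Finset.mem_image_of_mem _ (Finset.mem_univ e)
  have hc₀ : s₀.R.card = m ∧ s₀.dirty.card ≤ m ∧ engaged s₀ = 0 := by
    refine ⟨by simp [hs₀], (Finset.card_image_le).trans (by simp), by simp [hs₀, engaged]⟩
  have eq : ∀ i, i ∈ [0, 1] → μ.reg i = σ.reg i := fun i hi => by
    rw [hμ, Mem.setReg_reg, if_neg (by rintro rfl; simp at hi), hA₁.reg i (by
      rintro h; simp at hi h; omega)]
  refine (HT_measure (e := .k 0) (f := .r 6) (p := proposeStep q) (fun n t τ =>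
    Frame (proposeStep q) μ τ ∧
    ∃ s, PInv mn wm rm rw s ∧ RepP q s τ.arr ∧ τ.reg 6 ≤ 1 ∧ (τ.reg 6 = 0 → s.dirty = ∅) ∧
      -- Additive form of the measure, which avoids truncated subtraction; the flag in register 6
      -- pays for the last, empty pass. A pass takes at most 4N iterations and one for the loop,
      -- hence the factor 5N.
      n + engaged s = 3 * s.R.card + s.dirty.card + τ.reg 6 ∧
      t + 5 * N * (n + engaged s) ≤ 5 * N * (4 * m + 1 + engaged s)) ?_
      (3 * m + s₀.dirty.card + 1) 0 μ ?_).mono ?_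
  · rintro n T τ ⟨hF, s, hI, hR, h61, h6d, hn, hT⟩ hlt
    simp only [Ex.val] at hlt
    have h61' : τ.reg 6 = 1 := by omega
    have hw : (proposeStep q).wr (cond q 1 0) = false := by cases q <;> rfl
    refine (HT_proposeStep (hSμ.frame hF fun i hi => by
      interval_cases i <;> cases q <;> rfl) hR hI (by
        rw [hF.reg _ hw, eq _ (by cases q <;> simp), hlim]) h61').frame.mono ?_
    rintro t υ ⟨⟨ht, hres⟩, hF'⟩
    rcases hres with ⟨h1, h2, h3⟩ | ⟨h1, s', h2, h3, h4⟩
    · refine ⟨n - 1, ?_, hF.trans hF', s, hI, h3, by omega, fun _ => h2, ?_, ?_⟩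
      · have := hI.engaged_le; omega
      · have := hI.engaged_le; omega
      · have := hI.engaged_le
        obtain ⟨n', rfl⟩ : ∃ n', n = n' + 1 := ⟨n - 1, by omega⟩
        simp only [Nat.add_sub_cancel]
        have : 5 * N * (n' + 1 + engaged s) = 5 * N * (n' + engaged s) + 5 * N := by ring
        omega
    · have hle := h2.engaged_le
      refine ⟨3 * s'.R.card + s'.dirty.card + 1 - engaged s', by omega, hF.trans hF', s', h2, h3,
        by omega, fun h => by omega, by omega, ?_⟩
      have e1 : 3 * s'.R.card + s'.dirty.card + 1 - engaged s' + engaged s' + 1 + engaged s ≤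
        n + engaged s + engaged s' := by omega
      have e2 := Nat.mul_le_mul_left (5 * N) e1
      simp only [Nat.mul_add, Nat.mul_one] at e2 hT ⊢
      omega
  · refine ⟨Frame.refl _ _, s₀, hI₀, hRμ, by simp [hμ, Mem.setReg], fun h => ?_, ?_, ?_⟩
    · simp [hμ, Mem.setReg] at h
    · rw [hc₀.1, hc₀.2.2]; simp [hμ, Mem.setReg]
    · have : 3 * m + s₀.dirty.card + 1 + engaged s₀ ≤ 4 * m + 1 + engaged s₀ := by omega
      have := Nat.mul_le_mul_left (5 * N) this
      omega
  · rintro t τ ⟨hlt, n, hF, s, hI, hR, h61, h6d, hn, hT⟩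
    simp only [Ex.val] at hlt
    have hd := h6d (by omega)
    refine ⟨?_, Finset.univ.filter fun e => s.eng (wm e) = some e, ?_, ?_, fun w => ?_⟩
    · have h1 := hI.engaged_le
      have h2 : s.R.card ≤ m := (Finset.card_le_univ _).trans (by simp)
      have h3 := Nat.mul_le_mul_left (5 * N) (show 4 * m + 1 + engaged s ≤ 6 * m by omega)
      have h4 : m ≤ N * m := Nat.le_mul_of_pos_left _ hN
      have h5 : 5 * N * (6 * m) = 30 * (N * m) := by ring
      omega
    · exact (hI.final hd hN₀ (fun e => by simp)).1
    · exact (hI.final hd hN₀ (fun e => by simp)).2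
    · rw [hR.eng]
      cases ho : s.eng w with
      | none =>
        refine Or.inl ⟨rfl, fun e he => ?_⟩
        rintro rfl
        have := (Finset.mem_filter.1 he).2
        rw [ho] at this
        cases this
      | some e =>
        have := (hI.engOK w e ho).1
        exact Or.inr ⟨e, Finset.mem_filter.2 ⟨Finset.mem_univ _, by rw [this, ho]⟩, this, rfl⟩

end Proposal

end SuperStable

end


/-! ### Representation of the state in memory, and repair of the forest. -/

noncomputable section

open scoped Classical

namespace SuperStable

variable {I : Inst}

/-! ### The state of the algorithm in memory -/

/-- Arrays `10`, `11` hold the edge of the current matching at every man and woman. -/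
structure RepM (L : Layout I) (M : I.EdgeSet) (A : ℕ → ℕ → ℕ) : Prop where
  pm : ∀ x : Fin I.a, (A 10 x.val = 0 ∧ ∀ w, (x, w) ∉ M) ∨
    ∃ k : Fin I.numE, A 10 x.val = k.val + 1 ∧ L.man k = x ∧ (x, L.wom k) ∈ M
  pw : ∀ w : Fin I.b, (A 11 w.val = 0 ∧ ∀ x, (x, w) ∉ M) ∨
    ∃ k : Fin I.numE, A 11 w.val = k.val + 1 ∧ L.wom k = w ∧ (L.man k, w) ∈ M

def RepZ (L : Layout I) (Mz : I.EdgeSet) (A : ℕ → ℕ → ℕ) : Prop :=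
  ∀ x : Fin I.a, (A 12 x.val = 0 ∧ ∀ w, (x, w) ∉ Mz) ∨
    ∃ k : Fin I.numE, A 12 x.val = k.val + 1 ∧ L.man k = x ∧ (x, L.wom k) ∈ Mz

/-- Degrees are stored next to the edge flags, so that the degree conditions of the algorithm are
tested in constant time. -/
structure RepC (L : Layout I) (Ec : I.EdgeSet) (A : ℕ → ℕ → ℕ) : Prop where
  ec : ∀ k : Fin I.numE, A 25 k.val = if (L.man k, L.wom k) ∈ Ec then 1 else 0
  dM : ∀ x : Fin I.a, A 26 x.val = (Ec.filter fun e => e.1 = x).card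
  dW : ∀ w : Fin I.b, A 27 w.val = (Ec.filter fun e => e.2 = w).card

structure RepF (L : Layout I) (F : Forest I) (A : ℕ → ℕ → ℕ) : Prop where
  lab : ∀ y : Fin I.a, A 28 y.val = (F.lab y).val
  out : ∀ y : Fin I.a, (F.out y = none ∧ A 29 y.val = 0) ∨
    ∃ k : Fin I.numE, F.out y = some (L.man k, L.wom k) ∧ A 29 y.val = k.val + 1
  dirty : ∀ y : Fin I.a, A 30 y.val = if y ∈ F.dirty then 1 else 0

/-- The part of the memory that represents the state and the forest. -/
structure Rep (L : Layout I) (Mz : I.EdgeSet) (s : State I) (F : Forest I) (σ : Mem) : Prop where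
  r0 : σ.reg 0 = I.a
  r1 : σ.reg 1 = I.b
  r2 : σ.reg 2 = I.numE
  inp : Inp L σ.arr
  m : RepM L s.M σ.arr
  z : RepZ L Mz σ.arr
  ed : ∀ k : Fin I.numE, σ.arr 23 k.val = if (L.man k, L.wom k) ∈ s.Ed then 1 else 0
  er : ∀ k : Fin I.numE, σ.arr 24 k.val = if (L.man k, L.wom k) ∈ s.Er then 1 else 0
  c : RepC L s.Ec σ.arr
  f : RepF L F σ.arr

section

variable {L : Layout I} {Mz M : I.EdgeSet} {s : State I} {F : Forest I} {σ τ : Mem}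
  {A : ℕ → ℕ → ℕ}

theorem RepM.congr {A' : ℕ → ℕ → ℕ} (h : RepM L M A) (h1 : A' 10 = A 10) (h2 : A' 11 = A 11) :
    RepM L M A' := ⟨by rw [h1]; exact h.pm, by rw [h2]; exact h.pw⟩

theorem RepC.congr {A' : ℕ → ℕ → ℕ} {C : I.EdgeSet} (h : RepC L C A) (h1 : A' 25 = A 25)
    (h2 : A' 26 = A 26) (h3 : A' 27 = A 27) : RepC L C A' :=
  ⟨by rw [h1]; exact h.ec, by rw [h2]; exact h.dM, by rw [h3]; exact h.dW⟩

theorem RepF.congr {A' : ℕ → ℕ → ℕ} (h : RepF L F A) (h1 : A' 28 = A 28)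
    (h2 : A' 29 = A 29) (h3 : A' 30 = A 30) : RepF L F A' :=
  ⟨by rw [h1]; exact h.lab, by rw [h2]; exact h.out, by rw [h3]; exact h.dirty⟩

theorem RepM.pm_eq (h : RepM L M A) (hM : IsMatching I M) {x : Fin I.a} {k : Fin I.numE} :
    A 10 x.val = k.val + 1 ↔ L.man k = x ∧ (x, L.wom k) ∈ M := by
  rcases h.pm x with ⟨h1, h2⟩ | ⟨l, h1, h2, h3⟩
  · exact ⟨fun h => by omega, fun h => absurd h.2 (h2 _)⟩
  · rw [h1, Nat.add_right_cancel_iff, Fin.val_inj]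
    refine ⟨by rintro rfl; exact ⟨h2, h3⟩, fun ⟨h4, h5⟩ => ?_⟩
    exact L.edge_inj (h2.trans h4.symm) (hM.fst h3 h5)

theorem RepM.pw_man (h : RepM L M A) (hi : Inp L A) (hM : IsMatching I M) {w : Fin I.b} {m : Fin I.a}
    (hm : (m, w) ∈ M) : A 0 (A 11 w.val - 1) = m.val := by
  rcases h.pw w with ⟨h1, h2⟩ | ⟨l, h1, h2, h3⟩
  · exact absurd hm (h2 m)
  · rw [h1, Nat.add_sub_cancel, hi.man, hM.snd h3 hm]

theorem RepM.pw_rank (h : RepM L M A) (hi : Inp L A) (hM : IsMatching I M) {w : Fin I.b}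
    {m : Fin I.a} (hm : (m, w) ∈ M) : A 3 (A 11 w.val - 1) = I.rankW w m := by
  rcases h.pw w with ⟨h1, h2⟩ | ⟨l, h1, h2, h3⟩
  · exact absurd hm (h2 m)
  · rw [h1, Nat.add_sub_cancel, hi.rkW, hM.snd h3 hm, h2]

theorem RepF.out_eq (h : RepF L F A) (y : Fin I.a) : A 29 y.val = 0 ↔ F.out y = none := by
  rcases h.out y with ⟨h1, h2⟩ | ⟨k, h1, h2⟩ <;> simp [h1, h2]

/-- The man whose edge in the current matching is stored at the woman of the edge `e`. -/
def rival (e : Ex) : Ex := .ld 0 (.dec (.ld 11 (.ld 1 e)))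

theorem Rep.rival_val (h : Rep L Mz s F σ) (hM : IsMatching I s.M) {e : Ex} {k : Fin I.numE}
    {m : Fin I.a} (he : e.val σ = k.val) (hm : (m, L.wom k) ∈ s.M) : (rival e).val σ = m.val := by
  simp only [rival, Ex.val, he, h.inp.wom]
  exact h.m.pw_man h.inp hM hm

theorem Rep.congr (h : Rep L Mz s F σ) (h1 : τ.arr = σ.arr) (h2 : ∀ i < 3, τ.reg i = σ.reg i) :
    Rep L Mz s F τ := by
  obtain ⟨a1, a2, a3, a4, a5, a6, a7, a8, a9, a10⟩ := h
  refine ⟨?_, ?_, ?_, ?_, ?_, ?_, ?_, ?_, ?_, ?_⟩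
  · rw [h2 _ (by norm_num), a1]
  · rw [h2 _ (by norm_num), a2]
  · rw [h2 _ (by norm_num), a3]
  all_goals rw [h1]; assumption

theorem Rep.agree (h : Rep L Mz s F σ) {ws : List ℕ} (hA : Agree ws σ τ)
    (hw : 0 ∉ ws ∧ 1 ∉ ws ∧ 2 ∉ ws) : Rep L Mz s F τ :=
  h.congr hA.arr fun i hi => hA.reg i (by interval_cases i <;> tauto)

theorem Rep.setReg (h : Rep L Mz s F σ) {x : ℕ} (hx : 3 ≤ x) (v : ℕ) :
    Rep L Mz s F (σ.setReg x v) :=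
  h.congr rfl fun i hi => by rw [Mem.setReg_reg, if_neg (by omega)]

theorem Rep.setForest (h : Rep L Mz s F σ) {F' : Forest I} (hF : RepF L F' τ.arr)
    (h1 : ∀ B, B < 28 → τ.arr B = σ.arr B) (h2 : ∀ i < 3, τ.reg i = σ.reg i) :
    Rep L Mz s F' τ := by
  obtain ⟨a1, a2, a3, a4, a5, a6, a7, a8, a9, a10⟩ := h
  refine ⟨?_, ?_, ?_, a4.congr fun i hi => h1 i (by omega),
    a5.congr (h1 _ (by norm_num)) (h1 _ (by norm_num)), ?_, ?_, ?_,
    a9.congr (h1 _ (by norm_num)) (h1 _ (by norm_num)) (h1 _ (by norm_num)), hF⟩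
  · rw [h2 _ (by norm_num), a1]
  · rw [h2 _ (by norm_num), a2]
  · rw [h2 _ (by norm_num), a3]
  · unfold RepZ; rw [h1 _ (by norm_num)]; exact a6
  · rw [h1 _ (by norm_num)]; exact a7
  · rw [h1 _ (by norm_num)]; exact a8

end

/-! ### Restoring the forest -/

/-- Class reached from the class of register `13` by following an outgoing edge. -/
def advance : St :=
  .ite (.eq (.ld 29 (.r 13)) (.k 0)) .skip (.set 13 (.ld 28 (rival (.dec (.ld 29 (.r 13))))))

def relabel : St :=
  forN 14 0 (ifAll [.eq (.ld 28 (.r 14)) (.r 12)] (.put 28 (.r 14) (.r 15)) .skip)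

def leaveClass : List Cd :=
  [.eq (.ld 23 (.r 10)) (.k 1), .ne (.ld 10 (.r 7)) (.inc (.r 10)),
    .ne (.ld 28 (rival (.r 10))) (.ld 28 (.r 7))]

/-- One repair: a dirty man of a class without a recorded edge is examined. Following pointers for
as many steps as there are men surely reaches the final class (`iterate_card_fixed`); whether this
is his own class decides between merging and recording the edge. All cases cost O(n). -/
def restoreStep : St :=
  findN 4 0 5 [.eq (.ld 30 (.r 4)) (.k 1), .eq (.ld 29 (.ld 28 (.r 4))) (.k 0)] ⨟
  .ite (.eq (.r 5) (.k 0)) (.set 6 (.k 0)) (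
    .set 7 (.dec (.r 5)) ⨟
    minL 4 5 8 9 10 7 11 leaveClass (.lt (.k 0) (.k 0)) ⨟
    .ite (.eq (.r 11) (.k 0)) (.put 30 (.r 7) (.k 0)) (
      .set 12 (.ld 28 (rival (.dec (.r 11)))) ⨟
      .set 13 (.r 12) ⨟
      .set 15 (.ld 28 (.r 7)) ⨟
      forN 14 0 advance ⨟
      .ite (.eq (.r 13) (.r 15)) relabel (.put 29 (.r 15) (.r 11))))

def restore : St := .set 6 (.k 1) ⨟ .whl (.k 0) (.r 6) restoreStep

section

variable {L : Layout I} {Mz : I.EdgeSet} {s : State I} {F : Forest I} {σ : Mem}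

/-- The class reached by following the recorded edge. -/
def Forest.next (F : Forest I) (M : I.EdgeSet) (c : Fin I.a) : Fin I.a :=
  if h : ∃ m e, F.out c = some e ∧ (m, e.2) ∈ M then F.lab h.choose else c

theorem Forest.next_some (hM : IsMatching I s.M) {c m : Fin I.a} {e} (h : F.out c = some e)
    (hm : (m, e.2) ∈ s.M) : F.next s.M c = F.lab m := by
  have hex : ∃ m e, F.out c = some e ∧ (m, e.2) ∈ s.M := ⟨m, e, h, hm⟩
  rw [Forest.next, dif_pos hex]
  obtain ⟨e', h1, h2⟩ := hex.choose_spec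
  rw [h] at h1
  cases h1
  rw [hM.snd h2 hm]

theorem Forest.next_none {M : I.EdgeSet} {c : Fin I.a} (h : F.out c = none) : F.next M c = c := by
  rw [Forest.next, dif_neg]
  rintro ⟨m, e, h1, -⟩
  rw [h] at h1; cases h1

theorem Leads.next_iterate (hM : IsMatching I s.M) {c r : Fin I.a} (h : Leads s F c r) :
    (F.next s.M)^[I.a] c = r := by
  obtain ⟨k, hk⟩ : ∃ k, (F.next s.M)^[k] c = r := by
    induction h with
    | root ℓ h => exact ⟨0, rfl⟩
    | step ℓ e m r h1 h2 h3 ih =>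
      obtain ⟨k, hk⟩ := ih
      exact ⟨k + 1, by rw [Function.iterate_succ_apply, Forest.next_some hM h1 h2, hk]⟩
  exact iterate_card_fixed _ hk (Forest.next_none h.out_eq)

theorem HT_walk (g : Good Mz s) (ok : ForestOK Mz s F) (hR : Rep L Mz s F σ) {c : Fin I.a}
    (hc : F.lab c = c) (h13 : σ.reg 13 = c.val) :
    HT (forN 14 0 advance) σ (fun t τ => t ≤ I.a ∧ Agree [13, 14] σ τ ∧
      τ.reg 13 = ((F.next s.M)^[I.a] c).val) := by
  refine (HT_for (N := I.a) (fun k t τ => t ≤ k ∧ Agree [13, 14] σ τ ∧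
    ∃ d, d = (F.next s.M)^[k] c ∧ F.lab d = d ∧ τ.reg 13 = d.val) rfl rfl (by decide) hR.r0 ?_
    ?_).mono ?_
  · exact ⟨le_rfl, (Agree.refl _ _).setReg (by simp) _, c, rfl, hc, by simpa [Mem.setReg] using h13⟩
  · rintro k T τ hk - - - ⟨hT, hA, d, hd, hdl, hd13⟩
    have hR' := hR.agree hA (by decide)
    rw [advance, HT_ite, HT_skip, HT_set, Function.iterate_succ_apply', ← hd]
    simp only [Cd.holds]
    have e1 : (Ex.ld 29 (.r 13)).val τ = τ.arr 29 d.val := by rw [Ex.val, Ex.val, hd13]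
    refine ⟨fun h => ⟨by omega, hA.setReg (by simp) _, d, ?_, hdl, ?_⟩,
      fun h => ⟨by omega, (hA.setReg (by simp) _).setReg (by simp) _, ?_⟩⟩
    · rw [e1] at h
      rw [Forest.next_none ((hR'.f.out_eq d).1 h)]
    · rw [Mem.setReg_reg, if_neg (by decide), hd13]
    · rw [e1] at h
      rcases hR'.f.out d with ⟨-, h1⟩ | ⟨k, h1, h2⟩
      · exact absurd h1 h
      · obtain ⟨a1, -, -⟩ := ok.outOK _ _ hdl h1
        obtain ⟨m, hm⟩ := g.edM _ _ a1
        refine ⟨F.lab m, (Forest.next_some g.mat h1 hm).symm, ok.idem m, ?_⟩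
        rw [Mem.setReg_reg, if_neg (by decide), Mem.setReg_reg, if_pos rfl]
        have h3 : (Ex.dec (.ld 29 (.r 13))).val τ = k.val := by
          rw [Ex.val, e1, h2, Nat.add_sub_cancel]
        rw [Ex.val, hR'.rival_val g.mat h3 hm, hR'.f.lab]
  · rintro t τ ⟨⟨h1, h2, d, rfl, -, h3⟩, -⟩
    exact ⟨h1, h2, h3⟩

theorem HT_relabel (hR : Rep L Mz s F σ) {c ℓ : Fin I.a} (h12 : σ.reg 12 = c.val)
    (h15 : σ.reg 15 = ℓ.val) :
    HT relabel σ (fun t τ => t ≤ I.a ∧ Rep L Mz s (ForestOK.merge F ℓ c) τ ∧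
      τ.reg 6 = σ.reg 6) := by
  refine (HT_for (N := I.a) (fun k t τ => t ≤ k ∧ AgreeA [14] 28 σ τ ∧ ∀ y : Fin I.a,
    τ.arr 28 y.val = if y.val < k ∧ F.lab y = c then ℓ.val else (F.lab y).val)
    rfl rfl (by decide) hR.r0 ?_ ?_).mono ?_
  · refine ⟨le_rfl, (AgreeA.refl _ _ _).setReg (by simp) _, fun y => ?_⟩
    simp [Mem.setReg, hR.f.lab]
  · rintro k T τ hk hk14 - - ⟨hT, hA, hI⟩
    have h1 : τ.arr 28 k = (F.lab ⟨k, hk⟩).val := by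
      have := hI ⟨k, hk⟩
      simpa using this
    rw [HT_ifAll, HT_put, HT_skip]
    simp only [List.mem_singleton, forall_eq, Cd.holds, Ex.val, hk14, h1, hA.reg 12 (by decide),
      hA.reg 15 (by decide), h12, h15, Fin.val_inj]
    have key : ∀ y : Fin I.a, (y.val < k + 1 ∧ F.lab y = c) ↔
        (y.val < k ∧ F.lab y = c) ∨ (y.val = k ∧ F.lab ⟨k, hk⟩ = c) := by
      intro y
      by_cases hy : y.val = k
      · obtain rfl : y = ⟨k, hk⟩ := Fin.ext hy
        simp
      · have : y.val < k + 1 ↔ y.val < k := by omega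
        simp [hy, this]
    refine ⟨fun h => ⟨by omega, (hA.setArr _ _).setReg (by simp) _, fun y => ?_⟩,
      fun h => ⟨by omega, hA.setReg (by simp) _, fun y => ?_⟩⟩
    · rw [Mem.setReg_arr, Mem.setArr_arr, if_pos rfl, Function.update_apply, hI]
      simp only [key, h, and_true]
      by_cases hy : y.val = k <;> simp [hy]
    · rw [Mem.setReg_arr, hI]
      simp only [key, h, and_false, or_false]
  · rintro t τ ⟨⟨h1, h2, h3⟩, -⟩
    refine ⟨h1, hR.setForest ⟨fun y => ?_, ?_, ?_⟩ (fun B hB => h2.arr B (by omega))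
      (fun i hi => h2.reg i (by simp; omega)), h2.reg 6 (by decide)⟩
    · rw [h3]
      simp only [ForestOK.merge, y.2, true_and]
      split_ifs <;> rfl
    · rw [h2.arr _ (by decide)]; exact hR.f.out
    · rw [h2.arr _ (by decide)]; exact hR.f.dirty

theorem HT_restoreStep (g : Good Mz s) (ok : ForestOK Mz s F) (hR : Rep L Mz s F σ)
    (h6 : σ.reg 6 = 1) :
    HT restoreStep σ (fun t τ => t ≤ 3 * I.numV ∧ ((τ.reg 6 = 0 ∧ F.Clean ∧ Rep L Mz s F τ) ∨
      (τ.reg 6 = 1 ∧ ∃ F', ForestOK Mz s F' ∧ Rep L Mz s F' τ ∧ Psi Mz F' + 1 ≤ Psi Mz F))) := by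
  have hN : I.numV = I.a + I.b := rfl
  rw [restoreStep, HT_seq]
  refine (HT_findN (N := I.a) (fun k => ∃ h : k < I.a, (⟨k, h⟩ : Fin I.a) ∈ F.dirty ∧
    F.out (F.lab ⟨k, h⟩) = none) (by decide) hR.r0 ?_).mono ?_
  · intro k τ hk hA hk4
    have h1 := hR.f.dirty ⟨k, hk⟩
    have h2 := hR.f.lab ⟨k, hk⟩
    simp only at h1 h2
    simp [Cd.holds, Ex.val, hA.arr, hk4, h1, h2, hk, hR.f.out_eq]
  rintro t₁ τ₁ ⟨ht₁, hA₁, hres⟩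
  have hR₁ := hR.agree hA₁ (by decide)
  rw [HT_ite]
  refine ⟨fun h0 => ?_, fun h0 => ?_⟩
  · rw [HT_set]
    refine ⟨by omega, Or.inl ⟨by simp [Mem.setReg, Ex.val], ?_, hR₁.setReg (by decide) _⟩⟩
    simp only [Cd.holds, Ex.val] at h0
    rcases hres with ⟨-, h⟩ | ⟨k, _, h, -⟩
    · exact fun y hy hy' => h y.val y.2 ⟨y.2, hy, hy'⟩
    · omega
  simp only [Cd.holds, Ex.val] at h0
  obtain ⟨y, hy5, hyd, hyr⟩ : ∃ y : Fin I.a, τ₁.reg 5 = y.val + 1 ∧ y ∈ F.dirty ∧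
      F.out (F.lab y) = none := by
    rcases hres with ⟨h, -⟩ | ⟨k, hk, h, _, h'⟩
    · exact absurd h h0
    · exact ⟨⟨k, hk⟩, h, h'⟩
  rw [HT_seq, HT_set]
  simp only [Ex.val, hy5, Nat.add_sub_cancel]
  set μ := τ₁.setReg 7 y.val with hμ
  have hRμ : Rep L Mz s F μ := hR₁.setReg (by decide) _
  have hμ7 : μ.reg 7 = y.val := by simp [hμ, Mem.setReg]
  have hμ6 : μ.reg 6 = 1 := by
    rw [hμ, Mem.setReg_reg, if_neg (by decide), hA₁.reg 6 (by decide), h6]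
  rw [HT_seq]
  refine (HT_minL L.listsM (v := y) (fun f => (y, L.wom f) ∈ s.Ed ∧ (y, L.wom f) ∉ s.M ∧
    ∀ m, (m, L.wom f) ∈ s.M → F.lab m ≠ F.lab y) (fun _ => 0) (by decide)
    hRμ.inp.lstM hRμ.inp.offM hμ7 ?_ ?_).mono ?_
  · intro f τ hf hA hf10
    have hRτ := hRμ.agree hA (by decide)
    simp only [leaveClass, List.mem_cons, List.not_mem_nil, or_false, forall_eq_or_imp, forall_eq,
      Cd.holds]
    have h7 : τ.reg 7 = y.val := (hA.reg 7 (by decide)).trans hμ7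
    have e1 : (Ex.ld 23 (.r 10)).val τ = if (y, L.wom f) ∈ s.Ed then 1 else 0 := by
      rw [Ex.val, Ex.val, hf10, hRτ.ed, hf]
    have e2 : (Ex.ld 10 (.r 7)).val τ ≠ (Ex.inc (.r 10)).val τ ↔ (y, L.wom f) ∉ s.M := by
      rw [Ex.val, Ex.val, Ex.val, Ex.val, h7, hf10, ne_eq, hRτ.m.pm_eq g.mat]
      simp [hf]
    rw [e1, e2]
    by_cases hd : (y, L.wom f) ∈ s.Ed
    · obtain ⟨m, hm⟩ := g.edM _ _ hd
      have e3 : (Ex.ld 28 (rival (.r 10))).val τ = (F.lab m).val := by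
        rw [Ex.val, hRτ.rival_val g.mat (k := f) (by rw [Ex.val, hf10]) hm, hRτ.f.lab]
      have e4 : (Ex.ld 28 (.r 7)).val τ = (F.lab y).val := by
        rw [Ex.val, Ex.val, h7, hRτ.f.lab]
      simp only [hd, if_true, Ex.val, true_and] at e3 e4 ⊢
      rw [e3, e4, ne_eq, Fin.val_inj]
      refine and_congr_right fun _ => ⟨fun h m' hm' => by rwa [g.mat.snd hm' hm], fun h => h m hm⟩
    · simp [hd, Ex.val]
  · intro f g τ _ _ _ _ _ _
    simp [Cd.holds, Ex.val]
  rintro t₂ τ₂ ⟨ht₂, hA₂, hres₂⟩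
  have hd1 := L.degM y
  have hR₂ := hRμ.agree hA₂ (by decide)
  have h₂7 : τ₂.reg 7 = y.val := by rw [hA₂.reg 7 (by decide), hμ7]
  have h₂6 : τ₂.reg 6 = 1 := by rw [hA₂.reg 6 (by decide), hμ6]
  rw [HT_ite]
  refine ⟨fun h0 => ?_, fun h0 => ?_⟩
  · simp only [Cd.holds, Ex.val] at h0
    rw [HT_put]
    have hE := ok.erase_ok hyd (by
      intro w m h1 h2 h3
      rcases hres₂ with ⟨-, h⟩ | ⟨f, -, h, -⟩
      · obtain ⟨k, rfl, rfl⟩ := L.exists_edge (g.subD h1)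
        by_contra hcon
        exact h k rfl ⟨h1, h2, fun m' hm' => by rwa [g.mat.snd hm' h3]⟩
      · omega)
    refine ⟨by omega, Or.inr ⟨h₂6, _, hE.1, ?_, hE.2⟩⟩
    refine hR₂.setForest ⟨fun v => ?_, ?_, fun v => ?_⟩ (fun B hB => ?_) fun i _ => rfl
    · rw [Mem.setArr_arr, if_neg (by decide), hR₂.f.lab]; rfl
    · rw [Mem.setArr_arr, if_neg (by decide)]; exact hR₂.f.out
    · rw [Mem.setArr_arr, if_pos rfl]
      simp only [Ex.val, h₂7, Function.update_apply, Fin.val_inj, hR₂.f.dirty, ForestOK.erase,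
        Finset.mem_erase]
      by_cases hv : v = y <;> simp [hv]
    · rw [Mem.setArr_arr, if_neg (by omega)]
  simp only [Cd.holds, Ex.val] at h0
  obtain ⟨k, hk, hk11, hkd, hkM, hkl⟩ : ∃ k, L.man k = y ∧ τ₂.reg 11 = k.val + 1 ∧
      (y, L.wom k) ∈ s.Ed ∧ (y, L.wom k) ∉ s.M ∧
      ∀ m, (m, L.wom k) ∈ s.M → F.lab m ≠ F.lab y := by
    rcases hres₂ with ⟨h, -⟩ | ⟨f, h1, h2, h3, -⟩
    · exact absurd h h0
    · exact ⟨f, h1, h2, h3⟩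
  obtain ⟨m, hm⟩ := g.edM _ _ hkd
  have hne := hkl m hm
  have e12 : (Ex.ld 28 (rival (.dec (.r 11)))).val τ₂ = (F.lab m).val := by
    rw [Ex.val, hR₂.rival_val g.mat (k := k) (by rw [Ex.val, Ex.val, hk11, Nat.add_sub_cancel]) hm,
      hR₂.f.lab]
  rw [HT_seq, HT_set, e12, HT_seq, HT_set, HT_seq, HT_set, HT_seq]
  simp only [Ex.val, Mem.setReg_arr, Mem.setReg_reg, if_true, if_false, Nat.reduceEqDiff, h₂7,
    hR₂.f.lab]
  set ξ := ((τ₂.setReg 12 (F.lab m).val).setReg 13 (F.lab m).val).setReg 15 (F.lab y).val with hξ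
  have hRξ : Rep L Mz s F ξ :=
    ((hR₂.setReg (by decide) _).setReg (by decide) _).setReg (by decide) _
  refine (HT_walk g ok hRξ (ok.idem m) (by simp [hξ, Mem.setReg])).mono ?_
  rintro t₃ τ₃ ⟨ht₃, hA₃, h13⟩
  have hR₃ := hRξ.agree hA₃ (by decide)
  have h₃12 : τ₃.reg 12 = (F.lab m).val := by
    rw [hA₃.reg 12 (by decide)]; simp [hξ, Mem.setReg]
  have h₃15 : τ₃.reg 15 = (F.lab y).val := by
    rw [hA₃.reg 15 (by decide)]; simp [hξ, Mem.setReg]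
  have h₃6 : τ₃.reg 6 = 1 := by
    rw [hA₃.reg 6 (by decide)]; simpa [hξ, Mem.setReg] using h₂6
  have h₃11 : τ₃.reg 11 = k.val + 1 := by
    rw [hA₃.reg 11 (by decide)]; simpa [hξ, Mem.setReg] using hk11
  obtain ⟨r, hr⟩ := ok.leads m
  rw [hr.next_iterate g.mat] at h13
  rw [HT_ite]
  simp only [Cd.holds, Ex.val, h13, h₃15, Fin.val_inj]
  refine ⟨fun h => ?_, fun h => ?_⟩
  · subst h
    have hE := ok.merge_ok g hyd hyr hkd hkM hm hr hne
    refine (HT_relabel hR₃ h₃12 h₃15).mono ?_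
    rintro t τ ⟨h1, h2, h3⟩
    exact ⟨by omega, Or.inr ⟨h3.trans h₃6, _, hE.1, h2, hE.2⟩⟩
  · rw [HT_put]
    have hE := ok.setOut_ok hyd hyr hkd hkM hm hr h
    refine ⟨by omega, Or.inr ⟨h₃6, _, hE.1, ?_, hE.2⟩⟩
    refine hR₃.setForest ⟨fun v => ?_, fun v => ?_, fun v => ?_⟩ (fun B hB => ?_) fun i _ => rfl
    · rw [Mem.setArr_arr, if_neg (by decide), hR₃.f.lab]; rfl
    · rw [Mem.setArr_arr, if_pos rfl]
      simp only [Ex.val, h₃11, h₃15, Function.update_apply, Fin.val_inj, ForestOK.setOut]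
      by_cases hv : v = F.lab y
      · simp only [hv, if_true]
        exact Or.inr ⟨k, by rw [hk], rfl⟩
      · simp only [hv, if_false]
        exact hR₃.f.out v
    · rw [Mem.setArr_arr, if_neg (by decide), hR₃.f.dirty]; rfl
    · rw [Mem.setArr_arr, if_neg (by omega)]

/-- Each pass costs at most 3n iterations and one for the loop, and is paid by a unit of `Psi`; the
additional unit pays for the last pass, which finds nothing. -/
theorem HT_restore (hV : 0 < I.numV) (g : Good Mz s) (ok : ForestOK Mz s F) (hR : Rep L Mz s F σ) :
    HT restore σ (fun t τ => ∃ F', ForestOK Mz s F' ∧ F'.Clean ∧ Rep L Mz s F' τ ∧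
      t + 4 * I.numV * Psi Mz F' ≤ 4 * I.numV * (Psi Mz F + 1)) := by
  rw [restore, HT_seq, HT_set]
  refine (HT_measure (e := .k 0) (f := .r 6) (p := restoreStep) (fun n t τ => ∃ F',
    ForestOK Mz s F' ∧ Rep L Mz s F' τ ∧ τ.reg 6 ≤ 1 ∧ (τ.reg 6 = 0 → F'.Clean) ∧
      n = Psi Mz F' + τ.reg 6 ∧ t + 4 * I.numV * n ≤ 4 * I.numV * (Psi Mz F + 1)) ?_
      (Psi Mz F + 1) 0 _ ?_).mono ?_
  · rintro n T τ ⟨F', ok', hR', h1, h2, rfl, hT⟩ hlt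
    simp only [Ex.val] at hlt
    have h6 : τ.reg 6 = 1 := by omega
    refine (HT_restoreStep g ok' hR' h6).mono ?_
    rintro t υ ⟨ht, ⟨h3, h4, h5⟩ | ⟨h3, F'', h4, h5, h7⟩⟩
    · refine ⟨_, ?_, F', ok', h5, by omega, fun _ => h4, rfl, ?_⟩
      · omega
      · rw [h6] at hT
        rw [h3]
        have : 4 * I.numV * (Psi Mz F' + 1) = 4 * I.numV * (Psi Mz F' + 0) + 4 * I.numV := by ring
        omega
    · refine ⟨_, ?_, F'', h4, h5, by omega, fun h => by omega, rfl, ?_⟩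
      · omega
      · rw [h6] at hT
        rw [h3]
        have := Nat.mul_le_mul_left (4 * I.numV) h7
        have e1 : 4 * I.numV * (Psi Mz F' + 1) = 4 * I.numV * Psi Mz F' + 4 * I.numV := by ring
        have e2 : 4 * I.numV * (Psi Mz F'' + 1) = 4 * I.numV * Psi Mz F'' + 4 * I.numV := by ring
        omega
  · refine ⟨F, ok, hR.setReg (by decide) _, ?_, fun h => ?_, ?_, by omega⟩ <;>
      simp [Mem.setReg, Ex.val] at *
  · rintro t τ ⟨hlt, n, F', ok', hR', h1, h2, rfl, hT⟩
    simp only [Ex.val] at hlt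
    have h6 : τ.reg 6 = 0 := by omega
    refine ⟨F', ok', h2 h6, hR', ?_⟩
    rw [h6] at hT
    simpa using hT

end

end SuperStable

end


/-! ### Programs for the candidate edges and for scanning a man. -/

noncomputable section

open scoped Classical

namespace SuperStable

variable {I : Inst}

/-! ### Updating the candidate edges -/

/-- `τ` differs from `σ` at most in the registers `ws` and the arrays `as`. -/
structure Agr (ws as : List ℕ) (σ τ : Mem) : Prop where
  reg : ∀ x, x ∉ ws → τ.reg x = σ.reg x
  arr : ∀ B, B ∉ as → τ.arr B = σ.arr B
  out : τ.out = σ.out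

theorem Agr.refl (ws as : List ℕ) (σ : Mem) : Agr ws as σ σ := ⟨fun _ _ => rfl, fun _ _ => rfl, rfl⟩

theorem Agr.trans {ws as : List ℕ} {σ τ υ : Mem} (h : Agr ws as σ τ) (h' : Agr ws as τ υ) :
    Agr ws as σ υ := ⟨fun x hx => (h'.reg x hx).trans (h.reg x hx),
  fun x hx => (h'.arr x hx).trans (h.arr x hx), h'.out.trans h.out⟩

theorem Agr.mono {ws as ws' as' : List ℕ} {σ τ : Mem} (h : Agr ws as σ τ) (h1 : ws ⊆ ws')
    (h2 : as ⊆ as') : Agr ws' as' σ τ :=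
  ⟨fun x hx => h.reg x fun h => hx (h1 h), fun x hx => h.arr x fun h => hx (h2 h), h.out⟩

theorem Agr.setReg {ws as : List ℕ} {σ τ : Mem} (h : Agr ws as σ τ) {x : ℕ} (hx : x ∈ ws) (v : ℕ) :
    Agr ws as σ (τ.setReg x v) := by
  refine ⟨fun y hy => ?_, h.arr, h.out⟩
  rw [Mem.setReg_reg, if_neg (by rintro rfl; exact hy hx), h.reg y hy]

theorem Agr.setArr {ws as : List ℕ} {σ τ : Mem} (h : Agr ws as σ τ) {A : ℕ} (hA : A ∈ as) (i v : ℕ) :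
    Agr ws as σ (τ.setArr A i v) := by
  refine ⟨h.reg, fun B hB => ?_, h.out⟩
  rw [Mem.setArr_arr, if_neg (by rintro rfl; exact hB hA), h.arr B hB]

theorem Inp.agr {L : Layout I} {σ τ : Mem} {ws as : List ℕ} (h : Inp L σ.arr) (hA : Agr ws as σ τ)
    (ha : ∀ i < 8, i ∉ as) : Inp L τ.arr := h.congr fun i hi => hA.arr i (ha i hi)

theorem Agree.agr {ws as : List ℕ} {σ τ : Mem} (h : Agree ws σ τ) : Agr ws as σ τ :=
  ⟨h.reg, fun _ _ => by rw [h.arr], h.out⟩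

theorem AgreeA.agr {ws : List ℕ} {A : ℕ} {σ τ : Mem} (h : AgreeA ws A σ τ) : Agr ws [A] σ τ :=
  ⟨h.reg, fun B hB => h.arr B (by simpa using hB), h.out⟩

theorem ite_one_iff (p : Prop) [Decidable p] : (if p then 1 else 0) = 1 ↔ p := by
  by_cases h : p <;> simp [h]

/-- Delete the edge in register `x` from the candidate edges. -/
def delEc (x : ℕ) : St :=
  ifAll [.eq (.ld 25 (.r x)) (.k 1)] (.put 25 (.r x) (.k 0) ⨟
    .put 26 (.ld 0 (.r x)) (.dec (.ld 26 (.ld 0 (.r x)))) ⨟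
    .put 27 (.ld 1 (.r x)) (.dec (.ld 27 (.ld 1 (.r x))))) .skip

def addEc (x : ℕ) : St :=
  .put 25 (.r x) (.k 1) ⨟
    .put 26 (.ld 0 (.r x)) (.inc (.ld 26 (.ld 0 (.r x)))) ⨟
    .put 27 (.ld 1 (.r x)) (.inc (.ld 27 (.ld 1 (.r x))))

section

variable {L : Layout I} {C : I.EdgeSet} {σ : Mem}

theorem Layout.pair_inj (L : Layout I) {k l : Fin I.numE} :
    (L.man k, L.wom k) = (L.man l, L.wom l) ↔ k = l :=
  ⟨fun h => L.edge_inj (congrArg Prod.fst h) (congrArg Prod.snd h), by rintro rfl; rfl⟩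

theorem HT_delEc {x : ℕ} {k : Fin I.numE} (hi : Inp L σ.arr) (hC : RepC L C σ.arr)
    (hx : σ.reg x = k.val) :
    HT (delEc x) σ (fun t τ => t = 0 ∧ RepC L (C.erase (L.man k, L.wom k)) τ.arr ∧
      Agr [] [25, 26, 27] σ τ) := by
  rw [delEc, HT_ifAll]
  simp only [List.mem_singleton, forall_eq, Cd.holds, Ex.val, hx, hC.ec]
  rw [ite_one_iff]
  refine ⟨fun h => ?_, fun h => ?_⟩
  · simp only [HT_seq, HT_put, Ex.val, Mem.setArr_reg, hx, Mem.setArr_arr, Nat.reduceEqDiff, if_false,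
      hi.man, hi.wom, OfNat.zero_ne_ofNat, OfNat.one_ne_ofNat]
    refine ⟨trivial, ⟨fun l => ?_, fun y => ?_, fun w => ?_⟩,
      (((Agr.refl _ _ _).setArr (by simp) _ _).setArr (by simp) _ _).setArr (by simp) _ _⟩
    · simp only [Mem.setArr_arr, Nat.reduceEqDiff, if_true, if_false, Function.update_apply,
        Fin.val_inj, hC.ec, Finset.mem_erase, ne_eq, L.pair_inj]
      by_cases hl : l = k <;> simp [hl]
    · simp only [Mem.setArr_arr, Nat.reduceEqDiff, if_true, if_false, Function.update_apply,
        Fin.val_inj, hC.dM, Finset.filter_erase]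
      by_cases hy : y = L.man k
      · subst hy
        rw [if_pos rfl, Finset.card_erase_of_mem (by simp [h])]
      · rw [if_neg hy, Finset.erase_eq_of_notMem]
        intro h'
        exact hy (Finset.mem_filter.1 h').2.symm
    · simp only [Mem.setArr_arr, Nat.reduceEqDiff, if_true, if_false, Function.update_apply,
        Fin.val_inj, hC.dW, Finset.filter_erase]
      by_cases hy : w = L.wom k
      · subst hy
        rw [if_pos rfl, Finset.card_erase_of_mem (by simp [h])]
      · rw [if_neg hy, Finset.erase_eq_of_notMem]
        intro h'
        exact hy (Finset.mem_filter.1 h').2.symm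
  · rw [HT_skip, Finset.erase_eq_of_notMem h]
    exact ⟨rfl, hC, Agr.refl _ _ _⟩

theorem HT_addEc {x : ℕ} {k : Fin I.numE} (hi : Inp L σ.arr) (hC : RepC L C σ.arr)
    (hx : σ.reg x = k.val) (h : (L.man k, L.wom k) ∉ C) :
    HT (addEc x) σ (fun t τ => t = 0 ∧ RepC L (insert (L.man k, L.wom k) C) τ.arr ∧
      Agr [] [25, 26, 27] σ τ) := by
  rw [addEc]
  simp only [HT_seq, HT_put, Ex.val, Mem.setArr_reg, hx, Mem.setArr_arr, Nat.reduceEqDiff, if_false,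
    hi.man, hi.wom, OfNat.zero_ne_ofNat, OfNat.one_ne_ofNat]
  refine ⟨trivial, ⟨fun l => ?_, fun y => ?_, fun w => ?_⟩,
    (((Agr.refl _ _ _).setArr (by simp) _ _).setArr (by simp) _ _).setArr (by simp) _ _⟩
  · simp only [Mem.setArr_arr, Nat.reduceEqDiff, if_true, if_false, Function.update_apply,
      Fin.val_inj, hC.ec, Finset.mem_insert, L.pair_inj]
    by_cases hl : l = k <;> simp [hl]
  · simp only [Mem.setArr_arr, Nat.reduceEqDiff, if_true, if_false, Function.update_apply,
      Fin.val_inj, hC.dM, Finset.filter_insert]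
    by_cases hy : y = L.man k
    · subst hy
      rw [if_pos rfl, if_pos rfl, Finset.card_insert_of_notMem fun h' => h (Finset.mem_filter.1 h').1]
    · rw [if_neg hy, if_neg (Ne.symm hy)]
  · simp only [Mem.setArr_arr, Nat.reduceEqDiff, if_true, if_false, Function.update_apply,
      Fin.val_inj, hC.dW, Finset.filter_insert]
    by_cases hy : w = L.wom k
    · subst hy
      rw [if_pos rfl, if_pos rfl, Finset.card_insert_of_notMem fun h' => h (Finset.mem_filter.1 h').1]
    · rw [if_neg hy, if_neg (Ne.symm hy)]

/-- Delete the candidate edges at the woman in register `x` that satisfy the conditions. -/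
def delL (x : ℕ) (cs : List Cd) : St := forL 6 7 8 9 10 x (ifAll cs (delEc 10) .skip)

theorem HT_delL {x : ℕ} {cs : List Cd} {w : Fin I.b} (P : Fin I.a → Prop) (hi : Inp L σ.arr)
    (hC : RepC L C σ.arr) (hE : C ⊆ I.E) (hx : σ.reg x = w.val) (hne : 8 ≠ x)
    (hc : ∀ f τ, L.wom f = w → Agr [8, 9, 10] [25, 26, 27] σ τ → τ.reg 10 = f.val →
      ((∀ c ∈ cs, c.holds τ) ↔ P (L.man f))) :
    HT (delL x cs) σ (fun t τ => t ≤ I.a ∧ Agr [8, 9, 10] [25, 26, 27] σ τ ∧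
      RepC L (C.filter fun e => ¬ (e.2 = w ∧ P e.1)) τ.arr) := by
  refine (HT_list L.listsW (v := w) (fun D t τ => t ≤ D.card ∧ Agr [8, 9, 10] [25, 26, 27] σ τ ∧
      RepC L (C.filter fun e => ¬ ∃ f ∈ D, e = (L.man f, L.wom f) ∧ P e.1) τ.arr)
      (ifAll_wa rfl rfl) (ifAll_wr rfl rfl) (ifAll_wr rfl rfl) ⟨by decide, hne, by decide, by decide⟩
      hi.lstW hi.offW hx ?_ ?_).mono ?_
  · intro y z
    refine ⟨le_rfl, ((Agr.refl _ _ σ).setReg (by simp) _).setReg (by simp) _, ?_⟩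
    simpa [Mem.setReg_arr] using hC
  · rintro D T τ f - hfD hf - ⟨hT, hA, hI⟩
    have hA2 : Agr [8, 9, 10] [25, 26, 27] σ (τ.setReg 10 f.val) := hA.setReg (by simp) _
    have hcard : (insert f D).card = D.card + 1 := Finset.card_insert_of_notMem hfD
    have hef : (τ.setReg 10 f.val).reg 10 = f.val := by rw [Mem.setReg_reg, if_pos rfl]
    rw [HT_ifAll, hc f _ hf hA2 hef, HT_skip]
    refine ⟨fun hP => (HT_delEc (hi.agr hA2 (by decide)) hI hef).mono ?_,
      fun hP y => ⟨by omega, hA2.setReg (by simp) _, ?_⟩⟩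
    · rintro t υ ⟨rfl, h1, h2⟩ y
      refine ⟨by omega, (hA2.trans (h2.mono (by simp) (by simp))).setReg (by simp) _, ?_⟩
      rw [Mem.setReg_arr]
      convert h1 using 1
      ext e
      simp only [Finset.mem_filter, Finset.mem_erase, Finset.mem_insert, exists_eq_or_imp, not_or,
        ne_eq, not_and]
      constructor
      · rintro ⟨h3, h4, h5⟩
        refine ⟨fun h => h4 h (by rw [h]; exact hP), h3, h5⟩
      · rintro ⟨h3, h4, h5⟩
        exact ⟨h4, fun h => absurd h h3, h5⟩
    · rw [Mem.setReg_arr, Mem.setReg_arr]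
      convert hI using 1
      ext e
      simp only [Finset.mem_filter, Finset.mem_insert, exists_eq_or_imp, not_or, not_and]
      refine and_congr_right fun _ => ⟨fun h => h.2, fun h => ⟨fun h' => ?_, h⟩⟩
      rw [h']; exact hP
  · rintro t τ ⟨⟨h1, h2, h3⟩, -⟩
    refine ⟨h1.trans (L.degW w), h2, ?_⟩
    convert h3 using 1
    ext e
    simp only [Finset.mem_filter, Finset.mem_univ, true_and]
    refine and_congr_right fun he => not_congr ⟨fun h => ?_, fun ⟨f, h4, h5, h6⟩ => ?_⟩
    · obtain ⟨k, h4, h5⟩ := L.exists_edge (m := e.1) (w := e.2) (hE he)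
      exact ⟨k, h5.trans h.1, by rw [h4, h5], h.2⟩
    · refine ⟨by rw [h5]; exact h4, h6⟩

end

/-! ### Scanning a man -/

def scanMark : St :=
  minL 4 5 8 9 10 23 24 [.eq (.ld 24 (.r 10)) (.k 1)]
    (.lt (.ld 2 (.r 10)) (.ld 2 (.dec (.r 24)))) ⨟
  .set 25 (.ld 2 (.dec (.r 24))) ⨟
  putL 4 5 8 9 10 23 23 1 [.eq (.ld 24 (.r 10)) (.k 1), .eq (.ld 2 (.r 10)) (.r 25)] ⨟
  .put 30 (.r 23) (.k 1)

/-- Only the preference of the woman is tested. The condition on the man holds for every unprocessed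
edge by `rkR`. -/
def scanEdge : St :=
  .put 24 (.r 28) (.k 0) ⨟ .set 29 (.ld 1 (.r 28)) ⨟
  ifAll [.lt (.ld 3 (.r 28)) (.ld 3 (.dec (.ld 11 (.r 29))))]
    (addEc 28 ⨟ delL 29 [.lt (.ld 3 (.r 28)) (.ld 3 (.r 10))]) .skip

def scanFinish : St :=
  forL 4 5 26 27 28 23
    (ifAll [.eq (.ld 24 (.r 28)) (.k 1), .eq (.ld 2 (.r 28)) (.r 25)] scanEdge .skip)

section

variable {L : Layout I} {Mz : I.EdgeSet} {s : State I} {F : Forest I} {σ : Mem} {x : Fin I.a}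

open Good

/-- `v` is the rank of the top choices. -/
def TopRank (s : State I) (x : Fin I.a) (v : ℕ) : Prop :=
  ∀ w, (x, w) ∈ s.Er → (I.rankM x w = v ↔ (x, w) ∈ topChoices s x)

theorem HT_scanMark (g : Good Mz s) (hR : Rep L Mz s F σ) (hc : CanScan Mz s x)
    (h23 : σ.reg 23 = x.val) :
    HT scanMark σ (fun t τ => t ≤ 2 * I.b ∧ Rep L Mz (addTop s x) (ForestOK.mark F x) τ ∧
      τ.reg 23 = x.val ∧ TopRank s x (τ.reg 25)) := by
  rw [scanMark, HT_seq]
  refine (HT_minL L.listsM (v := x) (fun f => (x, L.wom f) ∈ s.Er)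
    (fun f => (I.rankM x (L.wom f) : ℤ)) (by decide) hR.inp.lstM hR.inp.offM h23 ?_ ?_).mono ?_
  · intro f τ hf hA hf10
    simp only [List.mem_singleton, forall_eq, Cd.holds, Ex.val, hA.arr, hf10, hR.er, hf, ite_one_iff]
  · intro f g' τ hf hg _ hA hf10 hg24
    simp only [Cd.holds, Ex.val, hA.arr, hf10, hg24, Nat.add_sub_cancel, hR.inp.rkM, hf, hg]
    omega
  rintro t₁ τ₁ ⟨ht₁, hA₁, hres⟩
  have hR₁ := hR.agree hA₁ (by decide)
  obtain ⟨f, hf, hf24, hfR, hmin⟩ : ∃ f, L.man f = x ∧ τ₁.reg 24 = f.val + 1 ∧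
      (x, L.wom f) ∈ s.Er ∧ ∀ w, (x, w) ∈ s.Er → I.rankM x (L.wom f) ≤ I.rankM x w := by
    obtain ⟨w, -, hw⟩ := canScan_mz g hc
    rcases hres with ⟨-, h⟩ | ⟨f, h1, h2, h3, h4⟩
    · obtain ⟨k, rfl, rfl⟩ := L.exists_edge (g.subR hw)
      exact absurd hw (h k rfl)
    · refine ⟨f, h1, h2, h3, fun w hw => ?_⟩
      obtain ⟨k, h5, rfl⟩ := L.exists_edge (g.subR hw)
      have := h4 k h5 hw
      omega
  have htop : TopRank s x (I.rankM x (L.wom f)) := by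
    intro w hw
    rw [mem_topChoices]
    refine ⟨fun h => ⟨hw, rfl, fun w' hw' => h ▸ hmin w' hw'⟩, fun h => ?_⟩
    exact le_antisymm (h.2.2 _ hfR) (hmin _ hw)
  have h25 : (Ex.ld 2 (.dec (.r 24))).val τ₁ = I.rankM x (L.wom f) := by
    simp only [Ex.val, hf24, Nat.add_sub_cancel, hR₁.inp.rkM, hf]
  rw [HT_seq, HT_set, h25]
  set μ := τ₁.setReg 25 (I.rankM x (L.wom f)) with hμ
  have hRμ : Rep L Mz s F μ := hR₁.setReg (by decide) _
  have hμ25 : μ.reg 25 = I.rankM x (L.wom f) := by simp [hμ, Mem.setReg]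
  have hμ23 : μ.reg 23 = x.val := by
    rw [hμ, Mem.setReg_reg, if_neg (by decide), hA₁.reg 23 (by decide), h23]
  rw [HT_seq]
  refine (HT_putL L.listsM (v := x) (fun f => (x, L.wom f) ∈ topChoices s x) (by decide)
    (by decide) hRμ.inp.lstM hRμ.inp.offM hμ23 ?_).mono ?_
  · intro e τ he hA he10
    simp only [List.mem_cons, List.not_mem_nil, or_false, forall_eq_or_imp, forall_eq, Cd.holds,
      Ex.val, hA.arr 24 (by decide), hA.arr 2 (by decide), he10, hRμ.er, ite_one_iff,
      hA.reg 25 (by decide), hμ25, hRμ.inp.rkM, he]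
    exact ⟨fun h => (htop _ h.1).1 h.2, fun h =>
      ⟨(mem_topChoices.1 h).1, (htop _ (mem_topChoices.1 h).1).2 h⟩⟩
  rintro t₂ τ₂ ⟨ht₂, hA₂, hed⟩
  have hd := L.degM x
  rw [HT_put]
  have h₂23 : τ₂.reg 23 = x.val := by rw [hA₂.reg 23 (by decide), hμ23]
  have harr : ∀ B, B ≠ 23 → B ≠ 30 →
      (τ₂.setArr 30 ((Ex.r 23).val τ₂) ((Ex.k 1).val τ₂)).arr B = μ.arr B := fun B h1 h2 => by
    rw [Mem.setArr_arr, if_neg h2, hA₂.arr B h1]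
  refine ⟨by omega, ⟨?_, ?_, ?_, ?_, ?_, ?_, ?_, ?_, ?_, ?_⟩, h₂23, ?_⟩
  · rw [Mem.setArr_reg, hA₂.reg 0 (by decide), hRμ.r0]
  · rw [Mem.setArr_reg, hA₂.reg 1 (by decide), hRμ.r1]
  · rw [Mem.setArr_reg, hA₂.reg 2 (by decide), hRμ.r2]
  · exact hRμ.inp.congr fun i hi => harr i (by omega) (by omega)
  · exact hRμ.m.congr (harr _ (by decide) (by decide)) (harr _ (by decide) (by decide))
  · unfold RepZ; rw [harr _ (by decide) (by decide)]; exact hRμ.z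
  · intro k
    rw [Mem.setArr_arr, if_neg (by decide), hed, hRμ.ed]
    have : (L.man k, L.wom k) ∈ (addTop s x).Ed ↔ (L.man k, L.wom k) ∈ s.Ed ∨
        (L.man k = x ∧ (x, L.wom k) ∈ topChoices s x) := by
      rw [addTop, Finset.mem_union, mem_topChoices, mem_topChoices]
      refine or_congr_right ⟨fun ⟨h1, h2, h3⟩ => ?_, fun ⟨h1, h2, _, h3⟩ => ?_⟩
      · exact ⟨h2, h2 ▸ h1, rfl, h3⟩
      · exact ⟨h1.symm ▸ h2, h1, h3⟩
    simp only [this]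
    by_cases h1 : L.man k = x ∧ (x, L.wom k) ∈ topChoices s x <;> simp [h1]
  · intro k
    rw [harr _ (by decide) (by decide)]; exact hRμ.er k
  · exact hRμ.c.congr (harr _ (by decide) (by decide)) (harr _ (by decide) (by decide))
      (harr _ (by decide) (by decide))
  · refine ⟨fun y => ?_, fun y => ?_, fun y => ?_⟩
    · rw [harr _ (by decide) (by decide)]; exact hRμ.f.lab y
    · rw [harr _ (by decide) (by decide)]; exact hRμ.f.out y
    · rw [Mem.setArr_arr, if_pos rfl, Function.update_apply, hA₂.arr 30 (by decide), hRμ.f.dirty]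
      simp only [Ex.val, h₂23, Fin.val_inj, ForestOK.mark, Finset.mem_insert]
      by_cases hy : y = x <;> simp [hy]
  · rw [Mem.setArr_reg, hA₂.reg 25 (by decide), hμ25]; exact htop

end

end SuperStable

end


noncomputable section

open scoped Classical

namespace SuperStable

variable {I : Inst} {L : Layout I} {Mz : I.EdgeSet} {s : State I} {F : Forest I} {σ : Mem}
  {x : Fin I.a}

open Good

/-- The candidate edges after the top choices with numbers in `D` have been treated. -/
def partEc (L : Layout I) (s : State I) (x : Fin I.a) (D : Finset (Fin I.numE)) : I.EdgeSet :=
  (s.Ec ∪ (scanAdded s x).filter fun e => ∃ f ∈ D, e = (L.man f, L.wom f)).filter fun e =>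
    ¬ ∃ f ∈ (scanAdded s x).filter (fun e => ∃ f ∈ D, e = (L.man f, L.wom f)),
      f.2 = e.2 ∧ I.rankW e.2 f.1 < I.rankW e.2 e.1

theorem mem_scanAdded_fst {e} (h : e ∈ scanAdded s x) : e.1 = x :=
  (mem_topChoices.1 (Finset.mem_filter.1 h).1).2.1

/-- All added edges belong to one man, so there is at most one per woman and no added edge dominates
another. Adding them one by one, with the deletions each of them causes, therefore agrees with the
simultaneous update. -/
theorem partEc_insert {D : Finset (Fin I.numE)} {f : Fin I.numE}
    (h : (L.man f, L.wom f) ∈ scanAdded s x) :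
    partEc L s x (insert f D) = (insert (L.man f, L.wom f) (partEc L s x D)).filter fun e =>
      ¬ (e.2 = L.wom f ∧ I.rankW (L.wom f) x < I.rankW (L.wom f) e.1) := by
  have hx : L.man f = x := mem_scanAdded_fst h
  ext ⟨y, w⟩
  simp only [partEc, Finset.mem_filter, Finset.mem_union, Finset.mem_insert, exists_eq_or_imp]
  constructor
  · rintro ⟨h1, h2⟩
    refine ⟨?_, ?_⟩
    · rcases h1 with h1 | ⟨h1, h3 | h3⟩
      · exact Or.inr ⟨Or.inl h1, fun ⟨f', h4, h5⟩ => h2 ⟨f', ⟨h4.1, Or.inr h4.2⟩, h5⟩⟩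
      · exact Or.inl h3
      · exact Or.inr ⟨Or.inr ⟨h1, h3⟩, fun ⟨f', h4, h5⟩ => h2 ⟨f', ⟨h4.1, Or.inr h4.2⟩, h5⟩⟩
    · rintro ⟨rfl, h3⟩
      exact h2 ⟨_, ⟨h, Or.inl rfl⟩, rfl, by simpa [hx] using h3⟩
  · rintro ⟨h1, h2⟩
    rcases h1 with h1 | ⟨h1, h3⟩
    · refine ⟨Or.inr ⟨h1 ▸ h, Or.inl h1⟩, ?_⟩
      rintro ⟨f', h4, h5, h6⟩
      have := mem_scanAdded_fst h4.1
      obtain ⟨rfl, rfl⟩ := Prod.mk.inj h1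
      rw [this, hx] at h6
      exact lt_irrefl _ h6
    · refine ⟨h1.imp_right fun h => ⟨h.1, Or.inr h.2⟩, ?_⟩
      rintro ⟨f', ⟨h4, rfl | h5⟩, h6, h7⟩
      · dsimp only at h6 h7
        subst h6
        exact h2 ⟨rfl, by simpa [hx] using h7⟩
      · exact h3 ⟨f', ⟨h4, h5⟩, h6, h7⟩

theorem partEc_insert_not {D : Finset (Fin I.numE)} {f : Fin I.numE}
    (h : (L.man f, L.wom f) ∉ scanAdded s x) : partEc L s x (insert f D) = partEc L s x D := by
  have : (scanAdded s x).filter (fun e => ∃ f' ∈ insert f D, e = (L.man f', L.wom f')) =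
      (scanAdded s x).filter (fun e => ∃ f' ∈ D, e = (L.man f', L.wom f')) := by
    refine Finset.filter_congr fun e he => ?_
    simp only [Finset.mem_insert, exists_eq_or_imp, or_iff_right_iff_imp]
    rintro rfl
    exact absurd he h
  unfold partEc
  rw [this]

theorem partEc_sub (g : Good Mz s) (D : Finset (Fin I.numE)) : partEc L s x D ⊆ I.E := by
  intro e he
  rcases Finset.mem_union.1 (Finset.mem_filter.1 he).1 with h | h
  · exact g.subC h
  · exact g.subR (Finset.mem_filter.1 (Finset.mem_filter.1 (Finset.mem_filter.1 h).1).1).1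

theorem HT_scanEdge (g : Good Mz s) (g₁ : Good Mz (addTop s x)) (hc : CanScan Mz s x)
    {D : Finset (Fin I.numE)} {f : Fin I.numE} (hf : (L.man f, L.wom f) ∈ topChoices s x)
    (hD : f ∉ D) (hi : Inp L σ.arr) (hm : RepM L s.M σ.arr) (h28 : σ.reg 28 = f.val)
    (hC : RepC L (partEc L s x D) σ.arr) :
    HT scanEdge σ (fun t τ => t ≤ I.a ∧ RepC L (partEc L s x (insert f D)) τ.arr ∧
      Agr [8, 9, 10, 29] [24, 25, 26, 27] σ τ ∧
      τ.arr 24 = Function.update (σ.arr 24) f.val 0) := by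
  obtain ⟨h1, h2, -⟩ := mem_topChoices.1 hf
  obtain ⟨m, hm'⟩ := g₁.edM _ _ (Finset.mem_union_right _ hf)
  rw [scanEdge, HT_seq, HT_put, HT_seq, HT_set]
  simp only [Ex.val, h28, Mem.setArr_reg, Mem.setArr_arr, OfNat.one_ne_ofNat, if_false, hi.wom]
  set μ := (σ.setArr 24 f.val 0).setReg 29 (L.wom f).val with hμ
  have hA : Agr [8, 9, 10, 29] [24, 25, 26, 27] σ μ :=
    ((Agr.refl _ _ _).setArr (by simp) _ _).setReg (by simp) _
  have h24 : μ.arr 24 = Function.update (σ.arr 24) f.val 0 := by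
    rw [hμ, Mem.setReg_arr, Mem.setArr_arr, if_pos rfl]
  have hμ29 : μ.reg 29 = (L.wom f).val := by simp [hμ, Mem.setReg]
  have hμ28 : μ.reg 28 = f.val := by rw [hA.reg 28 (by decide), h28]
  have hoff : ∀ B, B ≠ 24 → μ.arr B = σ.arr B := fun B hB => by
    rw [hμ, Mem.setReg_arr, Mem.setArr_arr, if_neg hB]
  have hiμ : Inp L μ.arr := hi.agr hA (by decide)
  have hCμ : RepC L (partEc L s x D) μ.arr :=
    hC.congr (hoff _ (by decide)) (hoff _ (by decide)) (hoff _ (by decide))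
  have hmμ : RepM L s.M μ.arr := hm.congr (hoff _ (by decide)) (hoff _ (by decide))
  rw [HT_ifAll]
  have hcond : (∀ c ∈ [Cd.lt (.ld 3 (.r 28)) (.ld 3 (.dec (.ld 11 (.r 29))))], c.holds μ) ↔
      (L.man f, L.wom f) ∈ scanAdded s x := by
    simp only [List.mem_singleton, forall_eq, Cd.holds, Ex.val, hμ28, hμ29, hiμ.rkW]
    rw [hmμ.pw_rank hiμ g.mat hm', scanAdded, Finset.mem_filter, Candidate]
    constructor
    · refine fun h => ⟨hf, ⟨m, hm', h⟩, ?_⟩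
      exact g.rkR _ _ h1
    · rintro ⟨-, ⟨m', h3, h4⟩, -⟩
      rwa [g.mat.snd h3 hm'] at h4
  rw [hcond, HT_seq, HT_skip]
  refine ⟨fun h => ?_, fun h => ⟨by omega, by rwa [partEc_insert_not h], hA, h24⟩⟩
  have hnot : (L.man f, L.wom f) ∉ partEc L s x D := by
    intro h'
    rcases Finset.mem_union.1 (Finset.mem_filter.1 h').1 with h3 | h3
    · exact hc.2.1 _ (h2 ▸ h3)
    · obtain ⟨f', h4, h5⟩ := (Finset.mem_filter.1 h3).2
      exact hD (L.pair_inj.1 h5 ▸ h4)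
  refine (HT_addEc hiμ hCμ hμ28 hnot).mono ?_
  rintro t τ ⟨rfl, h3, h4⟩
  have hE : insert (L.man f, L.wom f) (partEc L s x D) ⊆ I.E := by
    intro e he
    rcases Finset.mem_insert.1 he with rfl | he
    · exact L.mem_E f
    · exact partEc_sub g D he
  have hiτ : Inp L τ.arr := hiμ.agr h4 (by decide)
  have hτ : ∀ i, τ.reg i = μ.reg i := fun i => h4.reg i (by simp)
  refine (HT_delL (w := L.wom f) (fun y => I.rankW (L.wom f) x < I.rankW (L.wom f) y) hiτ h3 hE
    ((hτ 29).trans hμ29) (by decide) ?_).mono ?_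
  · intro f' υ hf' hυ hf10
    have hiυ := hiτ.agr hυ (by decide)
    simp only [List.mem_singleton, forall_eq, Cd.holds, Ex.val, hυ.reg 28 (by decide), hτ, hμ28,
      hf10, hiυ.rkW, hf', ← h2]
  · rintro u υ ⟨h5, h6, h7⟩
    refine ⟨by omega, ?_, hA.trans ((h4.mono (by simp) (by simp)).trans (h6.mono (by simp)
      (by simp))), ?_⟩
    · rw [partEc_insert h]; convert h7
    · rw [h6.arr 24 (by decide), h4.arr 24 (by decide), h24]

theorem HT_scanFinish (g : Good Mz s) (g₁ : Good Mz (addTop s x)) (hc : CanScan Mz s x)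
    (hR : Rep L Mz (addTop s x) F σ) (h23 : σ.reg 23 = x.val) (htop : TopRank s x (σ.reg 25)) :
    HT scanFinish σ (fun t τ => t ≤ I.b + I.a * (topChoices s x).card ∧
      Rep L Mz (scanDone s x) F τ) := by
  let TD : Finset (Fin I.numE) → I.EdgeSet := fun D =>
    (topChoices s x).filter fun e => ∃ f ∈ D, e = (L.man f, L.wom f)
  have hTD : ∀ D f, f ∉ D → (L.man f, L.wom f) ∈ topChoices s x →
      TD (insert f D) = insert (L.man f, L.wom f) (TD D) ∧ (L.man f, L.wom f) ∉ TD D := by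
    intro D f hfD hf
    constructor
    · ext e
      simp only [TD, Finset.mem_filter, Finset.mem_insert, exists_eq_or_imp]
      constructor
      · rintro ⟨h1, h2 | h2⟩
        · exact Or.inl h2
        · exact Or.inr ⟨h1, h2⟩
      · rintro (rfl | ⟨h1, h2⟩)
        · exact ⟨hf, Or.inl rfl⟩
        · exact ⟨h1, Or.inr h2⟩
    · intro h
      obtain ⟨f', h1, h2⟩ := (Finset.mem_filter.1 h).2
      exact hfD (L.pair_inj.1 h2 ▸ h1)
  have hTD' : ∀ D f, (L.man f, L.wom f) ∉ topChoices s x → TD (insert f D) = TD D := by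
    intro D f hf
    ext e
    simp only [TD, Finset.mem_filter, Finset.mem_insert, exists_eq_or_imp]
    refine and_congr_right fun he => or_iff_right_iff_imp.2 ?_
    rintro rfl
    exact absurd he hf
  have hnA : ∀ f, (L.man f, L.wom f) ∉ topChoices s x → (L.man f, L.wom f) ∉ scanAdded s x :=
    fun f h h' => h (Finset.mem_filter.1 h').1
  refine (HT_list L.listsM (v := x) (fun D t τ => t ≤ D.card + I.a * (TD D).card ∧
      Agr [8, 9, 10, 26, 27, 28, 29] [24, 25, 26, 27] σ τ ∧
      RepC L (partEc L s x D) τ.arr ∧ ∀ k : Fin I.numE, τ.arr 24 k.val =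
        if (L.man k, L.wom k) ∈ s.Er \ TD D then 1 else 0)
      rfl rfl rfl (by decide) hR.inp.lstM hR.inp.offM h23 ?_ ?_).mono ?_
  · intro y z
    refine ⟨by simp, ((Agr.refl _ _ σ).setReg (by simp) _).setReg (by simp) _, ?_, fun k => ?_⟩
    · have : partEc L s x ∅ = s.Ec := by simp [partEc]
      rw [this]; exact hR.c
    · have : TD ∅ = ∅ := by simp [TD]
      rw [this, Finset.sdiff_empty]
      exact hR.er k
  · rintro D T τ f hDv hfD hf - ⟨hT, hA, hC, hEr⟩
    have hA2 : Agr [8, 9, 10, 26, 27, 28, 29] [24, 25, 26, 27] σ (τ.setReg 28 f.val) :=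
      hA.setReg (by simp) _
    have hcard : (insert f D).card = D.card + 1 := Finset.card_insert_of_notMem hfD
    have h28 : (τ.setReg 28 f.val).reg 28 = f.val := by rw [Mem.setReg_reg, if_pos rfl]
    have hi2 := hR.inp.agr hA2 (by decide)
    have hcond : (∀ c ∈ [Cd.eq (.ld 24 (.r 28)) (.k 1), .eq (.ld 2 (.r 28)) (.r 25)],
        c.holds (τ.setReg 28 f.val)) ↔ (L.man f, L.wom f) ∈ topChoices s x := by
      simp only [List.mem_cons, List.not_mem_nil, or_false, forall_eq_or_imp, forall_eq, Cd.holds,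
        Ex.val, h28, hi2.rkM, hA2.reg 25 (by decide)]
      rw [Mem.setReg_arr, hEr, ite_one_iff, Finset.mem_sdiff, hf]
      constructor
      · rintro ⟨⟨h1, -⟩, h2⟩
        exact (htop _ h1).1 h2
      · intro h
        have h1 := (mem_topChoices.1 h).1
        refine ⟨⟨h1, ?_⟩, (htop _ h1).2 h⟩
        have := (hTD D f hfD (hf.symm ▸ h)).2
        rwa [hf] at this
    rw [HT_ifAll, hcond, HT_skip]
    refine ⟨fun h => ?_, fun h y => ⟨?_, hA2.setReg (by simp) _, ?_, fun k => ?_⟩⟩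
    · have hm2 : RepM L s.M (τ.setReg 28 f.val).arr :=
        hR.m.congr (hA2.arr _ (by decide)) (hA2.arr _ (by decide))
      refine (HT_scanEdge g g₁ hc h hfD hi2 hm2 h28 hC).mono ?_
      rintro t υ ⟨h1, h2, h3, h4⟩ y
      obtain ⟨e1, e2⟩ := hTD D f hfD h
      refine ⟨?_, (hA2.trans (h3.mono (by simp) (by simp))).setReg (by simp) _, h2, fun k => ?_⟩
      · rw [e1, Finset.card_insert_of_notMem e2, hcard, Nat.mul_add]
        omega
      · rw [Mem.setReg_arr, h4, Function.update_apply, Mem.setReg_arr, hEr, e1]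
        simp only [Fin.val_inj, Finset.mem_sdiff, Finset.mem_insert, L.pair_inj]
        by_cases hk : k = f <;> simp [hk]
    · rw [hTD' D f h, hcard]; omega
    · rw [partEc_insert_not (hnA f h)]; exact hC
    · rw [hTD' D f h]; exact hEr k
  · rintro t τ ⟨⟨h1, h2, h3, h4⟩, -⟩
    have hall : ∀ e ∈ topChoices s x, ∃ f ∈ Finset.univ.filter (fun f => L.man f = x),
        e = (L.man f, L.wom f) := by
      rintro ⟨y, w⟩ he
      obtain ⟨h5, h6, -⟩ := mem_topChoices.1 he
      obtain ⟨k, rfl, rfl⟩ := L.exists_edge (g.subR h5)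
      exact ⟨k, by simpa using h6, rfl⟩
    have e1 : TD (Finset.univ.filter fun f => L.man f = x) = topChoices s x :=
      Finset.filter_true_of_mem hall
    have e2 : partEc L s x (Finset.univ.filter fun f => L.man f = x) = (scanDone s x).Ec := by
      have : (scanAdded s x).filter (fun e => ∃ f ∈ Finset.univ.filter (fun f => L.man f = x),
          e = (L.man f, L.wom f)) = scanAdded s x :=
        Finset.filter_true_of_mem fun e he => hall e (Finset.mem_filter.1 he).1
      unfold partEc
      rw [this]
      rfl
    rw [e1] at h1 h4
    rw [e2] at h3
    refine ⟨h1.trans (Nat.add_le_add_right (L.degM x) _), ?_, ?_, ?_, hR.inp.agr h2 (by decide), ?_,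
      ?_, ?_, h4, h3, ?_⟩
    · rw [h2.reg 0 (by decide), hR.r0]
    · rw [h2.reg 1 (by decide), hR.r1]
    · rw [h2.reg 2 (by decide), hR.r2]
    · exact hR.m.congr (h2.arr _ (by decide)) (h2.arr _ (by decide))
    · unfold RepZ; rw [h2.arr _ (by decide)]; exact hR.z
    · intro k; rw [h2.arr _ (by decide)]; exact hR.ed k
    · exact hR.f.congr (h2.arr _ (by decide)) (h2.arr _ (by decide)) (h2.arr _ (by decide))

/-- A man is unsettled if and only if the stored edges differ. -/
theorem Rep.unsettled (h : Rep L Mz s F σ) (hz : IsSuperStable I Mz) (g : Good Mz s) (y : Fin I.a) :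
    σ.arr 10 y.val ≠ σ.arr 12 y.val ↔ ¬ Settled s.M Mz y := by
  rw [g.unsettled_iff hz]
  rcases h.m.pm y with ⟨h1, h2⟩ | ⟨k, h1, h2, h3⟩ <;> rcases h.z y with ⟨h4, h5⟩ | ⟨l, h4, h5, h6⟩
  · rw [h1, h4]
    exact ⟨fun h => absurd rfl h, fun ⟨w, h, _⟩ => absurd h (h2 w)⟩
  · obtain ⟨w, hw⟩ := (g.menM y).2 ⟨_, h6⟩
    exact absurd hw (h2 w)
  · obtain ⟨w, hw⟩ := (g.menM y).1 ⟨_, h3⟩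
    exact absurd hw (h5 w)
  · rw [h1, h4]
    constructor
    · refine fun h => ⟨_, h3, fun h' => h ?_⟩
      rw [L.edge_inj (h2.trans h5.symm) (hz.1.fst h' h6)]
    · rintro ⟨w, h7, h8⟩ heq
      have : k = l := Fin.ext (by omega)
      subst this
      exact h8 (g.mat.fst h7 h3 ▸ h6)

theorem RepC.dM_zero {C : I.EdgeSet} {A : ℕ → ℕ → ℕ} (h : RepC L C A) (y : Fin I.a) :
    A 26 y.val = 0 ↔ ∀ w, (y, w) ∉ C := by
  rw [h.dM, Finset.card_eq_zero, Finset.filter_eq_empty_iff]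
  constructor
  · intro h w hw; exact h hw rfl
  · rintro h ⟨y', w⟩ hw rfl; exact h w hw

def scanStep : St :=
  findN 21 0 22 [.ne (.ld 10 (.r 21)) (.ld 12 (.r 21)), .eq (.ld 26 (.r 21)) (.k 0),
    .eq (.ld 29 (.ld 28 (.r 21))) (.k 0)] ⨟
  .ite (.eq (.r 22) (.k 0)) (.set 20 (.k 0)) (
    .set 23 (.dec (.r 22)) ⨟ .out (.k 0) ⨟ .out (.r 23) ⨟ scanMark ⨟ restore ⨟
    .ite (.eq (.ld 29 (.ld 28 (.r 23))) (.k 0)) scanFinish .skip)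

/-- The combined potential; 16 n times its value is the time still available to the events. -/
def Theta (Mz : I.EdgeSet) (s : State I) (F : Forest I) : ℕ := Phi s + Psi Mz F

theorem Rep.out (h : Rep L Mz s F σ) {o : List ℕ} : Rep L Mz s F { σ with out := o } :=
  h.congr rfl fun _ _ => rfl

/-- Selecting and marking the man costs O(n), the repair 4n per unit lost by `Psi`, and processing
top choices O(n) for each of them. The new dirty man and the last repair pass raise the budget of
`Psi` by 2 at most, whereas `Phi` falls by 4 for every processed choice, or by 4 if the component
was opened. -/
theorem HT_scanStep (hz : IsSuperStable I Mz) (g : Good Mz s) (ok : ForestOK Mz s F) (hcl : F.Clean)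
    (hR : Rep L Mz s F σ) (h20 : σ.reg 20 = 1) :
    HT scanStep σ (fun t τ =>
      (τ.reg 20 = 0 ∧ (∀ m, ¬ CanScan Mz s m) ∧ Rep L Mz s F τ ∧ τ.out = σ.out ∧ t ≤ I.numV) ∨
      (τ.reg 20 = 1 ∧ ∃ m F', CanScan Mz s m ∧ Good Mz (scan s m) ∧ ForestOK Mz (scan s m) F' ∧
        F'.Clean ∧ Rep L Mz (scan s m) F' τ ∧ τ.out = σ.out ++ eventCode (I := I) (Event.scan m) ∧
        t + 1 + 16 * (I.numV * Theta Mz (scan s m) F') ≤ 16 * (I.numV * Theta Mz s F) ∧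
        Theta Mz (scan s m) F' < Theta Mz s F)) := by
  have hN : I.numV = I.a + I.b := rfl
  rw [scanStep, HT_seq]
  refine (HT_findN (N := I.a) (fun k => ∃ h : k < I.a, CanScan Mz s ⟨k, h⟩) (by decide) hR.r0
    ?_).mono ?_
  · intro k τ hk hA hk21
    have h1 := (hR.unsettled hz g ⟨k, hk⟩)
    have h2 := hR.c.dM_zero ⟨k, hk⟩
    have h3 := hR.f.lab ⟨k, hk⟩
    have h4 := hR.f.out_eq (F.lab ⟨k, hk⟩)
    have h5 := ok.noOut_iff g hcl ⟨k, hk⟩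
    simp only at h1 h2 h3
    simp only [List.mem_cons, List.not_mem_nil, or_false, forall_eq_or_imp, forall_eq, Cd.holds,
      Ex.val, hA.arr, hk21, h1, h2, h3, h4, ← h5, hk, exists_true_left, CanScan]
  rintro t₁ τ₁ ⟨ht₁, hA₁, hres⟩
  have hR₁ := hR.agree hA₁ (by decide)
  rw [HT_ite]
  refine ⟨fun h0 => ?_, fun h0 => ?_⟩
  · rw [HT_set]
    refine Or.inl ⟨by simp [Mem.setReg, Ex.val], ?_, hR₁.setReg (by decide) _, hA₁.out, by omega⟩
    simp only [Cd.holds, Ex.val] at h0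
    rcases hres with ⟨-, h⟩ | ⟨k, _, h, -⟩
    · exact fun y hy => h y.val y.2 ⟨y.2, hy⟩
    · omega
  simp only [Cd.holds, Ex.val] at h0
  obtain ⟨x, hx22, hc⟩ : ∃ x : Fin I.a, τ₁.reg 22 = x.val + 1 ∧ CanScan Mz s x := by
    rcases hres with ⟨h, -⟩ | ⟨k, hk, h, _, h'⟩
    · exact absurd h h0
    · exact ⟨⟨k, hk⟩, h, h'⟩
  have hpos : 0 < I.numV := by have := x.pos; omega
  rw [HT_seq, HT_set, HT_seq, HT_out, HT_seq, HT_out, HT_seq]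
  simp only [Ex.val, hx22, Nat.add_sub_cancel, Mem.setReg_reg, if_true, Mem.setReg_out]
  set μ : Mem := { { τ₁.setReg 23 x.val with out := τ₁.out ++ [0] } with
    out := τ₁.out ++ [0] ++ [x.val] } with hμ
  change HT scanMark μ _
  have hRμ : Rep L Mz s F μ := (hR₁.setReg (by decide) _).congr rfl fun _ _ => rfl
  have hμ23 : μ.reg 23 = x.val := by simp [hμ, Mem.setReg]
  have hμ20 : μ.reg 20 = 1 := by
    change (τ₁.setReg 23 x.val).reg 20 = 1
    rw [Mem.setReg_reg, if_neg (by decide), hA₁.reg 20 (by decide), h20]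
  have hμo : μ.out = σ.out ++ eventCode (I := I) (Event.scan x) := by
    simp [hμ, eventCode, hA₁.out]
  refine (HT_scanMark g hRμ hc hμ23).frame.mono ?_
  rintro t₂ τ₂ ⟨⟨ht₂, hR₂, h₂23, htop⟩, hF₂⟩
  have g₁ := addTop_good hz g hc
  obtain ⟨ok₁, hpsi⟩ := ok.mark_ok g hc
  rw [HT_seq]
  refine (HT_restore hpos g₁ ok₁ hR₂).frame.mono ?_
  rintro t₃ τ₃ ⟨⟨F', ok', hcl', hR₃, ht₃⟩, hF₃⟩
  have h₃23 : τ₃.reg 23 = x.val := by rw [hF₃.reg 23 rfl, h₂23]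
  have h₃25 : τ₃.reg 25 = τ₂.reg 25 := hF₃.reg 25 rfl
  have h₃20 : τ₃.reg 20 = 1 := by rw [hF₃.reg 20 rfl, hF₂.reg 20 rfl, hμ20]
  have h₃o : τ₃.out = σ.out ++ eventCode (I := I) (Event.scan x) := by
    rw [hF₃.out rfl, hF₂.out rfl, hμo]
  have hcond : (Cd.eq (.ld 29 (.ld 28 (.r 23))) (.k 0)).holds τ₃ ↔
      NoOut (addTop s x) (scc (addTop s x) (Sum.inl x)) := by
    simp only [Cd.holds, Ex.val, h₃23, hR₃.f.lab, hR₃.f.out_eq]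
    exact (ok'.noOut_iff g₁ hcl' x).symm
  have hq : Psi Mz F' ≤ Psi Mz F + 2 := by
    have : 4 * I.numV * Psi Mz F' ≤ 4 * I.numV * (Psi Mz F + 2) :=
      (Nat.le_add_left _ _).trans (ht₃.trans (Nat.mul_le_mul_left _ (by omega)))
    exact Nat.le_of_mul_le_mul_left this (by omega)
  have ht₃' : t₃ + 4 * (I.numV * Psi Mz F') ≤ 4 * (I.numV * Psi Mz F) + 8 * I.numV := by
    have : 4 * I.numV * (Psi Mz (ForestOK.mark F x) + 1) ≤ 4 * I.numV * (Psi Mz F + 2) :=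
      Nat.mul_le_mul_left _ (by omega)
    have e1 : 4 * I.numV * (Psi Mz F + 2) = 4 * (I.numV * Psi Mz F) + 8 * I.numV := by ring
    have e2 : 4 * I.numV * Psi Mz F' = 4 * (I.numV * Psi Mz F') := by ring
    omega
  have hq' := Nat.mul_le_mul_left I.numV hq
  rw [Nat.mul_add] at hq'
  rw [HT_ite, hcond, HT_skip]
  refine ⟨fun h => ?_, fun h => ?_⟩
  · refine (HT_scanFinish g g₁ hc hR₃ h₃23 (by rw [h₃25]; exact htop)).frame.mono ?_
    rintro t₄ τ₄ ⟨⟨ht₄, hR₄⟩, hF₄⟩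
    refine Or.inr ⟨by rw [hF₄.reg 20 rfl, h₃20], x, F', hc, ?_, ?_, hcl', ?_, ?_, ?_, ?_⟩
    · rw [scan_pos h]; exact scanDone_good hz g hc h
    · rw [scan_pos h]; exact ForestOK.congr (s := addTop s x) rfl rfl ok'
    · rw [scan_pos h]; exact hR₄
    · rw [hF₄.out rfl, h₃o]
    · have h1 := Phi_scanDone (m := x) g
      have h2 := (topChoices_nonempty g hc).card_pos
      rw [scan_pos h]
      simp only [Theta]
      have h3 := Nat.mul_le_mul_left I.numV h1
      simp only [Nat.mul_add] at h3 ⊢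
      have h4 : I.a * (topChoices s x).card ≤ I.numV * (topChoices s x).card :=
        Nat.mul_le_mul_right _ (by omega)
      have h5 : I.numV * (4 * (topChoices s x).card) = 4 * (I.numV * (topChoices s x).card) := by ring
      have h6 : I.numV ≤ I.numV * (topChoices s x).card := Nat.le_mul_of_pos_right _ h2
      omega
    · have h1 := Phi_scanDone (m := x) g
      have h2 := (topChoices_nonempty g hc).card_pos
      rw [scan_pos h]
      simp only [Theta]
      omega
  · refine Or.inr ⟨h₃20, x, F', hc, ?_⟩
    rw [scan_neg h]
    have h1 := Phi_addTop hc g h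
    refine ⟨g₁, ok', hcl', hR₃, h₃o, ?_, ?_⟩
    · simp only [Theta]
      have h3 := Nat.mul_le_mul_left I.numV h1
      simp only [Nat.mul_add] at h3 ⊢
      omega
    · simp only [Theta]
      omega

end SuperStable

end


/-! ### The search loop and the deletions at multiply engaged women. -/

noncomputable section

open scoped Classical

namespace SuperStable

variable {I : Inst} {L : Layout I} {Mz : I.EdgeSet} {s : State I} {F : Forest I} {σ : Mem}

open Good

/-- The memory represents a state that satisfies the invariants. -/
structure Valid (L : Layout I) (Mz : I.EdgeSet) (s : State I) (F : Forest I) (σ : Mem) : Prop where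
  good : Good Mz s
  ok : ForestOK Mz s F
  clean : F.Clean
  rep : Rep L Mz s F σ

/-! ### The search loop -/

def search : St := .set 20 (.k 1) ⨟ .whl (.k 0) (.r 20) scanStep

theorem HT_search (hz : IsSuperStable I Mz) (v : Valid L Mz s F σ) :
    HT search σ (fun t τ => ∃ s' F' l, SearchLoop Mz s l s' ∧ (∀ m, ¬ CanScan Mz s' m) ∧
      Valid L Mz s' F' τ ∧ τ.out = σ.out ++ l.flatMap eventCode ∧
      Theta Mz s' F' ≤ Theta Mz s F ∧
      t + 16 * (I.numV * Theta Mz s' F') ≤ 16 * (I.numV * Theta Mz s F) + I.numV + 1) := by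
  rw [search, HT_seq, HT_set]
  refine (HT_measure (e := .k 0) (f := .r 20) (p := scanStep) (fun n T τ => ∃ s' F' l,
    (∀ l' u, SearchLoop Mz s' l' u → SearchLoop Mz s (l ++ l') u) ∧
    Valid L Mz s' F' τ ∧ τ.out = σ.out ++ l.flatMap eventCode ∧ Theta Mz s' F' ≤ Theta Mz s F ∧
    τ.reg 20 ≤ 1 ∧ n = Theta Mz s' F' + τ.reg 20 ∧ (τ.reg 20 = 0 → ∀ m, ¬ CanScan Mz s' m) ∧
    T + 16 * (I.numV * Theta Mz s' F') ≤ 16 * (I.numV * Theta Mz s F) +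
      (if τ.reg 20 = 0 then I.numV + 1 else 0)) ?_ (Theta Mz s F + 1) 0 _ ?_).mono ?_
  · rintro n T τ ⟨s', F', l, h1, v', ho, hle, h20, rfl, -, hT⟩ hlt
    have h20' : τ.reg 20 = 1 := by simp only [Ex.val] at hlt; omega
    rw [if_neg (by omega)] at hT
    refine (HT_scanStep hz v'.good v'.ok v'.clean v'.rep h20').mono ?_
    rintro t υ (⟨a1, a2, a3, a4, a5⟩ | ⟨a1, m, F'', a2, a3, a4, a5, a6, a7, a8, a9⟩)
    · refine ⟨_, by omega, s', F', l, h1, ⟨v'.good, v'.ok, v'.clean, a3⟩, a4.trans ho, hle,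
        by omega, rfl, fun _ => a2, ?_⟩
      rw [if_pos a1]; omega
    · refine ⟨_, by omega, scan s' m, F'', l ++ [Event.scan m], fun l' u h => ?_,
        ⟨a3, a4, a5, a6⟩, ?_, by omega, by omega, rfl, fun h => by omega, ?_⟩
      · rw [List.append_assoc]; exact h1 _ _ (.step _ _ _ _ a2 h)
      · rw [a7, ho]; simp
      · rw [if_neg (by omega)]; omega
  · refine ⟨s, F, [], fun l' u h => h, ⟨v.good, v.ok, v.clean, v.rep.setReg (by decide) _⟩,
      by simp [Mem.setReg_out], le_rfl, ?_, ?_, fun h => ?_, ?_⟩ <;> simp [Mem.setReg, Ex.val] at *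
  · rintro t τ ⟨hlt, n, s', F', l, h1, v', ho, hle, h20, -, h0, hT⟩
    have h20' : τ.reg 20 = 0 := by simp only [Ex.val] at hlt; omega
    rw [if_pos h20'] at hT
    refine ⟨s', F', l, ?_, h0 h20', v', ho, hle, by omega⟩
    simpa using h1 [] s' (.exit _ (h0 h20'))

/-! ### The `for` loop -/

/-- Unprocessed and candidate edges are disjoint sets, so their flags differ exactly on the union.
The comparison is reversed in order to find the worst edge. -/
def pruneWoman : St :=
  minL 6 7 8 9 10 30 33 [.ne (.ld 24 (.r 10)) (.ld 25 (.r 10))]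
    (.lt (.ld 3 (.dec (.r 33))) (.ld 3 (.r 10))) ⨟
  .set 34 (.ld 3 (.dec (.r 33))) ⨟
  putL 6 7 8 9 10 30 24 0 [.eq (.ld 3 (.r 10)) (.r 34)] ⨟
  delL 30 [.eq (.ld 3 (.r 10)) (.r 34)]

/-- The women form the outer loop, which `prune_eq` permits. The components of the men concerned are
recognised by the label of the woman's partner (`pruneCond_iff`), and the degree is tested again
before each deletion. -/
def pruneLoop : St :=
  forN 30 1 (ifAll [.lt (.k 1) (.ld 27 (.r 30)),
      .eq (.ld 29 (.ld 28 (.ld 0 (.dec (.ld 11 (.r 30)))))) (.k 0)]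
    (.set 31 (.ld 28 (.ld 0 (.dec (.ld 11 (.r 30))))) ⨟
      forN 32 0 (ifAll [.eq (.ld 28 (.r 32)) (.r 31), .lt (.k 1) (.ld 27 (.r 30))] pruneWoman .skip))
    .skip)

theorem multiplyEngaged_iff {w : Fin I.b} :
    MultiplyEngaged s w ↔ 1 < (s.Ec.filter fun e => e.2 = w).card := by
  rw [Finset.one_lt_card]
  constructor
  · rintro ⟨m, m', h, h1, h2⟩
    exact ⟨(m, w), by simpa using h1, (m', w), by simpa using h2, fun h' => h (congrArg Prod.fst h')⟩
  · rintro ⟨⟨m, w1⟩, h1, ⟨m', w2⟩, h2, h3⟩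
    rw [Finset.mem_filter] at h1 h2
    obtain ⟨h1, rfl⟩ := h1
    obtain ⟨h2, h4⟩ := h2
    dsimp only at h4
    subst h4
    exact ⟨m, m', fun h => h3 (by rw [h]), h1, h2⟩

theorem lowSet_nonempty {w : Fin I.b} (h : MultiplyEngaged s w) : 0 < (lowSet s w).card := by
  obtain ⟨m, -, -, hm, -⟩ := id h
  obtain ⟨e, h1, h2⟩ := Finset.exists_max_image ((s.Ec ∪ s.Er).filter fun e => e.2 = w)
    (fun e => I.rankW w e.1) ⟨(m, w), by simp [hm]⟩
  obtain ⟨h3, h4⟩ := Finset.mem_filter.1 h1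
  exact Finset.card_pos.2 ⟨e, Finset.mem_filter.2 ⟨h3, h4, h, fun m' hm' =>
    h2 (m', w) (Finset.mem_filter.2 ⟨hm', rfl⟩)⟩⟩

theorem lowAt_eq_self {w : Fin I.b} (h : ¬ MultiplyEngaged s w) : lowAt s w = s := by
  have : lowSet s w = ∅ := Finset.filter_eq_empty_iff.2 fun e _ h' => h h'.2.1
  simp [lowAt, this]

theorem HT_pruneWoman (g : Good Mz s) (hR : Rep L Mz s F σ) {w : Fin I.b} (hw : MultiplyEngaged s w)
    (h30 : σ.reg 30 = w.val) :
    HT pruneWoman σ (fun t τ => t ≤ 3 * I.a ∧ Rep L Mz (lowAt s w) F τ ∧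
      Agr [8, 9, 10, 33, 34] [24, 25, 26, 27] σ τ) := by
  have hd := L.degW w
  have hmem : ∀ k : Fin I.numE, (¬ σ.arr 24 k.val = σ.arr 25 k.val) ↔
      (L.man k, L.wom k) ∈ s.Ec ∪ s.Er := by
    intro k
    have := g.Er_not_Ec (x := L.man k) (w := L.wom k)
    rw [hR.er, hR.c.ec, Finset.mem_union]
    by_cases h1 : (L.man k, L.wom k) ∈ s.Er <;> by_cases h2 : (L.man k, L.wom k) ∈ s.Ec <;>
      simp_all
  rw [pruneWoman, HT_seq]
  refine (HT_minL L.listsW (v := w) (fun f => (L.man f, L.wom f) ∈ s.Ec ∪ s.Er)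
    (fun f => -(I.rankW w (L.man f) : ℤ)) (by decide) hR.inp.lstW hR.inp.offW h30 ?_ ?_).mono ?_
  · intro f τ hf hA hf10
    simp only [List.mem_singleton, forall_eq, Cd.holds, Ex.val, hA.arr, hf10]
    exact hmem f
  · intro f g' τ hf hg _ hA hf10 hg24
    simp only [Cd.holds, Ex.val, hA.arr, hf10, hg24, Nat.add_sub_cancel, hR.inp.rkW, hf, hg]
    omega
  rintro t₁ τ₁ ⟨ht₁, hA₁, hres⟩
  have hR₁ := hR.agree hA₁ (by decide)
  obtain ⟨v, hv, hlow⟩ : ∃ v, (Ex.ld 3 (.dec (.r 33))).val τ₁ = v ∧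
      ∀ x, (x, w) ∈ s.Ec ∪ s.Er → (I.rankW w x = v ↔ (x, w) ∈ lowSet s w) := by
    rcases hres with ⟨-, h⟩ | ⟨f, h1, h2, h3, h4⟩
    · obtain ⟨m, -, -, hm, -⟩ := hw
      obtain ⟨k, rfl, rfl⟩ := L.exists_edge (g.subC hm)
      exact absurd (Finset.mem_union_left _ hm) (h k rfl)
    · have hmax : ∀ x, (x, w) ∈ s.Ec ∪ s.Er → I.rankW w x ≤ I.rankW w (L.man f) := by
        intro x hx
        obtain ⟨k, rfl, h5⟩ := L.exists_edge ((Finset.mem_union.1 hx).elim (fun h => g.subC h)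
          fun h => g.subR h)
        have := h4 k h5 (h5.symm ▸ hx)
        omega
      refine ⟨I.rankW w (L.man f), ?_, fun x hx => ?_⟩
      · simp only [Ex.val, h2, Nat.add_sub_cancel, hR₁.inp.rkW, h1]
      · rw [mem_lowSet]
        refine ⟨fun h => ⟨Finset.mem_union.1 hx, rfl, hw, fun m' hm' => ?_⟩, fun h => ?_⟩
        · rw [h]; exact hmax _ (Finset.mem_union.2 hm')
        · refine le_antisymm (hmax _ hx) (h.2.2.2 _ ?_)
          rw [← h1]; exact Finset.mem_union.1 h3
  rw [HT_seq, HT_set, hv]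
  set μ := τ₁.setReg 34 v with hμ
  have hAμ : Agr [8, 9, 10, 33, 34] [24, 25, 26, 27] σ μ :=
    ((hA₁.agr (as := [24, 25, 26, 27])).mono (by simp) (List.Subset.refl _)).setReg (by simp) _
  have hRμ : Rep L Mz s F μ := hR₁.setReg (by decide) _
  have hμ34 : μ.reg 34 = v := by simp [hμ, Mem.setReg]
  have hμ30 : μ.reg 30 = w.val := by rw [hAμ.reg 30 (by decide), h30]
  rw [HT_seq]
  refine (HT_putL L.listsW (v := w) (fun f => I.rankW w (L.man f) = v) (by decide)
    (by decide) hRμ.inp.lstW hRμ.inp.offW hμ30 ?_).mono ?_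
  · intro e τ he hA he10
    simp only [List.mem_singleton, forall_eq, Cd.holds, Ex.val, hA.arr 3 (by decide), he10,
      hA.reg 34 (by decide), hμ34, hRμ.inp.rkW, he]
  rintro t₂ τ₂ ⟨ht₂, hA₂, her⟩
  have hA₂' := hA₂.agr.mono (ws' := [8, 9, 10, 33, 34]) (as' := [24, 25, 26, 27]) (by simp) (by simp)
  have hi₂ := hRμ.inp.agr hA₂' (by decide)
  have hC₂ : RepC L s.Ec τ₂.arr :=
    hRμ.c.congr (hA₂.arr _ (by decide)) (hA₂.arr _ (by decide)) (hA₂.arr _ (by decide))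
  refine (HT_delL (w := w) (fun y => I.rankW w y = v) hi₂ hC₂ g.subC
    (by rw [hA₂.reg 30 (by decide), hμ30]) (by decide) ?_).mono ?_
  · intro f υ hf hυ hf10
    have hiυ := hi₂.agr hυ (by decide)
    simp only [List.mem_singleton, forall_eq, Cd.holds, Ex.val, hυ.reg 34 (by decide),
      hA₂.reg 34 (by decide), hμ34, hf10, hiυ.rkW, hf]
  rintro t₃ τ₃ ⟨ht₃, hA₃, hC₃⟩
  have hA : Agr [8, 9, 10, 33, 34] [24, 25, 26, 27] σ τ₃ :=
    hAμ.trans (hA₂'.trans (hA₃.mono (by simp) (by simp)))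
  refine ⟨by omega, ⟨?_, ?_, ?_, hR.inp.agr hA (by decide), ?_, ?_, ?_, ?_, ?_, ?_⟩, hA⟩
  · rw [hA.reg 0 (by decide), hR.r0]
  · rw [hA.reg 1 (by decide), hR.r1]
  · rw [hA.reg 2 (by decide), hR.r2]
  · exact hR.m.congr (hA.arr _ (by decide)) (hA.arr _ (by decide))
  · unfold RepZ; rw [hA.arr _ (by decide)]; exact hR.z
  · intro k; rw [hA.arr _ (by decide)]; exact hR.ed k
  · intro k
    rw [hA₃.arr 24 (by decide), her, hRμ.er]
    have : (L.man k, L.wom k) ∈ (lowAt s w).Er ↔ (L.man k, L.wom k) ∈ s.Er ∧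
        ¬ (L.wom k = w ∧ I.rankW w (L.man k) = v) := by
      rw [lowAt, Finset.mem_sdiff]
      refine and_congr_right fun h => not_congr ?_
      constructor
      · intro h'
        obtain ⟨-, h1, -⟩ := mem_lowSet.1 h'
        rw [h1] at h h'
        exact ⟨h1, (hlow _ (Finset.mem_union_right _ h)).2 h'⟩
      · rintro ⟨h1, h2⟩
        rw [h1] at h ⊢
        exact (hlow _ (Finset.mem_union_right _ h)).1 h2
    simp only [this]
    split_ifs <;> first | rfl | (exfalso; tauto)
  · convert hC₃ using 1
    ext ⟨x, y⟩
    simp only [lowAt, Finset.mem_sdiff, Finset.mem_filter]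
    refine and_congr_right fun h => not_congr ?_
    constructor
    · intro h'
      obtain ⟨-, h1, -⟩ := mem_lowSet.1 h'
      subst h1
      exact ⟨rfl, (hlow _ (Finset.mem_union_left _ h)).2 h'⟩
    · rintro ⟨h1, h2⟩
      subst h1
      exact (hlow _ (Finset.mem_union_left _ h)).1 h2
  · exact hR.f.congr (hA.arr _ (by decide)) (hA.arr _ (by decide)) (hA.arr _ (by decide))

/-- The deletions at the woman `w`. -/
def pruneAll (s t : State I) (w : Fin I.b) (l : List (Fin I.a)) : State I :=
  l.foldl (fun t m => if PruneCond s m w then lowAt t w else t) t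

theorem pruneAll_M (t : State I) (w : Fin I.b) (l : List (Fin I.a)) :
    (pruneAll s t w l).M = t.M ∧ (pruneAll s t w l).Ed = t.Ed := by
  induction l generalizing t with
  | nil => exact ⟨rfl, rfl⟩
  | cons m l ih =>
    obtain ⟨h1, h2⟩ := ih (if PruneCond s m w then lowAt t w else t)
    refine ⟨h1.trans ?_, h2.trans ?_⟩ <;> split_ifs <;> rfl

theorem pruneAll_self (t : State I) {w : Fin I.b} {l : List (Fin I.a)}
    (h : ∀ m, PruneCond s m w → ¬ MultiplyEngaged t w) : pruneAll s t w l = t := by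
  induction l with
  | nil => rfl
  | cons m l ih =>
    rw [pruneAll, List.foldl_cons]
    have : (if PruneCond s m w then lowAt t w else t) = t := by
      split_ifs with h'
      · exact lowAt_eq_self (h m h')
      · rfl
    rw [this]; exact ih

theorem pruneAll_good (hz : IsSuperStable I Mz) {t : State I} (g : Good Mz t) (w : Fin I.b)
    (l : List (Fin I.a)) : Good Mz (pruneAll s t w l) ∧ Phi (pruneAll s t w l) ≤ Phi t := by
  induction l generalizing t with
  | nil => exact ⟨g, le_rfl⟩
  | cons m l ih =>
    rw [pruneAll, List.foldl_cons]
    split_ifs with h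
    · obtain ⟨h1, h2⟩ := ih (lowAt_good hz g w)
      have := Phi_lowAt hz g w
      exact ⟨h1, by unfold pruneAll at h2; omega⟩
    · exact ih g

theorem pruneAll_lt (hz : IsSuperStable I Mz) {t : State I} (g : Good Mz t) {w : Fin I.b}
    {l : List (Fin I.a)} {m} (hm : m ∈ l) (h : PruneCond s m w) (hw : MultiplyEngaged t w) :
    Phi (pruneAll s t w l) < Phi t := by
  induction l generalizing t with
  | nil => cases hm
  | cons m' l ih =>
    have h1 := Phi_lowAt hz g w
    have h2 := lowSet_nonempty hw
    by_cases h' : PruneCond s m' w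
    · rw [pruneAll, List.foldl_cons, if_pos h']
      have := (pruneAll_good (s := s) hz (lowAt_good hz g w) w l).2
      unfold pruneAll at this
      omega
    · rw [pruneAll, List.foldl_cons, if_neg h']
      rcases List.mem_cons.1 hm with rfl | hm
      · exact absurd h h'
      · exact ih g hm hw

theorem prune_eq_pruneAll (s : State I) :
    prune s = (List.finRange I.b).foldl (fun t w => pruneAll s t w (List.finRange I.a)) s :=
  prune_eq s

/-- If a multiply engaged woman belongs to a closed component, either she is still multiply engaged
at her turn or an earlier deletion has changed the state; in both cases some edge is deleted. -/
theorem prune_progress (hz : IsSuperStable I Mz) (g : Good Mz s) : Phi (prune s) < Phi s ∨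
    prune s = s ∧ ∀ m w, PruneCond s m w → ¬ MultiplyEngaged s w := by
  by_cases h : ∀ m w, PruneCond s m w → ¬ MultiplyEngaged s w
  · refine Or.inr ⟨?_, h⟩
    rw [prune_eq_pruneAll]
    generalize List.finRange I.b = l
    induction l with
    | nil => rfl
    | cons w l ih => rw [List.foldl_cons, pruneAll_self s (fun m => h m w), ih]
  · push Not at h
    obtain ⟨m, w, h1, h2⟩ := h
    left
    rw [prune_eq_pruneAll]
    have key : ∀ (l : List (Fin I.b)) (t : State I), Good Mz t →
        Phi (l.foldl (fun t w => pruneAll s t w (List.finRange I.a)) t) ≤ Phi t := by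
      intro l
      induction l with
      | nil => intro t _; exact le_rfl
      | cons w l ih =>
        intro t gt
        obtain ⟨h3, h4⟩ := pruneAll_good (s := s) hz gt w (List.finRange I.a)
        exact (ih _ h3).trans h4
    have key2 : ∀ (l : List (Fin I.b)) (t : State I), Good Mz t → w ∈ l → MultiplyEngaged t w →
        Phi (l.foldl (fun t w => pruneAll s t w (List.finRange I.a)) t) < Phi t := by
      intro l
      induction l with
      | nil => intro t _ h; cases h
      | cons w' l ih =>
        intro t gt hw' ht
        obtain ⟨h3, h4⟩ := pruneAll_good (s := s) hz gt w' (List.finRange I.a)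
        by_cases he : w' = w
        · subst he
          exact (key l _ h3).trans_lt (pruneAll_lt hz gt (List.mem_finRange m) h1 ht)
        · by_cases hx : pruneAll s t w' (List.finRange I.a) = t
          · rw [List.foldl_cons, hx]
            exact ih t gt ((List.mem_cons.1 hw').resolve_left (Ne.symm he)) ht
          · have : ∃ m', PruneCond s m' w' ∧ MultiplyEngaged t w' := by
              by_contra hcon
              push Not at hcon
              exact hx (pruneAll_self t hcon)
            obtain ⟨m', h5, h6⟩ := this
            exact (key l _ h3).trans_lt (pruneAll_lt hz gt (List.mem_finRange m') h5 h6)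
    exact key2 _ s g (List.mem_finRange w) h2

/-- The label test for the men to whose component a multiply engaged woman belongs. -/
theorem pruneCond_iff (g : Good Mz s) (ok : ForestOK Mz s F) (hc : F.Clean) {t : State I}
    (gt : Good Mz t) (hM : t.M = s.M) (hd : t.Ed = s.Ed) {w : Fin I.b} (hw : MultiplyEngaged t w) :
    ∃ m, (m, w) ∈ s.M ∧ ∀ y, PruneCond s y w ↔ F.out (F.lab m) = none ∧ F.lab y = F.lab m := by
  obtain ⟨x, hx, h1⟩ : ∃ x, (x, w) ∈ t.Ec ∧ (x, w) ∉ s.M := by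
    obtain ⟨m, m', hne, h1, h2⟩ := hw
    by_cases h : (m, w) ∈ s.M
    · exact ⟨m', h2, fun h' => hne (g.mat.snd h h')⟩
    · exact ⟨m, h1, h⟩
  obtain ⟨h2, -, h3⟩ := (gt.cand _ _ hx).resolve_left fun h => h1 (hM ▸ h.1)
  rw [hd] at h2
  rw [arc_congr hM hd] at h3
  obtain ⟨m, hm⟩ := g.edM _ _ h2
  refine ⟨m, hm, fun y => ⟨fun h => ?_, fun h => ?_⟩⟩
  · have h4 := (ok.noOut_iff g hc y).1 h.1
    have h5 := ok.mem_scc_woman hc h4 h.2 hm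
    exact ⟨h5 ▸ h4, h5.symm⟩
  · exact ⟨(ok.noOut_iff g hc y).2 (h.2 ▸ h.1), ok.woman_mem_scc g hm h.2.symm h2 h1 h3⟩

theorem HT_pruneLoop (hz : IsSuperStable I Mz) (v : Valid L Mz s F σ) :
    HT pruneLoop σ (fun t τ => Valid L Mz (prune s) F τ ∧ τ.out = σ.out ∧
      Phi (prune s) ≤ Phi s ∧ t + 16 * (I.numV * Phi (prune s)) ≤ 16 * (I.numV * Phi s) + I.b) := by
  have hN : I.numV = I.a + I.b := rfl
  let st : ℕ → State I := fun k =>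
    ((List.finRange I.b).take k).foldl (fun t w => pruneAll s t w (List.finRange I.a)) s
  have hst : ∀ k (h : k < I.b), st (k + 1) = pruneAll s (st k) ⟨k, h⟩ (List.finRange I.a) := by
    intro k h
    simp only [st]
    rw [List.take_succ_eq_append_getElem (by simpa using h), List.foldl_append]
    simp
  have hlast : st I.b = prune s := by
    simp only [st]
    rw [List.take_of_length_le (by simp), prune_eq_pruneAll]
  have hstM : ∀ k, (st k).M = s.M ∧ (st k).Ed = s.Ed := by
    intro k
    simp only [st]
    generalize List.take k (List.finRange I.b) = l
    suffices ∀ t : State I, t.M = s.M → t.Ed = s.Ed →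
        (l.foldl (fun t w => pruneAll s t w (List.finRange I.a)) t).M = s.M ∧
        (l.foldl (fun t w => pruneAll s t w (List.finRange I.a)) t).Ed = s.Ed from this s rfl rfl
    induction l with
    | nil => exact fun t h1 h2 => ⟨h1, h2⟩
    | cons w l ih => exact fun t h1 h2 => ih _ ((pruneAll_M t w _).1.trans h1) ((pruneAll_M t w _).2.trans h2)
  refine (HT_for (N := I.b) (fun k T τ => Good Mz (st k) ∧ Rep L Mz (st k) F τ ∧ τ.out = σ.out ∧
    Phi (st k) ≤ Phi s ∧ T + 16 * (I.numV * Phi (st k)) ≤ 16 * (I.numV * Phi s) + k) rfl rfl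
    (by decide) v.rep.r1 ?_ ?_).mono ?_
  · refine ⟨v.good, v.rep.setReg (by decide) _, rfl, le_rfl, by simp [st]⟩
  · rintro k T τ hk hk30 - - ⟨gt, hR, ho, hP, hT⟩
    obtain ⟨hM, hd⟩ := hstM k
    set w : Fin I.b := ⟨k, hk⟩ with hw
    rw [hst k hk, HT_ifAll, HT_skip]
    have hdW : τ.arr 27 k = ((st k).Ec.filter fun e => e.2 = w).card := hR.c.dW w
    have h27 : 1 < τ.arr 27 k ↔ MultiplyEngaged (st k) w := by rw [hdW, multiplyEngaged_iff]
    simp only [List.mem_cons, List.not_mem_nil, or_false, forall_eq_or_imp, forall_eq, Cd.holds,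
      Ex.val, hk30, h27]
    refine ⟨fun ⟨hme, h29⟩ => ?_, fun hcon => ?_⟩
    · obtain ⟨m, hm, hpc⟩ := pruneCond_iff v.good v.ok v.clean gt hM hd hme
      have hpw : τ.arr 0 (τ.arr 11 k - 1) = m.val :=
        hR.m.pw_man hR.inp gt.mat (w := w) (by rw [hM]; exact hm)
      rw [hpw, hR.f.lab, hR.f.out_eq] at h29
      have hpc' : ∀ y, PruneCond s y w ↔ F.lab y = F.lab m := fun y => by rw [hpc]; simp [h29]
      rw [HT_seq, HT_set]
      simp only [Ex.val, hk30, hpw, hR.f.lab]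
      set μ := τ.setReg 31 (F.lab m).val with hμ
      have hRμ : Rep L Mz (st k) F μ := hR.setReg (by decide) _
      have hμ31 : μ.reg 31 = (F.lab m).val := by simp [hμ, Mem.setReg]
      have hμ30 : μ.reg 30 = k := by
        rw [hμ, Mem.setReg_reg, if_neg (by decide), hk30]
      let pt : ℕ → State I := fun j => pruneAll s (st k) w ((List.finRange I.a).take j)
      have hpt : ∀ j (h : j < I.a), pt (j + 1) =
          if PruneCond s ⟨j, h⟩ w then lowAt (pt j) w else pt j := by
        intro j h
        simp only [pt, pruneAll]
        rw [List.take_succ_eq_append_getElem (by simpa using h), List.foldl_append]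
        simp
      refine (HT_for (N := I.a) (fun j U υ => Good Mz (pt j) ∧ Rep L Mz (pt j) F υ ∧ υ.out = σ.out ∧
        -- The deletions use only half of the budget of 16 per unit. The other half pays for running
        -- through all men, which happens only for a woman at whom something is deleted.
        Phi (pt j) ≤ Phi (st k) ∧ U + 8 * (I.numV * Phi (pt j)) ≤ 8 * (I.numV * Phi (st k)) + j) rfl
        rfl (by decide) hRμ.r0 ?_ ?_).mono ?_
      · refine ⟨gt, hRμ.setReg (by decide) _, ho, le_rfl, by simp [pt, pruneAll]⟩
      · rintro j U υ hj hj32 - hF ⟨gp, hRp, hop, hPp, hU⟩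
        have hυ31 : υ.reg 31 = (F.lab m).val := (hF.reg 31 rfl).trans hμ31
        have hυ30 : υ.reg 30 = k := (hF.reg 30 rfl).trans hμ30
        have hdW' : υ.arr 27 k = ((pt j).Ec.filter fun e => e.2 = w).card := hRp.c.dW w
        have hlab : υ.arr 28 j = (F.lab ⟨j, hj⟩).val := hRp.f.lab ⟨j, hj⟩
        rw [hpt j hj, HT_ifAll, HT_skip]
        simp only [List.mem_cons, List.not_mem_nil, or_false, forall_eq_or_imp, forall_eq, Cd.holds,
          Ex.val, hj32, hυ30, hυ31, hlab, hdW', ← multiplyEngaged_iff, Fin.val_inj, ← hpc']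
        refine ⟨fun ⟨h1, h2⟩ => ?_, fun h => ?_⟩
        · refine (HT_pruneWoman gp hRp h2 hυ30).mono ?_
          rintro t ξ ⟨ht, hRξ, hAξ⟩
          have h3 := Phi_lowAt hz gp w
          have h4 := lowSet_nonempty h2
          rw [if_pos h1]
          refine ⟨lowAt_good hz gp w, hRξ.setReg (by decide) _, hAξ.out.trans hop, by omega, ?_⟩
          have h5 : I.numV * (Phi (lowAt (pt j) w) + 1) ≤ I.numV * Phi (pt j) :=
            Nat.mul_le_mul_left _ (by omega)
          rw [Nat.mul_add] at h5
          omega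
        · have : (if PruneCond s ⟨j, hj⟩ w then lowAt (pt j) w else pt j) = pt j := by
            split_ifs with h1
            · exact lowAt_eq_self fun h2 => h ⟨h1, h2⟩
            · rfl
          rw [this]
          exact ⟨gp, hRp.setReg (by decide) _, hop, hPp, by omega⟩
      · rintro U υ ⟨⟨gp, hRp, hop, hPp, hU⟩, -⟩
        have hlast' : pt I.a = pruneAll s (st k) w (List.finRange I.a) := by
          simp only [pt]
          rw [List.take_of_length_le (by simp)]
        rw [hlast'] at gp hRp hPp hU
        have hlt := pruneAll_lt hz gt (List.mem_finRange m) ((hpc' m).2 rfl) hme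
        refine ⟨gp, hRp.setReg (by decide) _, hop, hPp.trans hP, ?_⟩
        have h5 : I.numV * (Phi (pruneAll s (st k) w (List.finRange I.a)) + 1) ≤
            I.numV * Phi (st k) := Nat.mul_le_mul_left _ hlt
        rw [Nat.mul_add] at h5
        change _ + 16 * (I.numV * Phi (pruneAll s (st k) w _)) ≤ _
        omega
    · have : pruneAll s (st k) w (List.finRange I.a) = st k := by
        refine pruneAll_self _ fun y hy hme => hcon ⟨hme, ?_⟩
        obtain ⟨m, hm, hpc⟩ := pruneCond_iff v.good v.ok v.clean gt hM hd hme
        have hpw : τ.arr 0 (τ.arr 11 k - 1) = m.val :=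
          hR.m.pw_man hR.inp gt.mat (w := w) (by rw [hM]; exact hm)
        rw [hpw, hR.f.lab, hR.f.out_eq]
        exact ((hpc y).1 hy).1
      rw [this]
      exact ⟨gt, hR.setReg (by decide) _, ho, hP, by omega⟩
  · rintro t τ ⟨⟨gt, hR, ho, hP, hT⟩, -⟩
    obtain ⟨hM, hd⟩ := hstM I.b
    rw [hlast] at gt hR hP hT hM hd
    exact ⟨⟨gt, v.ok.congr hM hd, v.clean, hR⟩, ho, hP, hT⟩

end SuperStable

end


/-! ### Finding a closed component to rotate and updating its edges. -/

noncomputable section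

open scoped Classical

namespace SuperStable

variable {I : Inst} {L : Layout I} {Mz : I.EdgeSet} {s : State I} {F : Forest I} {σ : Mem}

open Good Relation

/-- A loop over the indices that satisfy the conditions `cs`. -/
theorem HT_each {n i lim c : ℕ} {cs : List Cd} {p : St} {σ : Mem} (S : Fin n → Prop)
    (J : Finset (Fin n) → Mem → Prop) (hi : (ifAll cs p .skip).wr i = false)
    (hl : (ifAll cs p .skip).wr lim = false) (hne : i ≠ lim) (hN : σ.reg lim = n)
    (h0 : J ∅ (σ.setReg i 0))
    (hc : ∀ D τ (y : Fin n), y ∉ D → τ.reg i = y.val → Frame (forN i lim (ifAll cs p .skip)) σ τ →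
      J D τ → ((∀ c ∈ cs, c.holds τ) ↔ S y))
    (hs : ∀ D τ (y : Fin n), y ∉ D → S y → τ.reg i = y.val →
      Frame (forN i lim (ifAll cs p .skip)) σ τ → J D τ →
      HT p τ (fun t υ => t ≤ c ∧ ∀ v, J (insert y D) (υ.setReg i v)))
    (hreg : ∀ D τ v, J D τ → J D (τ.setReg i v)) :
    HT (forN i lim (ifAll cs p .skip)) σ (fun t τ => t ≤ n + c * (Finset.univ.filter S).card ∧
      J (Finset.univ.filter S) τ) := by
  refine (HT_for (N := n) (fun k t τ => t ≤ k + c * (Finset.univ.filter fun y : Fin n =>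
    y.val < k ∧ S y).card ∧ J (Finset.univ.filter fun y : Fin n => y.val < k ∧ S y) τ) hi hl hne hN
    ?_ ?_).mono ?_
  · have : (Finset.univ.filter fun y : Fin n => y.val < 0 ∧ S y) = ∅ := by simp
    rw [this]; exact ⟨by simp, h0⟩
  · rintro k T τ hk hik - hF ⟨hT, hJ⟩
    have hnot : (⟨k, hk⟩ : Fin n) ∉ Finset.univ.filter fun y : Fin n => y.val < k ∧ S y := by simp
    rw [HT_ifAll, hc _ τ ⟨k, hk⟩ hnot hik hF hJ, HT_skip]
    refine ⟨fun hS => ?_, fun hS => ?_⟩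
    · have : (Finset.univ.filter fun y : Fin n => y.val < k + 1 ∧ S y) =
          insert ⟨k, hk⟩ (Finset.univ.filter fun y : Fin n => y.val < k ∧ S y) := by
        ext y
        simp only [Finset.mem_filter, Finset.mem_univ, true_and, Finset.mem_insert, Fin.ext_iff]
        constructor
        · rintro ⟨h1, h2⟩
          by_cases h : y.val = k
          · exact Or.inl h
          · exact Or.inr ⟨by omega, h2⟩
        · rintro (h | ⟨h1, h2⟩)
          · obtain rfl : y = ⟨k, hk⟩ := Fin.ext h
            exact ⟨by simp, hS⟩
          · exact ⟨by omega, h2⟩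
      rw [this, Finset.card_insert_of_notMem hnot]
      refine (hs _ τ ⟨k, hk⟩ hnot hS hik hF hJ).mono ?_
      rintro t υ ⟨h1, h2⟩
      exact ⟨by rw [Nat.mul_add]; omega, h2 _⟩
    · have : (Finset.univ.filter fun y : Fin n => y.val < k + 1 ∧ S y) =
          Finset.univ.filter fun y : Fin n => y.val < k ∧ S y := by
        refine Finset.filter_congr fun y _ => ⟨fun h => ⟨?_, h.2⟩, fun h => ⟨by omega, h.2⟩⟩
        by_contra hcon
        obtain rfl : y = ⟨k, hk⟩ := Fin.ext (by simp only; omega)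
        exact hS h.2
      rw [this]
      exact ⟨by omega, hreg _ _ _ hJ⟩
  · rintro t τ ⟨⟨h1, h2⟩, -⟩
    have : (Finset.univ.filter fun y : Fin n => y.val < n ∧ S y) = Finset.univ.filter S :=
      Finset.filter_congr fun y _ => by simp
    rw [this] at h1 h2
    exact ⟨h1, h2⟩

/-- A loop over all indices. -/
theorem HT_all {n i lim : ℕ} {p : St} {σ : Mem} (J : Finset (Fin n) → Mem → Prop)
    (hi : p.wr i = false) (hl : p.wr lim = false) (hne : i ≠ lim) (hN : σ.reg lim = n)
    (h0 : J ∅ (σ.setReg i 0))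
    (hs : ∀ D τ (y : Fin n), y ∉ D → τ.reg i = y.val → Frame (forN i lim p) σ τ → J D τ →
      HT p τ (fun t υ => t = 0 ∧ ∀ v, J (insert y D) (υ.setReg i v)))
    (hreg : ∀ D τ v, J D τ → J D (τ.setReg i v)) :
    HT (forN i lim p) σ (fun t τ => t ≤ n ∧ J Finset.univ τ) := by
  refine (HT_each (cs := []) (p := p) (c := 0) (fun _ => True) J hi hl hne hN h0 (by simp) ?_
    hreg).mono ?_
  · intro D τ y h1 _ h2 h3 h4
    exact (hs D τ y h1 h2 h3 h4).mono fun t υ h => ⟨h.1.le, h.2⟩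
  · rintro t τ ⟨h1, h2⟩
    exact ⟨by simpa using h1, by simpa using h2⟩

theorem Rep.agr {ws as : List ℕ} {τ : Mem} (h : Rep L Mz s F σ) (hA : Agr ws as σ τ)
    (hw : 0 ∉ ws ∧ 1 ∉ ws ∧ 2 ∉ ws)
    (ha : (∀ i < 13, i ∉ as) ∧ ∀ i < 31, 23 ≤ i → i ∉ as) : Rep L Mz s F τ := by
  obtain ⟨ha, hb⟩ := ha
  obtain ⟨a1, a2, a3, a4, a5, a6, a7, a8, a9, a10⟩ := h
  have k1 : ∀ i < 13, τ.arr i = σ.arr i := fun i hi => hA.arr i (ha i hi)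
  have k2 : ∀ i < 31, 23 ≤ i → τ.arr i = σ.arr i := fun i hi hi' => hA.arr i (hb i hi hi')
  refine ⟨?_, ?_, ?_, a4.agr hA fun i hi => ha i (by omega),
    a5.congr (k1 _ (by norm_num)) (k1 _ (by norm_num)), ?_, ?_, ?_,
    a9.congr (k2 _ (by norm_num) (by norm_num)) (k2 _ (by norm_num) (by norm_num))
      (k2 _ (by norm_num) (by norm_num)),
    a10.congr (k2 _ (by norm_num) (by norm_num)) (k2 _ (by norm_num) (by norm_num))
      (k2 _ (by norm_num) (by norm_num))⟩
  · rw [hA.reg 0 hw.1, a1]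
  · rw [hA.reg 1 hw.2.1, a2]
  · rw [hA.reg 2 hw.2.2, a3]
  · unfold RepZ; rw [k1 _ (by norm_num)]; exact a6
  · rw [k2 _ (by norm_num) (by norm_num)]; exact a7
  · rw [k2 _ (by norm_num) (by norm_num)]; exact a8

/-! ### Finding a component to rotate -/

/-- The condition on the men of a class that makes its component ready for rotation. -/
def Ready (Mz : I.EdgeSet) (s : State I) (F : Forest I) (y : Fin I.a) : Prop :=
  F.out (F.lab y) = none ∧ (s.Ec.filter fun e => e.1 = y).card = 1 ∧
    ∃ w, (y, w) ∈ s.M ∧ (y, w) ∉ Mz ∧ (s.Ec.filter fun e => e.2 = w).card = 1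

theorem card_fst_eq_one {C : I.EdgeSet} {y : Fin I.a} :
    (C.filter fun e => e.1 = y).card = 1 ↔ ∃! w, (y, w) ∈ C := by
  rw [Finset.card_eq_one]
  constructor
  · rintro ⟨⟨y', w⟩, h⟩
    have hm : ∀ w', (y, w') ∈ C ↔ (y, w') = (y', w) := fun w' => by
      rw [← Finset.mem_singleton, ← h, Finset.mem_filter]; simp
    have h0 : (y', w) ∈ C.filter fun e => e.1 = y := by rw [h]; simp
    replace h0 : y' = y := (Finset.mem_filter.1 h0).2
    subst h0
    exact ⟨w, (hm w).2 rfl, fun w' h' => congrArg Prod.snd ((hm w').1 h')⟩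
  · rintro ⟨w, h1, h2⟩
    refine ⟨(y, w), ?_⟩
    ext ⟨y', w'⟩
    simp only [Finset.mem_filter, Finset.mem_singleton, Prod.mk.injEq]
    exact ⟨by rintro ⟨h3, rfl⟩; exact ⟨rfl, h2 _ h3⟩, by rintro ⟨rfl, rfl⟩; exact ⟨h1, rfl⟩⟩

theorem card_snd_eq_one {C : I.EdgeSet} {w : Fin I.b} :
    (C.filter fun e => e.2 = w).card = 1 ↔ ∃! y, (y, w) ∈ C := by
  rw [Finset.card_eq_one]
  constructor
  · rintro ⟨⟨y, w'⟩, h⟩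
    have hm : ∀ y', (y', w) ∈ C ↔ (y', w) = (y, w') := fun w' => by
      rw [← Finset.mem_singleton, ← h, Finset.mem_filter]; simp
    have h0 : (y, w') ∈ C.filter fun e => e.2 = w := by rw [h]; simp
    replace h0 : w' = w := (Finset.mem_filter.1 h0).2
    subst h0
    exact ⟨y, (hm y).2 rfl, fun w' h' => congrArg Prod.fst ((hm w').1 h')⟩
  · rintro ⟨y, h1, h2⟩
    refine ⟨(y, w), ?_⟩
    ext ⟨y', w'⟩
    simp only [Finset.mem_filter, Finset.mem_singleton, Prod.mk.injEq]
    exact ⟨by rintro ⟨h3, rfl⟩; exact ⟨h2 _ h3, rfl⟩, by rintro ⟨rfl, rfl⟩; exact ⟨h1, rfl⟩⟩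

theorem ready_of_canRotate (g : Good Mz s) (ok : ForestOK Mz s F) (hc : F.Clean) {S : Set I.V}
    (h : CanRotate s S) : ∃ ℓ, F.lab ℓ = ℓ ∧ ∀ y, F.lab y = ℓ → Ready Mz s F y := by
  have f := rotFacts g h
  obtain ⟨⟨v, hv⟩, hN, -, -⟩ := h
  obtain ⟨m, hm⟩ : ∃ m, (Sum.inl m : I.V) ∈ S := by
    have hvS : v ∈ S := hv ▸ self_mem_scc s v
    rcases v with m | w
    · exact ⟨m, hvS⟩
    · obtain ⟨m, hm, -⟩ := f.ecW w hvS
      exact ⟨m, hm⟩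
  have hS : S = scc s (Sum.inl m) := by rw [hv] at hm ⊢; exact (scc_eq hm).symm
  have hout := (ok.noOut_iff g hc m).1 (hS ▸ hN)
  refine ⟨F.lab m, ok.idem m, fun y hy => ?_⟩
  have hyS : (Sum.inl y : I.V) ∈ S := hS ▸ (ok.mem_scc_iff hc hout y).2 hy
  obtain ⟨w, h1, h2⟩ := f.uns y hyS
  refine ⟨hy ▸ hout, card_fst_eq_one.2 ?_, w, h1, h2, card_snd_eq_one.2 ?_⟩
  · obtain ⟨w', hw'⟩ := f.ecM y hyS
    exact ⟨w', hw', fun w'' h => f.ecM' _ _ _ hyS h hw'⟩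
  · obtain ⟨m', -, hm'⟩ := f.ecW w (f.mM _ _ hyS h1)
    exact ⟨m', hm', fun m'' h => f.ecW' _ _ _ (f.mM _ _ hyS h1) h hm'⟩

/-- The women of a closed component are exactly the partners of its men, so it suffices to count
candidates at each man and at his partner. Candidates of unsettled men are arcs and stay inside; a
candidate at a woman inside comes from a man whom she reaches. -/
theorem canRotate_of_ready (g : Good Mz s) (ok : ForestOK Mz s F) (hc : F.Clean) {ℓ : Fin I.a}
    (hℓ : F.lab ℓ = ℓ) (h : ∀ y, F.lab y = ℓ → Ready Mz s F y) :
    CanRotate s (scc s (Sum.inl ℓ)) := by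
  have hout := (h ℓ hℓ).1
  have hN := (ok.noOut_iff g hc ℓ).2 hout
  have hmem : ∀ y, (Sum.inl y : I.V) ∈ scc s (Sum.inl ℓ) ↔ F.lab y = ℓ := fun y => by
    rw [ok.mem_scc_iff hc hout, hℓ]
  refine ⟨⟨_, rfl⟩, hN, fun y hy => ?_, fun w hw => ?_⟩
  · obtain ⟨-, h1, w, h2, h3, -⟩ := h y ((hmem y).1 hy)
    obtain ⟨w', h4, h5⟩ := card_fst_eq_one.1 h1
    obtain ⟨h6, h7, -⟩ := uns_of_ec g h4 ⟨w, h2, h3⟩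
    exact ⟨w', ⟨hN _ hy _ ⟨h6, h7⟩, h4⟩, fun w'' h => h5 _ h.2⟩
  · obtain ⟨m, hm⟩ : ∃ m, (m, w) ∈ s.M := by
      rcases ReflTransGen.cases_tail hw.1 with h0 | ⟨x, -, h2⟩
      · exact absurd h0 (by simp)
      · rcases x with y | w'
        · exact g.edM _ _ h2.1
        · exact h2.elim
    have h1 := ok.mem_scc_woman hc hout hw hm
    obtain ⟨-, -, w', h2, -, h3⟩ := h m (h1.trans hℓ)
    obtain rfl := g.mat.fst h2 hm
    obtain ⟨x, h4, h5⟩ := card_snd_eq_one.1 h3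
    refine ⟨x, ⟨?_, h4⟩, fun x' h => h5 _ h.2⟩
    rcases g.cand _ _ h4 with ⟨h6, -⟩ | ⟨-, -, h6⟩
    · exact hN _ hw _ ⟨g.mEd h6, h6⟩
    · exact noOut_reach hN hw h6

def readyConds : List Cd :=
  [.ne (.ld 10 (.r 30)) (.ld 12 (.r 30)), .eq (.ld 29 (.ld 28 (.r 30))) (.k 0),
    .eq (.ld 26 (.r 30)) (.k 1), .eq (.ld 27 (.ld 1 (.dec (.ld 10 (.r 30))))) (.k 1)]

theorem readyConds_holds (g : Good Mz s) (hz : IsSuperStable I Mz) (hR : Rep L Mz s F σ)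
    {y : Fin I.a} (h30 : σ.reg 30 = y.val) :
    (∀ c ∈ readyConds, c.holds σ) ↔ Ready Mz s F y := by
  simp only [readyConds, List.mem_cons, List.not_mem_nil, or_false, forall_eq_or_imp, forall_eq,
    Cd.holds, Ex.val, h30, hR.f.lab, hR.f.out_eq, hR.c.dM, Ready]
  rw [hR.unsettled hz g, g.unsettled_iff hz]
  constructor
  · rintro ⟨⟨w, h1, h2⟩, h3, h4, h5⟩
    refine ⟨h3, h4, w, h1, h2, ?_⟩
    rcases hR.m.pm y with ⟨-, h6⟩ | ⟨k, h6, h7, h8⟩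
    · exact absurd h1 (h6 w)
    · rw [h6, Nat.add_sub_cancel, hR.inp.wom, hR.c.dW] at h5
      rw [g.mat.fst h1 h8]; exact h5
  · rintro ⟨h3, h4, w, h1, h2, h5⟩
    refine ⟨⟨w, h1, h2⟩, h3, h4, ?_⟩
    rcases hR.m.pm y with ⟨-, h6⟩ | ⟨k, h6, h7, h8⟩
    · exact absurd h1 (h6 w)
    · rw [h6, Nat.add_sub_cancel, hR.inp.wom, hR.c.dW, ← g.mat.fst h1 h8]; exact h5

/-- Array 31 marks every class that contains an unsuitable man. The tests are made man by man, so
all components together cost O(n). -/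
def rotFind : St :=
  forN 30 0 (.put 31 (.r 30) (.k 0)) ⨟
  forN 30 0 (ifAll readyConds .skip (.put 31 (.ld 28 (.r 30)) (.k 1))) ⨟
  findN 30 0 22 [.eq (.ld 28 (.r 30)) (.r 30), .eq (.ld 31 (.r 30)) (.k 0)]

theorem HT_rotFind (hz : IsSuperStable I Mz) (v : Valid L Mz s F σ) :
    HT rotFind σ (fun t τ => t ≤ 3 * I.a ∧ Agr [22, 30] [31] σ τ ∧
      ((τ.reg 22 = 0 ∧ ∀ S, ¬ CanRotate s S) ∨
        ∃ ℓ : Fin I.a, τ.reg 22 = ℓ.val + 1 ∧ F.lab ℓ = ℓ ∧ F.out ℓ = none ∧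
          CanRotate s (scc s (Sum.inl ℓ)))) := by
  rw [rotFind, HT_seq]
  refine (HT_all (n := I.a) (fun D τ => Agr [22, 30] [31] σ τ ∧ ∀ y ∈ D, τ.arr 31 y.val = 0) rfl rfl
    (by decide) v.rep.r0 ⟨(Agr.refl _ _ _).setReg (by simp) _, by simp⟩ ?_
    fun D τ v h => ⟨h.1.setReg (by simp) _, h.2⟩).mono ?_
  · rintro D τ y - h30 - ⟨hA, h⟩
    rw [HT_put]
    refine ⟨rfl, fun v => ⟨(hA.setArr (by simp) _ _).setReg (by simp) _, fun x hx => ?_⟩⟩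
    rw [Mem.setReg_arr, Mem.setArr_arr, if_pos rfl, Function.update_apply]
    simp only [Ex.val, h30, Fin.val_inj]
    split_ifs with hxy
    · rfl
    · exact h x ((Finset.mem_insert.1 hx).resolve_left hxy)
  rintro t₁ τ₁ ⟨ht₁, hA₁, h₁⟩
  have hR₁ := v.rep.agr hA₁ (by decide) (by decide)
  rw [HT_seq]
  refine (HT_all (n := I.a) (fun D τ => Agr [22, 30] [31] σ τ ∧ ∀ ℓ : Fin I.a, τ.arr 31 ℓ.val = 0 ↔
    ∀ y ∈ D, F.lab y = ℓ → Ready Mz s F y) rfl rfl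
    (by decide) hR₁.r0 ⟨hA₁.setReg (by simp) _, fun ℓ => by simp [Mem.setReg_arr, h₁]⟩ ?_
    fun D τ v h => ⟨h.1.setReg (by simp) _, h.2⟩).mono ?_
  · rintro D τ y - h30 - ⟨hA, h⟩
    have hR := v.rep.agr hA (by decide) (by decide)
    rw [HT_ifAll, readyConds_holds v.good hz hR h30, HT_skip, HT_put]
    refine ⟨fun hy => ⟨rfl, fun v => ⟨hA.setReg (by simp) _, fun ℓ => ?_⟩⟩, fun hy =>
      ⟨rfl, fun v => ⟨(hA.setArr (by simp) _ _).setReg (by simp) _, fun ℓ => ?_⟩⟩⟩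
    · rw [Mem.setReg_arr, h]
      simp [hy]
    · rw [Mem.setReg_arr, Mem.setArr_arr, if_pos rfl, Function.update_apply]
      simp only [Ex.val, h30, hR.f.lab, Fin.val_inj, Finset.forall_mem_insert]
      split_ifs with hℓ
      · simp [hℓ, hy]
      · rw [h]; simp [Ne.symm hℓ]
  rintro t₂ τ₂ ⟨ht₂, hA₂, h₂⟩
  have hR₂ := v.rep.agr hA₂ (by decide) (by decide)
  refine (HT_findN (N := I.a) (fun k => ∃ h : k < I.a, F.lab ⟨k, h⟩ = ⟨k, h⟩ ∧
    ∀ y, F.lab y = ⟨k, h⟩ → Ready Mz s F y) (by decide) hR₂.r0 ?_).mono ?_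
  · intro k τ hk hA hk30
    have h1 := hR₂.f.lab ⟨k, hk⟩
    have h2 := h₂ ⟨k, hk⟩
    simp only at h1 h2
    simp only [List.mem_cons, List.not_mem_nil, or_false, forall_eq_or_imp, forall_eq, Cd.holds,
      Ex.val, hA.arr, hk30, h1, h2, hk, exists_true_left, Fin.ext_iff, Finset.mem_univ, true_imp_iff]
  · rintro t₃ τ₃ ⟨ht₃, hA₃, hres⟩
    refine ⟨by omega, hA₂.trans (hA₃.agr.mono (by simp) (List.Subset.refl _)), ?_⟩
    rcases hres with ⟨h0, h⟩ | ⟨k, hk, h1, _, h2, h3⟩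
    · refine Or.inl ⟨h0, fun S hS => ?_⟩
      obtain ⟨ℓ, h1, h2⟩ := ready_of_canRotate v.good v.ok v.clean hS
      exact h ℓ.val ℓ.2 ⟨ℓ.2, h1, h2⟩
    · refine Or.inr ⟨⟨k, hk⟩, h1, h2, ?_, canRotate_of_ready v.good v.ok v.clean h2 h3⟩
      have := (h3 _ h2).1
      rwa [h2] at this

end SuperStable

end


noncomputable section

open scoped Classical

namespace SuperStable

variable {I : Inst} {L : Layout I} {Mz : I.EdgeSet} {s : State I} {F : Forest I} {σ : Mem}

open Good Relation

theorem ite_ite_of_or {p q r : Prop} {_ : Decidable p} {_ : Decidable q} {_ : Decidable r} {u v : ℕ}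
    (h : r ↔ p ∨ q) : (if p then u else if q then u else v) = if r then u else v := by
  by_cases p <;> by_cases q <;> simp_all

theorem ite_ite_of_and_not {p q r : Prop} {_ : Decidable p} {_ : Decidable q} {_ : Decidable r}
    (h : r ↔ p ∧ ¬ q) : (if q then 0 else if p then 1 else 0) = if r then 1 else 0 := by
  by_cases p <;> by_cases q <;> simp_all

/-! ### Exchanging the matching edges of a component -/

def rotPair : St :=
  forN 30 0 (ifAll [.eq (.ld 28 (.r 30)) (.r 23)] (forL 4 5 8 9 10 30
    (ifAll [.eq (.ld 25 (.r 10)) (.k 1)]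
      (.put 10 (.r 30) (.inc (.r 10)) ⨟ .put 11 (.ld 1 (.r 10)) (.inc (.r 10))) .skip)) .skip)

/-- `e y` is the edge that joins `y ∈ S` to his new partner. -/
def NewEdge (L : Layout I) (s : State I) (S : Set I.V) (e : Fin I.a → Fin I.numE) : Prop :=
  ∀ y, Sum.inl y ∈ S → L.man (e y) = y ∧ ∀ f, L.man f = y → ((y, L.wom f) ∈ s.Ec ↔ f = e y)

theorem exists_newEdge (g : Good Mz s) {S : Set I.V} (f : RotFacts Mz s S) {ℓ : Fin I.a}
    (hℓ : Sum.inl ℓ ∈ S) : ∃ e, NewEdge L s S e := by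
  have key : ∀ y : Fin I.a, ∃ k : Fin I.numE, (Sum.inl y : I.V) ∈ S →
      L.man k = y ∧ ∀ f, L.man f = y → ((y, L.wom f) ∈ s.Ec ↔ f = k) := by
    intro y
    obtain ⟨w, hw⟩ := f.ecM ℓ hℓ
    obtain ⟨k₀, -, -⟩ := L.exists_edge (g.subC hw)
    by_cases hy : (Sum.inl y : I.V) ∈ S
    · obtain ⟨w, hw⟩ := f.ecM y hy
      obtain ⟨k, rfl, rfl⟩ := L.exists_edge (g.subC hw)
      refine ⟨k, fun _ => ⟨rfl, fun f' hf' => ⟨fun h => ?_, fun h => by rw [h]; exact hw⟩⟩⟩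
      exact L.edge_inj hf' (f.ecM' _ _ _ hy h hw)
    · exact ⟨k₀, fun h => absurd h hy⟩
  choose e he using key
  exact ⟨e, he⟩

theorem NewEdge.mem {S : Set I.V} {e : Fin I.a → Fin I.numE} (h : NewEdge L s S e) {y : Fin I.a}
    (hy : Sum.inl y ∈ S) : (y, L.wom (e y)) ∈ s.Ec := ((h y hy).2 _ (h y hy).1).2 rfl

theorem NewEdge.eq {S : Set I.V} {e : Fin I.a → Fin I.numE} (h : NewEdge L s S e) (g : Good Mz s)
    {y : Fin I.a} (hy : Sum.inl y ∈ S) {w} : (y, w) ∈ s.Ec ↔ w = L.wom (e y) := by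
  refine ⟨fun h' => ?_, fun h' => h' ▸ h.mem hy⟩
  obtain ⟨k, hk, rfl⟩ := L.exists_edge (g.subC h')
  rw [((h y hy).2 k hk).1 h']

theorem HT_rotPair (g : Good Mz s) (hR : Rep L Mz s F σ) {S : Set I.V} (f : RotFacts Mz s S)
    {ℓ : Fin I.a} (h23 : σ.reg 23 = ℓ.val) (hS : ∀ y, (Sum.inl y : I.V) ∈ S ↔ F.lab y = ℓ)
    {e : Fin I.a → Fin I.numE} (he : NewEdge L s S e) :
    HT rotPair σ (fun t τ => t ≤ I.a + I.b * (Finset.univ.filter fun y : Fin I.a =>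
      (Sum.inl y : I.V) ∈ S).card ∧ Agr [8, 9, 10, 30] [10, 11] σ τ ∧ RepM L (newMatching s S) τ.arr ∧
      ∀ y : Fin I.a, (Sum.inl y : I.V) ∈ S → τ.arr 10 y.val = (e y).val + 1) := by
  -- Different men of S get different women, so the entries written for the women do not overwrite
  -- each other.
  have hinj : ∀ x y, (Sum.inl x : I.V) ∈ S → (Sum.inl y : I.V) ∈ S → L.wom (e x) = L.wom (e y) →
      x = y := fun x y hx hy h => f.ecW' _ _ _ (f.ec _ _ hx (he.mem hx)).1 (he.mem hx)
        (h ▸ he.mem hy)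
  refine (HT_each (n := I.a) (c := I.b) (fun y => (Sum.inl y : I.V) ∈ S) (fun D τ =>
    Agr [8, 9, 10, 30] [10, 11] σ τ ∧
    (∀ y : Fin I.a, τ.arr 10 y.val = if y ∈ D then (e y).val + 1 else σ.arr 10 y.val) ∧
    ∀ w : Fin I.b, (∀ y ∈ D, (Sum.inl y : I.V) ∈ S → L.wom (e y) = w → τ.arr 11 w.val = (e y).val + 1) ∧
      ((∀ y ∈ D, (Sum.inl y : I.V) ∈ S → L.wom (e y) ≠ w) → τ.arr 11 w.val = σ.arr 11 w.val)) rfl rfl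
    (by decide) hR.r0 ⟨(Agr.refl _ _ _).setReg (by simp) _, by simp [Mem.setReg_arr],
      by simp [Mem.setReg_arr]⟩ ?_ ?_ fun D τ v h => ⟨h.1.setReg (by simp) _, h.2⟩).mono ?_
  · rintro D τ y - h30 - ⟨hA, -, -⟩
    simp only [List.mem_singleton, forall_eq, Cd.holds, Ex.val, h30, hA.arr 28 (by decide), hR.f.lab,
      hA.reg 23 (by decide), h23, Fin.val_inj, hS]
  · rintro D τ y hyD hy h30 - ⟨hA, h10, h11⟩
    have hi := hR.inp.agr hA (by decide)
    refine (HT_list L.listsM (v := y) (fun E t υ => t ≤ E.card ∧ Agr [8, 9, 10] [10, 11] τ υ ∧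
      (e y ∈ E → υ.arr 10 = Function.update (τ.arr 10) y.val ((e y).val + 1) ∧
        υ.arr 11 = Function.update (τ.arr 11) (L.wom (e y)).val ((e y).val + 1)) ∧
      (e y ∉ E → υ.arr 10 = τ.arr 10 ∧ υ.arr 11 = τ.arr 11)) rfl rfl rfl (by decide) hi.lstM hi.offM
      h30 ?_ ?_).mono ?_
    · intro u v
      exact ⟨by simp, ((Agr.refl _ _ _).setReg (by simp) _).setReg (by simp) _, by simp,
        fun _ => ⟨rfl, rfl⟩⟩
    · rintro E T υ k - hkE hk - ⟨hT, hA', h1, h2⟩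
      have hA2 : Agr [8, 9, 10] [10, 11] τ (υ.setReg 10 k.val) := hA'.setReg (by simp) _
      have h10k : (υ.setReg 10 k.val).reg 10 = k.val := by rw [Mem.setReg_reg, if_pos rfl]
      have hi2 := hi.agr hA2 (by decide)
      have hcard : (insert k E).card = E.card + 1 := Finset.card_insert_of_notMem hkE
      have hcond : (∀ c ∈ [Cd.eq (.ld 25 (.r 10)) (.k 1)], c.holds (υ.setReg 10 k.val)) ↔
          k = e y := by
        simp only [List.mem_singleton, forall_eq, Cd.holds, Ex.val, h10k, hA2.arr 25 (by decide),
          hA.arr 25 (by decide), hR.c.ec, ite_one_iff]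
        rw [hk, (he y hy).2 k hk]
      rw [HT_ifAll, hcond, HT_seq, HT_put, HT_put, HT_skip]
      refine ⟨?_, fun hne z => ⟨by omega, hA2.setReg (by simp) _, fun hm => ?_, fun hm => ?_⟩⟩
      · rintro rfl z
        obtain ⟨h3, h4⟩ := h2 hkE
        refine ⟨by omega, ((hA2.setArr (by simp) _ _).setArr (by simp) _ _).setReg (by simp) _,
          fun _ => ?_, fun h => absurd (Finset.mem_insert_self _ _) h⟩
        simp only [Mem.setReg_arr, Mem.setArr_arr, Ex.val, Mem.setArr_reg, h10k, hA2.reg 30 (by decide),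
          h30, OfNat.one_ne_ofNat, if_false, if_true, Nat.reduceEqDiff, h3, h4]
        have h5 : υ.arr 1 (e y).val = (L.wom (e y)).val := hi2.wom _
        rw [h5]
        exact ⟨trivial, rfl⟩
      · exact h1 ((Finset.mem_insert.1 hm).resolve_left (Ne.symm hne))
      · exact h2 fun h => hm (Finset.mem_insert_of_mem h)
    · rintro t υ ⟨⟨h1, h2, h3, -⟩, -⟩
      obtain ⟨h4, h5⟩ := h3 (by simpa using (he y hy).1)
      refine ⟨h1.trans (L.degM y), fun v => ⟨(hA.trans (h2.mono (by simp) (by simp))).setReg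
        (by simp) _, fun x => ?_, fun w => ⟨fun x hx hxS hxw => ?_, fun h => ?_⟩⟩⟩
      · rw [Mem.setReg_arr, h4, Function.update_apply, h10]
        simp only [Fin.val_inj, Finset.mem_insert]
        by_cases hxy : x = y
        · subst hxy; simp
        · simp [hxy]
      · rw [Mem.setReg_arr, h5, Function.update_apply]
        split_ifs with h6
        · rw [hinj x y hxS hy (hxw.trans (Fin.ext h6))]
        · rcases Finset.mem_insert.1 hx with rfl | hx
          · exact absurd (congrArg Fin.val hxw.symm) h6
          · exact (h11 w).1 x hx hxS hxw
      · rw [Mem.setReg_arr, h5, Function.update_apply, if_neg, (h11 w).2 fun x hx =>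
          h x (Finset.mem_insert_of_mem hx)]
        exact fun h6 => h y (Finset.mem_insert_self _ _) hy (Fin.ext h6.symm)
  · rintro t τ ⟨ht, hA, h10, h11⟩
    simp only [Finset.mem_filter, Finset.mem_univ, true_and] at h10 h11
    refine ⟨ht, hA, ⟨fun x => ?_, fun w => ?_⟩, fun y hy => by rw [h10, if_pos hy]⟩
    · by_cases hx : (Sum.inl x : I.V) ∈ S
      · refine Or.inr ⟨e x, by rw [h10, if_pos hx], (he x hx).1, ?_⟩
        exact (f.man_in hx).2 (he.mem hx)
      · rw [h10, if_neg hx]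
        simp only [f.man_out hx]
        exact hR.m.pm x
    · by_cases hw : (Sum.inr w : I.V) ∈ S
      · obtain ⟨x, hx, hxw⟩ := f.ecW w hw
        have h1 := (he.eq g hx).1 hxw
        refine Or.inr ⟨e x, (h11 w).1 x hx hx h1.symm, h1.symm, (f.wom_in hw).2 ?_⟩
        rw [(he x hx).1]
        exact ⟨hxw, hx⟩
      · rw [(h11 w).2 fun y hy hy' h => hw (h ▸ (f.ec _ _ hy (he.mem hy)).1)]
        simp only [f.wom_out hw]
        exact hR.m.pw w

/-! ### Updating the edges -/

/-- The update for the man in register `30` and his new partner. -/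
def rotMan : St :=
  .set 33 (.dec (.ld 10 (.r 30))) ⨟ .set 31 (.ld 1 (.r 33)) ⨟ .set 32 (.ld 3 (.r 33)) ⨟
  putL 6 7 8 9 10 31 23 0 [.lt (.r 32) (.ld 3 (.r 10))] ⨟
  putL 6 7 8 9 10 31 24 0 [.lt (.r 32) (.ld 3 (.r 10))] ⨟
  putL 4 5 8 9 10 30 23 0 [.ne (.r 10) (.r 33)] ⨟
  ifAll [.ne (.ld 10 (.r 30)) (.ld 12 (.r 30))] (delEc 33) .skip

/-- The woman of the edge `k` strictly prefers `k` to the edge `f`. -/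
def Worse (L : Layout I) (k f : Fin I.numE) : Prop :=
  L.wom f = L.wom k ∧ I.rankW (L.wom k) (L.man k) < I.rankW (L.wom k) (L.man f)

theorem HT_rotMan {C : I.EdgeSet} (hi : Inp L σ.arr) (k : Fin I.numE)
    (h30 : σ.reg 30 = (L.man k).val) (h10 : σ.arr 10 (L.man k).val = k.val + 1)
    (hC : RepC L C σ.arr) :
    HT rotMan σ (fun t τ => t ≤ 2 * I.a + I.b ∧
      Agr [8, 9, 10, 31, 32, 33] [23, 24, 25, 26, 27] σ τ ∧
      (∀ f : Fin I.numE, τ.arr 23 f.val =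
        if Worse L k f ∨ L.man f = L.man k ∧ f ≠ k then 0 else σ.arr 23 f.val) ∧
      (∀ f : Fin I.numE, τ.arr 24 f.val = if Worse L k f then 0 else σ.arr 24 f.val) ∧
      RepC L (if σ.arr 10 (L.man k).val ≠ σ.arr 12 (L.man k).val then C.erase (L.man k, L.wom k)
        else C) τ.arr) := by
  have hdW := L.degW (L.wom k)
  have hdM := L.degM (L.man k)
  have h33 : (Ex.dec (.ld 10 (.r 30))).val σ = k.val := by simp [Ex.val, h30, h10]
  rw [rotMan, HT_seq, HT_set, h33, HT_seq, HT_set, HT_seq, HT_set]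
  have e1 : (Ex.ld 1 (.r 33)).val (σ.setReg 33 k.val) = (L.wom k).val := by
    simp only [Ex.val, Mem.setReg_reg, if_true, Mem.setReg_arr, hi.wom]
  rw [e1]
  have e2 : (Ex.ld 3 (.r 33)).val ((σ.setReg 33 k.val).setReg 31 (L.wom k).val) =
      I.rankW (L.wom k) (L.man k) := by
    simp only [Ex.val, Mem.setReg_reg, if_true, Mem.setReg_arr, Nat.reduceEqDiff, if_false, hi.rkW]
  rw [e2]
  set μ := ((σ.setReg 33 k.val).setReg 31 (L.wom k).val).setReg 32 (I.rankW (L.wom k) (L.man k))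
    with hμ
  have hA : Agr [8, 9, 10, 31, 32, 33] [23, 24, 25, 26, 27] σ μ :=
    (((Agr.refl _ _ _).setReg (by simp) _).setReg (by simp) _).setReg (by simp) _
  have g31 : μ.reg 31 = (L.wom k).val := by simp [hμ, Mem.setReg]
  have g32 : μ.reg 32 = I.rankW (L.wom k) (L.man k) := by simp [hμ, Mem.setReg]
  have g33 : μ.reg 33 = k.val := by simp [hμ, Mem.setReg]
  have g30 : μ.reg 30 = (L.man k).val := by rw [hA.reg 30 (by decide), h30]
  have hiμ := hi.agr hA (by decide)
  have harr : μ.arr = σ.arr := rfl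
  clear_value μ
  rw [HT_seq]
  refine (HT_putL L.listsW (v := L.wom k) (fun f => I.rankW (L.wom k) (L.man k) <
    I.rankW (L.wom k) (L.man f)) (by decide) (by decide) hiμ.lstW hiμ.offW g31 ?_).mono ?_
  · intro f τ hf hA he10
    simp only [List.mem_singleton, forall_eq, Cd.holds, Ex.val, hA.arr 3 (by decide), he10,
      hA.reg 32 (by decide), g32, hiμ.rkW, hf]
  rintro t₁ τ₁ ⟨ht₁, hA₁, h₁⟩
  have hB₁ := hA.trans (hA₁.agr.mono (ws' := [8, 9, 10, 31, 32, 33]) (as' := [23, 24, 25, 26, 27])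
    (by simp) (by simp))
  have hi₁ := hi.agr hB₁ (by decide)
  rw [HT_seq]
  refine (HT_putL L.listsW (v := L.wom k) (fun f => I.rankW (L.wom k) (L.man k) <
    I.rankW (L.wom k) (L.man f)) (by decide) (by decide) hi₁.lstW hi₁.offW
    ((hA₁.reg 31 (by decide)).trans g31) ?_).mono ?_
  · intro f τ hf hA he10
    simp only [List.mem_singleton, forall_eq, Cd.holds, Ex.val, hA.arr 3 (by decide), he10,
      hA.reg 32 (by decide), hA₁.reg 32 (by decide), g32, hi₁.rkW, hf]
  rintro t₂ τ₂ ⟨ht₂, hA₂, h₂⟩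
  have hB₂ := hB₁.trans (hA₂.agr.mono (ws' := [8, 9, 10, 31, 32, 33]) (as' := [23, 24, 25, 26, 27])
    (by simp) (by simp))
  have hi₂ := hi.agr hB₂ (by decide)
  rw [HT_seq]
  refine (HT_putL L.listsM (v := L.man k) (fun f => f ≠ k) (by decide) (by decide) hi₂.lstM hi₂.offM
    ((hB₂.reg 30 (by decide)).trans h30) ?_).mono ?_
  · intro f τ hf hA he10
    simp only [List.mem_singleton, forall_eq, Cd.holds, Ex.val, he10, hA.reg 33 (by decide),
      hA₂.reg 33 (by decide), hA₁.reg 33 (by decide), g33, Fin.val_inj, ne_eq]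
  rintro t₃ τ₃ ⟨ht₃, hA₃, h₃⟩
  have hB₃ := hB₂.trans (hA₃.agr.mono (ws' := [8, 9, 10, 31, 32, 33]) (as' := [23, 24, 25, 26, 27])
    (by simp) (by simp))
  have hi₃ := hi.agr hB₃ (by decide)
  have g33' : τ₃.reg 33 = k.val := by
    rw [hA₃.reg 33 (by decide), hA₂.reg 33 (by decide), hA₁.reg 33 (by decide), g33]
  have off : ∀ B, B ≠ 23 → B ≠ 24 → τ₃.arr B = σ.arr B := fun B h h' => by
    rw [hA₃.arr B h, hA₂.arr B h', hA₁.arr B h, harr]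
  have hC₃ : RepC L C τ₃.arr := hC.congr (off _ (by decide) (by decide)) (off _ (by decide) (by decide))
    (off _ (by decide) (by decide))
  have k23 : ∀ f : Fin I.numE, τ₃.arr 23 f.val =
      if Worse L k f ∨ L.man f = L.man k ∧ f ≠ k then 0 else σ.arr 23 f.val := by
    intro f
    rw [h₃, hA₂.arr 23 (by decide), h₁, harr]
    exact ite_ite_of_or or_comm
  have k24 : ∀ f : Fin I.numE, τ₃.arr 24 f.val = if Worse L k f then 0 else σ.arr 24 f.val := by
    intro f
    rw [hA₃.arr 24 (by decide), h₂, hA₁.arr 24 (by decide), harr]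
    unfold Worse
    congr
  have hcond : (∀ c ∈ [Cd.ne (.ld 10 (.r 30)) (.ld 12 (.r 30))], c.holds τ₃) ↔
      σ.arr 10 (L.man k).val ≠ σ.arr 12 (L.man k).val := by
    simp only [List.mem_singleton, forall_eq, Cd.holds, Ex.val, hB₃.reg 30 (by decide), h30,
      off 10 (by decide) (by decide), off 12 (by decide) (by decide), ne_eq]
  rw [HT_ifAll, hcond, HT_skip]
  refine ⟨fun h => ?_, fun h => ⟨by omega, hB₃, k23, k24, by rw [if_neg h]; exact hC₃⟩⟩
  refine (HT_delEc hi₃ hC₃ g33').mono ?_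
  rintro t₄ τ₄ ⟨rfl, hC₄, hA₄⟩
  refine ⟨by omega, hB₃.trans (hA₄.mono (by simp) (by simp)), fun f => ?_, fun f => ?_, ?_⟩
  · rw [hA₄.arr 23 (by decide), k23]
  · rw [hA₄.arr 24 (by decide), k24]
  · rw [if_pos h]; exact hC₄

/-- It suffices to treat the men of S one by one: by closedness every arc at such a man ends inside
S, and every woman of S is the new partner of exactly one of them. The cost O(n) per man is paid by
the drop 6 of `Phi`. -/
def rotEdges : St := forN 30 0 (ifAll [.eq (.ld 28 (.r 30)) (.r 23)] rotMan .skip)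

theorem HT_rotEdges (hz : IsSuperStable I Mz) (g : Good Mz s) {S : Set I.V} (hrot : CanRotate s S)
    {ℓ : Fin I.a} (h23 : σ.reg 23 = ℓ.val) (hS : ∀ y, (Sum.inl y : I.V) ∈ S ↔ F.lab y = ℓ)
    {e : Fin I.a → Fin I.numE} (he : NewEdge L s S e)
    (hR : Rep L Mz { s with M := newMatching s S } F σ)
    (h10 : ∀ y : Fin I.a, (Sum.inl y : I.V) ∈ S → σ.arr 10 y.val = (e y).val + 1) :
    HT rotEdges σ (fun t τ => t ≤ I.a + (2 * I.a + I.b) * (Finset.univ.filter fun y : Fin I.a =>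
      (Sum.inl y : I.V) ∈ S).card ∧ Agr [8, 9, 10, 30, 31, 32, 33] [23, 24, 25, 26, 27] σ τ ∧
      Rep L Mz (rotate Mz s S) F τ) := by
  have f := rotFacts g hrot
  have g' := rotate_good hz g hrot
  have hset : ∀ y : Fin I.a, (Sum.inl y : I.V) ∈ S →
      (σ.arr 10 y.val ≠ σ.arr 12 y.val ↔ ¬ Settled (newMatching s S) Mz y) := by
    intro y hy
    have := g'.unsettled_iff hz y
    rw [rotate_M] at this
    rw [this, h10 y hy]
    have hm : (y, L.wom (e y)) ∈ newMatching s S := (f.man_in hy).2 (he.mem hy)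
    rcases hR.z y with ⟨h1, h2⟩ | ⟨k, h1, h2, h3⟩
    · rw [h1]
      exact ⟨fun _ => ⟨_, hm, h2 _⟩, fun _ => by omega⟩
    · rw [h1]
      constructor
      · refine fun h => ⟨_, hm, fun h' => h ?_⟩
        rw [L.edge_inj ((he y hy).1.trans h2.symm) (hz.1.fst h' h3)]
      · rintro ⟨w, h4, h5⟩ h6
        have : e y = k := Fin.ext (by omega)
        rw [this] at hm
        rw [(f.matching g).fst h4 hm] at h5
        exact h5 h3
  refine (HT_each (n := I.a) (c := 2 * I.a + I.b) (fun y => (Sum.inl y : I.V) ∈ S) (fun D τ =>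
    Agr [8, 9, 10, 30, 31, 32, 33] [23, 24, 25, 26, 27] σ τ ∧
    (∀ k : Fin I.numE, τ.arr 23 k.val = if ∃ y ∈ D, (Sum.inl y : I.V) ∈ S ∧
      (Worse L (e y) k ∨ L.man k = y ∧ k ≠ e y) then 0 else σ.arr 23 k.val) ∧
    (∀ k : Fin I.numE, τ.arr 24 k.val = if ∃ y ∈ D, (Sum.inl y : I.V) ∈ S ∧ Worse L (e y) k then 0
      else σ.arr 24 k.val) ∧
    RepC L (s.Ec.filter fun c => ¬ (c.1 ∈ D ∧ (Sum.inl c.1 : I.V) ∈ S ∧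
      ¬ Settled (newMatching s S) Mz c.1)) τ.arr) rfl rfl
    (by decide) hR.r0 ⟨(Agr.refl _ _ _).setReg (by simp) _, by simp [Mem.setReg_arr],
      by simp [Mem.setReg_arr], by simpa [Mem.setReg_arr] using hR.c⟩ ?_ ?_
      fun D τ v h => ⟨h.1.setReg (by simp) _, h.2⟩).mono ?_
  · rintro D τ y - h30 - ⟨hA, -, -⟩
    simp only [List.mem_singleton, forall_eq, Cd.holds, Ex.val, h30, hA.arr 28 (by decide), hR.f.lab,
      hA.reg 23 (by decide), h23, Fin.val_inj, hS]
  · rintro D τ y hyD hy h30 - ⟨hA, k23, k24, kC⟩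
    obtain ⟨hey, hey'⟩ := he y hy
    have hi := hR.inp.agr hA (by decide)
    have hτ10 : τ.arr 10 = σ.arr 10 := hA.arr _ (by decide)
    have hτ12 : τ.arr 12 = σ.arr 12 := hA.arr _ (by decide)
    refine (HT_rotMan hi (e y) (by rw [hey, h30]) (by rw [hey, hτ10, h10 y hy]) kC).mono ?_
    rintro t υ ⟨ht, hA', j23, j24, jC⟩
    refine ⟨ht, fun v => ⟨(hA.trans (hA'.mono (by simp) (by simp))).setReg (by simp) _,
      fun k => ?_, fun k => ?_, ?_⟩⟩
    · rw [Mem.setReg_arr, j23, k23, hey]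
      exact ite_ite_of_or (by simp only [Finset.mem_insert, exists_eq_or_imp, hy, true_and])
    · rw [Mem.setReg_arr, j24, k24]
      exact ite_ite_of_or (by simp only [Finset.mem_insert, exists_eq_or_imp, hy, true_and])
    · rw [Mem.setReg_arr]
      convert jC using 1
      rw [hey, hτ10, hτ12]
      ext ⟨x, w⟩
      by_cases hs : Settled (newMatching s S) Mz y
      · rw [if_neg (fun h => ((hset y hy).1 h) hs)]
        simp only [Finset.mem_filter, Finset.mem_insert]
        refine and_congr_right fun _ => not_congr (and_congr_left fun h => ?_)
        refine or_iff_right ?_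
        rintro rfl
        exact h.2 hs
      · rw [if_pos ((hset y hy).2 hs)]
        simp only [Finset.mem_filter, Finset.mem_insert, Finset.mem_erase, ne_eq, Prod.mk.injEq]
        constructor
        · rintro ⟨h1, h2⟩
          refine ⟨?_, h1, fun h => h2 ⟨Or.inr h.1, h.2⟩⟩
          rintro ⟨rfl, -⟩
          exact h2 ⟨Or.inl rfl, hy, hs⟩
        · rintro ⟨h1, h2, h3⟩
          refine ⟨h2, ?_⟩
          rintro ⟨rfl | h4, h5⟩
          · exact h1 ⟨rfl, (he.eq g hy).1 h2⟩
          · exact h3 ⟨h4, h5⟩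
  · rintro t τ ⟨ht, hA, k23, k24, kC⟩
    simp only [Finset.mem_filter, Finset.mem_univ, true_and] at k23 k24 kC
    have hdom : ∀ k : Fin I.numE, (∃ y, (Sum.inl y : I.V) ∈ S ∧ Worse L (e y) k) ↔
        (Sum.inr (L.wom k) : I.V) ∈ S ∧ Dominated (newMatching s S) (L.man k, L.wom k) := by
      intro k
      constructor
      · rintro ⟨y, hy, h1, h2⟩
        have h3 := he.mem hy
        have h4 := (f.ec _ _ hy h3).1
        rw [← h1] at h2 h3 h4
        refine ⟨h4, y, (f.man_in hy).2 h3, ?_⟩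
        rwa [(he y hy).1] at h2
      · rintro ⟨h1, y, h2, h3⟩
        obtain ⟨h4, hy⟩ := (f.wom_in h1).1 h2
        have h5 := (he.eq g hy).1 h4
        refine ⟨y, hy, h5, ?_⟩
        rw [← h5, (he y hy).1]; exact h3
    have off : ∀ B, B ∉ [23, 24, 25, 26, 27] → τ.arr B = σ.arr B := hA.arr
    refine ⟨ht, hA, ⟨?_, ?_, ?_, hR.inp.agr hA (by decide), ?_, ?_, fun k => ?_, fun k => ?_, ?_, ?_⟩⟩
    · rw [hA.reg 0 (by decide), hR.r0]
    · rw [hA.reg 1 (by decide), hR.r1]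
    · rw [hA.reg 2 (by decide), hR.r2]
    · exact hR.m.congr (off _ (by decide)) (off _ (by decide))
    · unfold RepZ; rw [off _ (by decide)]; exact hR.z
    · have hk : (L.man k, L.wom k) ∈ (rotate Mz s S).Ed ↔ (L.man k, L.wom k) ∈ s.Ed ∧
          ¬ ∃ y, (Sum.inl y : I.V) ∈ S ∧ (Sum.inl y : I.V) ∈ S ∧
            (Worse L (e y) k ∨ L.man k = y ∧ k ≠ e y) := by
        rw [mem_rotate_Ed]
        have h1 := hdom k
        constructor
        · rintro ⟨h2, h3, h4⟩
          refine ⟨h2, ?_⟩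
          rintro ⟨y, hy, -, h5 | ⟨rfl, h6⟩⟩
          · exact h4 (h1.1 ⟨y, hy, h5⟩).1 (h1.1 ⟨y, hy, h5⟩).2
          -- Edges of the digraph at a man of S end in S, by closedness or because they are his
          -- matching edge. Removing all but his new edge is thus what the rule for edges inside S
          -- demands.
          · have hw : (Sum.inr (L.wom k) : I.V) ∈ S := by
              by_cases hM : (L.man k, L.wom k) ∈ s.M
              · exact f.mM _ _ hy hM
              · exact f.closed _ hy _ ⟨h2, hM⟩
            exact h6 (((he _ hy).2 k rfl).1 ((f.man_in hy).1 (h3 hy hw)))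
        · rintro ⟨h2, h3⟩
          refine ⟨h2, fun hy hw => ?_, fun hw hd => ?_⟩
          · by_contra hcon
            refine h3 ⟨_, hy, hy, Or.inr ⟨rfl, fun h => hcon ((f.man_in hy).2 ?_)⟩⟩
            exact ((he _ hy).2 k rfl).2 h
          · obtain ⟨y, hy, h4⟩ := h1.2 ⟨hw, hd⟩
            exact h3 ⟨y, hy, hy, Or.inl h4⟩
      rw [k23, hR.ed]
      exact ite_ite_of_and_not hk
    · have hk : (L.man k, L.wom k) ∈ (rotate Mz s S).Er ↔ (L.man k, L.wom k) ∈ s.Er ∧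
          ¬ ∃ y, (Sum.inl y : I.V) ∈ S ∧ (Sum.inl y : I.V) ∈ S ∧ Worse L (e y) k := by
        rw [mem_rotate_Er]
        have h1 := hdom k
        refine and_congr_right fun _ => ?_
        rw [← not_and, ← h1]
        simp only [← and_assoc, and_self]
      rw [k24, hR.er]
      exact ite_ite_of_and_not hk
    · convert kC using 1
      ext ⟨x, w⟩
      rw [mem_rotate_Ec, Finset.mem_filter]
      refine and_congr_right fun h => ?_
      constructor
      · rintro h1 ⟨hx, -, hns⟩
        exact hns (h1 hx (f.ec _ _ hx h).1).2
      · intro h1 hx hw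
        exact ⟨(f.man_in hx).2 h, by_contra fun h2 => h1 ⟨hx, hx, h2⟩⟩
    · exact hR.f.congr (off _ (by decide)) (off _ (by decide)) (off _ (by decide))

end SuperStable

end


/-! ### Output of matchings, the output loop, and the total time of the main loop. -/

noncomputable section

open scoped Classical

namespace SuperStable

variable {I : Inst} {L : Layout I} {Mz : I.EdgeSet} {s : State I} {F : Forest I} {σ : Mem}

open Good Relation

/-! ### Writing a matching -/

/-- Write the matching whose edges at the men are stored in the array `B`. -/
def emitMatching (B : ℕ) : St :=
  forN 30 0 (.ite (.eq (.ld B (.r 30)) (.k 0)) (.out (.k 0))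
    (.out (.inc (.ld 1 (.dec (.ld B (.r 30)))))))

theorem HT_emitMatching {B : ℕ} {M : I.EdgeSet} (hi : Inp L σ.arr) (h0 : σ.reg 0 = I.a)
    (hM : IsMatching I M)
    (hB : ∀ x : Fin I.a, (σ.arr B x.val = 0 ∧ ∀ w, (x, w) ∉ M) ∨
      ∃ k : Fin I.numE, σ.arr B x.val = k.val + 1 ∧ L.man k = x ∧ (x, L.wom k) ∈ M) :
    HT (emitMatching B) σ (fun t τ => t ≤ I.a ∧ τ.out = σ.out ++ matchingCode M ∧
      τ.arr = σ.arr ∧ ∀ x, x ≠ 30 → τ.reg x = σ.reg x) := by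
  let q : Fin I.a → ℕ := fun m => ∑ w : Fin I.b, if (m, w) ∈ M then w.val + 1 else 0
  have hq : ∀ x : Fin I.a, q x = if σ.arr B x.val = 0 then 0 else
      σ.arr 1 (σ.arr B x.val - 1) + 1 := by
    intro x
    rcases hB x with ⟨h1, h2⟩ | ⟨k, h1, h2, h3⟩
    · rw [if_pos h1]
      exact Finset.sum_eq_zero fun w _ => if_neg (h2 w)
    · rw [if_neg (by omega), h1, Nat.add_sub_cancel, hi.wom]
      refine (Finset.sum_eq_single (L.wom k) (fun w _ hw => ?_) (by simp)).trans (if_pos h3)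
      exact if_neg fun h => hw (hM.fst h h3)
  refine (HT_for (N := I.a) (fun k t τ => t ≤ k ∧
    τ.out = σ.out ++ ((List.finRange I.a).take k).map q ∧ τ.arr = σ.arr ∧
    ∀ x, x ≠ 30 → τ.reg x = σ.reg x) rfl rfl (by decide) h0 ?_ ?_).mono ?_
  · exact ⟨le_rfl, by simp [Mem.setReg_out], rfl, fun x hx => by rw [Mem.setReg_reg, if_neg hx]⟩
  · rintro k T τ hk h30 - - ⟨h1, h2, h3, h4⟩
    have hs : σ.out ++ ((List.finRange I.a).take (k + 1)).map q = τ.out ++ [q ⟨k, hk⟩] := by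
      rw [List.take_succ_eq_append_getElem (by simpa using hk), h2]
      simp
    have hk' := hq ⟨k, hk⟩
    simp only at hk'
    rw [HT_ite, HT_out, HT_out, hs, hk']
    simp only [Cd.holds, Ex.val, h30, h3]
    refine ⟨fun h => ⟨by omega, ?_, rfl, fun x hx => ?_⟩, fun h => ⟨by omega, ?_, rfl, fun x hx => ?_⟩⟩
    · rw [if_pos h, Mem.setReg_out]
    · rw [Mem.setReg_reg, if_neg hx]; exact h4 x hx
    · rw [if_neg h, Mem.setReg_out]
    · rw [Mem.setReg_reg, if_neg hx]; exact h4 x hx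
  · rintro t τ ⟨⟨h1, h2, h3, h4⟩, -⟩
    rw [List.take_of_length_le (by simp)] at h2
    exact ⟨h1, h2, h3, h4⟩

/-! ### Updating the forest -/

def rotForest : St :=
  forN 30 0 (ifAll [.eq (.ld 28 (.r 30)) (.r 23)]
    (.put 28 (.r 30) (.r 30) ⨟ .put 29 (.r 30) (.k 0) ⨟ .put 30 (.r 30) (.k 0))
    (ifAll [.lt (.k 0) (.ld 29 (.r 30)), .eq (.ld 23 (.dec (.ld 29 (.r 30)))) (.k 0)]
      (.put 29 (.r 30) (.k 0)) .skip))

theorem HT_rotForest (hR : Rep L Mz s F σ) {S : Set I.V} {ℓ : Fin I.a} (h23 : σ.reg 23 = ℓ.val)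
    (hS : ∀ y, (Sum.inl y : I.V) ∈ S ↔ F.lab y = ℓ) :
    HT rotForest σ (fun t τ => t ≤ I.a ∧ Rep L Mz s (ForestOK.rotated s F S) τ) := by
  refine (HT_all (n := I.a) (fun D τ => Agr [30] [28, 29, 30] σ τ ∧ ∀ y : Fin I.a,
    τ.arr 28 y.val = (if y ∈ D ∧ (Sum.inl y : I.V) ∈ S then y.val else σ.arr 28 y.val) ∧
    τ.arr 29 y.val = (if y ∈ D ∧ ((Sum.inl y : I.V) ∈ S ∨ 0 < σ.arr 29 y.val ∧
      σ.arr 23 (σ.arr 29 y.val - 1) = 0) then 0 else σ.arr 29 y.val) ∧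
    τ.arr 30 y.val = (if y ∈ D ∧ (Sum.inl y : I.V) ∈ S then 0 else σ.arr 30 y.val)) rfl rfl
    (by decide) hR.r0 ⟨(Agr.refl _ _ _).setReg (by simp) _, by simp [Mem.setReg_arr]⟩ ?_
    fun D τ v h => ⟨h.1.setReg (by simp) _, h.2⟩).mono ?_
  · rintro D τ y hyD h30 - ⟨hA, h⟩
    obtain ⟨h1, h2, h3⟩ := h y
    simp only [hyD, false_and, if_false] at h1 h2 h3
    have hc1 : (∀ c ∈ [Cd.eq (.ld 28 (.r 30)) (.r 23)], c.holds τ) ↔ (Sum.inl y : I.V) ∈ S := by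
      simp only [List.mem_singleton, forall_eq, Cd.holds, Ex.val, h30, h1, hR.f.lab,
        hA.reg 23 (by decide), h23, Fin.val_inj, hS]
    have hc2 : (∀ c ∈ [Cd.lt (.k 0) (.ld 29 (.r 30)), .eq (.ld 23 (.dec (.ld 29 (.r 30)))) (.k 0)],
        c.holds τ) ↔ 0 < σ.arr 29 y.val ∧ σ.arr 23 (σ.arr 29 y.val - 1) = 0 := by
      simp only [List.mem_cons, List.not_mem_nil, or_false, forall_eq_or_imp, forall_eq, Cd.holds,
        Ex.val, h30, h2, hA.arr 23 (by decide)]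
    have hins : ∀ z, z ≠ y → (z ∈ insert y D ↔ z ∈ D) := fun z hz => by simp [hz]
    rw [HT_ifAll, hc1, HT_ifAll, hc2, HT_skip, HT_put, HT_seq, HT_put, HT_seq, HT_put, HT_put]
    refine ⟨fun hy => ⟨rfl, fun v => ⟨(((hA.setArr (by simp) _ _).setArr (by simp) _ _).setArr
      (by simp) _ _).setReg (by simp) _, fun z => ?_⟩⟩, fun hy => ⟨fun hc => ⟨rfl, fun v =>
      ⟨(hA.setArr (by simp) _ _).setReg (by simp) _, fun z => ?_⟩⟩, fun hc => ⟨rfl, fun v =>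
      ⟨hA.setReg (by simp) _, fun z => ?_⟩⟩⟩⟩
    all_goals
      simp only [Mem.setReg_arr, Mem.setArr_arr, Mem.setArr_reg, Ex.val, h30, Function.update_apply,
        Nat.reduceEqDiff, if_false, if_true, Fin.val_inj]
      by_cases hz : z = y
      · subst hz
        simp [hy, h1, h2, h3] <;> omega
      · simp only [hz, if_false, hins z hz]
        exact h z
  · rintro t τ ⟨ht, hA, h⟩
    simp only [Finset.mem_univ, true_and] at h
    refine ⟨ht, hR.setForest ⟨fun y => ?_, fun y => ?_, fun y => ?_⟩ (fun B hB => hA.arr B ?_)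
      fun i hi => hA.reg i ?_⟩
    · rw [(h y).1, hR.f.lab]
      simp only [ForestOK.rotated]
      split_ifs <;> rfl
    · rw [(h y).2.1]
      by_cases hy : (Sum.inl y : I.V) ∈ S
      · exact Or.inl ⟨by simp [ForestOK.rotated, hy], by simp [hy]⟩
      · rcases hR.f.out y with ⟨h1, h2⟩ | ⟨k, h1, h2⟩
        · exact Or.inl ⟨by simp [ForestOK.rotated, hy, h1], by simp [h2]⟩
        · rw [h2, Nat.add_sub_cancel, hR.ed]
          by_cases hk : (L.man k, L.wom k) ∈ s.Ed
          · exact Or.inr ⟨k, by simp [ForestOK.rotated, hy, h1, hk], by simp [hy, hk]⟩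
          · exact Or.inl ⟨by simp [ForestOK.rotated, hy, h1, hk], by simp [hk]⟩
    · rw [(h y).2.2, hR.f.dirty]
      simp only [ForestOK.rotated, Finset.mem_filter]
      by_cases hy : (Sum.inl y : I.V) ∈ S <;> simp [hy]
    · simp only [List.mem_cons, List.not_mem_nil, or_false]; omega
    · simp only [List.mem_cons, List.not_mem_nil, or_false]; omega

/-! ### The output loop -/

def rotateStep : St :=
  rotFind ⨟ .ite (.eq (.r 22) (.k 0)) (.set 20 (.k 0)) (.set 23 (.dec (.r 22)) ⨟ rotPair ⨟ rotEdges ⨟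
    .out (.k 2) ⨟ emitMatching 10 ⨟ rotForest ⨟ restore)

/-- A man of S raises `Psi` by at most 2 and lowers `Phi` by 6; a removed arc raises `Psi` by at
most 1 and lowers `Phi` by 2. So `Theta` falls in proportion to the size of S, which pays for O(n)
work per man and for the repair. -/
theorem HT_rotateStep (hz : IsSuperStable I Mz) (v : Valid L Mz s F σ) (h20 : σ.reg 20 = 1) :
    HT rotateStep σ (fun t τ =>
      (τ.reg 20 = 0 ∧ (∀ S, ¬ CanRotate s S) ∧ Valid L Mz s F τ ∧ τ.out = σ.out ∧ t ≤ 3 * I.a) ∨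
      (τ.reg 20 = 1 ∧ ∃ S F', CanRotate s S ∧ Valid L Mz (rotate Mz s S) F' τ ∧
        τ.out = σ.out ++ eventCode (Event.output (newMatching s S)) ∧
        t + 1 + 16 * (I.numV * Theta Mz (rotate Mz s S) F') ≤ 16 * (I.numV * Theta Mz s F) ∧
        Theta Mz (rotate Mz s S) F' < Theta Mz s F)) := by
  have hN : I.numV = I.a + I.b := rfl
  rw [rotateStep, HT_seq]
  refine (HT_rotFind hz v).mono ?_
  rintro t₁ τ₁ ⟨ht₁, hA₁, hres⟩
  have hR₁ := v.rep.agr hA₁ (by decide) (by decide)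
  rw [HT_ite, HT_set]
  simp only [Cd.holds, Ex.val]
  refine ⟨fun h0 => ?_, fun h0 => ?_⟩
  · rcases hres with ⟨-, h⟩ | ⟨ℓ, h, -⟩
    · exact Or.inl ⟨by simp [Mem.setReg], h, ⟨v.good, v.ok, v.clean, hR₁.setReg (by decide) _⟩,
        hA₁.out, by omega⟩
    · omega
  obtain ⟨ℓ, hℓ, hlab, hout, hrot⟩ := hres.resolve_left fun h => h0 h.1
  set S := scc s (Sum.inl ℓ) with hSdef
  have f := rotFacts v.good hrot
  have hroot : F.out (F.lab ℓ) = none := by rw [hlab, hout]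
  have hS : ∀ y, (Sum.inl y : I.V) ∈ S ↔ F.lab y = ℓ := fun y => by
    rw [hSdef, v.ok.mem_scc_iff v.clean hroot, hlab]
  have hself : (Sum.inl ℓ : I.V) ∈ S := self_mem_scc s _
  obtain ⟨e, he⟩ := exists_newEdge (L := L) v.good f hself
  obtain ⟨ok', hpsi⟩ := v.ok.rotated_ok v.good v.clean f hroot hSdef
  have g' := rotate_good hz v.good hrot
  rw [HT_seq, HT_set, HT_seq]
  have e1 : (Ex.dec (.r 22)).val τ₁ = ℓ.val := by simp [Ex.val, hℓ]
  rw [e1]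
  have hR₁' : Rep L Mz s F (τ₁.setReg 23 ℓ.val) := hR₁.setReg (by decide) _
  have h23 : (τ₁.setReg 23 ℓ.val).reg 23 = ℓ.val := by simp [Mem.setReg]
  refine (HT_rotPair v.good hR₁' f h23 hS he).mono ?_
  rintro t₂ τ₂ ⟨ht₂, hA₂, hM₂, h10⟩
  have hR₂ : Rep L Mz { s with M := newMatching s S } F τ₂ := by
    obtain ⟨a1, a2, a3, a4, -, a6, a7, a8, a9, a10⟩ := hR₁'
    have off : ∀ B, B ∉ [10, 11] → τ₂.arr B = _ := hA₂.arr
    refine ⟨?_, ?_, ?_, a4.agr hA₂ (by decide), hM₂, ?_, ?_, ?_,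
      a9.congr (off _ (by decide)) (off _ (by decide)) (off _ (by decide)),
      a10.congr (off _ (by decide)) (off _ (by decide)) (off _ (by decide))⟩
    · rw [hA₂.reg 0 (by decide), a1]
    · rw [hA₂.reg 1 (by decide), a2]
    · rw [hA₂.reg 2 (by decide), a3]
    · unfold RepZ; rw [off _ (by decide)]; exact a6
    · rw [off _ (by decide)]; exact a7
    · rw [off _ (by decide)]; exact a8
  have h23₂ : τ₂.reg 23 = ℓ.val := (hA₂.reg 23 (by decide)).trans h23
  rw [HT_seq]
  refine (HT_rotEdges hz v.good hrot h23₂ hS he hR₂ h10).mono ?_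
  rintro t₃ τ₃ ⟨ht₃, hA₃, hR₃⟩
  rw [HT_seq, HT_out, HT_seq]
  set μ : Mem := { τ₃ with out := τ₃.out ++ [Ex.val τ₃ (.k 2)] } with hμ
  have hRμ : Rep L Mz (rotate Mz s S) F μ := hR₃.out
  refine (HT_emitMatching hRμ.inp hRμ.r0 g'.mat hRμ.m.pm).mono ?_
  rintro t₄ τ₄ ⟨ht₄, ho₄, harr₄, hreg₄⟩
  have hR₄ : Rep L Mz (rotate Mz s S) F τ₄ := hRμ.congr harr₄ fun i hi => hreg₄ i (by omega)
  have h23₄ : τ₄.reg 23 = ℓ.val := by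
    rw [hreg₄ 23 (by decide)]
    exact (hA₃.reg 23 (by decide)).trans h23₂
  rw [HT_seq]
  refine (HT_rotForest hR₄ h23₄ hS).frame.mono ?_
  rintro t₅ τ₅ ⟨⟨ht₅, hR₅⟩, hF₅⟩
  have hpos : 0 < I.numV := by have := ℓ.pos; omega
  refine (HT_restore hpos g' ok' hR₅).frame.mono ?_
  rintro t₆ τ₆ ⟨⟨F', ok'', hc'', hR₆, ht₆⟩, hF₆⟩
  have hphi := Phi_rotate v.good f
  have hq : Psi Mz F' ≤ Psi Mz (ForestOK.rotated (rotate Mz s S) F S) + 1 :=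
    Nat.le_of_mul_le_mul_left ((Nat.le_add_left _ _).trans ht₆) (by omega)
  set c := (Finset.univ.filter fun m => (Sum.inl m : I.V) ∈ S).card with hcdef
  set d := ((s.Ed \ s.M) \ (rotate Mz s S).Ed).card with hddef
  have hc1 : 0 < c := Finset.card_pos.2 ⟨ℓ, by simpa using hself⟩
  refine Or.inr ⟨?_, S, F', hrot, ⟨g', ok'', hc'', hR₆⟩, ?_, ?_, ?_⟩
  · rw [hF₆.reg 20 rfl, hF₅.reg 20 rfl, hreg₄ 20 (by decide)]
    change τ₃.reg 20 = 1
    rw [hA₃.reg 20 (by decide), hA₂.reg 20 (by decide), Mem.setReg_reg, if_neg (by decide),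
      hA₁.reg 20 (by decide), h20]
  · rw [hF₆.out rfl, hF₅.out rfl, ho₄]
    change τ₃.out ++ [2] ++ matchingCode (newMatching s S) = _
    rw [hA₃.out, hA₂.out, Mem.setReg_out, hA₁.out]
    simp [eventCode]
  · set N := I.numV with hNdef
    set p := Psi Mz (ForestOK.rotated (rotate Mz s S) F S) with hpdef
    have a1 : I.b * c ≤ N * c := Nat.mul_le_mul_right _ (by omega)
    have a2 : (2 * I.a + I.b) * c ≤ 2 * (N * c) := by
      rw [← Nat.mul_assoc]; exact Nat.mul_le_mul_right _ (by omega)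
    have a3 : N ≤ N * c := Nat.le_mul_of_pos_right _ hc1
    have a4 := Nat.mul_le_mul_left N hpsi
    have a5 := Nat.mul_le_mul_left N hphi
    have a6 := Nat.mul_le_mul_left N hq
    have e2 : 4 * N * Psi Mz F' = 4 * (N * Psi Mz F') := by ring
    have e3 : 4 * N * (p + 1) = 4 * (N * p) + 4 * N := by ring
    have e4 : N * (2 * c) = 2 * (N * c) := by ring
    have e5 : N * (6 * c) = 6 * (N * c) := by ring
    have e6 : N * (2 * d) = 2 * (N * d) := by ring
    simp only [Nat.mul_add, e4, e5, e6] at a4 a5 a6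
    simp only [Theta, Nat.mul_add]
    omega
  · simp only [Theta]
    omega

def outputLoop : St := .set 20 (.k 1) ⨟ .whl (.k 0) (.r 20) rotateStep

theorem HT_outputLoop (hz : IsSuperStable I Mz) (v : Valid L Mz s F σ) :
    HT outputLoop σ (fun t τ => ∃ s' F' l, OutputLoop Mz s l s' ∧ (∀ S, ¬ CanRotate s' S) ∧
      Valid L Mz s' F' τ ∧ τ.out = σ.out ++ l.flatMap eventCode ∧
      (s' = s ∧ Theta Mz s' F' ≤ Theta Mz s F ∨ Theta Mz s' F' < Theta Mz s F) ∧
      t + 16 * (I.numV * Theta Mz s' F') ≤ 16 * (I.numV * Theta Mz s F) + 3 * I.numV + 1) := by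
  have hN : I.numV = I.a + I.b := rfl
  rw [outputLoop, HT_seq, HT_set]
  refine (HT_measure (e := .k 0) (f := .r 20) (p := rotateStep) (fun n T τ => ∃ s' F' l,
    (∀ l' u, OutputLoop Mz s' l' u → OutputLoop Mz s (l ++ l') u) ∧
    Valid L Mz s' F' τ ∧ τ.out = σ.out ++ l.flatMap eventCode ∧
    (s' = s ∧ Theta Mz s' F' ≤ Theta Mz s F ∨ Theta Mz s' F' < Theta Mz s F) ∧
    τ.reg 20 ≤ 1 ∧ n = Theta Mz s' F' + τ.reg 20 ∧ (τ.reg 20 = 0 → ∀ S, ¬ CanRotate s' S) ∧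
    T + 16 * (I.numV * Theta Mz s' F') ≤ 16 * (I.numV * Theta Mz s F) +
      (if τ.reg 20 = 0 then 3 * I.numV + 1 else 0)) ?_ (Theta Mz s F + 1) 0 _ ?_).mono ?_
  · rintro n T τ ⟨s', F', l, h1, v', ho, hle, h20, rfl, -, hT⟩ hlt
    have h20' : τ.reg 20 = 1 := by simp only [Ex.val] at hlt; omega
    rw [if_neg (by omega)] at hT
    refine (HT_rotateStep hz v' h20').mono ?_
    rintro t υ (⟨a1, a2, a3, a4, a5⟩ | ⟨a1, S, F'', a2, a3, a7, a8, a9⟩)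
    · refine ⟨_, by omega, s', F', l, h1, a3, a4.trans ho, hle, by omega, rfl, fun _ => a2, ?_⟩
      rw [if_pos a1]; omega
    · refine ⟨_, by omega, rotate Mz s' S, F'', l ++ [Event.output (newMatching s' S)],
        fun l' u h => ?_, a3, ?_, Or.inr (by omega), by omega, rfl, fun h => by omega, ?_⟩
      · rw [List.append_assoc]; exact h1 _ _ (.step _ _ _ _ a2 h)
      · rw [a7, ho]; simp
      · rw [if_neg (by omega)]; omega
  · refine ⟨s, F, [], fun l' u h => h, ⟨v.good, v.ok, v.clean, v.rep.setReg (by decide) _⟩,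
      by simp [Mem.setReg_out], Or.inl ⟨rfl, le_rfl⟩, ?_, ?_, fun h => ?_, ?_⟩ <;>
      simp [Mem.setReg, Ex.val] at *
  · rintro t τ ⟨hlt, n, s', F', l, h1, v', ho, hle, h20, -, h0, hT⟩
    have h20' : τ.reg 20 = 0 := by simp only [Ex.val] at hlt; omega
    rw [if_pos h20'] at hT
    refine ⟨s', F', l, ?_, h0 h20', v', ho, hle, by omega⟩
    simpa using h1 [] s' (.exit _ (h0 h20'))

/-! ### The main loop -/

/-- The final search leaves its result in register 20, which is also the flag of the main loop: it
is nonzero as long as some man is unsettled. -/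
def round : St :=
  search ⨟ .out (.k 1) ⨟ pruneLoop ⨟ outputLoop ⨟
  findN 21 0 20 [.ne (.ld 10 (.r 21)) (.ld 12 (.r 21))]

theorem HT_round (hz : IsSuperStable I Mz) (v : Valid L Mz s F σ) :
    HT round σ (fun t τ => ∃ t' u F' l₁ l₂, SearchLoop Mz s l₁ t' ∧ OutputLoop Mz (prune t') l₂ u ∧
      Valid L Mz u F' τ ∧ τ.out = σ.out ++ (l₁ ++ Event.prune :: l₂).flatMap eventCode ∧
      (τ.reg 20 = 0 ↔ ∀ m, Settled u.M Mz m) ∧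
      (τ.reg 20 ≠ 0 → Theta Mz u F' < Theta Mz s F) ∧
      t + 16 * (I.numV * Theta Mz u F') ≤ 16 * (I.numV * Theta Mz s F) + 6 * I.numV + 2) := by
  have hN : I.numV = I.a + I.b := rfl
  rw [round, HT_seq]
  refine (HT_search hz v).mono ?_
  rintro t₁ τ₁ ⟨s₁, F₁, l₁, hl₁, hno, v₁, ho₁, hle₁, ht₁⟩
  rw [HT_seq, HT_out, HT_seq]
  have v₁' : Valid L Mz s₁ F₁ { τ₁ with out := τ₁.out ++ [Ex.val τ₁ (.k 1)] } :=
    ⟨v₁.good, v₁.ok, v₁.clean, v₁.rep.out⟩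
  refine (HT_pruneLoop hz v₁').mono ?_
  rintro t₂ τ₂ ⟨v₂, ho₂, hle₂, ht₂⟩
  rw [HT_seq]
  refine (HT_outputLoop hz v₂).mono ?_
  rintro t₃ τ₃ ⟨u, F₃, l₂, hl₂, hno₃, v₃, ho₃, hle₃, ht₃⟩
  refine (HT_findN (N := I.a) (fun k => ∃ h : k < I.a, ¬ Settled u.M Mz ⟨k, h⟩) (by decide)
    v₃.rep.r0 ?_).mono ?_
  · intro k τ hk hA hk21
    have := v₃.rep.unsettled hz v₃.good ⟨k, hk⟩
    simp only at this
    simp only [List.mem_singleton, forall_eq, Cd.holds, Ex.val, hA.arr, hk21, ← this, hk,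
      exists_true_left, ne_eq]
  rintro t₄ τ₄ ⟨ht₄, hA₄, hres⟩
  have h20 : τ₄.reg 20 = 0 ↔ ∀ m, Settled u.M Mz m := by
    rcases hres with ⟨h1, h2⟩ | ⟨k, hk, h1, _, h2⟩
    · exact ⟨fun _ m => by_contra fun h => h2 m.val m.2 ⟨m.2, h⟩, fun _ => h1⟩
    · exact ⟨fun h => absurd (h1.symm.trans h) (Nat.succ_ne_zero k), fun h => absurd (h _) h2⟩
  refine ⟨s₁, u, F₃, l₁, l₂, hl₁, hl₂, ⟨v₃.good, v₃.ok, v₃.clean, v₃.rep.agree hA₄ (by decide)⟩,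
    ?_, h20, fun hne => ?_, ?_⟩
  · rw [hA₄.out, ho₃, ho₂, ho₁]
    simp [eventCode, Ex.val]
  -- If `Theta` did not fall, neither the deletions nor the output loop changed the state. Then
  -- nobody can be scanned, no relevant woman is multiply engaged and nothing can be rotated, so
  -- `not_stuck` applies.
  · by_contra hcon
    refine hne (h20.2 ?_)
    clear hres
    simp only [Theta] at hle₁ hle₃ hcon
    rcases hle₃ with ⟨rfl, hle₃⟩ | h
    · rcases prune_progress hz v₁.good with h | ⟨h, hp⟩
      · omega
      · rw [h] at hno₃ ⊢
        exact v₁.good.not_stuck hz hno (fun m w h1 h2 => hp m w ⟨h1, h2⟩) hno₃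
    · omega
  · clear hres
    simp only [Theta, Nat.mul_add] at ht₁ ht₃ ⊢
    omega

def mainLoop : St := .set 20 (.k 1) ⨟ .whl (.k 0) (.r 20) round

/-- A round costs 16n per unit of decrease of `Theta` and O(n) in addition. Every round except the
last lowers `Theta`, so the additional costs, at most 6n + 3 per round, are absorbed as well. -/
theorem HT_mainLoop (hz : IsSuperStable I Mz) (v : Valid L Mz s F σ) :
    HT mainLoop σ (fun t τ => ∃ l, RepeatLoop Mz s l ∧ τ.out = σ.out ++ l.flatMap eventCode ∧
      t ≤ (22 * I.numV + 3) * (Theta Mz s F + 1)) := by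
  rw [mainLoop, HT_seq, HT_set]
  refine (HT_measure (e := .k 0) (f := .r 20) (p := round) (fun n T τ => ∃ l,
    τ.out = σ.out ++ l.flatMap eventCode ∧
    ((τ.reg 20 = 0 ∧ n = 0 ∧ RepeatLoop Mz s l ∧ T ≤ (22 * I.numV + 3) * (Theta Mz s F + 1)) ∨
      (τ.reg 20 ≠ 0 ∧ ∃ s' F', n = Theta Mz s' F' + 1 ∧ Valid L Mz s' F' τ ∧
        (∀ l', RepeatLoop Mz s' l' → RepeatLoop Mz s (l ++ l')) ∧
        T + (22 * I.numV + 3) * (Theta Mz s' F' + 1) ≤ (22 * I.numV + 3) * (Theta Mz s F + 1))))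
    ?_ (Theta Mz s F + 1) 0 _ ?_).mono ?_
  · rintro n T τ ⟨l, ho, ⟨h0, -⟩ | ⟨-, s', F', rfl, v', hl, hT⟩⟩ hlt
    · simp only [Ex.val] at hlt; omega
    refine (HT_round hz v').mono ?_
    rintro t υ ⟨t', u, F'', l₁, l₂, h1, h2, v'', ho', h20, hlt', ht⟩
    by_cases h0 : υ.reg 20 = 0
    · refine ⟨0, by omega, l ++ (l₁ ++ Event.prune :: l₂), by rw [ho', ho]; simp,
        Or.inl ⟨h0, rfl, hl _ (.last _ _ _ _ _ h1 h2 (h20.1 h0)), ?_⟩⟩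
      have e1 : (22 * I.numV + 3) * (Theta Mz s' F' + 1) = 22 * (I.numV * Theta Mz s' F') +
        3 * Theta Mz s' F' + 22 * I.numV + 3 := by ring
      omega
    · refine ⟨Theta Mz u F'' + 1, by have := hlt' h0; omega, l ++ (l₁ ++ Event.prune :: l₂),
        by rw [ho', ho]; simp, Or.inr ⟨h0, u, F'', rfl, v'', fun l' h => ?_, ?_⟩⟩
      · rw [List.append_assoc]
        exact hl _ (.again _ _ _ _ _ _ h1 h2 (fun h => h0 (h20.2 h)) h)
      · have e1 : (22 * I.numV + 3) * (Theta Mz s' F' + 1) = 22 * (I.numV * Theta Mz s' F') +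
          3 * Theta Mz s' F' + 22 * I.numV + 3 := by ring
        have e2 : (22 * I.numV + 3) * (Theta Mz u F'' + 1) = 22 * (I.numV * Theta Mz u F'') +
          3 * Theta Mz u F'' + 22 * I.numV + 3 := by ring
        have e3 : I.numV * (Theta Mz u F'' + 1) ≤ I.numV * Theta Mz s' F' :=
          Nat.mul_le_mul_left _ (hlt' h0)
        have := hlt' h0
        rw [Nat.mul_add] at e3
        omega
  · refine ⟨[], by simp [Mem.setReg_out], Or.inr ⟨by simp [Mem.setReg, Ex.val], s, F, rfl,
      ⟨v.good, v.ok, v.clean, v.rep.setReg (by decide) _⟩, fun l' h => h, by omega⟩⟩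
  · rintro t τ ⟨hlt, n, l, ho, ⟨h0, -, hl, hT⟩ | ⟨h0, -⟩⟩
    · exact ⟨l, hl, ho, by omega⟩
    · simp only [Ex.val] at hlt; omega

end SuperStable

end


/-! ### Computation of the two optimal matchings, the initial state, and the theorem. -/

noncomputable section

open scoped Classical

namespace SuperStable

variable {I : Inst} {L : Layout I} {Mz : I.EdgeSet} {s : State I} {F : Forest I} {σ : Mem}

open Good Proposal

/-! ### Super-stable matchings as sets of edge numbers -/

/-- The condition on missing edges is an implication between the two sides whose contrapositive
exchanges them. Hence the same program and proof serve the women. -/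
theorem Proposal.Stable.swap {ι α β : Type*} {mn : ι → α} {wm : ι → β} {rm rw : ι → ℕ} {N : Finset ι}
    (h : Stable mn wm rm rw N) : Stable wm mn rw rm N := by
  refine ⟨fun e he f hf h' => h.mat e he f hf h'.symm, fun e he hw => ?_⟩
  by_contra hcon
  push Not at hcon
  obtain ⟨f, h1, h2, h3⟩ := h.ss e he hcon
  exact absurd (hw f h1 h2) (not_le.2 h3)

namespace Layout

variable (L)

abbrev rkM (k : Fin I.numE) : ℕ := I.rankM (L.man k) (L.wom k)

abbrev rkW (k : Fin I.numE) : ℕ := I.rankW (L.wom k) (L.man k)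

def edges (T : Finset (Fin I.numE)) : I.EdgeSet := T.image fun k => (L.man k, L.wom k)

variable {L}

theorem mem_edges {T : Finset (Fin I.numE)} {k : Fin I.numE} :
    (L.man k, L.wom k) ∈ L.edges T ↔ k ∈ T := by
  simp only [edges, Finset.mem_image]
  exact ⟨fun ⟨l, h, h'⟩ => L.pair_inj.1 h' ▸ h, fun h => ⟨k, h, rfl⟩⟩

theorem edges_sub {T : Finset (Fin I.numE)} : L.edges T ⊆ I.E := by
  intro e he
  obtain ⟨k, -, rfl⟩ := Finset.mem_image.1 he
  exact L.mem_E k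

theorem exists_edges {M : I.EdgeSet} (h : M ⊆ I.E) : ∃ T, L.edges T = M := by
  refine ⟨Finset.univ.filter fun k => (L.man k, L.wom k) ∈ M, ?_⟩
  ext ⟨m, w⟩
  constructor
  · intro h'
    obtain ⟨k, h1, h2⟩ := Finset.mem_image.1 h'
    rw [← h2]; exact (Finset.mem_filter.1 h1).2
  · intro h'
    obtain ⟨k, rfl, rfl⟩ := L.exists_edge (h h')
    exact mem_edges.2 (Finset.mem_filter.2 ⟨Finset.mem_univ _, h'⟩)

theorem stable_iff {T : Finset (Fin I.numE)} :
    Stable L.man L.wom L.rkM L.rkW T ↔ IsSuperStable I (L.edges T) := by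
  constructor
  · intro h
    refine ⟨⟨edges_sub, fun e he f hf h' => ?_⟩, ?_⟩
    · obtain ⟨k, h1, rfl⟩ := Finset.mem_image.1 he
      obtain ⟨l, h2, rfl⟩ := Finset.mem_image.1 hf
      rw [h.mat k h1 l h2 h']
    · rintro ⟨m, w⟩ ⟨h1, h2, h3, h4⟩
      obtain ⟨k, rfl, rfl⟩ := L.exists_edge h1
      obtain ⟨f, h5, h6, h7⟩ := h.ss k (fun h => h2 (mem_edges.2 h)) fun f hf hfk => by
        have := h3 (L.wom f) (by rw [← hfk]; exact mem_edges.2 hf)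
        simpa only [rkM, hfk] using this
      have := h4 (L.man f) (by rw [← h6]; exact mem_edges.2 h5)
      simp only [rkW, h6] at h7 this
      omega
  · intro h
    refine ⟨fun e he f hf h' => ?_, fun e he h' => ?_⟩
    · exact L.pair_inj.1 (h.1.2 _ (mem_edges.2 he) _ (mem_edges.2 hf) h')
    · obtain ⟨x, h1, h2⟩ := h.better (L.mem_E e) fun w' hw' => by
        obtain ⟨k, h3, rfl⟩ := L.exists_edge (edges_sub hw')
        rw [← h3] at hw' ⊢
        have := h' k (mem_edges.1 hw') h3
        simpa only [rkM, h3] using this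
      obtain ⟨k, rfl, h3⟩ := L.exists_edge (edges_sub h1)
      rw [← h3] at h1
      refine ⟨k, mem_edges.1 h1, h3, ?_⟩
      rcases h2 with h2 | h2
      · exact absurd (mem_edges.1 h1) (L.edge_inj h2 h3 ▸ he)
      · simpa only [rkW, h3] using h2

end Layout

theorem side_men {A : ℕ → ℕ → ℕ} (h : Inp L A) :
    Side false I.numV L.man L.wom L.rkM L.rkW L.listM L.listW (Layout.ofsM (I := I)) Layout.ofsW A :=
  ⟨h.man, h.wom, h.rkM, h.rkW, h.lstM, h.offM, h.lstW, h.offW, L.listsM, L.listsW,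
    Nat.le_add_right _ _, fun x => (L.degM x).trans (Nat.le_add_left _ _),
    fun x => (L.degW x).trans (Nat.le_add_right _ _)⟩

theorem side_women {A : ℕ → ℕ → ℕ} (h : Inp L A) :
    Side true I.numV L.wom L.man L.rkW L.rkM L.listW L.listM (Layout.ofsW (I := I)) Layout.ofsM A :=
  ⟨h.wom, h.man, h.rkW, h.rkM, h.lstW, h.offW, h.lstM, h.offM, L.listsW, L.listsM,
    Nat.le_add_left _ _, fun x => (L.degW x).trans (Nat.le_add_right _ _),
    fun x => (L.degM x).trans (Nat.le_add_left _ _)⟩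

/-! ### Initialisation -/

/-- Write `c` into the entries of `B` for the edges that satisfy the conditions. -/
def putEdges (B c : ℕ) (cs : List Cd) : St := forN 30 2 (ifAll cs (.put B (.r 30) (.k c)) .skip)

theorem HT_putEdges {B c : ℕ} {cs : List Cd} (P : Fin I.numE → Prop) (h2 : σ.reg 2 = I.numE)
    (hc : ∀ k τ, Agr [30] [B] σ τ → τ.reg 30 = k.val → ((∀ c ∈ cs, c.holds τ) ↔ P k)) :
    HT (putEdges B c cs) σ (fun t τ => t ≤ I.numE ∧ Agr [30] [B] σ τ ∧
      ∀ k : Fin I.numE, τ.arr B k.val = if P k then c else σ.arr B k.val) := by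
  refine (HT_each (n := I.numE) (c := 0) P (fun D τ => Agr [30] [B] σ τ ∧
    ∀ k : Fin I.numE, τ.arr B k.val = if k ∈ D then c else σ.arr B k.val)
    (ifAll_wr rfl rfl) (ifAll_wr rfl rfl) (by decide) h2
    ⟨(Agr.refl _ _ _).setReg (by simp) _, by simp [Mem.setReg_arr]⟩
    (fun D τ k _ h30 _ h => hc k τ h.1 h30) ?_ fun D τ v h => ⟨h.1.setReg (by simp) _, h.2⟩).mono ?_
  · rintro D τ k - - h30 - ⟨hA, h⟩
    rw [HT_put]
    refine ⟨le_rfl, fun v => ⟨(hA.setArr (by simp) _ _).setReg (by simp) _, fun l => ?_⟩⟩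
    simp only [Mem.setReg_arr, Mem.setArr_arr, if_true, Ex.val, h30, Function.update_apply, h,
      Fin.val_inj, Finset.mem_insert]
    by_cases hl : l = k <;> simp [hl]
  · rintro t τ ⟨h1, h3, h4⟩
    exact ⟨by omega, h3, fun k => by rw [h4]; simp⟩

def manEdge : Ex := .ld 10 (.ld 0 (.r 30))

def womEdge : Ex := .ld 11 (.ld 1 (.r 30))

/-- The men's proposals leave M₀ stored at the women, so its edges at the men are filled in first.
Unprocessed edges are then set by the condition on the man and cleared by domination at the woman.
-/
def initArrays : St :=
  forN 30 1 (ifAll [.lt (.k 0) (.ld 11 (.r 30))]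
    (.put 10 (.ld 0 (.dec (.ld 11 (.r 30)))) (.ld 11 (.r 30))) .skip) ⨟
  forN 30 0 (.put 28 (.r 30) (.r 30)) ⨟
  putEdges 23 1 [.eq manEdge (.inc (.r 30))] ⨟
  putEdges 24 1 [.lt (.k 0) manEdge, .lt (.ld 2 (.dec manEdge)) (.ld 2 (.r 30))] ⨟
  putEdges 24 0 [.lt (.k 0) womEdge, .lt (.ld 3 (.dec womEdge)) (.ld 3 (.r 30))] ⨟
  forN 30 2 (ifAll [.eq manEdge (.inc (.r 30)), .eq (.ld 12 (.ld 0 (.r 30))) manEdge] (addEc 30) .skip)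

theorem HT_initArrays {M₀ : I.EdgeSet} (h0 : IsManOptimal I M₀) (hz : IsWomanOptimal I Mz)
    (hi : Inp L σ.arr) (hr : σ.reg 0 = I.a ∧ σ.reg 1 = I.b ∧ σ.reg 2 = I.numE)
    (hpw : ∀ w : Fin I.b, (σ.arr 11 w.val = 0 ∧ ∀ x, (x, w) ∉ M₀) ∨
      ∃ k : Fin I.numE, σ.arr 11 w.val = k.val + 1 ∧ L.wom k = w ∧ (L.man k, w) ∈ M₀)
    (hzm : RepZ L Mz σ.arr) (hA0 : ∀ B ∈ [10, 23, 24, 25, 26, 27, 28, 29, 30], ∀ i, σ.arr B i = 0) :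
    HT initArrays σ (fun t τ => t ≤ I.numV + 4 * I.numE ∧ τ.out = σ.out ∧
      Valid L Mz (initState M₀ Mz) (ForestOK.init I) τ) := by
  obtain ⟨hr0, hr1, hr2⟩ := hr
  have hss := h0.1
  rw [initArrays, HT_seq]
  refine (HT_each (n := I.b) (c := 0) (fun w => ∃ k, σ.arr 11 w.val = k + 1) (fun D τ => Agr [30] [10] σ τ ∧
    ∀ x : Fin I.a, (τ.arr 10 x.val = 0 ∧ ∀ w ∈ D, (x, w) ∉ M₀) ∨
      ∃ k : Fin I.numE, τ.arr 10 x.val = k.val + 1 ∧ L.man k = x ∧ (x, L.wom k) ∈ M₀) rfl rfl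
    (by decide) hr1 ⟨(Agr.refl _ _ _).setReg (by simp) _, fun x => Or.inl ⟨?_, by simp⟩⟩ ?_ ?_
    fun D τ v h => ⟨h.1.setReg (by simp) _, h.2⟩).mono ?_
  · rw [Mem.setReg_arr]; exact hA0 10 (by simp) _
  · rintro D τ w - h30 - ⟨hA, -⟩
    simp only [List.mem_singleton, forall_eq, Cd.holds, Ex.val, h30, hA.arr 11 (by decide),
      Nat.exists_eq_add_one]
  · rintro D τ w - ⟨_, hw⟩ h30 - ⟨hA, h⟩
    obtain ⟨k, h1, rfl, h3⟩ := (hpw w).resolve_left (by omega)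
    rw [HT_put]
    refine ⟨le_rfl, fun v => ⟨(hA.setArr (by simp) _ _).setReg (by simp) _, fun x => ?_⟩⟩
    simp only [Mem.setReg_arr, Mem.setArr_arr, if_true, Ex.val, h30, hA.arr 11 (by decide), h1,
      Nat.add_sub_cancel, hA.arr 0 (by decide), hi.man, Function.update_apply, Fin.val_inj,
      Finset.forall_mem_insert]
    by_cases hx : x = L.man k
    · subst hx
      exact Or.inr ⟨k, by simp, rfl, h3⟩
    · rw [if_neg hx]
      refine (h x).imp_left fun h => ⟨h.1, fun h' => hx (hss.1.snd h' h3), h.2⟩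
  rintro t₁ τ₁ ⟨ht₁, hA₁, hpm⟩
  have hm₁ : RepM L M₀ τ₁.arr := by
    refine ⟨fun x => (hpm x).imp_left fun h => ⟨h.1, fun w hw => ?_⟩, fun w => ?_⟩
    · refine h.2 w ?_ hw
      rw [Finset.mem_filter]
      rcases hpw w with h1 | ⟨k, h1, -⟩
      · exact absurd hw (h1.2 x)
      · exact ⟨Finset.mem_univ _, _, h1⟩
    · rw [hA₁.arr 11 (by decide)]; exact hpw w
  rw [HT_seq]
  refine (HT_all (n := I.a) (fun D τ => Agr [30] [10, 28] σ τ ∧ τ.arr 10 = τ₁.arr 10 ∧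
    ∀ y ∈ D, τ.arr 28 y.val = y.val) rfl rfl (by decide) ((hA₁.reg 0 (by decide)).trans hr0)
    ⟨(hA₁.mono (List.Subset.refl _) (by simp)).setReg (by simp) _, rfl, by simp⟩ ?_
    fun D τ v h => ⟨h.1.setReg (by simp) _, h.2⟩).mono ?_
  · rintro D τ y - h30 - ⟨hA, h10, h⟩
    rw [HT_put]
    refine ⟨rfl, fun v => ⟨(hA.setArr (by simp) _ _).setReg (by simp) _, ?_, fun x hx => ?_⟩⟩
    · rw [Mem.setReg_arr, Mem.setArr_arr, if_neg (by decide), h10]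
    · simp only [Mem.setReg_arr, Mem.setArr_arr, if_true, Ex.val, h30, Function.update_apply]
      split_ifs with hxy
      · exact hxy.symm
      · exact h x ((Finset.mem_insert.1 hx).resolve_left fun h => hxy (congrArg Fin.val h))
  rintro t₂ τ₂ ⟨ht₂, hA₂, h10, h28⟩
  have hm₂ : RepM L M₀ τ₂.arr :=
    hm₁.congr h10 (by rw [hA₂.arr 11 (by decide), hA₁.arr 11 (by decide)])
  have key : ∀ {τ as}, Agr [30] as τ₂ τ → 10 ∉ as → 11 ∉ as → (∀ i < 8, i ∉ as) →
      RepM L M₀ τ.arr ∧ Inp L τ.arr := fun hA h1 h2 h3 =>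
    ⟨hm₂.congr (hA.arr _ h1) (hA.arr _ h2), (hi.agr hA₂ (by decide)).agr hA h3⟩
  have hme : ∀ {τ as} {k : Fin I.numE}, Agr [30] as τ₂ τ → 10 ∉ as → 11 ∉ as → (∀ i < 8, i ∉ as) →
      τ.reg 30 = k.val → manEdge.val τ = τ₂.arr 10 (L.man k).val ∧
        womEdge.val τ = τ₂.arr 11 (L.wom k).val := by
    intro τ as k hA h1 h2 h3 h30
    have hi' := (key hA h1 h2 h3).2
    simp only [manEdge, womEdge, Ex.val, h30, hi'.man, hi'.wom, hA.arr _ h1, hA.arr _ h2, and_self]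
  have hpe : ∀ k : Fin I.numE, τ₂.arr 10 (L.man k).val = k.val + 1 ↔ (L.man k, L.wom k) ∈ M₀ := by
    intro k
    rw [hm₂.pm_eq hss.1]; simp
  rw [HT_seq]
  refine (HT_putEdges (fun k => (L.man k, L.wom k) ∈ M₀) ((hA₂.reg 2 (by decide)).trans hr2) ?_).mono ?_
  · intro k τ hA h30
    have := (hme hA (by decide) (by decide) (by decide) h30).1
    simp only [List.mem_singleton, forall_eq, Cd.holds, this, Ex.val, h30, hpe]
  rintro t₃ τ₃ ⟨ht₃, hA₃, h₃⟩
  rw [HT_seq]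
  refine (HT_putEdges (fun k => ∃ w, (L.man k, w) ∈ M₀ ∧ I.rankM (L.man k) w < L.rkM k)
    ((hA₃.reg 2 (by decide)).trans ((hA₂.reg 2 (by decide)).trans hr2)) ?_).mono ?_
  · intro k τ hA h30
    have hA' := (hA₃.mono (List.Subset.refl _) (by simp)).trans (hA.mono (as' := [23, 24])
      (List.Subset.refl _) (by simp))
    have h1 := (hme hA' (by decide) (by decide) (by decide) h30).1
    have hi' := (key hA' (by decide) (by decide) (by decide)).2
    simp only [List.mem_cons, List.not_mem_nil, or_false, forall_eq_or_imp, forall_eq, Cd.holds,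
      Ex.val, h1, h30, hi'.rkM]
    rcases hm₂.pm (L.man k) with ⟨h3, h4⟩ | ⟨l, h3, h4, h5⟩
    · exact ⟨fun h => by omega, fun ⟨w, h, _⟩ => absurd h (h4 w)⟩
    · rw [h3, Nat.add_sub_cancel, hi'.rkM, h4]
      refine ⟨fun h => ⟨_, h5, h.2⟩, fun ⟨w, h6, h7⟩ => ⟨by omega, ?_⟩⟩
      rwa [hss.1.fst h5 h6]
  rintro t₄ τ₄ ⟨ht₄, hA₄, h₄⟩
  have hA₄' := (hA₃.mono (List.Subset.refl _) (by simp)).trans (hA₄.mono (as' := [23, 24])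
      (List.Subset.refl _) (by simp))
  rw [HT_seq]
  refine (HT_putEdges (fun k => Dominated M₀ (L.man k, L.wom k))
    ((hA₄'.reg 2 (by decide)).trans ((hA₂.reg 2 (by decide)).trans hr2)) ?_).mono ?_
  · intro k τ hA h30
    have hA' := hA₄'.trans (hA.mono (as' := [23, 24]) (List.Subset.refl _) (by simp))
    have h1 := (hme hA' (by decide) (by decide) (by decide) h30).2
    have hi' := (key hA' (by decide) (by decide) (by decide)).2
    simp only [List.mem_cons, List.not_mem_nil, or_false, forall_eq_or_imp, forall_eq, Cd.holds,
      Ex.val, h1, h30, hi'.rkW, Dominated]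
    rcases hm₂.pw (L.wom k) with ⟨h3, h4⟩ | ⟨l, h3, h4, h5⟩
    · exact ⟨fun h => by omega, fun ⟨w, h, _⟩ => absurd h (h4 w)⟩
    · rw [h3, Nat.add_sub_cancel, hi'.rkW, h4]
      refine ⟨fun h => ⟨_, h5, h.2⟩, fun ⟨w, h6, h7⟩ => ⟨by omega, ?_⟩⟩
      rwa [hss.1.snd h5 h6]
  rintro t₅ τ₅ ⟨ht₅, hA₅, h₅⟩
  have hA₅' := hA₄'.trans (hA₅.mono (as' := [23, 24]) (List.Subset.refl _) (by simp))
  have hz0 : ∀ B ∈ [25, 26, 27], ∀ i, τ₅.arr B i = 0 := by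
    intro B hB i
    rw [hA₅'.arr B (by fin_cases hB <;> decide), hA₂.arr B (by fin_cases hB <;> decide)]
    exact hA0 B (by fin_cases hB <;> decide) i
  set Ec := (initState M₀ Mz).Ec with hEc
  have hsettled : ∀ k : Fin I.numE, (L.man k, L.wom k) ∈ M₀ →
      (σ.arr 12 (L.man k).val = τ₂.arr 10 (L.man k).val ↔ Settled M₀ Mz (L.man k)) := by
    intro k hk
    have := (init_good h0 hz).unsettled_iff hz.1 (L.man k)
    rw [← not_iff_not, (hpe k).2 hk]
    refine Iff.trans ?_ this.symm
    change _ ↔ ∃ w, (L.man k, w) ∈ M₀ ∧ (L.man k, w) ∉ Mz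
    rcases hzm (L.man k) with ⟨h1, h2⟩ | ⟨l, h1, h2, h3⟩
    · rw [h1]; exact ⟨fun _ => ⟨_, hk, h2 _⟩, fun _ => by omega⟩
    · rw [h1]
      constructor
      · refine fun h => ⟨_, hk, fun h' => h ?_⟩
        rw [L.edge_inj h2 (hz.1.1.fst h3 h')]
      · rintro ⟨w, h4, h5⟩ h6
        have : l = k := Fin.ext (by omega)
        subst this
        exact h5 (hss.1.fst h4 hk ▸ h3)
  refine (HT_each (n := I.numE) (c := 0) (fun k => (L.man k, L.wom k) ∈ Ec) (fun D τ =>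
    Agr [30] [25, 26, 27] τ₅ τ ∧ RepC L (L.edges D) τ.arr) rfl rfl (by decide)
    ((hA₅'.reg 2 (by decide)).trans ((hA₂.reg 2 (by decide)).trans hr2))
    ⟨(Agr.refl _ _ _).setReg (by simp) _, ⟨fun k => ?_, fun x => ?_, fun w => ?_⟩⟩ ?_ ?_
    fun D τ v h => ⟨h.1.setReg (by simp) _, h.2⟩).mono ?_
  · rw [Mem.setReg_arr, hz0 25 (by simp)]; simp [Layout.edges]
  · rw [Mem.setReg_arr, hz0 26 (by simp)]; simp [Layout.edges]
  · rw [Mem.setReg_arr, hz0 27 (by simp)]; simp [Layout.edges]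
  · rintro D τ k - h30 - ⟨hA, -⟩
    have hA' := (hA₅'.mono (List.Subset.refl _) (by simp)).trans (hA.mono
      (as' := [23, 24, 25, 26, 27]) (List.Subset.refl _) (by simp))
    have h1 := (hme hA' (by decide) (by decide) (by decide) h30).1
    have hi' := (key hA' (by decide) (by decide) (by decide)).2
    simp only [List.mem_cons, List.not_mem_nil, or_false, forall_eq_or_imp, forall_eq, Cd.holds,
      h1, Ex.val, h30, hi'.man, hpe, hA'.arr 12 (by decide), hA₂.arr 12 (by decide)]
    rw [hEc, initState, Finset.mem_filter]
    exact and_congr_right fun h => hsettled k h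
  · rintro D τ k hkD - h30 - ⟨hA, hC⟩
    have hA' := (hA₅'.mono (List.Subset.refl _) (by simp)).trans (hA.mono
      (as' := [23, 24, 25, 26, 27]) (List.Subset.refl _) (by simp))
    have hi' := (key hA' (by decide) (by decide) (by decide)).2
    refine (HT_addEc hi' hC h30 fun h => hkD (Layout.mem_edges.1 h)).mono ?_
    rintro t υ ⟨rfl, h1, h2⟩
    refine ⟨le_rfl, fun v => ⟨(hA.trans (h2.mono (by simp) (List.Subset.refl _))).setReg (by simp) _,
      ?_⟩⟩
    have : L.edges (insert k D) = insert (L.man k, L.wom k) (L.edges D) := Finset.image_insert _ _ _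
    rw [this]; exact h1
  rintro t₆ τ₆ ⟨ht₆, hA₆, hC₆⟩
  have hA' := (hA₅'.mono (List.Subset.refl _) (by simp)).trans (hA₆.mono
      (as' := [23, 24, 25, 26, 27]) (List.Subset.refl _) (by simp))
  obtain ⟨hm₆, hi₆⟩ := key hA' (by decide) (by decide) (by decide)
  have hE : ∀ D, (∀ k, k ∈ D ↔ (L.man k, L.wom k) ∈ Ec) → L.edges D = Ec := by
    obtain ⟨T, hT⟩ := L.exists_edges (init_good h0 hz).subC
    intro D hD
    rw [hEc, ← hT]
    congr 1
    ext k
    rw [hD, hEc, ← hT, Layout.mem_edges]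
  rw [hE _ fun k => by simp] at hC₆
  have hreg : ∀ i < 3, τ₆.reg i = σ.reg i := fun i hi => by
    rw [hA'.reg i (by simp; omega), hA₂.reg i (by simp; omega)]
  have hN : I.numV = I.a + I.b := rfl
  refine ⟨by omega, hA'.out.trans hA₂.out, init_good h0 hz, ForestOK.init_ok, ?_,
    ⟨(hreg 0 (by decide)).trans hr0, (hreg 1 (by decide)).trans hr1,
      (hreg 2 (by decide)).trans hr2, hi₆, hm₆, ?_, fun k => ?_, fun k => ?_, hC₆, ?_⟩⟩
  · intro y hy; simp [ForestOK.init] at hy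
  · unfold RepZ
    rw [hA'.arr 12 (by decide), hA₂.arr 12 (by decide)]; exact hzm
  · rw [hA₆.arr 23 (by decide), hA₅.arr 23 (by decide), hA₄.arr 23 (by decide), h₃,
      hA₂.arr 23 (by decide), hA0 23 (by simp)]
    congr 1
  · rw [hA₆.arr 24 (by decide), h₅, h₄, hA₃.arr 24 (by decide), hA₂.arr 24 (by decide),
      hA0 24 (by simp)]
    refine ite_ite_of_and_not ?_
    rw [initState, Finset.mem_filter, Finset.mem_sdiff]
    constructor
    · rintro ⟨⟨h1, h2⟩, h3, h4⟩
      -- The program sets flags only for men with a strictly better partner in M₀. An edge outside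
      -- M₀ without such a partner is dominated at its woman, by super-stability of M₀, so nothing
      -- is missed.
      refine ⟨by_contra fun hcon => h3 ?_, h3⟩
      push Not at hcon
      obtain ⟨x, hx, h5⟩ := hss.better h1 fun w' hw' => hcon w' hw'
      rcases h5 with rfl | h5
      · exact absurd hx h2
      · exact ⟨x, hx, h5⟩
    · rintro ⟨⟨w, h1, h2⟩, h3⟩
      refine ⟨⟨L.mem_E k, fun h => ?_⟩, h3, ?_⟩
      · rw [hss.1.fst h1 h] at h2; exact lt_irrefl _ h2
      · rintro ⟨w', h4, h5⟩
        rw [hss.1.fst h4 h1] at h5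
        exact absurd h2 (not_lt.2 h5)
  · refine ⟨fun y => ?_, fun y => Or.inl ⟨rfl, ?_⟩, fun y => ?_⟩
    · rw [hA'.arr 28 (by decide)]; exact h28 y (Finset.mem_univ _)
    · rw [hA'.arr 29 (by decide), hA₂.arr 29 (by decide), hA0 29 (by simp)]
    · rw [hA'.arr 30 (by decide), hA₂.arr 30 (by decide), hA0 30 (by simp)]
      simp [ForestOK.init]

def initialise : St :=
  proposals false ⨟ proposals true ⨟ initArrays ⨟ emitMatching 10 ⨟ emitMatching 12

theorem HT_initialise (hm : 0 < I.numE) (hex : ∃ M, IsSuperStable I M) :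
    HT initialise (inputMem L) (fun t τ => ∃ M₀ Mz, IsManOptimal I M₀ ∧ IsWomanOptimal I Mz ∧
      Valid L Mz (initState M₀ Mz) (ForestOK.init I) τ ∧
      τ.out = eventCode (Event.start M₀ Mz) ∧ t ≤ 89 * (I.numE * I.numV)) := by
  obtain ⟨M, hM⟩ := hex
  obtain ⟨N₀, rfl⟩ := L.exists_edges hM.1.1
  have hN₀ := Layout.stable_iff.2 hM
  have hi := inp_inputMem L
  have hzero : ∀ B, 8 ≤ B → ∀ i, (inputMem L).arr B i = 0 := by
    intro B hB i
    obtain ⟨n, rfl⟩ := Nat.exists_eq_add_of_le hB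
    rw [Nat.add_comm]; rfl
  have har : ∀ q i, 8 ≤ i → 8 ≤ ar q i := by
    intro q i h
    cases q <;> simp only [ar, cond_true, cond_false] <;> split_ifs <;> omega
  rw [initialise, HT_seq]
  refine (HT_proposals (side_men hi) rfl rfl hm (fun i h => hzero _ (har _ _ h)) hN₀).frame.mono ?_
  rintro t₁ τ₁ ⟨⟨ht₁, T₁, hT₁, hopt₁, hres₁⟩, hF₁⟩
  have hi₁ : Inp L τ₁.arr := hi.frame hF₁ fun i hi => by interval_cases i <;> rfl
  -- The first run writes only odd-numbered arrays, so the work arrays of the second run are still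
  -- zero, as its specification requires.
  have hodd : ∀ i, 8 ≤ i → ∀ k, τ₁.arr (ar true i) k = 0 := by
    intro i h k
    rw [hF₁.arr _ ?_]
    · exact hzero _ (har _ _ h) k
    · have h1 : ar true i = 2 * i - 4 := if_neg (not_lt.2 h)
      have h2 : ∀ B, (proposals false).wa B = true → B % 2 = 1 := by
        intro B hB
        simp [proposals, proposeStep, propose, accept, putL, minL, findN, forN, forL, ifAll,
          St.wa, ar] at hB
        omega
      rw [← Bool.not_eq_true]
      exact fun h3 => by have := h2 _ h3; omega
  rw [HT_seq]
  refine (HT_proposals (side_women hi₁) (hF₁.reg 1 rfl) (hF₁.reg 2 rfl) hm hodd hN₀.swap).frame.mono ?_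
  rintro t₂ τ₂ ⟨⟨ht₂, T₂, hT₂, hopt₂, hres₂⟩, hF₂⟩
  have h0 : IsManOptimal I (L.edges T₁) := by
    refine ⟨Layout.stable_iff.1 hT₁, fun N hN m w hmw => ?_⟩
    obtain ⟨T, rfl⟩ := L.exists_edges hN.1.1
    obtain ⟨f, rfl, rfl⟩ := L.exists_edge (hN.1.1 hmw)
    obtain ⟨e, he, h1, h2⟩ := hopt₁ T (Layout.stable_iff.2 hN) f (Layout.mem_edges.1 hmw)
    exact ⟨L.wom e, h1 ▸ Layout.mem_edges.2 he, by simpa only [Layout.rkM, h1] using h2⟩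
  have hz : IsWomanOptimal I (L.edges T₂) := by
    refine ⟨Layout.stable_iff.1 hT₂.swap, fun N hN w m hmw => ?_⟩
    obtain ⟨T, rfl⟩ := L.exists_edges hN.1.1
    obtain ⟨f, rfl, rfl⟩ := L.exists_edge (hN.1.1 hmw)
    obtain ⟨e, he, h1, h2⟩ := hopt₂ T (Layout.stable_iff.2 hN).swap f (Layout.mem_edges.1 hmw)
    exact ⟨L.man e, h1 ▸ Layout.mem_edges.2 he, by simpa only [Layout.rkW, h1] using h2⟩
  have h11 : τ₂.arr 11 = τ₁.arr 11 := hF₂.arr 11 rfl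
  rw [HT_seq]
  refine (HT_initArrays h0 hz (hi₁.frame hF₂ fun i hi => by interval_cases i <;> rfl)
    ⟨(hF₂.reg 0 rfl).trans (hF₁.reg 0 rfl), (hF₂.reg 1 rfl).trans (hF₁.reg 1 rfl),
      (hF₂.reg 2 rfl).trans (hF₁.reg 2 rfl)⟩ (fun w => ?_) (fun x => ?_) ?_).mono ?_
  · rw [h11]
    rcases hres₁ w with ⟨h1, h2⟩ | ⟨e, h1, rfl, h3⟩
    · refine Or.inl ⟨h1, fun x hx => ?_⟩
      obtain ⟨k, rfl, rfl⟩ := L.exists_edge (Layout.edges_sub hx)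
      exact h2 k (Layout.mem_edges.1 hx) rfl
    · exact Or.inr ⟨e, h3, rfl, Layout.mem_edges.2 h1⟩
  · rcases hres₂ x with ⟨h1, h2⟩ | ⟨e, h1, rfl, h3⟩
    · refine Or.inl ⟨h1, fun w hx => ?_⟩
      obtain ⟨k, rfl, rfl⟩ := L.exists_edge (Layout.edges_sub hx)
      exact h2 k (Layout.mem_edges.1 hx) rfl
    · exact Or.inr ⟨e, h3, rfl, Layout.mem_edges.2 h1⟩
  · intro B hB i
    have : τ₂.arr B = (inputMem L).arr B := by
      fin_cases hB <;> exact (hF₂.arr _ rfl).trans (hF₁.arr _ rfl)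
    rw [this, hzero B (by fin_cases hB <;> decide)]
  rintro t₃ τ₃ ⟨ht₃, ho₃, v⟩
  rw [HT_seq]
  refine (HT_emitMatching v.rep.inp v.rep.r0 h0.1.1 v.rep.m.pm).mono ?_
  rintro t₄ τ₄ ⟨ht₄, ho₄, ha₄, hr₄⟩
  have hR₄ : Rep L _ _ _ τ₄ := v.rep.congr ha₄ fun i hi => hr₄ i (by omega)
  refine (HT_emitMatching hR₄.inp hR₄.r0 hz.1.1 hR₄.z).mono ?_
  rintro t₅ τ₅ ⟨ht₅, ho₅, ha₅, hr₅⟩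
  refine ⟨_, _, h0, hz, ⟨v.good, v.ok, v.clean, hR₄.congr ha₅ fun i hi => hr₅ i (by omega)⟩, ?_, ?_⟩
  · rw [ho₅, ho₄, ho₃, hF₂.out rfl, hF₁.out rfl]
    rfl
  · have hN : I.numV = I.a + I.b := rfl
    have hp : 0 < I.numV := by have := (L.man ⟨0, hm⟩).pos; omega
    have e1 : I.numV ≤ I.numE * I.numV := Nat.le_mul_of_pos_left _ hm
    have e2 : I.numE ≤ I.numE * I.numV := Nat.le_mul_of_pos_right _ hp
    rw [Nat.mul_comm I.numV] at ht₁ ht₂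
    omega

end SuperStable

end

namespace SuperStable

theorem sim_inputMem {I : Inst} (L : Layout I) : Sim (inputMem L) (inputMem L) := by
  refine ⟨fun x => ?_, rfl, rfl⟩
  rcases x with _ | _ | _ | x <;> rfl

end SuperStable

theorem mainTheorem7 :
    ∃ (P : SuperStable.Prog) (C : ℕ),
      ∀ (I : SuperStable.Inst), 0 < I.numE →
        (∃ M, SuperStable.IsSuperStable I M) →
        ∀ L : SuperStable.Layout I,
          ∃ (t : ℕ) (τ : SuperStable.Mem) (l : List (SuperStable.Event I)),
            SuperStable.Exec P (SuperStable.inputMem L) t τ ∧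
            t ≤ C * (I.numE * I.numV) ∧
            SuperStable.IsRun I l ∧
            τ.out = l.flatMap SuperStable.eventCode := by
  refine ⟨(SuperStable.St.seq SuperStable.initialise SuperStable.mainLoop).cmp,
    -- 715 = 89 + 625 + 1: initialisation takes at most 89 mn iterations, the main loop at most 25n
    -- · 25m since `Theta` starts at no more than 24m, and the last 1 comes from the bound size · (1
    -- + t) of the compiler.
    (SuperStable.St.seq SuperStable.initialise SuperStable.mainLoop).size * 715,
    fun I hm hex L => ?_⟩
  obtain ⟨t₁, τ₁, r₁, M₀, Mz, h0, hz, v, ho₁, ht₁⟩ := SuperStable.HT_initialise (L := L) hm hex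
  obtain ⟨t₂, τ₂, r₂, l, hl, ho₂, ht₂⟩ := SuperStable.HT_mainLoop hz.1 v
  obtain ⟨u, τ, hu, hs, hle⟩ := SuperStable.St.exec_cmp
    (SuperStable.St.seq SuperStable.initialise SuperStable.mainLoop)
    (SuperStable.sim_inputMem L) ⟨t₁, τ₁, t₂, r₁, r₂, rfl⟩
  refine ⟨u, τ, SuperStable.Event.start M₀ Mz :: l, hu, hle.trans ?_, ⟨M₀, Mz, l, h0, hz, hl, rfl⟩, ?_⟩
  · rw [Nat.mul_assoc]
    refine Nat.mul_le_mul_left _ ?_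
    have h1 := SuperStable.Phi_le (SuperStable.initState M₀ Mz)
    have h2 := SuperStable.ForestOK.init_Psi hz.1.1
    have h3 : SuperStable.Theta Mz (SuperStable.initState M₀ Mz) (SuperStable.ForestOK.init I) ≤
        24 * I.numE := by
      simp only [SuperStable.Theta]; omega
    have hp : 1 ≤ I.numV := by
      have := (L.man ⟨0, hm⟩).pos
      have : I.numV = I.a + I.b := rfl
      omega
    have h4 : (22 * I.numV + 3) * (SuperStable.Theta Mz (SuperStable.initState M₀ Mz)
        (SuperStable.ForestOK.init I) + 1) ≤ 25 * I.numV * (25 * I.numE) :=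
      Nat.mul_le_mul (by omega) (by omega)
    have h5 : 25 * I.numV * (25 * I.numE) = 625 * (I.numE * I.numV) := by ring
    have h6 : 0 < I.numE * I.numV := Nat.mul_pos hm hp
    omega
  · rw [hs.2.2, ho₂, ho₁]; rfl
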